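/- Let $k$ be a field of characteristic $0$. All operads are symmetric operads with two colours $\mathfrak c$ (closed) and $\mathfrak o$ (open) in the category of $\mathbb Z$-graded $k$-vector spaces with a differential of degree $-1$, with the Koszul sign convention. Let $\mathbf{sc}^!$ (the Koszul dual of the homology $\mathbf{sc}$ of Kontsevich's Swiss-cheese operad) be the differential graded operad with generators $$\mathfrak l_2\in(\mathfrak c,\mathfrak c;\mathfrak c),\quad \mathfrak c_2\in(\mathfrak c,\mathfrak c;\mathfrak c),\quad \mathfrak n_{0,2}\in(\mathfrak o,\mathfrak o;\mathfrak o),\quad \mathfrak n_{1,1}\in(\mathfrak c,\mathfrak o;\mathfrak o),\quad \mathfrak n_{1,0}\in(\mathfrak c;\mathfrak o)$$ of degrees $0,-1,0,0,-1$, where $S_2$ acts on $\mathfrak l_2$ and on $\mathfrak c_2$ by the signature and there are no symmetry conditions on the others, with the relations \begin{align*} &\mathfrak c_2(\mathrm{id}\otimes\mathfrak c_2)=-\mathfrak c_2(\mathfrak c_2\otimes\mathrm{id}),\qquad \mathfrak l_2(\mathfrak l_2\otimes\mathrm{id})\cdot((123)+(231)+(312))=0,\\ &\mathfrak l_2(\mathrm{id}\otimes\mathfrak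 c_2)=\mathfrak c_2(\mathfrak l_2\otimes\mathrm{id})+\mathfrak c_2(\mathrm{id}\otimes\mathfrak l_2)\cdot(213),\qquad \mathfrak n_{0,2}(\mathrm{id}\otimes\mathfrak n_{0,2})=\mathfrak n_{0,2}(\mathfrak n_{0,2}\otimes\mathrm{id}),\\ &\mathfrak n_{1,1}(\mathfrak l_2\otimes\mathrm{id})=\mathfrak n_{1,1}(\mathrm{id}\otimes\mathfrak n_{1,1})\cdot(\mathrm{id}-(213)),\\ &\mathfrak n_{1,1}(\mathrm{id}\otimes\mathfrak n_{0,2})=\mathfrak n_{0,2}(\mathfrak n_{1,1}\otimes\mathrm{id})+\mathfrak n_{0,2}(\mathrm{id}\otimes\mathfrak n_{1,1})\cdot(213),\qquad \mathfrak n_{1,1}(\mathfrak c_2\otimes\mathrm{id})=0,\\ &\mathfrak n_{1,0}(\mathfrak l_2)=\mathfrak n_{1,1}(\mathrm{id}\otimes\mathfrak n_{1,0})\cdot((12)-(21)),\qquad \mathfrak n_{1,0}(\mathfrak c_2)=0, \end{align*} and with the differential that is $d\mathfrak n_{1,1}=\mathfrak n_{0,2}(\mathfrak n_{1,0}\otimes\mathrm{id})-\mathfrak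 n_{0,2}(\mathrm{id}\otimes\mathfrak n_{1,0})\cdot(21)$ and zero on the other generators. A $\Lambda\mathcal Ger$-algebra is a differential graded vector space $H$ with a bracket $[\,,]$ of degree $0$ and a product $\times$ of degree $-1$, both compatible with the differential ($d[x,y]=[dx,y]+(-1)^{|x|}[x,dy]$ and $d(x\times y)=-dx\times y-(-1)^{|x|}x\times dy$), such that for homogeneous $x,y,z$ $$[x,y]=-(-1)^{|x||y|}[y,x],\qquad x\times y=-(-1)^{|x||y|}y\times x,$$ $$[[x,y],z]+(-1)^{|x|(|y|+|z|)}[[y,z],x]+(-1)^{|z|(|x|+|y|)}[[z,x],y]=0,$$ $$(-1)^{|x|}x\times(y\times z)=-(x\times y)\times z,\qquad (-1)^{|x|}[x,y\times z]=[x,y]\times z+(-1)^{|x||y|}y\times[x,z].$$ **Theorem.** Algebras over the homology operad $H_*(\mathbf{sc}^!)$ are the triples $(H,A,\beta)$ where $H$ is a $\Lambda\mathcal Ger$-algebra, $A$ is a (differential graded, not necessarily unital) associative algebra, and $\beta:H\to A$ is a linear map of degree $-1$ with $d\beta=-\beta d$ which is central, $\beta(x)a=(-1)^{|a|(|x|+1)}a\beta(x)$,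 and satisfies $\beta(x\times y)=0$. Precisely, for every pair $(H,A)$ of differential graded vector spaces, letting the homology classes of $\mathfrak l_2,\mathfrak c_2,\mathfrak n_{0,2},\mathfrak n_{1,0}$ act as $[\,,]$, $\times$, the product of $A$ and $\beta$ defines a bijection from the $H_*(\mathbf{sc}^!)$-algebra structures on $(H,A)$ to the structures of such a triple on $(H,A)$, and a pair of chain maps is a morphism of algebras if and only if it is a morphism of triples. -/

import Mathlib

universe u w

open CategoryTheory

/-- The two colours: `cl` (closed) and `op` (open). -/
inductive Color : Type
  | cl : Color
  | op : Color
  deriving DecidableEq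

/-- Position, after grafting an operation with `m` inputs at position `i` (counted from `0`), of
the input that was at position `j ≠ i`. -/
def graftPos (i m j : ℕ) : ℕ := if j < i then j else j + m - 1

/-- A `2`-coloured symmetric operad in differential graded `k`-vector spaces (lower grading by `ℤ`,
differential of degree `-1`).  `obj l d p` is the degree `p` part of `P(l; d)`, where `l` is the
tuple of input colours and `d` the output colour.  The operad is given in the partial composition
form, with Koszul signs:
* `act e he f` is `f · e`, where `e` is a permutation and `l' = l · e`, i.e. `l'ᵢ = l_{e i}`;
* `comp l₁ l₂ _ _ _ f g` is `f (id ⊗ ⋯ ⊗ g ⊗ ⋯ ⊗ id)`, with `g` grafted at the input of `f` that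
  stands between the blocks of inputs `l₁` and `l₂`. -/
structure DGOperad (k : Type u) [Field k] where
  obj : List Color → Color → ℤ → Type u
  [instAddCommGroup : ∀ l d p, AddCommGroup (obj l d p)]
  [instModule : ∀ l d p, Module k (obj l d p)]
  diff : ∀ {l : List Color} {d : Color} {p q : ℤ}, q + 1 = p → (obj l d p →ₗ[k] obj l d q)
  one : ∀ x : Color, obj [x] x 0
  act : ∀ {l l' : List Color} {d : Color} {p : ℤ} (e : Fin l'.length ≃ Fin l.length),
    (∀ i, l'.get i = l.get (e i)) → (obj l d p →ₗ[k] obj l' d p)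
  comp : ∀ {l b l' : List Color} {x d : Color} {p q r : ℤ} (l₁ l₂ : List Color),
    l = l₁ ++ x :: l₂ → l' = l₁ ++ b ++ l₂ → p + q = r →
      (obj l d p →ₗ[k] obj b x q →ₗ[k] obj l' d r)
  /-- the differential -/
  diff_diff : ∀ {l : List Color} {d : Color} {p q r : ℤ} (h : q + 1 = p) (h' : r + 1 = q)
    (f : obj l d p), diff h' (diff h f) = 0
  diff_one : ∀ {x : Color} {q : ℤ} (h : q + 1 = 0), diff h (one x) = 0
  diff_act : ∀ {l l' : List Color} {d : Color} {p q : ℤ} (h : q + 1 = p)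
    (e : Fin l'.length ≃ Fin l.length) (he : ∀ i, l'.get i = l.get (e i)) (f : obj l d p),
    diff h (act e he f) = act e he (diff h f)
  diff_comp : ∀ {l b l' : List Color} {x d : Color} {p q r p' q' r' : ℤ} (l₁ l₂ : List Color)
    (hl : l = l₁ ++ x :: l₂) (hl' : l' = l₁ ++ b ++ l₂) (hr : p + q = r)
    (hp' : p' + 1 = p) (hq' : q' + 1 = q) (hr' : r' + 1 = r) (h₁ : p' + q = r') (h₂ : p + q' = r')
    (f : obj l d p) (g : obj b x q),
    diff hr' (comp l₁ l₂ hl hl' hr f g) =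
      comp l₁ l₂ hl hl' h₁ (diff hp' f) g + p.negOnePow • comp l₁ l₂ hl hl' h₂ f (diff hq' g)
  /-- the actions of the symmetric groups -/
  act_refl : ∀ {l : List Color} {d : Color} {p : ℤ} (f : obj l d p),
    act (Equiv.refl _) (fun _ => rfl) f = f
  act_act : ∀ {l l' l'' : List Color} {d : Color} {p : ℤ} (e : Fin l'.length ≃ Fin l.length)
    (e' : Fin l''.length ≃ Fin l'.length) (he : ∀ i, l'.get i = l.get (e i))
    (he' : ∀ i, l''.get i = l'.get (e' i)) (f : obj l d p),
    act e' he' (act e he f) = act (e'.trans e) (fun i => (he' i).trans (he (e' i))) f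
  /-- unit -/
  one_comp : ∀ {l : List Color} {d : Color} {p : ℤ} (hl : [d] = [] ++ d :: [])
    (hl' : l = [] ++ l ++ []) (hr : 0 + p = p) (g : obj l d p),
    comp [] [] hl hl' hr (one d) g = g
  comp_one : ∀ {l : List Color} {x d : Color} {p : ℤ} (l₁ l₂ : List Color)
    (hl : l = l₁ ++ x :: l₂) (hl' : l = l₁ ++ [x] ++ l₂) (hr : p + 0 = p) (f : obj l d p),
    comp l₁ l₂ hl hl' hr f (one x) = f
  /-- sequential associativity -/
  comp_comp : ∀ {l m b lm mb lmb : List Color} {x y d : Color} {p q r pq qr pqr : ℤ}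
    (l₁ l₂ m₁ m₂ : List Color)
    (hl : l = l₁ ++ x :: l₂) (hm : m = m₁ ++ y :: m₂)
    (hlm : lm = l₁ ++ m ++ l₂) (hmb : mb = m₁ ++ b ++ m₂)
    (hlm' : lm = (l₁ ++ m₁) ++ y :: (m₂ ++ l₂))
    (hlmb : lmb = (l₁ ++ m₁) ++ b ++ (m₂ ++ l₂)) (hlmb' : lmb = l₁ ++ mb ++ l₂)
    (hpq : p + q = pq) (hqr : q + r = qr) (h₁ : pq + r = pqr) (h₂ : p + qr = pqr)
    (f : obj l d p) (g : obj m x q) (h : obj b y r),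
    comp (l₁ ++ m₁) (m₂ ++ l₂) hlm' hlmb h₁ (comp l₁ l₂ hl hlm hpq f g) h =
      comp l₁ l₂ hl hlmb' h₂ f (comp m₁ m₂ hm hmb hqr g h)
  /-- parallel associativity -/
  comp_comm : ∀ {l b c lb lc lbc : List Color} {x y d : Color} {p q r pq pr pqr : ℤ}
    (l₁ l₂ l₃ : List Color)
    (hx : l = l₁ ++ x :: (l₂ ++ y :: l₃)) (hy : l = (l₁ ++ x :: l₂) ++ y :: l₃)
    (hlb : lb = l₁ ++ b ++ (l₂ ++ y :: l₃)) (hlb' : lb = (l₁ ++ b ++ l₂) ++ y :: l₃)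
    (hlc : lc = (l₁ ++ x :: l₂) ++ c ++ l₃) (hlc' : lc = l₁ ++ x :: (l₂ ++ c ++ l₃))
    (hlbc : lbc = (l₁ ++ b ++ l₂) ++ c ++ l₃) (hlbc' : lbc = l₁ ++ b ++ (l₂ ++ c ++ l₃))
    (hpq : p + q = pq) (hpr : p + r = pr) (h₁ : pq + r = pqr) (h₂ : pr + q = pqr)
    (f : obj l d p) (g : obj b x q) (h : obj c y r),
    comp (l₁ ++ b ++ l₂) l₃ hlb' hlbc h₁ (comp l₁ (l₂ ++ y :: l₃) hx hlb hpq f g) h =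
      (q * r).negOnePow •
        comp l₁ (l₂ ++ c ++ l₃) hlc' hlbc' h₂ (comp (l₁ ++ x :: l₂) l₃ hy hlc hpr f h) g
  /-- equivariance: `(f · e) ∘ (g · t) = (f ∘ g) · s`, where `e` takes the grafted input of `f · e`
  to the grafted input of `f`, and `s` is `t` on the block of `g` and `e` outside of it -/
  comp_act : ∀ {l m b c lb mc : List Color} {x d : Color} {p q r : ℤ} (l₁ l₂ m₁ m₂ : List Color)
    (hl : l = l₁ ++ x :: l₂) (hm : m = m₁ ++ x :: m₂)
    (hlb : lb = l₁ ++ b ++ l₂) (hmc : mc = m₁ ++ c ++ m₂) (hr : p + q = r)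
    (e : Fin m.length ≃ Fin l.length) (he : ∀ i, m.get i = l.get (e i))
    (t : Fin c.length ≃ Fin b.length) (ht : ∀ i, c.get i = b.get (t i))
    (s : Fin mc.length ≃ Fin lb.length) (hs : ∀ i, mc.get i = lb.get (s i))
    (_ : ∀ j : Fin m.length, (j : ℕ) = m₁.length → (e j : ℕ) = l₁.length)
    (_ : ∀ (j : Fin m.length) (i : Fin mc.length), (j : ℕ) ≠ m₁.length →
      (i : ℕ) = graftPos m₁.length c.length j → (s i : ℕ) = graftPos l₁.length b.length (e j))
    (_ : ∀ (j : Fin c.length) (i : Fin mc.length),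
      (i : ℕ) = m₁.length + j → (s i : ℕ) = l₁.length + t j)
    (f : obj l d p) (g : obj b x q),
    comp m₁ m₂ hm hmc hr (act e he f) (act t ht g) = act s hs (comp l₁ l₂ hl hlb hr f g)

attribute [instance] DGOperad.instAddCommGroup DGOperad.instModule

namespace DGOperad

variable {k : Type u} [Field k]

/-! ### The homology operad -/

section Homology

variable (P : DGOperad k)

/-- Cycles of degree `p`. -/
def cycles (l : List Color) (d : Color) (p : ℤ) : Submodule k (P.obj l d p) :=
  LinearMap.ker (P.diff (l := l) (d := d) (sub_add_cancel p 1))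

/-- Boundaries of degree `p`, as a subspace of the cycles. -/
def boundaries (l : List Color) (d : Color) (p : ℤ) : Submodule k (P.cycles l d p) :=
  (LinearMap.range (P.diff (l := l) (d := d) (p := p + 1) (q := p) rfl)).comap
    (P.cycles l d p).subtype

/-- Homology of degree `p`. -/
abbrev homObj (l : List Color) (d : Color) (p : ℤ) : Type u :=
  P.cycles l d p ⧸ P.boundaries l d p

variable {P}

theorem mem_cycles {l : List Color} {d : Color} {p q : ℤ} (h : q + 1 = p) {f : P.obj l d p} :
    f ∈ P.cycles l d p ↔ P.diff h f = 0 := by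
  obtain rfl : q = p - 1 := by omega
  rfl

theorem mem_boundaries {l : List Color} {d : Color} {p q : ℤ} (h : p + 1 = q)
    {f : P.cycles l d p} :
    f ∈ P.boundaries l d p ↔ ∃ g : P.obj l d q, P.diff h g = f := by
  subst h
  rfl

/-- The homology class of a cycle. -/
def homClass {l : List Color} {d : Color} {p q : ℤ} (h : q + 1 = p) (f : P.obj l d p)
    (hf : P.diff h f = 0) : P.homObj l d p :=
  Submodule.Quotient.mk ⟨f, (mem_cycles h).2 hf⟩

theorem act_mem_cycles {l l' : List Color} {d : Color} {p : ℤ} (e : Fin l'.length ≃ Fin l.length)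
    (he : ∀ i, l'.get i = l.get (e i)) (f : P.obj l d p) (hf : f ∈ P.cycles l d p) :
    P.act e he f ∈ P.cycles l' d p := by
  rw [mem_cycles (sub_add_cancel p 1)] at hf ⊢
  rw [P.diff_act, hf, map_zero]

/-- The action of a permutation on cycles. -/
def cyclesAct {l l' : List Color} {d : Color} {p : ℤ} (e : Fin l'.length ≃ Fin l.length)
    (he : ∀ i, l'.get i = l.get (e i)) : P.cycles l d p →ₗ[k] P.cycles l' d p :=
  (P.act e he).restrict (act_mem_cycles e he)

theorem cyclesAct_boundaries {l l' : List Color} {d : Color} {p : ℤ}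
    (e : Fin l'.length ≃ Fin l.length) (he : ∀ i, l'.get i = l.get (e i)) :
    P.boundaries l d p ≤ (P.boundaries l' d p).comap (cyclesAct e he) := by
  intro f hf
  obtain ⟨g, hg⟩ := (mem_boundaries (P := P) rfl).1 hf
  refine (mem_boundaries (P := P) rfl).2 ⟨P.act e he g, ?_⟩
  rw [P.diff_act, hg]
  rfl

theorem comp_mem_cycles {l b l' : List Color} {x d : Color} {p q r : ℤ} (l₁ l₂ : List Color)
    (hl : l = l₁ ++ x :: l₂) (hl' : l' = l₁ ++ b ++ l₂) (hr : p + q = r)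
    (f : P.cycles l d p) (g : P.cycles b x q) :
    P.comp l₁ l₂ hl hl' hr f.1 g.1 ∈ P.cycles l' d r := by
  rw [mem_cycles (sub_add_cancel r 1), P.diff_comp l₁ l₂ hl hl' hr (sub_add_cancel p 1)
    (sub_add_cancel q 1) _ (by omega) (by omega),
    (mem_cycles (sub_add_cancel p 1)).1 f.2, (mem_cycles (sub_add_cancel q 1)).1 g.2]
  simp

/-- Partial composition of cycles. -/
def cyclesComp {l b l' : List Color} {x d : Color} {p q r : ℤ} (l₁ l₂ : List Color)
    (hl : l = l₁ ++ x :: l₂) (hl' : l' = l₁ ++ b ++ l₂) (hr : p + q = r) :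
    P.cycles l d p →ₗ[k] P.cycles b x q →ₗ[k] P.cycles l' d r :=
  LinearMap.mk₂ k (fun f g => ⟨P.comp l₁ l₂ hl hl' hr f.1 g.1,
      comp_mem_cycles l₁ l₂ hl hl' hr f g⟩)
    (fun f f' g => Subtype.ext (by simp))
    (fun a f g => Subtype.ext (by simp))
    (fun f g g' => Subtype.ext (by simp))
    (fun a f g => Subtype.ext (by simp))

theorem cyclesComp_boundaries_right {l b l' : List Color} {x d : Color} {p q r : ℤ}
    (l₁ l₂ : List Color) (hl : l = l₁ ++ x :: l₂) (hl' : l' = l₁ ++ b ++ l₂) (hr : p + q = r)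
    (f : P.cycles l d p) (g : P.cycles b x q) (hg : g ∈ P.boundaries b x q) :
    cyclesComp l₁ l₂ hl hl' hr f g ∈ P.boundaries l' d r := by
  obtain ⟨g', hg'⟩ := (mem_boundaries (P := P) rfl).1 hg
  refine (mem_boundaries (P := P) rfl).2
    ⟨p.negOnePow • P.comp l₁ l₂ hl hl' (by omega : p + (q + 1) = r + 1) f.1 g', ?_⟩
  rw [Units.smul_def, map_zsmul, P.diff_comp l₁ l₂ hl hl' _ (sub_add_cancel p 1) rfl rfl
    (by omega) hr, (mem_cycles (sub_add_cancel p 1)).1 f.2, hg', ← Units.smul_def]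
  simp only [map_zero, LinearMap.zero_apply, zero_add, smul_smul, Int.units_mul_self, one_smul]
  rfl

theorem cyclesComp_boundaries_left {l b l' : List Color} {x d : Color} {p q r : ℤ}
    (l₁ l₂ : List Color) (hl : l = l₁ ++ x :: l₂) (hl' : l' = l₁ ++ b ++ l₂) (hr : p + q = r)
    (f : P.cycles l d p) (g : P.cycles b x q) (hf : f ∈ P.boundaries l d p) :
    cyclesComp l₁ l₂ hl hl' hr f g ∈ P.boundaries l' d r := by
  obtain ⟨f', hf'⟩ := (mem_boundaries (P := P) rfl).1 hf
  refine (mem_boundaries (P := P) rfl).2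
    ⟨P.comp l₁ l₂ hl hl' (by omega : p + 1 + q = r + 1) f' g.1, ?_⟩
  rw [P.diff_comp l₁ l₂ hl hl' _ rfl (sub_add_cancel q 1) rfl hr (by omega),
    (mem_cycles (sub_add_cancel q 1)).1 g.2, hf']
  simp only [map_zero, smul_zero, add_zero]
  rfl

/-- Partial composition in homology. -/
def homComp {l b l' : List Color} {x d : Color} {p q r : ℤ} (l₁ l₂ : List Color)
    (hl : l = l₁ ++ x :: l₂) (hl' : l' = l₁ ++ b ++ l₂) (hr : p + q = r) :
    P.homObj l d p →ₗ[k] P.homObj b x q →ₗ[k] P.homObj l' d r :=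
  Submodule.liftQ _
    { toFun := fun f => Submodule.mapQ _ _ (cyclesComp l₁ l₂ hl hl' hr f)
        (cyclesComp_boundaries_right l₁ l₂ hl hl' hr f)
      map_add' := fun f f' => by
        refine Submodule.linearMap_qext _ (LinearMap.ext fun g => ?_)
        simp
      map_smul' := fun a f => by
        refine Submodule.linearMap_qext _ (LinearMap.ext fun g => ?_)
        simp }
    (by
      intro f hf
      refine (LinearMap.mem_ker).2 (Submodule.linearMap_qext _ (LinearMap.ext fun g => ?_))
      simpa using cyclesComp_boundaries_left l₁ l₂ hl hl' hr f g hf)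

variable (P)

/-- The homology of a dg operad, as an operad with zero differential. -/
def homology : DGOperad k where
  obj := P.homObj
  diff := fun _ => 0
  one := fun x => homClass (show (-1 : ℤ) + 1 = 0 by norm_num) (P.one x) (P.diff_one _)
  act := fun e he => Submodule.mapQ _ _ (cyclesAct e he) (cyclesAct_boundaries e he)
  comp := homComp
  diff_diff := by intros; rfl
  diff_one := by intros; rfl
  diff_act := by intros; simp
  diff_comp := by intros; simp
  act_refl := by
    rintro l d p ⟨f⟩
    exact congrArg Submodule.Quotient.mk (Subtype.ext (P.act_refl f.1))
  act_act := by
    rintro l l' l'' d p e e' he he' ⟨f⟩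
    exact congrArg Submodule.Quotient.mk (Subtype.ext (P.act_act e e' he he' f.1))
  one_comp := by
    rintro l d p hl hl' hr ⟨g⟩
    exact congrArg Submodule.Quotient.mk (Subtype.ext (P.one_comp hl hl' hr g.1))
  comp_one := by
    rintro l x d p l₁ l₂ hl hl' hr ⟨f⟩
    exact congrArg Submodule.Quotient.mk (Subtype.ext (P.comp_one l₁ l₂ hl hl' hr f.1))
  comp_comp := by
    rintro l m b lm mb lmb x y d p q r pq qr pqr l₁ l₂ m₁ m₂ hl hm hlm hmb hlm' hlmb hlmb'
      hpq hqr h₁ h₂ ⟨f⟩ ⟨g⟩ ⟨h⟩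
    exact congrArg Submodule.Quotient.mk (Subtype.ext (P.comp_comp l₁ l₂ m₁ m₂ hl hm hlm hmb hlm'
      hlmb hlmb' hpq hqr h₁ h₂ f.1 g.1 h.1))
  comp_comm := by
    rintro l b c lb lc lbc x y d p q r pq pr pqr l₁ l₂ l₃ hx hy hlb hlb' hlc hlc' hlbc hlbc'
      hpq hpr h₁ h₂ ⟨f⟩ ⟨g⟩ ⟨h⟩
    exact congrArg Submodule.Quotient.mk (Subtype.ext (P.comp_comm l₁ l₂ l₃ hx hy hlb hlb' hlc hlc'
      hlbc hlbc' hpq hpr h₁ h₂ f.1 g.1 h.1))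
  comp_act := by
    rintro l m b c lb mc x d p q r l₁ l₂ m₁ m₂ hl hm hlb hmc hr e he t ht s hs h₁ h₂ h₃ ⟨f⟩ ⟨g⟩
    exact congrArg Submodule.Quotient.mk (Subtype.ext (P.comp_act l₁ l₂ m₁ m₂ hl hm hlb hmc hr
      e he t ht s hs h₁ h₂ h₃ f.1 g.1))

end Homology

end DGOperad

/-! ### The dg operad `sc^!` -/

open Color in
/-- Elements of a dg operad `Q` with the colours, degrees and symmetries of the generators of
`sc^!` (the symmetric group acts by the signature on `l2` and `c2`), which satisfy the defining
relations of `sc^!` and on which the differential takes the prescribed values. -/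
structure ScDualData {k : Type u} [Field k] (Q : DGOperad k) where
  l2 : Q.obj [cl, cl] cl 0
  c2 : Q.obj [cl, cl] cl (-1)
  n02 : Q.obj [op, op] op 0
  n11 : Q.obj [cl, op] op 0
  n10 : Q.obj [cl] op (-1)
  /-- `l2 · (21) = - l2` -/
  l2_symm : Q.act (l := [cl, cl]) (l' := [cl, cl]) (Equiv.swap (0 : Fin 2) 1) (by decide) l2 = -l2
  /-- `c2 · (21) = - c2` -/
  c2_symm : Q.act (l := [cl, cl]) (l' := [cl, cl]) (Equiv.swap (0 : Fin 2) 1) (by decide) c2 = -c2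
  /-- `c2 (id ⊗ c2) = - c2 (c2 ⊗ id)` -/
  c2_assoc : Q.comp (l' := [cl, cl, cl]) (r := -2) [cl] [] rfl rfl (by norm_num) c2 c2 =
    -Q.comp (l' := [cl, cl, cl]) (r := -2) [] [cl] rfl rfl (by norm_num) c2 c2
  /-- `l2 (l2 ⊗ id) · ((123) + (231) + (312)) = 0` -/
  jacobi : Q.comp (l' := [cl, cl, cl]) (r := 0) [] [cl] rfl rfl (by norm_num) l2 l2 +
    Q.act (l := [cl, cl, cl]) (l' := [cl, cl, cl]) (finRotate 3) (by decide)
      (Q.comp (l' := [cl, cl, cl]) (r := 0) [] [cl] rfl rfl (by norm_num) l2 l2) +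
    Q.act (l := [cl, cl, cl]) (l' := [cl, cl, cl]) (finRotate 3).symm (by decide)
      (Q.comp (l' := [cl, cl, cl]) (r := 0) [] [cl] rfl rfl (by norm_num) l2 l2) = 0
  /-- `l2 (id ⊗ c2) = c2 (l2 ⊗ id) + c2 (id ⊗ l2) · (213)` -/
  leibniz : Q.comp (l' := [cl, cl, cl]) (r := -1) [cl] [] rfl rfl (by norm_num) l2 c2 =
    Q.comp (l' := [cl, cl, cl]) (r := -1) [] [cl] rfl rfl (by norm_num) c2 l2 +
    Q.act (l := [cl, cl, cl]) (l' := [cl, cl, cl]) (Equiv.swap (0 : Fin 3) 1) (by decide)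
      (Q.comp (l' := [cl, cl, cl]) (r := -1) [cl] [] rfl rfl (by norm_num) c2 l2)
  /-- `n02 (id ⊗ n02) = n02 (n02 ⊗ id)` -/
  n02_assoc : Q.comp (l' := [op, op, op]) (r := 0) [op] [] rfl rfl (by norm_num) n02 n02 =
    Q.comp (l' := [op, op, op]) (r := 0) [] [op] rfl rfl (by norm_num) n02 n02
  /-- `n11 (l2 ⊗ id) = n11 (id ⊗ n11) · (id - (213))` -/
  n11_l2 : Q.comp (l' := [cl, cl, op]) (r := 0) [] [op] rfl rfl (by norm_num) n11 l2 =
    Q.comp (l' := [cl, cl, op]) (r := 0) [cl] [] rfl rfl (by norm_num) n11 n11 -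
    Q.act (l := [cl, cl, op]) (l' := [cl, cl, op]) (Equiv.swap (0 : Fin 3) 1) (by decide)
      (Q.comp (l' := [cl, cl, op]) (r := 0) [cl] [] rfl rfl (by norm_num) n11 n11)
  /-- `n11 (id ⊗ n02) = n02 (n11 ⊗ id) + n02 (id ⊗ n11) · (213)` -/
  n11_n02 : Q.comp (l' := [cl, op, op]) (r := 0) [cl] [] rfl rfl (by norm_num) n11 n02 =
    Q.comp (l' := [cl, op, op]) (r := 0) [] [op] rfl rfl (by norm_num) n02 n11 +
    Q.act (l := [op, cl, op]) (l' := [cl, op, op]) (Equiv.swap (0 : Fin 3) 1) (by decide)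
      (Q.comp (l' := [op, cl, op]) (r := 0) [op] [] rfl rfl (by norm_num) n02 n11)
  /-- `n11 (c2 ⊗ id) = 0` -/
  n11_c2 : Q.comp (l' := [cl, cl, op]) (r := -1) [] [op] rfl rfl (by norm_num) n11 c2 = 0
  /-- `n10 (l2) = n11 (id ⊗ n10) · ((12) - (21))` -/
  n10_l2 : Q.comp (l' := [cl, cl]) (r := -1) [] [] rfl rfl (by norm_num) n10 l2 =
    Q.comp (l' := [cl, cl]) (r := -1) [cl] [] rfl rfl (by norm_num) n11 n10 -
    Q.act (l := [cl, cl]) (l' := [cl, cl]) (Equiv.swap (0 : Fin 2) 1) (by decide)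
      (Q.comp (l' := [cl, cl]) (r := -1) [cl] [] rfl rfl (by norm_num) n11 n10)
  /-- `n10 (c2) = 0` -/
  n10_c2 : Q.comp (l' := [cl, cl]) (r := -2) [] [] rfl rfl (by norm_num) n10 c2 = 0
  diff_l2 : Q.diff (show (-1 : ℤ) + 1 = 0 by norm_num) l2 = 0
  diff_c2 : Q.diff (show (-2 : ℤ) + 1 = -1 by norm_num) c2 = 0
  diff_n02 : Q.diff (show (-1 : ℤ) + 1 = 0 by norm_num) n02 = 0
  diff_n10 : Q.diff (show (-2 : ℤ) + 1 = -1 by norm_num) n10 = 0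
  /-- `d n11 = n02 (n10 ⊗ id) - n02 (id ⊗ n10) · (21)` -/
  diff_n11 : Q.diff (show (-1 : ℤ) + 1 = 0 by norm_num) n11 =
    Q.comp (l' := [cl, op]) (r := -1) [] [op] rfl rfl (by norm_num) n02 n10 -
    Q.act (l := [op, cl]) (l' := [cl, op]) (Equiv.swap (0 : Fin 2) 1) (by decide)
      (Q.comp (l' := [op, cl]) (r := -1) [op] [] rfl rfl (by norm_num) n02 n10)

open Color in
/-- Formal operadic expressions in the generators of `sc^!`. -/
inductive ScTerm (k : Type u) : List Color → Color → ℤ → Type u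
  | l2 : ScTerm k [cl, cl] cl 0
  | c2 : ScTerm k [cl, cl] cl (-1)
  | n02 : ScTerm k [op, op] op 0
  | n11 : ScTerm k [cl, op] op 0
  | n10 : ScTerm k [cl] op (-1)
  | zero {l : List Color} {d : Color} {p : ℤ} : ScTerm k l d p
  | add {l : List Color} {d : Color} {p : ℤ} (f g : ScTerm k l d p) : ScTerm k l d p
  | smul {l : List Color} {d : Color} {p : ℤ} (a : k) (f : ScTerm k l d p) : ScTerm k l d p
  | diff {l : List Color} {d : Color} {p q : ℤ} (h : q + 1 = p) (f : ScTerm k l d p) :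
      ScTerm k l d q
  | one (x : Color) : ScTerm k [x] x 0
  | act {l l' : List Color} {d : Color} {p : ℤ} (e : Fin l'.length ≃ Fin l.length)
      (he : ∀ i, l'.get i = l.get (e i)) (f : ScTerm k l d p) : ScTerm k l' d p
  | comp {l b l' : List Color} {x d : Color} {p q r : ℤ} (l₁ l₂ : List Color)
      (hl : l = l₁ ++ x :: l₂) (hl' : l' = l₁ ++ b ++ l₂) (hr : p + q = r)
      (f : ScTerm k l d p) (g : ScTerm k b x q) : ScTerm k l' d r

namespace ScTerm

variable {k : Type u} [Field k]

/-- The value of a formal expression in a dg operad with chosen generators. -/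
def eval {Q : DGOperad k} (D : ScDualData Q) :
    {l : List Color} → {d : Color} → {p : ℤ} → ScTerm k l d p → Q.obj l d p
  | _, _, _, l2 => D.l2
  | _, _, _, c2 => D.c2
  | _, _, _, n02 => D.n02
  | _, _, _, n11 => D.n11
  | _, _, _, n10 => D.n10
  | _, _, _, zero => 0
  | _, _, _, add f g => eval D f + eval D g
  | _, _, _, smul a f => a • eval D f
  | _, _, _, diff h f => Q.diff h (eval D f)
  | _, _, _, one x => Q.one x
  | _, _, _, act e he f => Q.act e he (eval D f)
  | _, _, _, comp l₁ l₂ hl hl' hr f g => Q.comp l₁ l₂ hl hl' hr (eval D f) (eval D g)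

variable (k) in
/-- Two expressions are identified when their equality follows from the relations: that is, when
they agree in every dg operad with elements satisfying the defining relations of `sc^!`. -/
def setoid (l : List Color) (d : Color) (p : ℤ) : Setoid (ScTerm k l d p) where
  r f g := ∀ (Q : DGOperad.{u} k) (D : ScDualData Q), eval D f = eval D g
  iseqv := ⟨fun _ _ _ => rfl, fun h Q D => (h Q D).symm, fun h h' Q D => (h Q D).trans (h' Q D)⟩

variable (k) in
/-- The degree `p` part of `sc^!(l; d)`. -/
def Obj (l : List Color) (d : Color) (p : ℤ) : Type u := Quotient (setoid k l d p)

variable {l : List Color} {d : Color} {p : ℤ}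

instance : Zero (Obj k l d p) := ⟨Quotient.mk _ zero⟩

instance : Add (Obj k l d p) :=
  ⟨Quotient.map₂ add fun _ _ h _ _ h' Q D => congrArg₂ (· + ·) (h Q D) (h' Q D)⟩

instance : SMul k (Obj k l d p) :=
  ⟨fun a => Quotient.map (smul a) fun _ _ h Q D => congrArg (a • ·) (h Q D)⟩

instance : Neg (Obj k l d p) :=
  ⟨Quotient.map (smul (-1)) fun _ _ h Q D => congrArg ((-1 : k) • ·) (h Q D)⟩

instance : AddCommGroup (Obj k l d p) where
  add_assoc := by rintro ⟨a⟩ ⟨b⟩ ⟨c⟩; exact Quotient.sound fun Q D => add_assoc _ _ _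
  zero_add := by rintro ⟨a⟩; exact Quotient.sound fun Q D => zero_add _
  add_zero := by rintro ⟨a⟩; exact Quotient.sound fun Q D => add_zero _
  add_comm := by rintro ⟨a⟩ ⟨b⟩; exact Quotient.sound fun Q D => add_comm _ _
  neg_add_cancel := by
    rintro ⟨a⟩
    exact Quotient.sound fun Q D => by simp [eval]
  nsmul := nsmulRec
  zsmul := zsmulRec

instance : Module k (Obj k l d p) where
  one_smul := by rintro ⟨a⟩; exact Quotient.sound fun Q D => one_smul _ _
  mul_smul := by rintro a b ⟨c⟩; exact Quotient.sound fun Q D => mul_smul _ _ _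
  smul_zero := by rintro a; exact Quotient.sound fun Q D => smul_zero _
  smul_add := by rintro a ⟨b⟩ ⟨c⟩; exact Quotient.sound fun Q D => smul_add _ _ _
  add_smul := by rintro a b ⟨c⟩; exact Quotient.sound fun Q D => add_smul _ _ _
  zero_smul := by rintro ⟨a⟩; exact Quotient.sound fun Q D => zero_smul _ _

/-- The differential, the symmetric group actions and the compositions of the classes of formal
expressions. -/
def objDiff {q : ℤ} (h : q + 1 = p) : Obj k l d p →ₗ[k] Obj k l d q where
  toFun := Quotient.map (diff h) fun _ _ H Q D => congrArg (Q.diff h) (H Q D)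
  map_add' := by rintro ⟨a⟩ ⟨b⟩; exact Quotient.sound fun Q D => map_add (Q.diff h) _ _
  map_smul' := by rintro a ⟨b⟩; exact Quotient.sound fun Q D => map_smul (Q.diff h) _ _

/-- See `objDiff`. -/
def objAct {l' : List Color} (e : Fin l'.length ≃ Fin l.length)
    (he : ∀ i, l'.get i = l.get (e i)) : Obj k l d p →ₗ[k] Obj k l' d p where
  toFun := Quotient.map (act e he) fun _ _ H Q D => congrArg (Q.act e he) (H Q D)
  map_add' := by rintro ⟨a⟩ ⟨b⟩; exact Quotient.sound fun Q D => map_add (Q.act e he) _ _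
  map_smul' := by rintro a ⟨b⟩; exact Quotient.sound fun Q D => map_smul (Q.act e he) _ _

/-- See `objDiff`. -/
def objComp {b l' : List Color} {x : Color} {q r : ℤ} (l₁ l₂ : List Color)
    (hl : l = l₁ ++ x :: l₂) (hl' : l' = l₁ ++ b ++ l₂) (hr : p + q = r) :
    Obj k l d p →ₗ[k] Obj k b x q →ₗ[k] Obj k l' d r :=
  LinearMap.mk₂ k
    (Quotient.map₂ (comp l₁ l₂ hl hl' hr) fun _ _ H _ _ H' Q D =>
      congrArg₂ (fun f g => Q.comp l₁ l₂ hl hl' hr f g) (H Q D) (H' Q D))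
    (by rintro ⟨f⟩ ⟨f'⟩ ⟨g⟩
        exact Quotient.sound fun Q D => LinearMap.map_add₂ (Q.comp l₁ l₂ hl hl' hr) _ _ _)
    (by rintro a ⟨f⟩ ⟨g⟩
        exact Quotient.sound fun Q D => LinearMap.map_smul₂ (Q.comp l₁ l₂ hl hl' hr) _ _ _)
    (by rintro ⟨f⟩ ⟨g⟩ ⟨g'⟩
        exact Quotient.sound fun Q D => map_add (Q.comp l₁ l₂ hl hl' hr _) _ _)
    (by rintro a ⟨f⟩ ⟨g⟩
        exact Quotient.sound fun Q D => map_smul (Q.comp l₁ l₂ hl hl' hr _) _ _)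

/-- The value of an element of `sc^!` in a dg operad with chosen generators. -/
def objEval {Q : DGOperad k} (D : ScDualData Q) : Obj k l d p →ₗ[k] Q.obj l d p where
  toFun := Quotient.lift (eval D) fun _ _ h => h Q D
  map_add' := by rintro ⟨a⟩ ⟨b⟩; rfl
  map_smul' := by rintro a ⟨b⟩; rfl

theorem obj_ext {f g : Obj k l d p}
    (h : ∀ (Q : DGOperad.{u} k) (D : ScDualData Q), objEval D f = objEval D g) : f = g := by
  induction f using Quotient.ind
  induction g using Quotient.ind
  exact Quotient.sound h

theorem objEval_diff {Q : DGOperad k} (D : ScDualData Q) {q : ℤ} (h : q + 1 = p)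
    (f : Obj k l d p) : objEval D (objDiff h f) = Q.diff h (objEval D f) := by
  induction f using Quotient.ind
  rfl

theorem objEval_act {Q : DGOperad k} (D : ScDualData Q) {l' : List Color}
    (e : Fin l'.length ≃ Fin l.length) (he : ∀ i, l'.get i = l.get (e i))
    (f : Obj k l d p) : objEval D (objAct e he f) = Q.act e he (objEval D f) := by
  induction f using Quotient.ind
  rfl

theorem objEval_comp {Q : DGOperad k} (D : ScDualData Q) {b l' : List Color} {x : Color} {q r : ℤ}
    (l₁ l₂ : List Color) (hl : l = l₁ ++ x :: l₂) (hl' : l' = l₁ ++ b ++ l₂) (hr : p + q = r)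
    (f : Obj k l d p) (g : Obj k b x q) :
    objEval D (objComp l₁ l₂ hl hl' hr f g) =
      Q.comp l₁ l₂ hl hl' hr (objEval D f) (objEval D g) := by
  induction f using Quotient.ind
  induction g using Quotient.ind
  rfl

theorem objEval_units {Q : DGOperad k} (D : ScDualData Q) (s : ℤˣ) (f : Obj k l d p) :
    objEval D (s • f) = s • objEval D f := by
  simp only [Units.smul_def, map_zsmul]

end ScTerm

open ScTerm in
/-- The dg operad `sc^!`: generated by `l2`, `c2`, `n02`, `n11`, `n10`, with the relations and the
differential listed in `ScDualData`.  It is the universal (initial) dg operad with these data. -/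
def scDual (k : Type u) [Field k] : DGOperad k where
  obj := Obj k
  diff := objDiff
  one x := Quotient.mk _ (one x)
  act := objAct
  comp := objComp
  diff_diff := by
    intros; refine obj_ext fun Q D => ?_
    simp only [objEval_diff, map_zero]; exact Q.diff_diff _ _ _
  diff_one := by
    intros; refine obj_ext fun Q D => ?_
    simp only [map_zero]; exact Q.diff_one _
  diff_act := by
    intros; refine obj_ext fun Q D => ?_
    simp only [objEval_diff, objEval_act]; exact Q.diff_act _ _ _ _
  diff_comp := by
    intro _ _ _ _ _ _ _ _ _ _ _ _ _ _ _ _ hp' hq' _ _ _ _ _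
    refine obj_ext fun Q D => ?_
    simp only [objEval_diff, objEval_comp, map_add, objEval_units]
    exact Q.diff_comp _ _ _ _ _ hp' hq' _ _ _ _ _
  act_refl := by
    rintro _ _ _ ⟨f⟩
    exact Quotient.sound fun Q D => Q.act_refl _
  act_act := by
    intros; refine obj_ext fun Q D => ?_
    simp only [objEval_act]; exact Q.act_act _ _ _ _ _
  one_comp := by
    rintro _ _ _ hl hl' hr ⟨g⟩
    exact Quotient.sound fun Q D => Q.one_comp hl hl' hr _
  comp_one := by
    rintro _ _ _ _ l₁ l₂ hl hl' hr ⟨f⟩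
    exact Quotient.sound fun Q D => Q.comp_one l₁ l₂ hl hl' hr _
  comp_comp := by
    intros; refine obj_ext fun Q D => ?_
    simp only [objEval_comp]; apply Q.comp_comp
  comp_comm := by
    intros; refine obj_ext fun Q D => ?_
    simp only [objEval_comp, objEval_units]; apply Q.comp_comm
  comp_act := by
    intros; refine obj_ext fun Q D => ?_
    simp only [objEval_comp, objEval_act]; apply Q.comp_act <;> assumption

/-- The generators of `sc^!`. -/
def scDualGens (k : Type u) [Field k] : ScDualData (scDual k) where
  l2 := Quotient.mk _ .l2
  c2 := Quotient.mk _ .c2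
  n02 := Quotient.mk _ .n02
  n11 := Quotient.mk _ .n11
  n10 := Quotient.mk _ .n10
  l2_symm := Quotient.sound fun _ D => D.l2_symm.trans (by simp [ScTerm.eval])
  c2_symm := Quotient.sound fun _ D => D.c2_symm.trans (by simp [ScTerm.eval])
  c2_assoc := Quotient.sound fun _ D => D.c2_assoc.trans (by simp [ScTerm.eval])
  jacobi := Quotient.sound fun _ D => D.jacobi
  leibniz := Quotient.sound fun _ D => D.leibniz
  n02_assoc := Quotient.sound fun _ D => D.n02_assoc
  n11_l2 := by
    rw [sub_eq_add_neg]
    exact Quotient.sound fun _ D => D.n11_l2.trans (by simp [ScTerm.eval, sub_eq_add_neg])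
  n11_n02 := Quotient.sound fun _ D => D.n11_n02
  n11_c2 := Quotient.sound fun _ D => D.n11_c2
  n10_l2 := by
    rw [sub_eq_add_neg]
    exact Quotient.sound fun _ D => D.n10_l2.trans (by simp [ScTerm.eval, sub_eq_add_neg])
  n10_c2 := Quotient.sound fun _ D => D.n10_c2
  diff_l2 := Quotient.sound fun _ D => D.diff_l2
  diff_c2 := Quotient.sound fun _ D => D.diff_c2
  diff_n02 := Quotient.sound fun _ D => D.diff_n02
  diff_n10 := Quotient.sound fun _ D => D.diff_n10
  diff_n11 := by
    rw [sub_eq_add_neg]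
    exact Quotient.sound fun _ D => D.diff_n11.trans (by simp [ScTerm.eval, sub_eq_add_neg])

/-! ### Algebras over a `2`-coloured operad -/

section Algebras

variable {k : Type u} [Field k]

/-- Homogeneous inputs: tuples `(a₁, …, aₙ)` with `aᵢ` a homogeneous element of `V_{lᵢ}`. -/
inductive Inputs (V : Color → ChainComplex (ModuleCat.{w} k) ℤ) : List Color → Type w
  | nil : Inputs V []
  | cons {x : Color} {l : List Color} (n : ℤ) (a : (V x).X n) (v : Inputs V l) : Inputs V (x :: l)

namespace Inputs

variable {V W : Color → ChainComplex (ModuleCat.{w} k) ℤ}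

/-- Total degree. -/
def deg : {l : List Color} → Inputs V l → ℤ
  | _, nil => 0
  | _, cons n _ v => n + deg v

/-- Concatenation. -/
def append : {l m : List Color} → Inputs V l → Inputs V m → Inputs V (l ++ m)
  | _, _, nil, w => w
  | _, _, cons n a v, w => cons n a (append v w)

/-- `∑ᵢ (-1)^(|a₁| + ⋯ + |aᵢ₋₁|) F (a₁, …, d aᵢ, …, aₙ)`. -/
def dSum {M : Type w} [AddCommGroup M] :
    {l : List Color} → Inputs V l → (Inputs V l → M) → M
  | _, nil, _ => 0
  | _, cons (x := x) n a v, F =>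
      F (cons (n - 1) (((V x).d n (n - 1)).hom a) v) +
        n.negOnePow • dSum v (fun v' => F (cons n a v'))

/-- Image under a pair of maps. -/
def map (φ : ∀ x, V x ⟶ W x) : {l : List Color} → Inputs V l → Inputs W l
  | _, nil => nil
  | _, cons (x := x) n a v => cons n (((φ x).f n).hom a) (map φ v)

end Inputs

open Inputs in
/-- The structure of an algebra over the dg operad `P` on the pair of dg vector spaces
`V = (V_c, V_o)`.  `ev f v r` is the component of degree `r` of `f (v)`, which is nonzero only if
`r = |f| + |v|`.  The axioms are those of a morphism of dg operads from `P` to the endomorphism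
operad of `V`, with the Koszul sign rule; equivariance is stated for adjacent transpositions,
which generate the symmetric groups. -/
@[ext]
structure OperadAlgebra (P : DGOperad k) (V : Color → ChainComplex (ModuleCat.{w} k) ℤ) where
  ev : ∀ {l : List Color} {d : Color} {p : ℤ}, P.obj l d p → Inputs V l → ∀ r : ℤ, (V d).X r
  ev_deg : ∀ {l : List Color} {d : Color} {p : ℤ} (f : P.obj l d p) (v : Inputs V l) (r : ℤ),
    p + v.deg ≠ r → ev f v r = 0
  ev_add : ∀ {l : List Color} {d : Color} {p : ℤ} (f g : P.obj l d p) (v : Inputs V l) (r : ℤ),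
    ev (f + g) v r = ev f v r + ev g v r
  ev_smul : ∀ {l : List Color} {d : Color} {p : ℤ} (a : k) (f : P.obj l d p) (v : Inputs V l)
    (r : ℤ), ev (a • f) v r = a • ev f v r
  ev_add_arg : ∀ {l₁ l₂ : List Color} {x d : Color} {p n : ℤ} (f : P.obj (l₁ ++ x :: l₂) d p)
    (u : Inputs V l₁) (a b : (V x).X n) (v : Inputs V l₂) (r : ℤ),
    ev f (u.append (cons n (a + b) v)) r =
      ev f (u.append (cons n a v)) r + ev f (u.append (cons n b v)) r
  ev_smul_arg : ∀ {l₁ l₂ : List Color} {x d : Color} {p n : ℤ} (f : P.obj (l₁ ++ x :: l₂) d p)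
    (u : Inputs V l₁) (c : k) (a : (V x).X n) (v : Inputs V l₂) (r : ℤ),
    ev f (u.append (cons n (c • a) v)) r = c • ev f (u.append (cons n a v)) r
  ev_one : ∀ {x : Color} {n : ℤ} (a : (V x).X n), ev (P.one x) (cons n a nil) n = a
  ev_comp : ∀ {l₁ l₂ b : List Color} {x d : Color} {p q s : ℤ} (hs : p + q = s)
    (f : P.obj (l₁ ++ x :: l₂) d p) (g : P.obj b x q)
    (u : Inputs V l₁) (v : Inputs V b) (w : Inputs V l₂) (r : ℤ),
    ev (P.comp l₁ l₂ rfl rfl hs f g) ((u.append v).append w) r =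
      (q * u.deg).negOnePow • ev f (u.append (cons (q + v.deg) (ev g v (q + v.deg)) w)) r
  ev_swap : ∀ {l₁ l₂ : List Color} {x y d : Color} {p m n : ℤ}
    (f : P.obj (l₁ ++ x :: y :: l₂) d p)
    (e : Fin (l₁ ++ y :: x :: l₂).length ≃ Fin (l₁ ++ x :: y :: l₂).length)
    (he : ∀ i, (l₁ ++ y :: x :: l₂).get i = (l₁ ++ x :: y :: l₂).get (e i))
    (_ : ∀ i, (e i : ℕ) = Equiv.swap l₁.length (l₁.length + 1) (i : ℕ))
    (u : Inputs V l₁) (a : (V x).X m) (b : (V y).X n) (v : Inputs V l₂) (r : ℤ),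
    ev (P.act e he f) (u.append (cons n b (cons m a v))) r =
      (m * n).negOnePow • ev f (u.append (cons m a (cons n b v))) r
  ev_diff : ∀ {l : List Color} {d : Color} {p q : ℤ} (h : q + 1 = p) (f : P.obj l d p)
    (v : Inputs V l) (r : ℤ),
    ((V d).d r (r - 1)).hom (ev f v r) =
      ev (P.diff h f) v (r - 1) + p.negOnePow • v.dSum (fun v' => ev f v' (r - 1))

/-- A pair of chain maps is a morphism of algebras over the operad `P`. -/
def OperadAlgebra.IsHom {P : DGOperad k} {V W : Color → ChainComplex (ModuleCat.{w} k) ℤ}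
    (S : OperadAlgebra P V) (T : OperadAlgebra P W) (φ : ∀ x, V x ⟶ W x) : Prop :=
  ∀ {l : List Color} {d : Color} {p : ℤ} (f : P.obj l d p) (v : Inputs V l) (r : ℤ),
    ((φ d).f r).hom (S.ev f v r) = T.ev f (v.map φ) r

/-- The structure of a (dg) `ΛGer`-algebra: a Lie bracket of degree `0` and a product `×` of
degree `-1`. -/
@[ext]
structure LambdaGerAlgebra (H : ChainComplex (ModuleCat.{w} k) ℤ) where
  br : ∀ {m n r : ℤ}, m + n = r → (H.X m →ₗ[k] H.X n →ₗ[k] H.X r)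
  mul : ∀ {m n r : ℤ}, m + n - 1 = r → (H.X m →ₗ[k] H.X n →ₗ[k] H.X r)
  br_symm : ∀ {m n r : ℤ} (h : m + n = r) (x : H.X m) (y : H.X n),
    br h x y = -((m * n).negOnePow • br (by omega) y x)
  mul_symm : ∀ {m n r : ℤ} (h : m + n - 1 = r) (x : H.X m) (y : H.X n),
    mul h x y = -((m * n).negOnePow • mul (by omega) y x)
  mul_assoc : ∀ {m n p r : ℤ} (h : m + n + p - 2 = r) (x : H.X m) (y : H.X n) (z : H.X p),
    m.negOnePow • mul (r := r) (by omega) x (mul (r := n + p - 1) rfl y z) =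
      -mul (by omega) (mul (r := m + n - 1) rfl x y) z
  jacobi : ∀ {m n p r : ℤ} (h : m + n + p = r) (x : H.X m) (y : H.X n) (z : H.X p),
    br (r := r) (by omega) (br (r := m + n) rfl x y) z +
      (m * (n + p)).negOnePow • br (by omega) (br (r := n + p) rfl y z) x +
      (p * (m + n)).negOnePow • br (by omega) (br (r := p + m) rfl z x) y = 0
  leibniz : ∀ {m n p r : ℤ} (h : m + n + p - 1 = r) (x : H.X m) (y : H.X n) (z : H.X p),
    m.negOnePow • br (r := r) (by omega) x (mul (r := n + p - 1) rfl y z) =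
      mul (by omega) (br (r := m + n) rfl x y) z +
        (m * n).negOnePow • mul (by omega) y (br (r := m + p) rfl x z)
  diff_br : ∀ {m n r : ℤ} (h : m + n = r) (x : H.X m) (y : H.X n),
    (H.d r (r - 1)).hom (br h x y) =
      br (by omega) ((H.d m (m - 1)).hom x) y +
        m.negOnePow • br (by omega) x ((H.d n (n - 1)).hom y)
  diff_mul : ∀ {m n r : ℤ} (h : m + n - 1 = r) (x : H.X m) (y : H.X n),
    (H.d r (r - 1)).hom (mul h x y) =
      -(mul (by omega) ((H.d m (m - 1)).hom x) y +
        m.negOnePow • mul (by omega) x ((H.d n (n - 1)).hom y))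

/-- The structure of a (dg, not necessarily unital) associative algebra. -/
@[ext]
structure DGAssocAlgebra (A : ChainComplex (ModuleCat.{w} k) ℤ) where
  mul : ∀ {m n r : ℤ}, m + n = r → (A.X m →ₗ[k] A.X n →ₗ[k] A.X r)
  mul_assoc : ∀ {m n p r : ℤ} (h : m + n + p = r) (a : A.X m) (b : A.X n) (c : A.X p),
    mul (r := r) (by omega) a (mul (r := n + p) rfl b c) = mul (by omega) (mul (r := m + n) rfl a b) c
  diff_mul : ∀ {m n r : ℤ} (h : m + n = r) (a : A.X m) (b : A.X n),
    (A.d r (r - 1)).hom (mul h a b) =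
      mul (by omega) ((A.d m (m - 1)).hom a) b +
        m.negOnePow • mul (by omega) a ((A.d n (n - 1)).hom b)

/-- Triples `(H, A, β)`: a `ΛGer`-algebra structure on `H`, an associative algebra structure on `A`
and a central map `β : H → A` of degree `-1` which vanishes on products `x × y`. -/
@[ext]
structure CentralTriple (H A : ChainComplex (ModuleCat.{w} k) ℤ) where
  ger : LambdaGerAlgebra H
  assoc : DGAssocAlgebra A
  beta : ∀ {m n : ℤ}, n + 1 = m → (H.X m →ₗ[k] A.X n)
  beta_central : ∀ {m n p r : ℤ} (h : n + 1 = m) (h' : n + p = r) (x : H.X m) (a : A.X p),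
    assoc.mul h' (beta h x) a = (p * n).negOnePow • assoc.mul (by omega) a (beta h x)
  beta_mul : ∀ {m n r s : ℤ} (h : m + n - 1 = r) (h' : s + 1 = r) (x : H.X m) (y : H.X n),
    beta h' (ger.mul h x y) = 0
  diff_beta : ∀ {m n : ℤ} (h : n + 1 = m) (x : H.X m),
    (A.d n (n - 1)).hom (beta h x) = -beta (by omega) ((H.d m (m - 1)).hom x)

/-- A pair of chain maps is a morphism of triples `(H, A, β)`. -/
structure CentralTriple.IsHom {H A H' A' : ChainComplex (ModuleCat.{w} k) ℤ}
    (S : CentralTriple H A) (T : CentralTriple H' A') (φ : H ⟶ H') (ψ : A ⟶ A') : Prop where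
  map_br : ∀ {m n r : ℤ} (h : m + n = r) (x : H.X m) (y : H.X n),
    (φ.f r).hom (S.ger.br h x y) = T.ger.br h ((φ.f m).hom x) ((φ.f n).hom y)
  map_ger_mul : ∀ {m n r : ℤ} (h : m + n - 1 = r) (x : H.X m) (y : H.X n),
    (φ.f r).hom (S.ger.mul h x y) = T.ger.mul h ((φ.f m).hom x) ((φ.f n).hom y)
  map_assoc_mul : ∀ {m n r : ℤ} (h : m + n = r) (a : A.X m) (b : A.X n),
    (ψ.f r).hom (S.assoc.mul h a b) = T.assoc.mul h ((ψ.f m).hom a) ((ψ.f n).hom b)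
  map_beta : ∀ {m n : ℤ} (h : n + 1 = m) (x : H.X m),
    (ψ.f n).hom (S.beta h x) = T.beta h ((φ.f m).hom x)

end Algebras

/-! ### The classes of the generators in the homology of `sc^!` -/

section Classes

variable (k : Type u) [Field k]

/-- The homology operad `H_*(sc^!)`. -/
abbrev scDualHomology : DGOperad k := (scDual k).homology

open Color

/-- The class of `l2`. -/
def l2Class : (scDualHomology k).obj [cl, cl] cl 0 :=
  DGOperad.homClass _ (scDualGens k).l2 (scDualGens k).diff_l2

/-- The class of `c2`. -/
def c2Class : (scDualHomology k).obj [cl, cl] cl (-1) :=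
  DGOperad.homClass _ (scDualGens k).c2 (scDualGens k).diff_c2

/-- The class of `n02`. -/
def n02Class : (scDualHomology k).obj [op, op] op 0 :=
  DGOperad.homClass _ (scDualGens k).n02 (scDualGens k).diff_n02

/-- The class of `n10`. -/
def n10Class : (scDualHomology k).obj [cl] op (-1) :=
  DGOperad.homClass _ (scDualGens k).n10 (scDualGens k).diff_n10

end Classes

noncomputable section

section KoszulSign

variable {ι κ : Type*} [Fintype ι] [Fintype κ]

/-- The Koszul sign of the rearrangement of elements of degrees `δ` from the order given by `r`
to the order given by `s`. -/
def koszul (r s : ι → ℕ) (δ : ι → ℤ) : ℤˣ :=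
  ∏ i, ∏ j, if r i < r j ∧ s j < s i then (δ i * δ j).negOnePow else 1

lemma koszul_reindex (e : κ ≃ ι) (r s : ι → ℕ) (δ : ι → ℤ) :
    koszul (r ∘ e) (s ∘ e) (δ ∘ e) = koszul r s δ := by
  unfold koszul
  rw [← e.prod_comp]
  refine Finset.prod_congr rfl fun i _ => ?_
  rw [← e.prod_comp]
  rfl

lemma negOnePow_mul_self (n : ℤ) : n.negOnePow * n.negOnePow = 1 :=
  Int.units_mul_self _

lemma prod_prod_symm (r : ι → ℕ) (hr : Function.Injective r) (G : ι → ι → ℤˣ)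
    (hG : ∀ i, G i i = 1) :
    ∏ i, ∏ j, G i j = ∏ i, ∏ j, if r i < r j then G i j * G j i else 1 := by
  have h : ∀ i j, G i j = (if r i < r j then G i j else 1) * (if r j < r i then G i j else 1) := by
    intro i j
    rcases lt_trichotomy (r i) (r j) with h | h | h
    · simp [h, h.not_gt]
    · obtain rfl := hr h
      simp [hG]
    · simp [h, h.not_gt]
  have h2 : ∏ i, ∏ j, (if r j < r i then G i j else 1) =
      ∏ i, ∏ j, (if r i < r j then G j i else 1) := Finset.prod_comm
  have h3 : ∏ i, ∏ j, G i j = (∏ i, ∏ j, if r i < r j then G i j else 1) *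
      ∏ i, ∏ j, (if r j < r i then G i j else 1) := by
    simp only [← Finset.prod_mul_distrib, ← h]
  rw [h3, h2, ← Finset.prod_mul_distrib]
  refine Finset.prod_congr rfl fun i _ => ?_
  rw [← Finset.prod_mul_distrib]
  refine Finset.prod_congr rfl fun j _ => ?_
  split_ifs <;> simp

lemma koszul_trans (r s t : ι → ℕ) (hr : Function.Injective r) (hs : Function.Injective s)
    (ht : Function.Injective t) (δ : ι → ℤ) :
    koszul r t δ = koszul r s δ * koszul s t δ := by
  unfold koszul
  rw [← Finset.prod_mul_distrib]
  simp_rw [← Finset.prod_mul_distrib]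
  rw [prod_prod_symm r hr _ (by simp)]
  conv_rhs => rw [prod_prod_symm r hr _ (by simp)]
  refine Finset.prod_congr rfl fun i _ => Finset.prod_congr rfl fun j _ => ?_
  by_cases hij : r i < r j
  · have hne : i ≠ j := by rintro rfl; exact lt_irrefl _ hij
    have e := mul_comm (δ j) (δ i)
    have sq := negOnePow_mul_self (δ i * δ j)
    rcases lt_or_gt_of_ne (hs.ne hne) with h1 | h1 <;> rcases lt_or_gt_of_ne (ht.ne hne) with h2 | h2 <;>
      simp [hij, hij.not_gt, h1, h1.not_gt, h2, h2.not_gt, e, sq]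
  · simp [hij]

lemma koszul_refl (r : ι → ℕ) (δ : ι → ℤ) : koszul r r δ = 1 := by
  unfold koszul
  refine Finset.prod_eq_one fun i _ => Finset.prod_eq_one fun j _ => if_neg ?_
  omega

lemma koszul_zero (r s : ι → ℕ) (δ : ι → ℤ) (h : ∀ i, δ i = 0) : koszul r s δ = 1 := by
  unfold koszul
  refine Finset.prod_eq_one fun i _ => Finset.prod_eq_one fun j _ => ?_
  simp [h]

/-- The sign of the elements that stand before `i0` -/
def passSign (r : ι → ℕ) (δ : ι → ℤ) (q : ℤ) (i0 : ι) : ℤˣ :=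
  ∏ i, if r i < r i0 then (q * δ i).negOnePow else 1

lemma negOnePow_sum {α : Type*} (s : Finset α) (f : α → ℤ) :
    (∑ i ∈ s, f i).negOnePow = ∏ i ∈ s, (f i).negOnePow := by
  classical
  induction s using Finset.induction_on with
  | empty => simp
  | insert a s ha ih => rw [Finset.sum_insert ha, Finset.prod_insert ha, Int.negOnePow_add, ih]

lemma passSign_add (r : ι → ℕ) (δ : ι → ℤ) (q q' : ℤ) (i0 : ι) :
    passSign r δ (q + q') i0 = passSign r δ q i0 * passSign r δ q' i0 := by
  unfold passSign
  rw [← Finset.prod_mul_distrib]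
  refine Finset.prod_congr rfl fun i _ => ?_
  split_ifs <;> simp [add_mul, Int.negOnePow_add]

lemma passSign_eq (r : ι → ℕ) (δ : ι → ℤ) (q : ℤ) (i0 : ι) :
    passSign r δ q i0 = (q * ∑ i, if r i < r i0 then δ i else 0).negOnePow := by
  unfold passSign
  rw [Finset.mul_sum, negOnePow_sum]
  refine Finset.prod_congr rfl fun i _ => ?_
  split_ifs <;> simp

variable [DecidableEq ι]

/-- One distinguished element against all the others. -/
lemma koszul_split (r s : ι → ℕ) (hr : Function.Injective r) (hs : Function.Injective s)
    (δ : ι → ℤ) (i0 : ι) :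
    koszul r s δ = (∏ i, ∏ j, if i ≠ i0 ∧ j ≠ i0 ∧ r i < r j ∧ s j < s i then
      (δ i * δ j).negOnePow else 1) *
      (passSign r δ (δ i0) i0 * passSign s δ (δ i0) i0) := by
  unfold koszul passSign
  have h : ∀ i j, (if r i < r j ∧ s j < s i then (δ i * δ j).negOnePow else 1) =
      (if i ≠ i0 ∧ j ≠ i0 ∧ r i < r j ∧ s j < s i then (δ i * δ j).negOnePow else 1) *
      ((if j = i0 then (if r i < r i0 ∧ s i0 < s i then (δ i0 * δ i).negOnePow else 1) else 1) *
       (if i = i0 then (if r i0 < r j ∧ s j < s i0 then (δ i0 * δ j).negOnePow else 1) else 1)) := by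
    intro i j
    by_cases hi : i = i0 <;> by_cases hj : j = i0 <;> simp [hi, hj, mul_comm]
  rw [Finset.prod_congr rfl fun i _ => Finset.prod_congr rfl fun j _ => h i j]
  simp only [Finset.prod_mul_distrib]
  congr 1
  have h3 : ∏ x, ∏ x_1, (if x = i0 then if r i0 < r x_1 ∧ s x_1 < s i0 then
      (δ i0 * δ x_1).negOnePow else 1 else 1) = ∏ x_1, if r i0 < r x_1 ∧ s x_1 < s i0 then
      (δ i0 * δ x_1).negOnePow else 1 := by
    rw [Finset.prod_comm]
    simp
  rw [h3]
  simp only [Finset.prod_ite_eq', Finset.mem_univ, if_true]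
  rw [← Finset.prod_mul_distrib, ← Finset.prod_mul_distrib]
  refine Finset.prod_congr rfl fun i _ => ?_
  by_cases hi : i = i0
  · simp [hi]
  · have sq := negOnePow_mul_self (δ i0 * δ i)
    rcases lt_or_gt_of_ne (hs.ne hi) with h1 | h1 <;> rcases lt_or_gt_of_ne (hr.ne hi) with h2 | h2 <;>
      simp [h1, h1.not_gt, h2, h2.not_gt, sq]

lemma passSign_congr (r : ι → ℕ) (δ δ' : ι → ℤ) (q : ℤ) (i0 : ι) (h : ∀ i, i ≠ i0 → δ i = δ' i) :
    passSign r δ q i0 = passSign r δ' q i0 := by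
  unfold passSign
  refine Finset.prod_congr rfl fun i _ => ?_
  by_cases hi : i = i0
  · simp [hi]
  · rw [h i hi]

lemma koszul_shift (r s : ι → ℕ) (hr : Function.Injective r) (hs : Function.Injective s)
    (δ δ' : ι → ℤ) (i0 : ι) (q : ℤ) (h : ∀ i, i ≠ i0 → δ' i = δ i) (h0 : δ' i0 = δ i0 + q) :
    koszul r s δ' = koszul r s δ * (passSign r δ q i0 * passSign s δ q i0) := by
  rw [koszul_split r s hr hs δ i0, koszul_split r s hr hs δ' i0, h0, passSign_add, passSign_add,
    passSign_congr r δ' δ _ i0 h, passSign_congr r δ' δ _ i0 h, passSign_congr s δ' δ _ i0 h,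
    passSign_congr s δ' δ _ i0 h]
  have : (∏ i, ∏ j, if i ≠ i0 ∧ j ≠ i0 ∧ r i < r j ∧ s j < s i then
      (δ' i * δ' j).negOnePow else 1) = (∏ i, ∏ j, if i ≠ i0 ∧ j ≠ i0 ∧ r i < r j ∧ s j < s i then
      (δ i * δ j).negOnePow else 1) := by
    refine Finset.prod_congr rfl fun i _ => Finset.prod_congr rfl fun j _ => ?_
    by_cases hi : i = i0
    · simp [hi]
    · by_cases hj : j = i0
      · simp [hj]
      · rw [h i hi, h j hj]
  rw [this]
  simp only [mul_assoc, mul_left_comm, mul_comm]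

/-- Replacing one element by a block of elements. -/
lemma koszul_block (i0 : ι) (r s : ι → ℕ) (hr : Function.Injective r)
    (hs : Function.Injective s) (r' s' : κ → ℕ)
    (R S : {i // i ≠ i0} ⊕ κ → ℕ) (δ : ι → ℤ) (δ' : κ → ℤ) (h0 : δ i0 = ∑ j, δ' j)
    (R1 : ∀ i i' : {i // i ≠ i0}, R (.inl i) < R (.inl i') ↔ r i < r i')
    (R2 : ∀ (i : {i // i ≠ i0}) (j : κ), R (.inl i) < R (.inr j) ↔ r i < r i0)
    (R2' : ∀ (i : {i // i ≠ i0}) (j : κ), R (.inr j) < R (.inl i) ↔ r i0 < r i)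
    (R3 : ∀ j j' : κ, R (.inr j) < R (.inr j') ↔ r' j < r' j')
    (S1 : ∀ i i' : {i // i ≠ i0}, S (.inl i) < S (.inl i') ↔ s i < s i')
    (S2 : ∀ (i : {i // i ≠ i0}) (j : κ), S (.inl i) < S (.inr j) ↔ s i < s i0)
    (S2' : ∀ (i : {i // i ≠ i0}) (j : κ), S (.inr j) < S (.inl i) ↔ s i0 < s i)
    (S3 : ∀ j j' : κ, S (.inr j) < S (.inr j') ↔ s' j < s' j') :
    koszul R S (Sum.elim (fun i => δ i) δ') = koszul r s δ * koszul r' s' δ' := by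
  have hsub : ∀ f : ι → ℤˣ, f i0 = 1 → ∏ i, f i = ∏ i : {i // i ≠ i0}, f i := by
    intro f hf
    rw [Fintype.prod_eq_mul_prod_subtype_ne f i0, hf, one_mul]
  rw [koszul_split r s hr hs δ i0, hsub _ (by simp)]
  have e1 : ∀ i : {i // i ≠ i0}, (∏ j, if (i : ι) ≠ i0 ∧ j ≠ i0 ∧ r i < r j ∧ s j < s i then
      (δ i * δ j).negOnePow else 1) = ∏ j : {i // i ≠ i0}, if r i < r j ∧ s j < s i then
      (δ i * δ j).negOnePow else 1 := by
    intro i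
    rw [hsub _ (by simp)]
    refine Finset.prod_congr rfl fun j _ => ?_
    simp [i.2, j.2]
  simp_rw [e1]
  have e2 : passSign r δ (δ i0) i0 * passSign s δ (δ i0) i0 =
      ∏ i : {i // i ≠ i0}, ((if r i < r i0 then ((δ i0) * δ i).negOnePow else 1) *
        (if s i < s i0 then ((δ i0) * δ i).negOnePow else 1)) := by
    unfold passSign
    rw [← Finset.prod_mul_distrib, hsub _ (by simp)]
  rw [e2]
  unfold koszul
  simp only [Fintype.prod_sum_type, Sum.elim_inl, Sum.elim_inr, R1, R2, R2', R3, S1, S2, S2', S3]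
  rw [Finset.prod_mul_distrib, Finset.prod_mul_distrib, ← mul_assoc, mul_assoc (∏ _, ∏ _, _)]
  congr 2
  rw [Finset.prod_comm (s := (Finset.univ : Finset κ)), ← Finset.prod_mul_distrib]
  refine Finset.prod_congr rfl fun i _ => ?_
  have hsum : (δ i0 * δ i).negOnePow = ∏ j, (δ' j * δ i).negOnePow := by
    rw [h0, Finset.sum_mul, negOnePow_sum]
  have hsum' : ∏ j, (δ i * δ' j).negOnePow = (δ i0 * δ i).negOnePow := by
    rw [hsum]
    exact Finset.prod_congr rfl fun j _ => by rw [mul_comm]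
  have sq := negOnePow_mul_self (δ i0 * δ i)
  rcases lt_or_gt_of_ne (hs.ne i.2) with h1 | h1 <;> rcases lt_or_gt_of_ne (hr.ne i.2) with h2 | h2 <;>
    simp [h1, h1.not_gt, h2, h2.not_gt, sq, hsum', ← hsum]

end KoszulSign

section EndOperad

variable {k : Type u} [Field k]

/-- Homogeneous elements of a pair of complexes. -/
structure HomEl (V : Color → ChainComplex (ModuleCat.{w} k) ℤ) where
  col : Color
  deg : ℤ
  val : (V col).X deg

variable {V : Color → ChainComplex (ModuleCat.{w} k) ℤ}

instance : Inhabited (HomEl V) := ⟨⟨.cl, 0, 0⟩⟩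

/-- The differential of a homogeneous element. -/
def HomEl.diff (a : HomEl V) : HomEl V :=
  ⟨a.col, a.deg - 1, ((V a.col).d a.deg (a.deg - 1)).hom a.val⟩

/-- The colours of a list of homogeneous elements. -/
def cols (v : List (HomEl V)) : List Color := v.map HomEl.col

/-- The total degree of a list of homogeneous elements. -/
def degs (v : List (HomEl V)) : ℤ := (v.map HomEl.deg).sum

@[simp] lemma cols_nil : cols ([] : List (HomEl V)) = [] := rfl
@[simp] lemma cols_cons (a : HomEl V) (v) : cols (a :: v) = a.col :: cols v := rfl
@[simp] lemma cols_append (v v' : List (HomEl V)) : cols (v ++ v') = cols v ++ cols v' := by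
  simp [cols]
@[simp] lemma degs_nil : degs ([] : List (HomEl V)) = 0 := rfl
@[simp] lemma degs_cons (a : HomEl V) (v) : degs (a :: v) = a.deg + degs v := by simp [degs]
@[simp] lemma degs_append (v v' : List (HomEl V)) : degs (v ++ v') = degs v + degs v' := by
  simp [degs]
@[simp] lemma length_cols (v : List (HomEl V)) : (cols v).length = v.length := by simp [cols]

/-- The homogeneous element with value `f n`. -/
def HomEl.out (x : Color) (f : ∀ r, (V x).X r) (n : ℤ) : HomEl V := ⟨x, n, f n⟩

@[simp] lemma HomEl.out_col (x : Color) (f : ∀ r, (V x).X r) (n : ℤ) :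
    (HomEl.out x f n).col = x := rfl
@[simp] lemma HomEl.out_deg (x : Color) (f : ∀ r, (V x).X r) (n : ℤ) :
    (HomEl.out x f n).deg = n := rfl

/-- Multilinear operations of colours `(l; d)` and degree `p`; `F v r` is the component of degree
`r` of the value at `v`. -/
structure IsMultiOp (l : List Color) (d : Color) (p : ℤ)
    (F : List (HomEl V) → ∀ r, (V d).X r) : Prop where
  cols_ne : ∀ v r, cols v ≠ l → F v r = 0
  degs_ne : ∀ v r, p + degs v ≠ r → F v r = 0
  map_add : ∀ u x n (a b : (V x).X n) v r,
    F (u ++ ⟨x, n, a + b⟩ :: v) r = F (u ++ ⟨x, n, a⟩ :: v) r + F (u ++ ⟨x, n, b⟩ :: v) r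
  map_smul : ∀ u x n (c : k) (a : (V x).X n) v r,
    F (u ++ ⟨x, n, c • a⟩ :: v) r = c • F (u ++ ⟨x, n, a⟩ :: v) r

variable (V) in
/-- The space of multilinear operations of colours `(l; d)` and degree `p`. -/
def EndObj (l : List Color) (d : Color) (p : ℤ) :
    Submodule k (List (HomEl V) → ∀ r, (V d).X r) where
  carrier := {F | IsMultiOp l d p F}
  zero_mem' := ⟨fun _ _ _ => rfl, fun _ _ _ => rfl, by simp, by simp⟩
  add_mem' := fun {F G} hF hG =>
    ⟨fun v r h => by simp [hF.cols_ne v r h, hG.cols_ne v r h],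
      fun v r h => by simp [hF.degs_ne v r h, hG.degs_ne v r h],
      fun u x n a b v r => by simp only [Pi.add_apply, hF.map_add, hG.map_add]; abel,
      fun u x n c a v r => by simp only [Pi.add_apply, hF.map_smul, hG.map_smul, smul_add]⟩
  smul_mem' := fun c F hF =>
    ⟨fun v r h => by simp [hF.cols_ne v r h],
      fun v r h => by simp [hF.degs_ne v r h],
      fun u x n a b v r => by simp only [Pi.smul_apply, hF.map_add, smul_add],
      fun u x n c' a v r => by simp only [Pi.smul_apply, hF.map_smul, smul_comm c c']⟩

variable {l l' l'' b c m : List Color} {x y d : Color} {p q r : ℤ}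

lemma EndObj.ext {F G : EndObj V l d p}
    (h : ∀ v, cols v = l → F.1 v (p + degs v) = G.1 v (p + degs v)) : F = G := by
  refine Subtype.ext (funext fun v => funext fun r => ?_)
  by_cases hv : cols v = l
  · by_cases hr : p + degs v = r
    · subst hr; exact h v hv
    · rw [F.2.degs_ne v r hr, G.2.degs_ne v r hr]
  · rw [F.2.cols_ne v r hv, G.2.cols_ne v r hv]

lemma EndObj.ext' {F G : EndObj V l d p}
    (h : ∀ v r, cols v = l → F.1 v r = G.1 v r) : F = G :=
  EndObj.ext fun v hv => h v _ hv

namespace IsMultiOp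

lemma of_linear {F : List (HomEl V) → ∀ r, (V d).X r} (h1 : ∀ v r, cols v ≠ l → F v r = 0)
    (h2 : ∀ v r, p + degs v ≠ r → F v r = 0) (h : ∀ u x n (c : k) (a b : (V x).X n) v r,
      F (u ++ ⟨x, n, c • a + b⟩ :: v) r =
        c • F (u ++ ⟨x, n, a⟩ :: v) r + F (u ++ ⟨x, n, b⟩ :: v) r) : IsMultiOp l d p F :=
  ⟨h1, h2, fun u x n a b v r => by simpa using h u x n 1 a b v r, fun u x n c a v r => by
    have h0 := h u x n 1 0 0 v r
    rw [one_smul, one_smul, add_zero, left_eq_add] at h0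
    simpa [h0] using h u x n c a 0 v r⟩

variable {F : List (HomEl V) → ∀ r, (V d).X r}

lemma map_zero (hF : IsMultiOp l d p F) (u x n v r) : F (u ++ ⟨x, n, 0⟩ :: v) r = 0 := by
  have := hF.map_smul u x n 0 0 v r
  rwa [zero_smul, zero_smul] at this

lemma map_units (hF : IsMultiOp l d p F) (u x n) (s : ℤˣ) (a v r) :
    F (u ++ ⟨x, n, s • a⟩ :: v) r = s • F (u ++ ⟨x, n, a⟩ :: v) r := by
  rcases Int.units_eq_one_or s with rfl | rfl
  · simp
  · simpa [Units.smul_def] using hF.map_smul u x n (-1) a v r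

lemma out_add (hF : IsMultiOp l d p F) (u x) (f g : ∀ r, (V x).X r) (n v r) : F (u ++ HomEl.out x (f + g) n :: v) r =
    F (u ++ HomEl.out x f n :: v) r + F (u ++ HomEl.out x g n :: v) r := hF.map_add ..

lemma out_smul (hF : IsMultiOp l d p F) (u x) (c : k) (f : ∀ r, (V x).X r) (n v r) :
    F (u ++ HomEl.out x (c • f) n :: v) r = c • F (u ++ HomEl.out x f n :: v) r := hF.map_smul ..

lemma out_units (hF : IsMultiOp l d p F) (u x) (s : ℤˣ) (f : ∀ r, (V x).X r) (n v r) :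
    F (u ++ HomEl.out x (s • f) n :: v) r = s • F (u ++ HomEl.out x f n :: v) r := hF.map_units ..

lemma fun_linear (hF : IsMultiOp l d p F) (u x n) (c : k) (a b : (V x).X n) (v) : F (u ++ ⟨x, n, c • a + b⟩ :: v) =
    c • F (u ++ ⟨x, n, a⟩ :: v) + F (u ++ ⟨x, n, b⟩ :: v) :=
  funext fun _ => by rw [hF.map_add, hF.map_smul]; rfl

end IsMultiOp

/-! ### Composition -/

lemma exists_split (l₁ b l₂ : List Color) (v : List (HomEl V)) (h : cols v = l₁ ++ b ++ l₂) :
    ∃ v1 v2 v3, v = v1 ++ v2 ++ v3 ∧ cols v1 = l₁ ∧ cols v2 = b ∧ cols v3 = l₂ := by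
  unfold cols at h
  obtain ⟨v', v3, rfl, h', h3⟩ := List.map_eq_append_iff.1 h
  obtain ⟨v1, v2, rfl, h1, h2⟩ := List.map_eq_append_iff.1 h'
  exact ⟨v1, v2, v3, rfl, h1, h2, h3⟩

lemma exists_split_cons (l₁ b l₂ : List Color) (y : Color) (u w : List (HomEl V))
    (h : cols u ++ y :: cols w = l₁ ++ b ++ l₂) :
    (∃ w1 w2 w3, w = w1 ++ w2 ++ w3 ∧ cols u ++ y :: cols w1 = l₁ ∧ cols w2 = b ∧
      cols w3 = l₂) ∨
    (∃ u1 u2 w2 w3, u = u1 ++ u2 ∧ w = w2 ++ w3 ∧ cols u1 = l₁ ∧ cols u2 ++ y :: cols w2 = b ∧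
      cols w3 = l₂) ∨
    (∃ u1 u2 u3, u = u1 ++ u2 ++ u3 ∧ cols u1 = l₁ ∧ cols u2 = b ∧
      cols u3 ++ y :: cols w = l₂) := by
  have h' : cols (u ++ (⟨y, 0, 0⟩ : HomEl V) :: w) = l₁ ++ b ++ l₂ := by simpa using h
  obtain ⟨v1, v2, v3, e, h1, h2, h3⟩ := exists_split l₁ b l₂ _ h'
  rw [List.append_assoc] at e
  rcases List.append_eq_append_iff.1 e with ⟨a, ha, ha'⟩ | ⟨a, ha, ha'⟩
  · rcases a with _ | ⟨a0, a⟩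
    · simp only [List.append_nil, List.nil_append] at ha ha'
      rcases v2 with _ | ⟨a0, v2⟩
      · obtain ⟨rfl, rfl⟩ : v1 = u ∧ v3 = ⟨y, 0, 0⟩ :: w := ⟨ha, by simpa using ha'.symm⟩
        exact .inr (.inr ⟨v1, [], [], by simp, h1, h2, by simpa using h3⟩)
      · simp only [List.cons_append, List.cons.injEq] at ha'
        obtain ⟨rfl, rfl⟩ := ha'
        exact .inr (.inl ⟨u, [], v2, v3, by simp, rfl, by rw [← h1, ha], by simpa using h2, h3⟩)
    · simp only [List.cons_append, List.cons.injEq] at ha'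
      obtain ⟨rfl, rfl⟩ := ha'
      exact .inl ⟨a, v2, v3, by simp, by simpa [ha] using h1, h2, h3⟩
  · rcases List.append_eq_append_iff.1 ha' with ⟨a', hb, hb'⟩ | ⟨a', hb, hb'⟩
    · exact .inr (.inr ⟨v1, v2, a', by simp [ha, hb], h1, h2, by simpa [hb'] using h3⟩)
    · rcases a' with _ | ⟨a0, a'⟩
      · simp only [List.append_nil, List.nil_append] at hb hb'
        exact .inr (.inr ⟨v1, v2, [], by simp [ha, hb], h1, h2, by simpa [← hb'] using h3⟩)
      · simp only [List.cons_append, List.cons.injEq] at hb'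
        obtain ⟨rfl, rfl⟩ := hb'
        exact .inr (.inl ⟨v1, a, a', v3, ha, rfl, h1, by simpa [hb] using h2, h3⟩)

/-- The operation `f (id ⊗ ⋯ ⊗ g ⊗ ⋯ ⊗ id)`. -/
def compFun (l₁ b l₂ : List Color) (x : Color) (q : ℤ) (F : List (HomEl V) → ∀ r, (V d).X r)
    (G : List (HomEl V) → ∀ r, (V x).X r) (v : List (HomEl V)) (r : ℤ) : (V d).X r :=
  if cols v = l₁ ++ b ++ l₂ then
    let v1 := v.take l₁.length
    let v2 := (v.drop l₁.length).take b.length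
    let v3 := (v.drop l₁.length).drop b.length
    (q * degs v1).negOnePow • F (v1 ++ HomEl.out x (G v2) (q + degs v2) :: v3) r
  else 0

lemma compFun_append {l₁ b l₂ : List Color} (F : List (HomEl V) → ∀ r, (V d).X r)
    (G : List (HomEl V) → ∀ r, (V x).X r) (u v w : List (HomEl V)) (r : ℤ)
    (hu : cols u = l₁) (hv : cols v = b) (hw : cols w = l₂) :
    compFun l₁ b l₂ x q F G (u ++ v ++ w) r = (q * degs u).negOnePow •
      F (u ++ HomEl.out x (G v) (q + degs v) :: w) r := by
  subst hu hv hw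
  have h1 : (u ++ v ++ w).take u.length = u := by simp
  have h2 : (u ++ v ++ w).drop u.length = v ++ w := by simp
  have h3 : (v ++ w).take v.length = v := by simp
  have h4 : (v ++ w).drop v.length = w := by simp
  simp only [compFun, length_cols, h1, h2, h3, h4, cols_append, if_true]

lemma compFun_ne {l₁ b l₂ : List Color} (F : List (HomEl V) → ∀ r, (V d).X r)
    (G : List (HomEl V) → ∀ r, (V x).X r) (v : List (HomEl V)) (r : ℤ)
    (h : cols v ≠ l₁ ++ b ++ l₂) : compFun l₁ b l₂ x q F G v r = 0 := if_neg h

lemma isMultiOp_comp (l₁ l₂ : List Color) {F : List (HomEl V) → ∀ r, (V d).X r}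
    {G : List (HomEl V) → ∀ r, (V x).X r} (hF : IsMultiOp (l₁ ++ x :: l₂) d p F)
    (hG : IsMultiOp b x q G) (hr : p + q = r) :
    IsMultiOp (l₁ ++ b ++ l₂) d r (compFun l₁ b l₂ x q F G) := by
  refine .of_linear (fun v s hv => if_neg hv) (fun v s hv => ?_) ?_
  · by_cases h : cols v = l₁ ++ b ++ l₂
    · obtain ⟨v1, v2, v3, rfl, h1, h2, h3⟩ := exists_split _ _ _ _ h
      rw [compFun_append F G _ _ _ _ h1 h2 h3, hF.degs_ne, smul_zero]
      simp only [degs_append, degs_cons, HomEl.out_deg] at hv ⊢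
      omega
    · exact if_neg h
  · intro u y n c a1 a2 w s
    by_cases h : cols u ++ y :: cols w = l₁ ++ b ++ l₂
    · rcases exists_split_cons _ _ _ _ _ _ h with ⟨w1, w2, w3, rfl, h1, h2, h3⟩ |
        ⟨u1, u2, w2, w3, rfl, rfl, h1, h2, h3⟩ | ⟨u1, u2, u3, rfl, h1, h2, h3⟩
      · have e : ∀ a : HomEl V, u ++ a :: (w1 ++ w2 ++ w3) = (u ++ a :: w1) ++ w2 ++ w3 := by simp
        have e' : ∀ a a' : HomEl V, (u ++ a :: w1) ++ a' :: w3 = u ++ a :: (w1 ++ a' :: w3) := by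
          simp
        simp only [e]
        simp only [compFun_append F G _ _ _ _ (show cols (u ++ (⟨y, n, _⟩ : HomEl V) :: w1) = l₁ by
          simpa using h1) h2 h3, e', hF.map_add, hF.map_smul, smul_add]
        simp [smul_comm c]
      · have e : ∀ a : HomEl V, (u1 ++ u2) ++ a :: (w2 ++ w3) = u1 ++ (u2 ++ a :: w2) ++ w3 := by
          simp
        simp only [e]
        simp only [compFun_append F G _ _ _ _ h1 (show cols (u2 ++ (⟨y, n, _⟩ : HomEl V) :: w2) = b by
          simpa using h2) h3]
        simp only [degs_append, degs_cons, hG.fun_linear, hF.out_add, hF.out_smul, smul_add,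
          smul_comm c]
      · have e : ∀ a : HomEl V, (u1 ++ u2 ++ u3) ++ a :: w = u1 ++ u2 ++ (u3 ++ a :: w) := by
          simp
        have e' : ∀ a a' : HomEl V, u1 ++ a' :: (u3 ++ a :: w) = (u1 ++ a' :: u3) ++ a :: w := by
          simp
        simp only [e]
        simp only [compFun_append F G _ _ _ _ h1 h2
          (show cols (u3 ++ (⟨y, n, _⟩ : HomEl V) :: w) = l₂ by simpa using h3), e', hF.map_add,
          hF.map_smul, smul_add, smul_comm c]
    · have h' : ∀ a : (V y).X n, cols (u ++ ⟨y, n, a⟩ :: w) ≠ l₁ ++ b ++ l₂ := by simpa using h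
      simp only [compFun_ne F G _ _ (h' _), add_zero, smul_zero]

/-- Partial composition of multilinear operations. -/
def endComp (l₁ l₂ : List Color) (hl : l = l₁ ++ x :: l₂) (hl' : l' = l₁ ++ b ++ l₂)
    (hr : p + q = r) : EndObj V l d p →ₗ[k] EndObj V b x q →ₗ[k] EndObj V l' d r :=
  by
    refine LinearMap.mk₂ k (fun F G => ⟨compFun l₁ b l₂ x q F.1 G.1, by
      subst hl hl'; exact isMultiOp_comp l₁ l₂ F.2 G.2 hr⟩) ?_ ?_ ?_ ?_ <;>
    · intro F G a
      refine EndObj.ext fun v hv => ?_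
      rw [hl'] at hv
      obtain ⟨v1, v2, v3, rfl, h1, h2, h3⟩ := exists_split _ _ _ _ hv
      simp only [Submodule.coe_add, Submodule.coe_smul, Pi.add_apply, Pi.smul_apply, smul_add,
        compFun_append _ _ _ _ _ _ h1 h2 h3]
      try simp only [F.2.out_add, smul_add]
      try simp only [G.2.out_smul, smul_comm F]

lemma endComp_apply (l₁ l₂ : List Color) (hl : l = l₁ ++ x :: l₂) (hl' : l' = l₁ ++ b ++ l₂)
    (hr : p + q = r) (F : EndObj V l d p) (G : EndObj V b x q) (u v w : List (HomEl V)) (s : ℤ)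
    (hu : cols u = l₁) (hv : cols v = b) (hw : cols w = l₂) :
    (endComp l₁ l₂ hl hl' hr F G).1 (u ++ v ++ w) s = (q * degs u).negOnePow •
      F.1 (u ++ HomEl.out x (G.1 v) (q + degs v) :: w) s :=
  compFun_append _ _ _ _ _ _ hu hv hw

/-- The identity operation. -/
def endOne (x : Color) : EndObj V [x] x 0 :=
  ⟨fun v r => match v with
    | [a] => if h : a.col = x ∧ a.deg = r then h.1 ▸ h.2 ▸ a.val else 0
    | _ => 0, by
    refine .of_linear (fun v r hv => ?_) (fun v r hv => ?_) fun u y n c a b v r => ?_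
    · rcases v with _ | ⟨a, _ | ⟨b, v⟩⟩
      · rfl
      · exact dif_neg fun h => hv (by simp [h.1])
      · rfl
    · rcases v with _ | ⟨a, _ | ⟨b, v⟩⟩
      · rfl
      · exact dif_neg fun h => hv (by simp [h.2])
      · rfl
    · rcases u with _ | ⟨c, _ | ⟨c', u⟩⟩
      · rcases v with _ | ⟨c, v⟩
        · by_cases h : y = x ∧ n = r
          · obtain ⟨rfl, rfl⟩ := h
            simp
          · simp [h]
        · simp
      all_goals simp⟩

lemma endOne_apply {x : Color} {n : ℤ} (a : (V x).X n) :
    (endOne (V := V) x).1 [⟨x, n, a⟩] n = a := by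
  simp [endOne]

lemma end_one_comp (hl : [d] = [] ++ d :: []) (hl' : l = [] ++ l ++ []) (hr : 0 + p = p)
    (G : EndObj V l d p) : endComp [] [] hl hl' hr (endOne d) G = G := by
  refine EndObj.ext fun v hv => ?_
  have := endComp_apply [] [] hl hl' hr (endOne d) G [] v [] (p + degs v) rfl hv rfl
  simp only [List.nil_append, List.append_nil] at this
  rw [this]
  unfold HomEl.out
  rw [endOne_apply]
  simp

lemma end_comp_one (l₁ l₂ : List Color) (hl : l = l₁ ++ x :: l₂) (hl' : l = l₁ ++ [x] ++ l₂)
    (hr : p + 0 = p) (F : EndObj V l d p) : endComp l₁ l₂ hl hl' hr F (endOne x) = F := by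
  refine EndObj.ext fun v hv => ?_
  rw [hl'] at hv
  obtain ⟨v1, v2, v3, rfl, h1, h2, h3⟩ := exists_split _ _ _ _ hv
  rw [endComp_apply _ _ _ _ _ _ _ _ _ _ _ h1 h2 h3]
  rcases v2 with _ | ⟨a, _ | ⟨b, v⟩⟩
  · simp at h2
  · obtain ⟨y, n, a⟩ := a
    simp only [cols_cons, cols_nil, List.cons.injEq, and_true] at h2
    subst h2
    simp only [degs_cons, degs_nil, zero_mul, Int.negOnePow_zero, one_smul, List.append_assoc,
      List.cons_append, List.nil_append]
    rw [show (0 : ℤ) + (n + 0) = n by ring]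
    unfold HomEl.out
    rw [endOne_apply]
  · simp at h2

lemma end_comp_comp {lm mb lmb : List Color} {pq qr pqr : ℤ}
    (l₁ l₂ m1 m2 : List Color)
    (hl : l = l₁ ++ x :: l₂) (hm : m = m1 ++ y :: m2)
    (hlm : lm = l₁ ++ m ++ l₂) (hmb : mb = m1 ++ b ++ m2)
    (hlm' : lm = (l₁ ++ m1) ++ y :: (m2 ++ l₂))
    (hlmb : lmb = (l₁ ++ m1) ++ b ++ (m2 ++ l₂)) (hlmb' : lmb = l₁ ++ mb ++ l₂)
    (hpq : p + q = pq) (hqr : q + r = qr) (h1 : pq + r = pqr) (h2 : p + qr = pqr)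
    (f : EndObj V l d p) (g : EndObj V m x q) (h : EndObj V b y r) :
    endComp (l₁ ++ m1) (m2 ++ l₂) hlm' hlmb h1 (endComp l₁ l₂ hl hlm hpq f g) h =
      endComp l₁ l₂ hl hlmb' h2 f (endComp m1 m2 hm hmb hqr g h) := by
  refine EndObj.ext fun v hv => ?_
  rw [hlmb', hmb] at hv
  obtain ⟨v1, v', v5, rfl, c1, c', c5⟩ := exists_split _ _ _ _ hv
  obtain ⟨v2, v3, v4, rfl, c2, c3, c4⟩ := exists_split _ _ _ _ c'
  have hgh : (endComp m1 m2 hm hmb hqr g h).1 (v2 ++ v3 ++ v4) = (r * degs v2).negOnePow •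
      g.1 (v2 ++ HomEl.out y (h.1 v3) (r + degs v3) :: v4) := funext fun _ =>
    endComp_apply _ _ _ _ _ _ _ v2 v3 v4 _ c2 c3 c4
  rw [endComp_apply _ _ _ _ _ _ _ v1 (v2 ++ v3 ++ v4) v5 _ c1 (by rw [hmb, c']) c5, hgh]
  have e : v1 ++ (v2 ++ v3 ++ v4) ++ v5 = (v1 ++ v2) ++ v3 ++ (v4 ++ v5) := by simp
  rw [e, endComp_apply _ _ _ _ _ _ _ (v1 ++ v2) v3 (v4 ++ v5) _ (by simp [c1, c2]) c3
    (by simp [c4, c5])]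
  have e' : ∀ a : HomEl V, (v1 ++ v2) ++ a :: (v4 ++ v5) = v1 ++ (v2 ++ a :: v4) ++ v5 := by simp
  rw [e', endComp_apply _ _ _ _ _ _ _ v1 _ v5 _ c1 (by simp [hm, c2, c4]) c5, f.2.out_units,
    smul_smul, smul_smul, ← Int.negOnePow_add, ← Int.negOnePow_add]
  congr 2
  · simp only [degs_append]; subst hqr; ring
  · simp only [degs_append, degs_cons, HomEl.out_deg]
    rw [show q + (degs v2 + (r + degs v3 + degs v4)) =
      qr + (degs v2 + degs v3 + degs v4) by omega]

lemma end_comp_comm {lb lc lbc : List Color} {pq pr pqr : ℤ}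
    (l₁ l₂ l3 : List Color)
    (hx : l = l₁ ++ x :: (l₂ ++ y :: l3)) (hy : l = (l₁ ++ x :: l₂) ++ y :: l3)
    (hlb : lb = l₁ ++ b ++ (l₂ ++ y :: l3)) (hlb' : lb = (l₁ ++ b ++ l₂) ++ y :: l3)
    (hlc : lc = (l₁ ++ x :: l₂) ++ c ++ l3) (hlc' : lc = l₁ ++ x :: (l₂ ++ c ++ l3))
    (hlbc : lbc = (l₁ ++ b ++ l₂) ++ c ++ l3) (hlbc' : lbc = l₁ ++ b ++ (l₂ ++ c ++ l3))
    (hpq : p + q = pq) (hpr : p + r = pr) (h1 : pq + r = pqr) (h2 : pr + q = pqr)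
    (f : EndObj V l d p) (g : EndObj V b x q) (h : EndObj V c y r) :
    endComp (l₁ ++ b ++ l₂) l3 hlb' hlbc h1 (endComp l₁ (l₂ ++ y :: l3) hx hlb hpq f g) h =
      (q * r).negOnePow •
        endComp l₁ (l₂ ++ c ++ l3) hlc' hlbc' h2 (endComp (l₁ ++ x :: l₂) l3 hy hlc hpr f h) g := by
  refine EndObj.ext fun v hv => ?_
  rw [hlbc'] at hv
  obtain ⟨v1, v2, v', rfl, c1, c2, c'⟩ := exists_split _ _ _ _ hv
  obtain ⟨v3, v4, v5, rfl, c3, c4, c5⟩ := exists_split _ _ _ _ c'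
  have us : ∀ (s : ℤˣ) (F : EndObj V lbc d pqr) (w t), (s • F).1 w t = s • F.1 w t :=
    fun s F w t => by rcases Int.units_eq_one_or s with rfl | rfl <;> simp [Units.smul_def]
  rw [us, endComp_apply _ _ _ _ _ _ _ v1 v2 (v3 ++ v4 ++ v5) _ c1 c2 c']
  have e : v1 ++ v2 ++ (v3 ++ v4 ++ v5) = (v1 ++ v2 ++ v3) ++ v4 ++ v5 := by simp
  have e' : ∀ a : HomEl V, v1 ++ a :: (v3 ++ v4 ++ v5) = (v1 ++ a :: v3) ++ v4 ++ v5 := by simp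
  rw [e, endComp_apply _ _ _ _ _ _ _ (v1 ++ v2 ++ v3) v4 v5 _ (by simp [c1, c2, c3]) c4 c5, e',
    endComp_apply _ _ _ _ _ _ _ (v1 ++ _ :: v3) v4 v5 _ (by simp [c1, c3]) c4 c5]
  have e'' : ∀ a : HomEl V, (v1 ++ v2 ++ v3) ++ a :: v5 = v1 ++ v2 ++ (v3 ++ a :: v5) := by simp
  rw [e'', endComp_apply _ _ _ _ _ _ _ v1 v2 (v3 ++ _ :: v5) _ c1 c2 (by simp [c3, c5]),
    smul_smul, smul_smul, smul_smul, ← Int.negOnePow_add, ← Int.negOnePow_add,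
    ← Int.negOnePow_add]
  congr 1
  · simp only [degs_append, degs_cons, HomEl.out_deg]
    rw [Int.negOnePow_eq_iff]
    exact ⟨-(q * r), by ring⟩
  · simp

end EndOperad

section EndAct

variable {k : Type u} [Field k] {V : Color → ChainComplex (ModuleCat.{w} k) ℤ}
variable {l l' l'' b c m : List Color} {x y d : Color} {p q r : ℤ}

/-- The degrees of the entries of a list. -/
def degVec (n : ℕ) (v : List (HomEl V)) (i : Fin n) : ℤ := (v.map HomEl.deg).getD i 0

/-- The list `v` in the order prescribed by `e`. -/
def permL (e : Fin l'.length ≃ Fin l.length) (v : List (HomEl V)) : List (HomEl V) :=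
  List.ofFn fun j : Fin l.length => v.getD (e.symm j) default

/-- The Koszul sign of the rearrangement `permL e v`. -/
def permSign (e : Fin l'.length ≃ Fin l.length) (v : List (HomEl V)) : ℤˣ :=
  koszul (fun i : Fin l'.length => (i : ℕ)) (fun i => (e i : ℕ)) (degVec _ v)

@[simp] lemma length_permL (e : Fin l'.length ≃ Fin l.length) (v : List (HomEl V)) :
    (permL e v).length = l.length := by simp [permL]

lemma permL_getElem (e : Fin l'.length ≃ Fin l.length) (v : List (HomEl V)) (j : ℕ)
    (hj : j < (permL e v).length) :
    (permL e v)[j] = v.getD (e.symm ⟨j, by simpa using hj⟩) default := by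
  simp [permL]

lemma getD_append_cons (u w : List (HomEl V)) (a : HomEl V) (i : ℕ) :
    (u ++ a :: w).getD i default = if i = u.length then a else (u ++ default :: w).getD i default := by
  split_ifs with h
  · subst h; simp
  · simp only [List.getD_eq_getElem?_getD, List.getElem?_append, List.getElem?_cons]
    split_ifs <;> first | rfl | omega

lemma degVec_eq (v : List (HomEl V)) (n : ℕ) (i : Fin n) :
    degVec n v i = (v.getD i default).deg := by
  unfold degVec
  rw [show (0 : ℤ) = (default : HomEl V).deg from rfl]
  simp only [List.getD_eq_getElem?_getD, List.getElem?_map]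
  cases v[(i : ℕ)]? <;> rfl

lemma degs_eq_sum (v : List (HomEl V)) (n : ℕ) (h : v.length = n) :
    degs v = ∑ i, degVec n v i := by
  subst h
  simp only [degVec_eq, degs]
  rw [Finset.sum_congr rfl fun i _ => by rw [List.getD_eq_getElem _ _ i.2], 
    ← List.sum_ofFn, List.ofFn_getElem_eq_map]

lemma degVec_permL (e : Fin l'.length ≃ Fin l.length) (v : List (HomEl V)) :
    degVec l.length (permL e v) = degVec l'.length v ∘ e.symm := by
  funext j
  rw [Function.comp, degVec_eq, degVec_eq, List.getD_eq_getElem _ _ (by simp), permL_getElem]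

lemma degs_permL (e : Fin l'.length ≃ Fin l.length) (v : List (HomEl V))
    (hv : v.length = l'.length) : degs (permL e v) = degs v := by
  rw [degs_eq_sum _ l.length (by simp), degs_eq_sum v _ hv, degVec_permL]
  exact e.symm.sum_comp (degVec _ v)

lemma cols_permL (e : Fin l'.length ≃ Fin l.length) (he : ∀ i, l'.get i = l.get (e i))
    (v : List (HomEl V)) (hv : cols v = l') : cols (permL e v) = l := by
  refine List.ext_getElem (by simp) fun j h1 h2 => ?_
  have h3 : ((e.symm ⟨j, h2⟩ : Fin _) : ℕ) < v.length := by
    rw [← length_cols, hv]; exact Fin.isLt _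
  simp only [cols, List.getElem_map, permL_getElem]
  rw [List.getD_eq_getElem _ _ h3]
  have := he (e.symm ⟨j, h2⟩)
  rw [e.apply_symm_apply] at this
  simp only [List.get_eq_getElem] at this
  rw [← this]
  subst hv
  simp [cols]

lemma permL_append_cons (e : Fin l'.length ≃ Fin l.length) (u w : List (HomEl V))
    (h : u.length + w.length + 1 = l'.length) :
    ∃ u' w', u'.length = (e ⟨u.length, by omega⟩ : ℕ) ∧
      ∀ a, permL e (u ++ a :: w) = u' ++ a :: w' := by
  set j := e ⟨u.length, by omega⟩ with hj
  have key : ∀ a, permL e (u ++ a :: w) = (permL e (u ++ default :: w)).set j a := by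
    intro a
    refine List.ext_getElem (by simp) fun i h1 h2 => ?_
    rw [permL_getElem, List.getElem_set, getD_append_cons, permL_getElem]
    by_cases hi : (j : ℕ) = i
    · subst hi
      simp [hj]
    · rw [if_neg, if_neg hi]
      intro h3
      apply hi
      have : e.symm ⟨i, by simpa using h1⟩ = ⟨u.length, by omega⟩ := Fin.ext h3
      rw [Equiv.symm_apply_eq] at this
      rw [hj, ← this]
  refine ⟨(permL e (u ++ default :: w)).take j, (permL e (u ++ default :: w)).drop (j + 1), ?_,
    fun a => ?_⟩
  · simp [j.2.le]
  · rw [key, List.set_eq_take_append_cons_drop, if_pos (by simp)]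

lemma permSign_congr (e : Fin l'.length ≃ Fin l.length) {v v' : List (HomEl V)}
    (h : v.map HomEl.deg = v'.map HomEl.deg) : permSign e v = permSign e v' := by
  unfold permSign degVec
  rw [h]

lemma isMultiOp_act (e : Fin l'.length ≃ Fin l.length) (he : ∀ i, l'.get i = l.get (e i))
    {F : List (HomEl V) → ∀ r, (V d).X r} (hF : IsMultiOp l d p F) :
    IsMultiOp l' d p (fun v r => if cols v = l' then permSign e v • F (permL e v) r else 0) := by
  refine .of_linear (fun v s hv => if_neg hv) (fun v s hv => ?_) ?_
  · by_cases h : cols v = l'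
    · simp only [if_pos h]
      rw [hF.degs_ne, smul_zero]
      rwa [degs_permL e v (by rw [← h, length_cols])]
    · simp only [if_neg h]
  · intro u y n c a1 a2 w s
    by_cases h : cols u ++ y :: cols w = l'
    · have hlen : u.length + w.length + 1 = l'.length := by
        rw [← h]; simp; omega
      obtain ⟨u', w', -, h3⟩ := permL_append_cons e u w hlen
      have sg : ∀ a, permSign e (u ++ ⟨y, n, a⟩ :: w) = permSign e (u ++ ⟨y, n, 0⟩ :: w) :=
        fun a => permSign_congr e (by simp)
      simp only [cols_append, cols_cons, h, if_true, h3, hF.map_add, hF.map_smul, smul_add, sg,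
        smul_comm c]
    · simp [h]

/-- The action of a permutation on multilinear operations. -/
def endAct (e : Fin l'.length ≃ Fin l.length) (he : ∀ i, l'.get i = l.get (e i)) :
    EndObj V l d p →ₗ[k] EndObj V l' d p where
  toFun F := ⟨_, isMultiOp_act e he F.2⟩
  map_add' F G := by
    refine EndObj.ext' fun v r hv => ?_
    simp [hv]
  map_smul' c F := by
    refine EndObj.ext' fun v r hv => ?_
    simp [hv, smul_comm c]

lemma endAct_apply (e : Fin l'.length ≃ Fin l.length) (he : ∀ i, l'.get i = l.get (e i))
    (F : EndObj V l d p) (v : List (HomEl V)) (s : ℤ) (hv : cols v = l') :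
    (endAct e he F).1 v s = permSign e v • F.1 (permL e v) s := if_pos hv

lemma permL_refl (v : List (HomEl V)) (hv : v.length = l.length) :
    permL (Equiv.refl (Fin l.length)) v = v := by
  refine List.ext_getElem (by simp [hv]) fun i h1 h2 => ?_
  rw [permL_getElem]
  simp [h2]

lemma end_act_refl (F : EndObj V l d p) :
    endAct (Equiv.refl _) (fun _ => rfl) F = F := by
  refine EndObj.ext' fun v r hv => ?_
  refine (endAct_apply (Equiv.refl _) _ F v r hv).trans ?_
  rw [permL_refl _ (by rw [← hv, length_cols])]
  simp [permSign, koszul_refl]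

lemma permL_permL (e : Fin l'.length ≃ Fin l.length) (e' : Fin l''.length ≃ Fin l'.length)
    (v : List (HomEl V)) : permL e (permL e' v) = permL (e'.trans e) v := by
  refine List.ext_getElem (by simp) fun i h1 h2 => ?_
  rw [permL_getElem, permL_getElem, List.getD_eq_getElem _ _ (by simp), permL_getElem]
  rfl

lemma end_act_act (e : Fin l'.length ≃ Fin l.length) (e' : Fin l''.length ≃ Fin l'.length)
    (he : ∀ i, l'.get i = l.get (e i)) (he' : ∀ i, l''.get i = l'.get (e' i))
    (F : EndObj V l d p) :
    endAct e' he' (endAct e he F) =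
      endAct (e'.trans e) (fun i => (he' i).trans (he (e' i))) F := by
  refine EndObj.ext' fun v r hv => ?_
  rw [endAct_apply _ _ _ _ _ hv, endAct_apply _ _ _ _ _ hv,
    endAct_apply _ _ _ _ _ (cols_permL e' he' v hv), permL_permL, smul_smul]
  congr 1
  unfold permSign
  rw [degVec_permL, ← koszul_reindex e']
  have h : (degVec l''.length v ∘ e'.symm) ∘ e' = degVec l''.length v := by
    funext i; simp
  rw [h]
  exact (koszul_trans _ _ _ Fin.val_injective (Fin.val_injective.comp e'.injective)
    (Fin.val_injective.comp (e'.trans e).injective) _).symm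

/-! ### Differential -/

/-- `∑ᵢ (-1)^(|a1| + ⋯ + |aᵢ₋₁|) F (a1, …, d aᵢ, …, aₙ)`. -/
def dSumL {M : Type*} [AddCommGroup M] : List (HomEl V) → (List (HomEl V) → M) → M
  | [], _ => 0
  | a :: v, F => F (a.diff :: v) + a.deg.negOnePow • dSumL v (fun v' => F (a :: v'))

section

variable {M : Type*} [AddCommGroup M]

lemma dSumL_append (u v : List (HomEl V)) (F : List (HomEl V) → M) :
    dSumL (u ++ v) F = dSumL u (fun u' => F (u' ++ v)) +
      (degs u).negOnePow • dSumL v (fun v' => F (u ++ v')) := by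
  induction u generalizing F with
  | nil => simp [dSumL]
  | cons a u ih =>
    simp only [List.cons_append, dSumL, ih, smul_add, smul_smul, degs_cons, Int.negOnePow_add,
      add_assoc]

lemma dSumL_congr (v : List (HomEl V)) (F G : List (HomEl V) → M)
    (h : ∀ v', cols v' = cols v → degs v' = degs v - 1 → F v' = G v') : dSumL v F = dSumL v G := by
  induction v generalizing F G with
  | nil => rfl
  | cons a v ih =>
    simp only [dSumL]
    rw [h _ (by simp [HomEl.diff]) (by simp [HomEl.diff]; ring),
      ih _ (fun v' => G (a :: v')) fun v' h1 h2 => h _ (by simp [h1]) (by simp [h2]; ring)]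

lemma dSumL_add (v : List (HomEl V)) (F G : List (HomEl V) → M) :
    dSumL v (fun v' => F v' + G v') = dSumL v F + dSumL v G := by
  induction v generalizing F G with
  | nil => simp [dSumL]
  | cons a v ih => simp only [dSumL, ih, smul_add]; abel

lemma dSumL_zero (v : List (HomEl V)) : dSumL v (fun _ => (0 : M)) = 0 := by
  induction v with
  | nil => rfl
  | cons a v ih => simp only [dSumL, ih, smul_zero, add_zero]

lemma dSumL_map {N : Type*} [AddCommGroup N] (φ : M →+ N) (v : List (HomEl V))
    (F : List (HomEl V) → M) : φ (dSumL v F) = dSumL v (fun v' => φ (F v')) := by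
  induction v generalizing F with
  | nil => simp [dSumL]
  | cons a v ih => simp only [dSumL, map_add, Units.smul_def, map_zsmul, ih]

lemma dSumL_sub (v : List (HomEl V)) (F G : List (HomEl V) → M) :
    dSumL v (fun v' => F v' - G v') = dSumL v F - dSumL v G := by
  induction v generalizing F G with
  | nil => simp [dSumL]
  | cons a v ih => simp only [dSumL, ih, smul_sub]; abel

lemma dSumL_units (s : ℤˣ) (v : List (HomEl V)) (F : List (HomEl V) → M) :
    dSumL v (fun v' => s • F v') = s • dSumL v F := by
  rw [Units.smul_def]
  exact (dSumL_map (zsmulAddGroupHom (s : ℤ)) v F).symm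

lemma dSumL_smul [Module k M] (s : k) (v : List (HomEl V)) (F : List (HomEl V) → M) :
    dSumL v (fun v' => s • F v') = s • dSumL v F :=
  (dSumL_map (DistribSMul.toAddMonoidHom M s) v F).symm

end

lemma dSumL_eq_sum {M : Type*} [AddCommGroup M] (v : List (HomEl V)) (F : List (HomEl V) → M)
    (n : ℕ) (h : v.length = n) : dSumL v F =
      ∑ i : Fin n, (degs (v.take i)).negOnePow • F (v.set i (v.getD i default).diff) := by
  induction v generalizing F n with
  | nil => subst h; simp [dSumL]
  | cons a v ih =>
    rw [dSumL, ih _ _ rfl]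
    subst h
    simp only [List.length_cons]
    rw [Fin.sum_univ_succ]
    simp [Finset.smul_sum, smul_smul, Int.negOnePow_add]

lemma degs_take (v : List (HomEl V)) (n i : ℕ) (h : v.length = n) :
    degs (v.take i) = ∑ j : Fin n, if (j : ℕ) < i then degVec n v j else 0 := by
  induction v generalizing n i with
  | nil => subst h; simp
  | cons a v ih =>
    subst h
    simp only [List.length_cons]
    rw [Fin.sum_univ_succ]
    cases i with
    | zero => simp
    | succ i => simp [ih _ i rfl, degVec]

lemma permL_set (e : Fin l'.length ≃ Fin l.length) (v : List (HomEl V))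
    (hv : v.length = l'.length) (i : Fin l'.length) (a : HomEl V) :
    permL e (v.set i a) = (permL e v).set (e i) a := by
  refine List.ext_getElem (by simp) fun j h1 h2 => ?_
  have hj : ((e.symm ⟨j, by simpa using h1⟩ : Fin _) : ℕ) < v.length := by rw [hv]; exact Fin.isLt _
  rw [permL_getElem, List.getElem_set, permL_getElem, List.getD_eq_getElem _ _ (by simpa using hj),
    List.getD_eq_getElem _ _ hj, List.getElem_set]
  have : (i : ℕ) = (e.symm ⟨j, by simpa using h1⟩ : Fin _) ↔ (e i : ℕ) = j := by
    rw [← Fin.ext_iff, Equiv.eq_symm_apply, Fin.ext_iff]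
  simp only [this]

lemma passSign_val (v : List (HomEl V)) (n : ℕ) (hv : v.length = n) (q : ℤ) (i : Fin n) :
    passSign (fun i : Fin n => (i : ℕ)) (degVec n v) q i = (q * degs (v.take i)).negOnePow := by
  rw [passSign_eq, degs_take v n i hv]

lemma passSign_perm (e : Fin l'.length ≃ Fin l.length) (v : List (HomEl V)) (q : ℤ)
    (i : Fin l'.length) : passSign (fun i => (e i : ℕ)) (degVec _ v) q i =
      (q * degs ((permL e v).take (e i))).negOnePow := by
  rw [passSign_eq, degs_take _ l.length _ (by simp), degVec_permL, ← e.sum_comp]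
  simp

lemma isMultiOp_diff_linear (u w : List (HomEl V)) {n : ℤ} {F : List (HomEl V) → ∀ r, (V d).X r}
    (hF : IsMultiOp l d p F) (c : k) (a b : (V x).X n) (s : ℤ) :
    F (u ++ HomEl.diff ⟨x, n, c • a + b⟩ :: w) s =
      c • F (u ++ HomEl.diff ⟨x, n, a⟩ :: w) s + F (u ++ HomEl.diff ⟨x, n, b⟩ :: w) s := by
  simp only [HomEl.diff, map_add, map_smul]
  exact congrFun (hF.fun_linear ..) s

/-- The operation `d ∘ F - (-1)^p F ∘ d`. -/
def diffFun (p : ℤ) (F : List (HomEl V) → ∀ r, (V d).X r) (v : List (HomEl V)) (r : ℤ) :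
    (V d).X r :=
  ((V d).d (r + 1) r).hom (F v (r + 1)) - p.negOnePow • dSumL v (fun v' => F v' r)

lemma isMultiOp_diff (h : q + 1 = p) {F : List (HomEl V) → ∀ r, (V d).X r}
    (hF : IsMultiOp l d p F) : IsMultiOp l d q (diffFun p F) := by
  refine .of_linear (fun v s hv => ?_) (fun v s hv => ?_) fun u y n c a b w s => ?_
  · rw [diffFun, hF.cols_ne _ _ hv, dSumL_congr v _ (fun _ => 0) (fun v' h _ => hF.cols_ne _ _ ?_),
      dSumL_zero]
    · simp
    · rwa [h]
  · rw [diffFun, hF.degs_ne _ _ (by omega), dSumL_congr v _ (fun _ => 0)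
      (fun v' _ h => hF.degs_ne _ _ ?_), dSumL_zero]
    · simp
    · omega
  · simp only [diffFun, hF.map_add, hF.map_smul, map_add, map_smul, dSumL_append, dSumL,
      dSumL_add, dSumL_smul]
    rw [isMultiOp_diff_linear u w hF c a b s]
    simp only [smul_add, smul_sub, smul_comm c]
    abel

/-- The differential of multilinear operations. -/
def endDiff (h : q + 1 = p) : EndObj V l d p →ₗ[k] EndObj V l d q where
  toFun F := ⟨diffFun p F.1, isMultiOp_diff h F.2⟩
  map_add' F G := by
    refine EndObj.ext' fun v r hv => ?_
    simp only [diffFun, Submodule.coe_add, Pi.add_apply, map_add, dSumL_add, smul_add]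
    abel
  map_smul' c F := by
    refine EndObj.ext' fun v r hv => ?_
    simp only [diffFun, Submodule.coe_smul, Pi.smul_apply, map_smul, dSumL_smul, smul_sub,
      RingHom.id_apply, smul_comm c]

lemma endDiff_apply (h : q + 1 = p) (F : EndObj V l d p) (v : List (HomEl V)) (s : ℤ) :
    (endDiff h F).1 v s = ((V d).d (s + 1) s).hom (F.1 v (s + 1)) -
      p.negOnePow • dSumL v (fun v' => F.1 v' s) := rfl

lemma dSumL_dSumL (v : List (HomEl V)) {F : List (HomEl V) → ∀ r, (V d).X r}
    (hF : IsMultiOp l d p F) (s : ℤ) (u : List (HomEl V)) :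
    dSumL v (fun v' => dSumL v' (fun v'' => F (u ++ v'') s)) = 0 := by
  induction v generalizing u with
  | nil => rfl
  | cons a v ih =>
    simp only [dSumL]
    have h0 : F (u ++ a.diff.diff :: v) s = 0 := by
      have : a.diff.diff = ⟨a.col, a.deg - 1 - 1, 0⟩ := by
        simp only [HomEl.diff]
        congr 1
        have := (V a.col).d_comp_d a.deg (a.deg - 1) (a.deg - 1 - 1)
        exact congrArg (fun f => f.hom a.val) this
      rw [this, hF.map_zero]
    have h1 : dSumL v (fun v' => dSumL v' (fun v'' => F (u ++ a :: v'') s)) = 0 := by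
      have := ih (u ++ [a])
      simpa using this
    have h2 : a.diff.deg.negOnePow = -a.deg.negOnePow := by
      simp [HomEl.diff, Int.negOnePow_sub]
    rw [dSumL_add, dSumL_units, h1, h0, h2]
    simp

lemma end_diff_diff (h : q + 1 = p) (h' : r + 1 = q) (F : EndObj V l d p) :
    endDiff h' (endDiff h F) = 0 := by
  refine EndObj.ext' fun v s hv => ?_
  simp only [endDiff_apply, map_sub, Submodule.coe_zero, Pi.zero_apply]
  have h0 : ((V d).d (s + 1) s).hom (((V d).d (s + 1 + 1) (s + 1)).hom (F.1 v (s + 1 + 1))) = 0 := by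
    have := (V d).d_comp_d (s + 1 + 1) (s + 1) s
    exact congrArg (fun f => f.hom (F.1 v (s + 1 + 1))) this
  have h1 : dSumL v (fun v' => dSumL v' (fun v'' => F.1 v'' s)) = 0 := dSumL_dSumL v F.2 s []
  have h2 := dSumL_map (((V d).d (s + 1) s).hom.toAddMonoidHom) v (fun v' => F.1 v' (s + 1))
  simp only [LinearMap.toAddMonoidHom_coe] at h2
  rw [dSumL_sub, dSumL_units, h1, h0, ← h2]
  obtain rfl : p = q + 1 := h.symm
  simp [Units.smul_def, Int.negOnePow_add]

lemma end_diff_one (h : q + 1 = 0) : endDiff h (endOne (V := V) x) = 0 := by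
  refine EndObj.ext fun v hv => ?_
  rcases v with _ | ⟨⟨y, n, a⟩, _ | ⟨b, v⟩⟩
  · simp at hv
  · simp only [cols_cons, cols_nil, List.cons.injEq, and_true] at hv
    subst hv
    obtain rfl : q = -1 := by omega
    have e : (-1 : ℤ) + degs [(⟨y, n, a⟩ : HomEl V)] = n - 1 := by simp; ring
    rw [endDiff_apply, e]
    simp only [dSumL, smul_zero, add_zero, HomEl.diff, Int.negOnePow_zero, one_smul]
    rw [endOne_apply]
    refine sub_eq_zero.2 ?_
    rw [show n - 1 + 1 = n by ring, endOne_apply]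
  · simp at hv

lemma end_diff_act (h : q + 1 = p) (e : Fin l'.length ≃ Fin l.length)
    (he : ∀ i, l'.get i = l.get (e i)) (F : EndObj V l d p) :
    endDiff h (endAct e he F) = endAct e he (endDiff h F) := by
  refine EndObj.ext' fun v s hv => ?_
  have hlen : v.length = l'.length := by rw [← hv, length_cols]
  rw [endAct_apply _ _ _ _ _ hv, endDiff_apply, endDiff_apply, endAct_apply _ _ _ _ _ hv, smul_sub,
    dSumL_congr v _ (fun v' => permSign e v' • F.1 (permL e v') s)
    (fun v' h1 _ => endAct_apply _ _ _ _ _ (h1.trans hv))]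
  congr 1
  · simp [Units.smul_def]
  · rw [smul_comm]
    congr 1
    rw [dSumL_eq_sum _ _ _ hlen, dSumL_eq_sum (permL e v) _ l.length (by simp), Finset.smul_sum,
      ← e.sum_comp]
    refine Finset.sum_congr rfl fun i _ => ?_
    have e1 : (permL e v).getD (e i) default = v.getD i default := by
      rw [List.getD_eq_getElem _ _ (by simp), permL_getElem]
      simp
    rw [permL_set e v hlen, e1, smul_smul, smul_smul]
    congr 1
    have hi : (i : ℕ) < v.length := by rw [hlen]; exact i.2
    have := koszul_shift (fun i : Fin l'.length => (i : ℕ)) (fun i => (e i : ℕ)) Fin.val_injective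
      (Fin.val_injective.comp e.injective) (degVec _ v)
      (degVec _ (v.set i (v.getD i default).diff)) i (-1)
      (fun j hj => by
        rw [degVec_eq, degVec_eq]
        simp only [List.getD_eq_getElem?_getD]
        rw [List.getElem?_set_ne (fun h => hj (Fin.ext h.symm))])
      (by
        rw [degVec_eq, degVec_eq, List.getD_eq_getElem _ _ (by simpa using hi)]
        simp [HomEl.diff, sub_eq_add_neg])
    rw [passSign_val v _ hlen, passSign_perm] at this
    unfold permSign
    rw [this]
    simp only [neg_one_mul, Int.negOnePow_neg]
    rw [mul_left_comm, ← mul_assoc (degs _).negOnePow, negOnePow_mul_self, one_mul]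

lemma IsMultiOp.dSumL_out {F : List (HomEl V) → ∀ r, (V d).X r} (hF : IsMultiOp l d p F)
    (u w v : List (HomEl V)) (f : List (HomEl V) → ∀ r, (V x).X r) (n s : ℤ) :
    F (u ++ ⟨x, n, dSumL v (fun v' => f v' n)⟩ :: w) s =
      dSumL v (fun v' => F (u ++ HomEl.out x (f v') n :: w) s) := by
  have := dSumL_map (M := (V x).X n) (N := (V d).X s)
    { toFun := fun a => F (u ++ ⟨x, n, a⟩ :: w) s
      map_zero' := hF.map_zero ..
      map_add' := fun a b => hF.map_add .. } v (fun v' => f v' n)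
  exact this

lemma end_diff_comp {p' q' r' : ℤ} (l₁ l₂ : List Color)
    (hl : l = l₁ ++ x :: l₂) (hl' : l' = l₁ ++ b ++ l₂) (hr : p + q = r)
    (hp' : p' + 1 = p) (hq' : q' + 1 = q) (hr' : r' + 1 = r) (h₁ : p' + q = r') (h₂ : p + q' = r')
    (f : EndObj V l d p) (g : EndObj V b x q) :
    endDiff hr' (endComp l₁ l₂ hl hl' hr f g) =
      endComp l₁ l₂ hl hl' h₁ (endDiff hp' f) g +
        p.negOnePow • endComp l₁ l₂ hl hl' h₂ f (endDiff hq' g) := by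
  refine EndObj.ext' fun v s hv => ?_
  rw [hl'] at hv
  obtain ⟨u, v, w, rfl, c1, c2, c3⟩ := exists_split _ _ _ _ hv
  have us : ∀ (s : ℤˣ) (F : EndObj V l' d r') (w t), (s • F).1 w t = s • F.1 w t :=
    fun s F w t => by rcases Int.units_eq_one_or s with rfl | rfl <;> simp [Units.smul_def]
  rw [Submodule.coe_add, Pi.add_apply, Pi.add_apply, us,
    endComp_apply _ _ _ _ _ _ _ u v w _ c1 c2 c3, endComp_apply _ _ _ _ _ _ _ u v w _ c1 c2 c3,
    endDiff_apply, endDiff_apply, endComp_apply _ _ _ _ _ _ _ u v w _ c1 c2 c3]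
  set o := HomEl.out x (g.1 v) (q + degs v) with ho
  have e1 : dSumL u (fun u' => (endComp l₁ l₂ hl hl' hr f g).1 (u' ++ v ++ w) s) =
      (q * (degs u - 1)).negOnePow • dSumL u (fun u' => f.1 (u' ++ o :: w) s) := by
    rw [← dSumL_units]
    refine dSumL_congr _ _ _ fun u' h1 h2 => ?_
    rw [endComp_apply _ _ _ _ _ _ _ u' v w _ (h1.trans c1) c2 c3, h2]
  have e2 : dSumL v (fun v' => (endComp l₁ l₂ hl hl' hr f g).1 (u ++ v' ++ w) s) =
      (q * degs u).negOnePow •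
        dSumL v (fun v' => f.1 (u ++ HomEl.out x (g.1 v') (q' + degs v) :: w) s) := by
    rw [← dSumL_units]
    refine dSumL_congr _ _ _ fun v' h1 h2 => ?_
    rw [endComp_apply _ _ _ _ _ _ _ u v' w _ c1 (h1.trans c2) c3, h2,
      show q + (degs v - 1) = q' + degs v by omega]
  have e3 : dSumL w (fun w' => (endComp l₁ l₂ hl hl' hr f g).1 (u ++ v ++ w') s) =
      (q * degs u).negOnePow • dSumL w (fun w' => f.1 (u ++ o :: w') s) := by
    rw [← dSumL_units]
    refine dSumL_congr _ _ _ fun w' h1 h2 => ?_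
    rw [endComp_apply _ _ _ _ _ _ _ u v w' _ c1 c2 (h1.trans c3)]
  have e4 : HomEl.out x ((endDiff hq' g).1 v) (q' + degs v) = ⟨x, q' + degs v,
      ((V x).d (q' + degs v + 1) (q' + degs v)).hom (g.1 v (q' + degs v + 1)) -
        q.negOnePow • dSumL v (fun v' => g.1 v' (q' + degs v))⟩ := rfl
  have e5 : f.1 (u ++ HomEl.out x ((endDiff hq' g).1 v) (q' + degs v) :: w) s =
      f.1 (u ++ o.diff :: w) s - q.negOnePow •
        dSumL v (fun v' => f.1 (u ++ HomEl.out x (g.1 v') (q' + degs v) :: w) s) := by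
    rw [e4, sub_eq_add_neg, ← Units.neg_smul, f.2.map_add, f.2.map_units, f.2.dSumL_out,
      Units.neg_smul, ← sub_eq_add_neg]
    congr 4
    rw [ho]
    unfold HomEl.out HomEl.diff
    simp only
    have e6 : q' + degs v + 1 = q + degs v := by omega
    have e7 : q' + degs v = q + degs v - 1 := by omega
    rw [e6, e7]
  rw [dSumL_append, dSumL_append, e1, e2, e3, e5, dSumL_append, dSumL]
  subst hr hq'
  simp only [smul_sub, smul_add, smul_smul]
  have hd : ((V d).d (s + 1) s).hom ((((q' + 1) * degs u).negOnePow • f.1 (u ++ o :: w) (s + 1))) =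
      ((q' + 1) * degs u).negOnePow • ((V d).d (s + 1) s).hom (f.1 (u ++ o :: w) (s + 1)) := by
    simp [Units.smul_def]
  rw [hd]
  have ho' : o.deg = q' + 1 + degs v := rfl
  simp only [ho', degs_append, Int.negOnePow_add, mul_sub, add_mul, one_mul, mul_one, mul_add,
    Int.negOnePow_sub, Int.negOnePow_one]
  generalize p.negOnePow = P
  generalize q'.negOnePow = Q
  generalize (q' * degs u).negOnePow = R
  generalize (degs u).negOnePow = U
  generalize (degs v).negOnePow = W
  rcases Int.units_eq_one_or P with rfl | rfl <;> rcases Int.units_eq_one_or Q with rfl | rfl <;>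
  rcases Int.units_eq_one_or R with rfl | rfl <;> rcases Int.units_eq_one_or U with rfl | rfl <;>
  rcases Int.units_eq_one_or W with rfl | rfl <;>
  simp only [mul_one, one_mul, mul_neg, neg_mul, neg_neg, one_smul, Units.neg_smul] <;> abel

end EndAct

section EndEquivariance

variable {k : Type u} [Field k] {V : Color → ChainComplex (ModuleCat.{w} k) ℤ}
variable {l b c m : List Color} {x d : Color} {p q r : ℤ}

lemma graftPos_lt {i n j N : ℕ} (hj : j ≠ i) (hi : i < N + 1) (h : j < N + 1) :
    graftPos i n j < N + n := by
  unfold graftPos; split_ifs <;> omega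

/-- The inputs after a grafting are those of the grafted operation and the other inputs of the
first operation. -/
lemma exists_graftEquiv (i n N : ℕ) (hi : i < N + 1) :
    ∃ E : {j : Fin (N + 1) // j ≠ ⟨i, hi⟩} ⊕ Fin n ≃ Fin (N + n),
      (∀ j, (E (.inl j) : ℕ) = graftPos i n j) ∧ ∀ j, (E (.inr j) : ℕ) = i + j := by
  have hne : ∀ j : {j : Fin (N + 1) // j ≠ ⟨i, hi⟩}, (j.1 : ℕ) ≠ i := fun j h =>
    j.2 (Fin.ext h)
  let f : {j : Fin (N + 1) // j ≠ ⟨i, hi⟩} ⊕ Fin n → Fin (N + n) := Sum.elim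
    (fun j => ⟨graftPos i n j, graftPos_lt (hne j) hi j.1.2⟩)
    (fun j => ⟨i + j, by omega⟩)
  have hf : Function.Bijective f := by
    rw [Fintype.bijective_iff_injective_and_card]
    refine ⟨?_, ?_⟩
    · rintro (j | j) (j' | j') h
      · have h' := congrArg Fin.val h
        have h1 := hne j
        have h2 := hne j'
        simp only [f, Sum.elim_inl, graftPos] at h'
        congr 1
        refine Subtype.ext (Fin.ext ?_)
        split_ifs at h' <;> omega
      · have h' := congrArg Fin.val h
        have h1 := hne j
        simp only [f, Sum.elim_inl, Sum.elim_inr, graftPos] at h'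
        split_ifs at h' <;> omega
      · have h' := congrArg Fin.val h
        have h1 := hne j'
        simp only [f, Sum.elim_inl, Sum.elim_inr, graftPos] at h'
        split_ifs at h' <;> omega
      · have h' := congrArg Fin.val h
        simp only [f, Sum.elim_inr] at h'
        congr 1
        exact Fin.ext (by omega)
    · simp
  exact ⟨Equiv.ofBijective f hf, fun j => rfl, fun j => rfl⟩

lemma getD_graftPos {α : Type*} (u v w : List α) (a z : α) {n1 n2 j : ℕ} (h1 : u.length = n1)
    (h2 : v.length = n2) (hj : j ≠ n1) :
    (u ++ v ++ w).getD (graftPos n1 n2 j) z = (u ++ a :: w).getD j z := by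
  subst h1 h2
  unfold graftPos
  simp only [List.getD_eq_getElem?_getD, List.getElem?_append, List.getElem?_cons,
    List.length_append]
  split_ifs <;> first | rfl | omega | skip
  congr 2
  omega

lemma getD_block {α : Type*} (u v w : List α) (z : α) {n1 j : ℕ} (h1 : u.length = n1)
    (hj : j < v.length) : (u ++ v ++ w).getD (n1 + j) z = v.getD j z := by
  subst h1
  simp only [List.getD_eq_getElem?_getD, List.getElem?_append, List.length_append]
  split_ifs <;> first | omega | simp

lemma permL_getD (e : Fin m.length ≃ Fin l.length) (v : List (HomEl V)) (i : Fin m.length) :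
    (permL e v).getD (e i) default = v.getD i default := by
  rw [List.getD_eq_getElem _ _ (by simp), permL_getElem]
  simp

lemma end_comp_act {lb mc : List Color} (l₁ l₂ m1 m2 : List Color)
    (hl : l = l₁ ++ x :: l₂) (hm : m = m1 ++ x :: m2)
    (hlb : lb = l₁ ++ b ++ l₂) (hmc : mc = m1 ++ c ++ m2) (hr : p + q = r)
    (e : Fin m.length ≃ Fin l.length) (he : ∀ i, m.get i = l.get (e i))
    (t : Fin c.length ≃ Fin b.length) (ht : ∀ i, c.get i = b.get (t i))
    (s : Fin mc.length ≃ Fin lb.length) (hs : ∀ i, mc.get i = lb.get (s i))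
    (H1 : ∀ j : Fin m.length, (j : ℕ) = m1.length → (e j : ℕ) = l₁.length)
    (H2 : ∀ (j : Fin m.length) (i : Fin mc.length), (j : ℕ) ≠ m1.length →
      (i : ℕ) = graftPos m1.length c.length j → (s i : ℕ) = graftPos l₁.length b.length (e j))
    (H3 : ∀ (j : Fin c.length) (i : Fin mc.length),
      (i : ℕ) = m1.length + j → (s i : ℕ) = l₁.length + t j)
    (f : EndObj V l d p) (g : EndObj V b x q) :
    endComp m1 m2 hm hmc hr (endAct e he f) (endAct t ht g) =
      endAct s hs (endComp l₁ l₂ hl hlb hr f g) := by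
  refine EndObj.ext' fun v z hv => ?_
  obtain ⟨u, v, w, rfl, c1, c2, c3⟩ := exists_split m1 c m2 v (hv.trans hmc)
  have lm : m.length = m1.length + m2.length + 1 := by rw [hm]; simp; omega
  have lu : u.length = m1.length := by rw [← c1, length_cols]
  have lv : v.length = c.length := by rw [← c2, length_cols]
  have lw : w.length = m2.length := by rw [← c3, length_cols]
  have lmc : mc.length = m1.length + m2.length + c.length := by rw [hmc]; simp; omega
  have lll : lb.length = l₁.length + b.length + l₂.length := by rw [hlb]; simp; omega
  have hi0 : m1.length < m.length := by omega
  obtain ⟨u', w', lu', hp⟩ := permL_append_cons e u w (by omega)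
  have hu'l : u'.length = l₁.length := by
    rw [lu']
    exact H1 _ (by simp [lu])
  have cu : cols u' = l₁ ∧ cols w' = l₂ := by
    have h1 := cols_permL e he (u ++ ⟨x, 0, 0⟩ :: w) (by simp [c1, c3, hm])
    rw [hp, hl, cols_append, cols_cons] at h1
    obtain ⟨h2, h3⟩ := List.append_inj h1 (by simp [hu'l])
    exact ⟨h2, (List.cons.inj h3).2⟩
  have lw' : w'.length = l₂.length := by rw [← cu.2, length_cols]
  obtain ⟨E, hE1, hE2⟩ := exists_graftEquiv m1.length c.length (m1.length + m2.length) (by omega)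
  let E' : {j : Fin m.length // j ≠ ⟨m1.length, hi0⟩} ⊕ Fin c.length ≃ Fin mc.length :=
    (Equiv.sumCongr ((finCongr lm).subtypeEquiv fun j => by
      simp [Fin.ext_iff]) (Equiv.refl _)).trans (E.trans (finCongr lmc.symm))
  have hE1' : ∀ j, (E' (.inl j) : ℕ) = graftPos m1.length c.length j := fun j => hE1 _
  have hE2' : ∀ j, (E' (.inr j) : ℕ) = m1.length + j := fun j => hE2 _
  have hne : ∀ j : {j : Fin m.length // j ≠ ⟨m1.length, hi0⟩}, (j.1 : ℕ) ≠ m1.length :=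
    fun j h => j.2 (Fin.ext h)
  have hne' : ∀ j : {j : Fin m.length // j ≠ ⟨m1.length, hi0⟩}, (e j.1 : ℕ) ≠ l₁.length := by
    intro j h
    apply j.2
    apply e.injective
    exact Fin.ext (h.trans (H1 _ rfl).symm)
  have hS1 : ∀ j, (s (E' (.inl j)) : ℕ) = graftPos l₁.length b.length (e j.1) := fun j =>
    H2 _ _ (hne j) (hE1' j)
  have hS2 : ∀ j, (s (E' (.inr j)) : ℕ) = l₁.length + t j := fun j => H3 _ _ (hE2' j)
  have hperm : permL s (u ++ v ++ w) = u' ++ permL t v ++ w' := by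
    refine List.ext_getElem (by simp [lll, hu'l, lw', add_assoc]) fun i h₁ h₂ => ?_
    obtain ⟨a, rfl⟩ : ∃ a, i = (s (E' a) : ℕ) :=
      ⟨E'.symm (s.symm ⟨i, by simpa using h₁⟩), by simp⟩
    rw [← List.getD_eq_getElem _ default h₁, ← List.getD_eq_getElem _ default h₂, permL_getD]
    rcases a with j | j
    · rw [hE1', hS1, getD_graftPos u v w default _ lu lv (hne j),
        getD_graftPos u' _ w' default _ hu'l (length_permL t v) (hne' j), ← hp, permL_getD]
    · rw [hE2', hS2, getD_block _ _ _ _ lu (by rw [lv]; exact j.2),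
        getD_block _ _ _ _ hu'l (by rw [length_permL]; exact (t j).2), permL_getD]
  set o := HomEl.out x (g.1 (permL t v)) (q + degs v) with ho
  set o0 : HomEl V := ⟨x, degs v, 0⟩ with ho0
  have sg1 : permSign s (u ++ v ++ w) = permSign e (u ++ o0 :: w) * permSign t v := by
    unfold permSign
    rw [← koszul_reindex E']
    have hδ : degVec mc.length (u ++ v ++ w) ∘ E' =
        Sum.elim (fun i => degVec m.length (u ++ o0 :: w) i.1) (degVec c.length v) := by
      funext a
      rcases a with j | j
      · simp only [Function.comp, degVec_eq, Sum.elim_inl]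
        rw [hE1', getD_graftPos u v w o0 _ lu lv (hne j)]
      · simp only [Function.comp, degVec_eq, Sum.elim_inr]
        rw [hE2', getD_block _ _ _ _ lu (by rw [lv]; exact j.2)]
    rw [hδ]
    refine koszul_block (ι := Fin m.length) (κ := Fin c.length) ⟨m1.length, hi0⟩ _ _ Fin.val_injective
      (Fin.val_injective.comp e.injective) _ _ _ _ _ _ ?_ ?_ ?_ ?_ ?_ ?_ ?_ ?_ ?_
    · rw [← degs_eq_sum v _ lv, degVec_eq, getD_append_cons, if_pos lu.symm]
    · intro i i'
      simp only [Function.comp, hE1', graftPos]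
      have := hne i; have := hne i'
      split_ifs <;> omega
    · intro i j
      simp only [Function.comp, hE1', hE2', graftPos]
      have := hne i; have := j.2
      split_ifs <;> omega
    · intro i j
      simp only [Function.comp, hE1', hE2', graftPos]
      have := hne i; have := j.2
      split_ifs <;> omega
    · intro i j
      simp only [Function.comp, hE2']
      omega
    · intro i i'
      simp only [Function.comp, hS1, graftPos]
      have := hne' i; have := hne' i'
      split_ifs <;> omega
    · intro i j
      simp only [Function.comp, hS1, hS2, graftPos, H1 ⟨m1.length, hi0⟩ rfl]
      have := hne' i; have := (t j).2
      split_ifs <;> omega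
    · intro i j
      simp only [Function.comp, hS1, hS2, graftPos, H1 ⟨m1.length, hi0⟩ rfl]
      have := hne' i; have := (t j).2
      split_ifs <;> omega
    · intro i j
      simp only [Function.comp, hS2]
      omega
  have sg2 : permSign e (u ++ o :: w) = permSign e (u ++ o0 :: w) *
      ((q * degs u).negOnePow * (q * degs u').negOnePow) := by
    have := koszul_shift (fun i : Fin m.length => (i : ℕ)) (fun i => (e i : ℕ)) Fin.val_injective
      (Fin.val_injective.comp e.injective) (degVec _ (u ++ o0 :: w)) (degVec _ (u ++ o :: w))
      ⟨m1.length, hi0⟩ q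
      (fun j hj => by
        have hj' : (j : ℕ) ≠ u.length := fun h => hj (Fin.ext (h.trans lu))
        rw [degVec_eq, degVec_eq, getD_append_cons, if_neg hj', getD_append_cons u w o0,
          if_neg hj'])
      (by
        rw [degVec_eq, degVec_eq, getD_append_cons, if_pos lu.symm, getD_append_cons,
          if_pos lu.symm, ho, ho0, HomEl.out_deg, add_comm])
    rw [passSign_val _ _ (by simp; omega), passSign_perm, hp, H1 ⟨m1.length, hi0⟩ rfl] at this
    simp only [← lu, ← hu'l, List.take_left] at this
    exact this
  have hg : (endAct t ht g).1 v = permSign t v • g.1 (permL t v) :=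
    funext fun _ => endAct_apply _ _ _ _ _ c2
  rw [endAct_apply _ _ _ _ _ hv, hperm, endComp_apply _ _ _ _ _ _ _ u v w _ c1 c2 c3,
    endComp_apply _ _ _ _ _ _ _ u' _ w' _ cu.1 (cols_permL t ht v c2) cu.2, hg,
    endAct_apply _ _ _ _ _ (by simp [c1, c3, hm]), hp, f.2.out_units, degs_permL t v lv,
    permSign_congr e (show (u ++ HomEl.out x (permSign t v • g.1 (permL t v)) (q + degs v) :: w).map
      HomEl.deg = (u ++ o :: w).map HomEl.deg by simp [ho]), sg1, sg2, smul_smul, smul_smul,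
      smul_smul]
  congr 1
  generalize (q * degs u).negOnePow = A
  generalize (q * degs u').negOnePow = B
  rcases Int.units_eq_one_or A with rfl | rfl <;> simp [mul_assoc, mul_comm, mul_left_comm]

end EndEquivariance

section SubOperad

variable {k : Type u} [Field k] (V : Color → ChainComplex (ModuleCat.{w} k) ℤ)

open Color in
/-- Multilinear operations with the colours and degrees of the generators of `sc^!`. -/
structure EndGens where
  l2 : EndObj V [cl, cl] cl 0
  c2 : EndObj V [cl, cl] cl (-1)
  n02 : EndObj V [op, op] op 0
  n11 : EndObj V [cl, op] op 0
  n10 : EndObj V [cl] op (-1)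

variable {V} (G : EndGens V)

namespace EndGens

/-- The value of a formal expression in the endomorphism operad. -/
def eval : {l : List Color} → {d : Color} → {p : ℤ} → ScTerm k l d p → EndObj V l d p
  | _, _, _, .l2 => G.l2
  | _, _, _, .c2 => G.c2
  | _, _, _, .n02 => G.n02
  | _, _, _, .n11 => G.n11
  | _, _, _, .n10 => G.n10
  | _, _, _, .zero => 0
  | _, _, _, .add f g => eval f + eval g
  | _, _, _, .smul a f => a • eval f
  | _, _, _, .diff h f => endDiff h (eval f)
  | _, _, _, .one x => endOne x
  | _, _, _, .act e he f => endAct e he (eval f)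
  | _, _, _, .comp l₁ l₂ hl hl' hr f g => endComp l₁ l₂ hl hl' hr (eval f) (eval g)

/-- The operations which are values of formal expressions. -/
def sub (l : List Color) (d : Color) (p : ℤ) : Submodule k (EndObj V l d p) where
  carrier := Set.range (G.eval (l := l) (d := d) (p := p))
  zero_mem' := ⟨.zero, rfl⟩
  add_mem' := by
    rintro _ _ ⟨f, rfl⟩ ⟨g, rfl⟩
    exact ⟨.add f g, rfl⟩
  smul_mem' := by
    rintro a _ ⟨f, rfl⟩
    exact ⟨.smul a f, rfl⟩

instance (l : List Color) (d : Color) (p : ℤ) : Small.{u} (G.sub l d p) :=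
  inferInstanceAs (Small.{u} (Set.range (G.eval (l := l) (d := d) (p := p))))

variable {l l' b : List Color} {x d : Color} {p q r : ℤ}

/-- The inclusion into the endomorphism operad. -/
def toEnd : Shrink.{u} (G.sub l d p) →ₗ[k] EndObj V l d p :=
  (G.sub l d p).subtype ∘ₗ (Shrink.linearEquiv k (G.sub l d p)).toLinearMap

/-- The corestriction of an operation which is the value of a formal expression. -/
def ofEnd (f : EndObj V l d p) (hf : f ∈ G.sub l d p) :
    Shrink.{u} (G.sub l d p) :=
  (Shrink.linearEquiv k (G.sub l d p)).symm ⟨f, hf⟩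

lemma toEnd_ofEnd (f : EndObj V l d p) (hf : f ∈ G.sub l d p) :
    G.toEnd (G.ofEnd f hf) = f := by
  simp [EndGens.toEnd, EndGens.ofEnd]

lemma toEnd_injective : Function.Injective (G.toEnd (l := l) (d := d) (p := p)) :=
  Subtype.val_injective.comp (Shrink.linearEquiv k (G.sub l d p)).injective

lemma toEnd_mem (f : Shrink.{u} (G.sub l d p)) : G.toEnd f ∈ G.sub l d p :=
  Subtype.prop _

lemma diff_mem (h : q + 1 = p) (f : EndObj V l d p) (hf : f ∈ G.sub l d p) :
    endDiff h f ∈ G.sub l d q := by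
  obtain ⟨f, rfl⟩ := hf
  exact ⟨.diff h f, rfl⟩

lemma act_mem (e : Fin l'.length ≃ Fin l.length) (he : ∀ i, l'.get i = l.get (e i))
    (f : EndObj V l d p) (hf : f ∈ G.sub l d p) : endAct e he f ∈ G.sub l' d p := by
  obtain ⟨f, rfl⟩ := hf
  exact ⟨.act e he f, rfl⟩

lemma comp_mem (l₁ l₂ : List Color) (hl : l = l₁ ++ x :: l₂) (hl' : l' = l₁ ++ b ++ l₂)
    (hr : p + q = r) (f : EndObj V l d p) (g : EndObj V b x q) (hf : f ∈ G.sub l d p)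
    (hg : g ∈ G.sub b x q) : endComp l₁ l₂ hl hl' hr f g ∈ G.sub l' d r := by
  obtain ⟨f, rfl⟩ := hf
  obtain ⟨g, rfl⟩ := hg
  exact ⟨.comp l₁ l₂ hl hl' hr f g, rfl⟩

/-- The differential of the operad generated by `G`. -/
def subDiff (h : q + 1 = p) :
    Shrink.{u} (G.sub l d p) →ₗ[k] Shrink.{u} (G.sub l d q) where
  toFun f := G.ofEnd (endDiff h (G.toEnd f)) (G.diff_mem h _ (G.toEnd_mem f))
  map_add' f g := G.toEnd_injective (by simp only [G.toEnd_ofEnd, map_add])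
  map_smul' a f := G.toEnd_injective (by simp only [G.toEnd_ofEnd, map_smul, RingHom.id_apply])

/-- The symmetric group actions of the operad generated by `G`. -/
def subAct (e : Fin l'.length ≃ Fin l.length)
    (he : ∀ i, l'.get i = l.get (e i)) :
    Shrink.{u} (G.sub l d p) →ₗ[k] Shrink.{u} (G.sub l' d p) where
  toFun f := G.ofEnd (endAct e he (G.toEnd f)) (G.act_mem e he _ (G.toEnd_mem f))
  map_add' f g := G.toEnd_injective (by simp only [G.toEnd_ofEnd, map_add])
  map_smul' a f := G.toEnd_injective (by simp only [G.toEnd_ofEnd, map_smul, RingHom.id_apply])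

/-- The compositions of the operad generated by `G`. -/
def subComp (l₁ l₂ : List Color) (hl : l = l₁ ++ x :: l₂)
    (hl' : l' = l₁ ++ b ++ l₂) (hr : p + q = r) : Shrink.{u} (G.sub l d p) →ₗ[k]
      Shrink.{u} (G.sub b x q) →ₗ[k] Shrink.{u} (G.sub l' d r) :=
  LinearMap.mk₂ k (fun f g => G.ofEnd (endComp l₁ l₂ hl hl' hr (G.toEnd f) (G.toEnd g))
      (G.comp_mem l₁ l₂ hl hl' hr _ _ (G.toEnd_mem f) (G.toEnd_mem g)))
    (fun _ _ _ => G.toEnd_injective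
      (by simp only [G.toEnd_ofEnd, map_add, LinearMap.add_apply]))
    (fun _ _ _ => G.toEnd_injective
      (by simp only [G.toEnd_ofEnd, map_smul, LinearMap.smul_apply]))
    (fun _ _ _ => G.toEnd_injective (by simp only [G.toEnd_ofEnd, map_add]))
    (fun _ _ _ => G.toEnd_injective (by simp only [G.toEnd_ofEnd, map_smul]))

/-- The units of the operad generated by `G`. -/
def subOne (x : Color) : Shrink.{u} (G.sub [x] x 0) :=
  G.ofEnd (endOne x) ⟨.one x, rfl⟩

lemma toEnd_one (x : Color) : G.toEnd (G.subOne x) = endOne x := G.toEnd_ofEnd _ _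

lemma toEnd_diff (h : q + 1 = p) (f : Shrink.{u} (G.sub l d p)) :
    G.toEnd (G.subDiff h f) = endDiff h (G.toEnd f) := G.toEnd_ofEnd _ _

lemma toEnd_act (e : Fin l'.length ≃ Fin l.length) (he : ∀ i, l'.get i = l.get (e i))
    (f : Shrink.{u} (G.sub l d p)) : G.toEnd (G.subAct e he f) = endAct e he (G.toEnd f) :=
  G.toEnd_ofEnd _ _

lemma toEnd_comp (l₁ l₂ : List Color) (hl : l = l₁ ++ x :: l₂)
    (hl' : l' = l₁ ++ b ++ l₂) (hr : p + q = r) (f : Shrink.{u} (G.sub l d p))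
    (g : Shrink.{u} (G.sub b x q)) :
    G.toEnd (G.subComp l₁ l₂ hl hl' hr f g) = endComp l₁ l₂ hl hl' hr (G.toEnd f) (G.toEnd g) :=
  G.toEnd_ofEnd _ _

lemma toEnd_units (s : ℤˣ) (f : Shrink.{u} (G.sub l d p)) :
    G.toEnd (s • f) = s • G.toEnd f := by
  simp only [Units.smul_def, map_zsmul]

/-- The suboperad of the endomorphism operad generated by `G`. -/
def operad : DGOperad k where
  obj l d p := Shrink.{u} (G.sub l d p)
  diff := G.subDiff
  one := G.subOne
  act := G.subAct
  comp := G.subComp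
  diff_diff := by
    intros; apply G.toEnd_injective
    simp only [G.toEnd_diff, map_zero]; apply end_diff_diff
  diff_one := by
    intros; apply G.toEnd_injective
    simp only [G.toEnd_diff, map_zero, G.toEnd_one]; apply end_diff_one
  diff_act := by
    intros; apply G.toEnd_injective
    simp only [G.toEnd_diff, G.toEnd_act]; apply end_diff_act
  diff_comp := by
    intro _ _ _ _ _ _ _ _ _ _ _ _ _ _ _ _ hp' hq' _ _ _ _ _
    apply G.toEnd_injective
    simp only [G.toEnd_diff, G.toEnd_comp, map_add, G.toEnd_units]
    exact end_diff_comp _ _ _ _ _ hp' hq' _ _ _ _ _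
  act_refl := by
    intros; apply G.toEnd_injective
    exact (G.toEnd_act _ _ _).trans (end_act_refl _)
  act_act := by
    intros; apply G.toEnd_injective
    simp only [G.toEnd_act]; apply end_act_act
  one_comp := by
    intros; apply G.toEnd_injective
    simp only [G.toEnd_comp, G.toEnd_one]; apply end_one_comp
  comp_one := by
    intros; apply G.toEnd_injective
    simp only [G.toEnd_comp, G.toEnd_one]; apply end_comp_one
  comp_comp := by
    intros; apply G.toEnd_injective
    simp only [G.toEnd_comp]; apply end_comp_comp
  comp_comm := by
    intros; apply G.toEnd_injective
    simp only [G.toEnd_comp, G.toEnd_units]; apply end_comp_comm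
  comp_act := by
    intros; apply G.toEnd_injective
    simp only [G.toEnd_comp, G.toEnd_act]; apply end_comp_act <;> assumption

/-- The inclusion of the operad generated by `G` into the endomorphism operad. -/
def incl : G.operad.obj l d p →ₗ[k] EndObj V l d p := G.toEnd

lemma incl_injective : Function.Injective (G.incl (l := l) (d := d) (p := p)) :=
  G.toEnd_injective

lemma incl_diff (h : q + 1 = p) (f : G.operad.obj l d p) :
    G.incl (G.operad.diff h f) = endDiff h (G.incl f) := G.toEnd_diff h f

lemma incl_act (e : Fin l'.length ≃ Fin l.length) (he : ∀ i, l'.get i = l.get (e i))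
    (f : G.operad.obj l d p) : G.incl (G.operad.act e he f) = endAct e he (G.incl f) :=
  G.toEnd_act e he f

lemma incl_comp (l₁ l₂ : List Color) (hl : l = l₁ ++ x :: l₂)
    (hl' : l' = l₁ ++ b ++ l₂) (hr : p + q = r) (f : G.operad.obj l d p)
    (g : G.operad.obj b x q) : G.incl (G.operad.comp l₁ l₂ hl hl' hr f g) =
      endComp l₁ l₂ hl hl' hr (G.incl f) (G.incl g) :=
  G.toEnd_comp l₁ l₂ hl hl' hr f g

/-- The value of a formal expression in the operad generated by `G`. -/
def term (t : ScTerm k l d p) : G.operad.obj l d p :=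
  G.ofEnd (G.eval t) ⟨t, rfl⟩

lemma incl_term (t : ScTerm k l d p) : G.incl (G.term t) = G.eval t := G.toEnd_ofEnd _ _

end EndGens

end SubOperad

section LowArity

variable {k : Type u} [Field k] {V : Color → ChainComplex (ModuleCat.{w} k) ℤ}
variable {x y z d : Color} {p q t : ℤ}

/-- The unary operation given by a family of linear maps. -/
def unOp (F : ∀ {m r : ℤ}, p + m = r → ((V x).X m →ₗ[k] (V d).X r)) : EndObj V [x] d p :=
  ⟨fun v r => match v with
    | [⟨x', m, a⟩] => if h : x' = x ∧ p + m = r then F h.2 (h.1 ▸ a) else 0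
    | _ => 0, by
    refine ⟨?_, ?_, ?_, ?_⟩
    · rintro (_ | ⟨⟨x', m, a⟩, _ | ⟨b, v⟩⟩) r h <;> try rfl
      refine dif_neg fun h' => h ?_
      simp [h'.1]
    · rintro (_ | ⟨⟨x', m, a⟩, _ | ⟨b, v⟩⟩) r h <;> try rfl
      refine dif_neg fun h' => h ?_
      simp [h'.2]
    · rintro (_ | ⟨c, _ | ⟨c', u⟩⟩) x' n a b (_ | ⟨b', v⟩) r <;> try simp
      by_cases h : x' = x ∧ p + n = r
      · obtain ⟨rfl, rfl⟩ := h
        simp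
      · simp [h]
    · rintro (_ | ⟨c, _ | ⟨c', u⟩⟩) x' n a b (_ | ⟨b', v⟩) r <;> try simp
      by_cases h : x' = x ∧ p + n = r
      · obtain ⟨rfl, rfl⟩ := h
        simp
      · simp [h]⟩

lemma unOp_apply (F : ∀ {m r : ℤ}, p + m = r → ((V x).X m →ₗ[k] (V d).X r)) {m r : ℤ}
    (a : (V x).X m) (h : p + m = r) : (unOp F).1 [⟨x, m, a⟩] r = F h a := by
  simp [unOp, h]

/-- The binary operation given by a family of bilinear maps. -/
def binOp (F : ∀ {m n r : ℤ}, p + (m + n) = r → ((V x).X m →ₗ[k] (V y).X n →ₗ[k] (V d).X r)) :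
    EndObj V [x, y] d p :=
  ⟨fun v r => match v with
    | [⟨x', m, a⟩, ⟨y', n, b⟩] => if h : x' = x ∧ y' = y ∧ p + (m + n) = r then
        F h.2.2 (h.1 ▸ a) (h.2.1 ▸ b) else 0
    | _ => 0, by
    refine ⟨?_, ?_, ?_, ?_⟩
    · rintro (_ | ⟨⟨x', m, a⟩, _ | ⟨⟨y', n, b⟩, _ | ⟨b, v⟩⟩⟩) r h <;> try rfl
      refine dif_neg fun h' => h ?_
      simp [h'.1, h'.2.1]
    · rintro (_ | ⟨⟨x', m, a⟩, _ | ⟨⟨y', n, b⟩, _ | ⟨b, v⟩⟩⟩) r h <;> try rfl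
      refine dif_neg fun h' => h ?_
      simp [h'.2.2]
    · rintro (_ | ⟨⟨x', m, c⟩, _ | ⟨c', _ | ⟨c'', u⟩⟩⟩) x'' n a b (_ | ⟨⟨y', m', c⟩, _ | ⟨_, v⟩⟩) r <;>
        try simp
      · by_cases h : x'' = x ∧ y' = y ∧ p + (n + m') = r
        · obtain ⟨rfl, rfl, rfl⟩ := h
          simp
        · simp [h]
      · by_cases h : x' = x ∧ x'' = y ∧ p + (m + n) = r
        · obtain ⟨rfl, rfl, rfl⟩ := h
          simp
        · simp [h]
    · rintro (_ | ⟨⟨x', m, c⟩, _ | ⟨c', _ | ⟨c'', u⟩⟩⟩) x'' n a b (_ | ⟨⟨y', m', c⟩, _ | ⟨_, v⟩⟩) r <;>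
        try simp
      · by_cases h : x'' = x ∧ y' = y ∧ p + (n + m') = r
        · obtain ⟨rfl, rfl, rfl⟩ := h
          simp
        · simp [h]
      · by_cases h : x' = x ∧ x'' = y ∧ p + (m + n) = r
        · obtain ⟨rfl, rfl, rfl⟩ := h
          simp
        · simp [h]⟩

lemma binOp_apply
    (F : ∀ {m n r : ℤ}, p + (m + n) = r → ((V x).X m →ₗ[k] (V y).X n →ₗ[k] (V d).X r))
    {m n r : ℤ} (a : (V x).X m) (b : (V y).X n) (h : p + (m + n) = r) :
    (binOp F).1 [⟨x, m, a⟩, ⟨y, n, b⟩] r = F h a b := by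
  simp [binOp, h]

lemma eq_of_cols_one {v : List (HomEl V)} (h : cols v = [x]) :
    ∃ (m : ℤ) (a : (V x).X m), v = [⟨x, m, a⟩] := by
  rcases v with _ | ⟨⟨x', m, a⟩, _ | ⟨_, _⟩⟩ <;> simp at h
  subst h
  exact ⟨m, a, rfl⟩

lemma eq_of_cols_two {v : List (HomEl V)} (h : cols v = [x, y]) :
    ∃ (m n : ℤ) (a : (V x).X m) (b : (V y).X n), v = [⟨x, m, a⟩, ⟨y, n, b⟩] := by
  rcases v with _ | ⟨⟨x', m, a⟩, v⟩ <;> simp at h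
  obtain ⟨rfl, h⟩ := h
  obtain ⟨n, b, rfl⟩ := eq_of_cols_one h
  exact ⟨m, n, a, b, rfl⟩

lemma eq_of_cols_three {v : List (HomEl V)} (h : cols v = [x, y, z]) :
    ∃ (m n p : ℤ) (a : (V x).X m) (b : (V y).X n) (c : (V z).X p),
      v = [⟨x, m, a⟩, ⟨y, n, b⟩, ⟨z, p, c⟩] := by
  rcases v with _ | ⟨⟨x', m, a⟩, v⟩ <;> simp at h
  obtain ⟨rfl, h⟩ := h
  obtain ⟨n, p, b, c, rfl⟩ := eq_of_cols_two h
  exact ⟨m, n, p, a, b, c, rfl⟩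

variable {x' y' x1 x2 : Color} {m n m' s : ℤ}

lemma HomEl.out_eq (f : ∀ r, (V x).X r) (h : m = n) : HomEl.out x f m = ⟨x, n, f n⟩ := by
  subst h
  rfl

lemma comp_bin_left {l' : List Color} (hl' : l' = [] ++ [x1, x2] ++ [y]) (hr : p + q = t)
    (F : ∀ {m n r : ℤ}, p + (m + n) = r → ((V x).X m →ₗ[k] (V y).X n →ₗ[k] (V d).X r))
    (G : ∀ {m n r : ℤ}, q + (m + n) = r → ((V x1).X m →ₗ[k] (V x2).X n →ₗ[k] (V x).X r))
    (a : (V x1).X m) (b : (V x2).X n) (c : (V y).X m') (h : t + (m + n + m') = s) :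
    (endComp (l := [x, y]) (l' := l') [] [y] rfl hl' hr (binOp F) (binOp G)).1
      [⟨x1, m, a⟩, ⟨x2, n, b⟩, ⟨y, m', c⟩] s =
    F (by omega) (G (r := q + (m + n)) rfl a b) c := by
  have := endComp_apply (l := [x, y]) (l' := l') [] [y] rfl hl' hr (binOp F) (binOp G) []
    [⟨x1, m, a⟩, ⟨x2, n, b⟩] [⟨y, m', c⟩] s rfl rfl rfl
  refine this.trans ?_
  rw [HomEl.out_eq _ (show _ = q + (m + n) by simp)]
  simp only [degs_nil, mul_zero, Int.negOnePow_zero, one_smul, List.nil_append]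
  rw [binOp_apply G _ _ rfl, binOp_apply F _ _ (by omega)]

lemma comp_bin_right {l' : List Color} (hl' : l' = [x] ++ [x1, x2] ++ []) (hr : p + q = t)
    (F : ∀ {m n r : ℤ}, p + (m + n) = r → ((V x).X m →ₗ[k] (V y).X n →ₗ[k] (V d).X r))
    (G : ∀ {m n r : ℤ}, q + (m + n) = r → ((V x1).X m →ₗ[k] (V x2).X n →ₗ[k] (V y).X r))
    (a : (V x).X m) (b : (V x1).X n) (c : (V x2).X m') (h : t + (m + n + m') = s) :
    (endComp (l := [x, y]) (l' := l') [x] [] rfl hl' hr (binOp F) (binOp G)).1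
      [⟨x, m, a⟩, ⟨x1, n, b⟩, ⟨x2, m', c⟩] s =
    (q * m).negOnePow • F (by omega) a (G (r := q + (n + m')) rfl b c) := by
  have := endComp_apply (l := [x, y]) (l' := l') [x] [] rfl hl' hr (binOp F) (binOp G)
    [⟨x, m, a⟩] [⟨x1, n, b⟩, ⟨x2, m', c⟩] [] s rfl rfl rfl
  refine this.trans ?_
  rw [HomEl.out_eq _ (show _ = q + (n + m') by simp)]
  simp only [degs_cons, degs_nil, add_zero, List.singleton_append]
  rw [binOp_apply G _ _ rfl, binOp_apply F _ _ (by omega)]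

lemma comp_bin_un_left {l' : List Color} (hl' : l' = [] ++ [x1] ++ [y]) (hr : p + q = t)
    (F : ∀ {m n r : ℤ}, p + (m + n) = r → ((V x).X m →ₗ[k] (V y).X n →ₗ[k] (V d).X r))
    (G : ∀ {m r : ℤ}, q + m = r → ((V x1).X m →ₗ[k] (V x).X r))
    (a : (V x1).X m) (b : (V y).X n) (h : t + (m + n) = s) :
    (endComp (l := [x, y]) (l' := l') [] [y] rfl hl' hr (binOp F) (unOp G)).1
      [⟨x1, m, a⟩, ⟨y, n, b⟩] s = F (by omega) (G (r := q + m) rfl a) b := by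
  have := endComp_apply (l := [x, y]) (l' := l') [] [y] rfl hl' hr (binOp F) (unOp G) []
    [⟨x1, m, a⟩] [⟨y, n, b⟩] s rfl rfl rfl
  refine this.trans ?_
  rw [HomEl.out_eq _ (show _ = q + m by simp)]
  simp only [degs_cons, degs_nil, add_zero, mul_zero, Int.negOnePow_zero, one_smul,
    List.nil_append]
  rw [unOp_apply G _ rfl, binOp_apply F _ _ (by omega)]

lemma comp_bin_un_right {l' : List Color} (hl' : l' = [x] ++ [x1] ++ []) (hr : p + q = t)
    (F : ∀ {m n r : ℤ}, p + (m + n) = r → ((V x).X m →ₗ[k] (V y).X n →ₗ[k] (V d).X r))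
    (G : ∀ {m r : ℤ}, q + m = r → ((V x1).X m →ₗ[k] (V y).X r))
    (a : (V x).X m) (b : (V x1).X n) (h : t + (m + n) = s) :
    (endComp (l := [x, y]) (l' := l') [x] [] rfl hl' hr (binOp F) (unOp G)).1
      [⟨x, m, a⟩, ⟨x1, n, b⟩] s =
    (q * m).negOnePow • F (by omega) a (G (r := q + n) rfl b) := by
  have := endComp_apply (l := [x, y]) (l' := l') [x] [] rfl hl' hr (binOp F) (unOp G)
    [⟨x, m, a⟩] [⟨x1, n, b⟩] [] s rfl rfl rfl
  refine this.trans ?_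
  rw [HomEl.out_eq _ (show _ = q + n by simp)]
  simp only [degs_cons, degs_nil, add_zero, List.singleton_append]
  rw [unOp_apply G _ rfl, binOp_apply F _ _ (by omega)]

lemma comp_un_bin {l' : List Color} (hl' : l' = [] ++ [x1, x2] ++ []) (hr : p + q = t)
    (F : ∀ {m r : ℤ}, p + m = r → ((V x).X m →ₗ[k] (V d).X r))
    (G : ∀ {m n r : ℤ}, q + (m + n) = r → ((V x1).X m →ₗ[k] (V x2).X n →ₗ[k] (V x).X r))
    (a : (V x1).X m) (b : (V x2).X n) (h : t + (m + n) = s) :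
    (endComp (l := [x]) (l' := l') [] [] rfl hl' hr (unOp F) (binOp G)).1
      [⟨x1, m, a⟩, ⟨x2, n, b⟩] s = F (by omega) (G (r := q + (m + n)) rfl a b) := by
  have := endComp_apply (l := [x]) (l' := l') [] [] rfl hl' hr (unOp F) (binOp G) []
    [⟨x1, m, a⟩, ⟨x2, n, b⟩] [] s rfl rfl rfl
  refine this.trans ?_
  rw [HomEl.out_eq _ (show _ = q + (m + n) by simp)]
  simp only [degs_nil, mul_zero, Int.negOnePow_zero, one_smul, List.nil_append]
  rw [binOp_apply G _ _ rfl, unOp_apply F _ (by omega)]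

lemma act_swap_two {l l' : List Color} (hl : l = [x, y]) (hl' : l' = [y, x])
    (e : Fin l'.length ≃ Fin l.length) (he : ∀ i, l'.get i = l.get (e i))
    (H : ∀ i, (e i : ℕ) = Equiv.swap 0 1 (i : ℕ)) (f : EndObj V l d p) (a : (V y).X m)
    (b : (V x).X n) : (endAct e he f).1 [⟨y, m, a⟩, ⟨x, n, b⟩] s =
      (m * n).negOnePow • f.1 [⟨x, n, b⟩, ⟨y, m, a⟩] s := by
  subst hl hl'
  refine (endAct_apply e he f _ s rfl).trans ?_
  have he : e = Equiv.swap (0 : Fin 2) 1 := by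
    ext i
    rw [H]
    fin_cases i <;> rfl
  subst he
  congr 1
  simp [permSign, koszul, degVec, Fin.prod_univ_two]

lemma act_swap_three {l l' : List Color} (hl : l = [x, y, z]) (hl' : l' = [y, x, z])
    (e : Fin l'.length ≃ Fin l.length) (he : ∀ i, l'.get i = l.get (e i))
    (H : ∀ i, (e i : ℕ) = Equiv.swap 0 1 (i : ℕ)) (f : EndObj V l d p) (a : (V y).X m)
    (b : (V x).X n) (c : (V z).X m') : (endAct e he f).1 [⟨y, m, a⟩, ⟨x, n, b⟩, ⟨z, m', c⟩] s =
      (m * n).negOnePow • f.1 [⟨x, n, b⟩, ⟨y, m, a⟩, ⟨z, m', c⟩] s := by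
  subst hl hl'
  refine (endAct_apply e he f _ s rfl).trans ?_
  have he : e = Equiv.swap (0 : Fin 3) 1 := by
    ext i
    rw [H]
    fin_cases i <;> rfl
  subst he
  have : permSign (l' := [y, x, z]) (l := [x, y, z]) (Equiv.swap (0 : Fin 3) 1)
      [(⟨y, m, a⟩ : HomEl V), ⟨x, n, b⟩, ⟨z, m', c⟩] = (m * n).negOnePow := by
    change koszul (ι := Fin 3) _ _ _ = _
    simp [koszul, degVec, Fin.prod_univ_three, Equiv.swap_apply_def]
    exact fun h => absurd (show (2 : Fin 3) = 1 from h) (by decide)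
  rw [this]
  rfl

lemma act_rotate (f : EndObj V [x, x, x] d p) (a b c : HomEl V) (ha : a.col = x) (hb : b.col = x)
    (hc : c.col = x) (he) : (endAct (l := [x, x, x]) (l' := [x, x, x]) (finRotate 3) he f).1 [a, b, c] s =
      (c.deg * (a.deg + b.deg)).negOnePow • f.1 [c, a, b] s := by
  refine (endAct_apply _ he f _ s (by simp [ha, hb, hc])).trans ?_
  have : permSign (l' := [x, x, x]) (l := [x, x, x]) (finRotate 3) [a, b, c] =
      (c.deg * (a.deg + b.deg)).negOnePow := by
    change koszul (ι := Fin 3) _ _ _ = _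
    simp [koszul, degVec, Fin.prod_univ_three, mul_add, Int.negOnePow_add, mul_comm]
  rw [this]
  rfl

lemma act_rotate_symm (f : EndObj V [x, x, x] d p) (a b c : HomEl V) (ha : a.col = x)
    (hb : b.col = x) (hc : c.col = x) (he) :
    (endAct (l := [x, x, x]) (l' := [x, x, x]) (finRotate 3).symm he f).1 [a, b, c] s =
      (a.deg * (b.deg + c.deg)).negOnePow • f.1 [b, c, a] s := by
  refine (endAct_apply _ he f _ s (by simp [ha, hb, hc])).trans ?_
  have : permSign (l' := [x, x, x]) (l := [x, x, x]) (finRotate 3).symm [a, b, c] =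
      (a.deg * (b.deg + c.deg)).negOnePow := by
    change koszul (ι := Fin 3) _ _ _ = _
    simp [koszul, degVec, Fin.prod_univ_three, mul_add, Int.negOnePow_add, mul_comm]
    rw [if_pos (by decide), if_pos (by decide)]
  rw [this]
  rfl

end LowArity

section ScAlgebra

variable {k : Type u} [Field k]

/-- The structure of an algebra over `sc^!`, in terms of elements. -/
structure ScAlgebra (H A : ChainComplex (ModuleCat.{w} k) ℤ) where
  ger : LambdaGerAlgebra H
  assoc : DGAssocAlgebra A
  act : ∀ {m n r : ℤ}, m + n = r → (H.X m →ₗ[k] A.X n →ₗ[k] A.X r)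
  beta : ∀ {m n : ℤ}, n + 1 = m → (H.X m →ₗ[k] A.X n)
  act_br : ∀ {m n p r : ℤ} (h : m + n + p = r) (x : H.X m) (y : H.X n) (a : A.X p),
    act (r := r) (by omega) (ger.br (r := m + n) rfl x y) a =
      act (by omega) x (act (r := n + p) rfl y a) -
        (m * n).negOnePow • act (by omega) y (act (r := m + p) rfl x a)
  act_mul : ∀ {m n p r : ℤ} (h : m + n + p = r) (x : H.X m) (a : A.X n) (b : A.X p),
    act (r := r) (by omega) x (assoc.mul (r := n + p) rfl a b) =
      assoc.mul (by omega) (act (r := m + n) rfl x a) b +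
        (m * n).negOnePow • assoc.mul (by omega) a (act (r := m + p) rfl x b)
  act_ger_mul : ∀ {m n p r : ℤ} (h : m + n - 1 + p = r) (x : H.X m) (y : H.X n) (a : A.X p),
    act h (ger.mul rfl x y) a = 0
  beta_br : ∀ {m n r : ℤ} (h : r + 1 = m + n) (x : H.X m) (y : H.X n),
    beta h (ger.br rfl x y) = m.negOnePow • act (by omega) x (beta (n := n - 1) (by omega) y) -
      (m * n + n).negOnePow • act (by omega) y (beta (n := m - 1) (by omega) x)
  beta_ger_mul : ∀ {m n r : ℤ} (h : r + 1 = m + n - 1) (x : H.X m) (y : H.X n),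
    beta h (ger.mul rfl x y) = 0
  diff_beta : ∀ {m n : ℤ} (h : n + 1 = m) (x : H.X m),
    (A.d n (n - 1)).hom (beta h x) = -beta (by omega) ((H.d m (m - 1)).hom x)
  diff_act : ∀ {m n r : ℤ} (h : m + n = r) (x : H.X m) (a : A.X n),
    (A.d r (r - 1)).hom (act h x a) =
      assoc.mul (by omega) (beta (n := m - 1) (by omega) x) a -
        ((m - 1) * n).negOnePow • assoc.mul (by omega) a (beta (n := m - 1) (by omega) x) +
        (act (by omega) ((H.d m (m - 1)).hom x) a +
          m.negOnePow • act (by omega) x ((A.d n (n - 1)).hom a))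

variable {V : Color → ChainComplex (ModuleCat.{w} k) ℤ}

open Color

/-- The operations of an algebra over `sc^!`. -/
def ScAlgebra.gens (S : ScAlgebra (V cl) (V op)) : EndGens V where
  l2 := binOp fun h => S.ger.br (by omega)
  c2 := binOp fun h => S.ger.mul (by omega)
  n02 := binOp fun h => S.assoc.mul (by omega)
  n11 := binOp fun h => S.act (by omega)
  n10 := unOp fun h => S.beta (by omega)

section Flexible

variable {H A : ChainComplex (ModuleCat.{w} k) ℤ} {m n p mn np mp pm m' n' r s : ℤ}

lemma LambdaGerAlgebra.mul_assoc' (S : LambdaGerAlgebra H)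
    (h1 : m + n - 1 = mn) (h2 : n + p - 1 = np) (h : m + np - 1 = r) (h' : mn + p - 1 = r)
    (x : H.X m) (y : H.X n) (z : H.X p) :
    m.negOnePow • S.mul h x (S.mul h2 y z) = -S.mul h' (S.mul h1 x y) z := by
  subst h1 h2
  exact S.mul_assoc (by omega) x y z

lemma LambdaGerAlgebra.jacobi' (S : LambdaGerAlgebra H)
    (h1 : m + n = mn) (h2 : n + p = np) (h3 : p + m = pm) (h1' : mn + p = r) (h2' : np + m = r)
    (h3' : pm + n = r) (x : H.X m) (y : H.X n) (z : H.X p) :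
    S.br h1' (S.br h1 x y) z + (m * (n + p)).negOnePow • S.br h2' (S.br h2 y z) x +
      (p * (m + n)).negOnePow • S.br h3' (S.br h3 z x) y = 0 := by
  subst h1 h2 h3
  exact S.jacobi (by omega) x y z

lemma LambdaGerAlgebra.leibniz' (S : LambdaGerAlgebra H)
    (h1 : m + n = mn) (h2 : n + p - 1 = np) (h3 : m + p = mp) (h1' : mn + p - 1 = r)
    (h2' : m + np = r) (h3' : n + mp - 1 = r) (x : H.X m) (y : H.X n) (z : H.X p) :
    m.negOnePow • S.br h2' x (S.mul h2 y z) =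
      S.mul h1' (S.br h1 x y) z + (m * n).negOnePow • S.mul h3' y (S.br h3 x z) := by
  subst h1 h2 h3
  exact S.leibniz (by omega) x y z

lemma LambdaGerAlgebra.diff_br' (S : LambdaGerAlgebra H) (h : m + n = r)
    (hm : m' + 1 = m) (hn : n' + 1 = n) (hr : s + 1 = r) (h1 : m' + n = s) (h2 : m + n' = s)
    (x : H.X m) (y : H.X n) :
    (H.d r s).hom (S.br h x y) = S.br h1 ((H.d m m').hom x) y +
      m.negOnePow • S.br h2 x ((H.d n n').hom y) := by
  obtain rfl : m' = m - 1 := by omega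
  obtain rfl : n' = n - 1 := by omega
  obtain rfl : s = r - 1 := by omega
  exact S.diff_br h x y

lemma LambdaGerAlgebra.diff_mul' (S : LambdaGerAlgebra H)
    (h : m + n - 1 = r) (hm : m' + 1 = m) (hn : n' + 1 = n) (hr : s + 1 = r)
    (h1 : m' + n - 1 = s) (h2 : m + n' - 1 = s) (x : H.X m) (y : H.X n) :
    (H.d r s).hom (S.mul h x y) = -(S.mul h1 ((H.d m m').hom x) y +
      m.negOnePow • S.mul h2 x ((H.d n n').hom y)) := by
  obtain rfl : m' = m - 1 := by omega
  obtain rfl : n' = n - 1 := by omega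
  obtain rfl : s = r - 1 := by omega
  exact S.diff_mul h x y

lemma DGAssocAlgebra.mul_assoc' (S : DGAssocAlgebra A) (h1 : m + n = mn)
    (h2 : n + p = np) (h : m + np = r) (h' : mn + p = r) (a : A.X m) (b : A.X n) (c : A.X p) :
    S.mul h a (S.mul h2 b c) = S.mul h' (S.mul h1 a b) c := by
  subst h1 h2
  exact S.mul_assoc (by omega) a b c

lemma DGAssocAlgebra.diff_mul' (S : DGAssocAlgebra A) (h : m + n = r)
    (hm : m' + 1 = m) (hn : n' + 1 = n) (hr : s + 1 = r) (h1 : m' + n = s) (h2 : m + n' = s)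
    (x : A.X m) (y : A.X n) :
    (A.d r s).hom (S.mul h x y) = S.mul h1 ((A.d m m').hom x) y +
      m.negOnePow • S.mul h2 x ((A.d n n').hom y) := by
  obtain rfl : m' = m - 1 := by omega
  obtain rfl : n' = n - 1 := by omega
  obtain rfl : s = r - 1 := by omega
  exact S.diff_mul h x y

variable (S : ScAlgebra H A)

lemma ScAlgebra.act_br' (h1 : m + n = mn) (h2 : n + p = np)
    (h3 : m + p = mp) (h1' : mn + p = r) (h2' : m + np = r) (h3' : n + mp = r)
    (x : H.X m) (y : H.X n) (a : A.X p) :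
    S.act h1' (S.ger.br h1 x y) a = S.act h2' x (S.act h2 y a) -
        (m * n).negOnePow • S.act h3' y (S.act h3 x a) := by
  subst h1 h2 h3
  exact S.act_br (by omega) x y a

lemma ScAlgebra.act_mul' (h1 : m + n = mn) (h2 : n + p = np)
    (h3 : m + p = mp) (h1' : mn + p = r) (h2' : m + np = r) (h3' : n + mp = r)
    (x : H.X m) (a : A.X n) (b : A.X p) :
    S.act h2' x (S.assoc.mul h2 a b) = S.assoc.mul h1' (S.act h1 x a) b +
        (m * n).negOnePow • S.assoc.mul h3' a (S.act h3 x b) := by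
  subst h1 h2 h3
  exact S.act_mul (by omega) x a b

lemma ScAlgebra.act_ger_mul' (h1 : m + n - 1 = mn) (h : mn + p = r)
    (x : H.X m) (y : H.X n) (a : A.X p) : S.act h (S.ger.mul h1 x y) a = 0 := by
  subst h1
  exact S.act_ger_mul h x y a

lemma ScAlgebra.beta_br' (h1 : m + n = mn) (h : r + 1 = mn)
    (hm : m' + 1 = m) (hn : n' + 1 = n) (h2 : m + n' = r) (h3 : n + m' = r)
    (x : H.X m) (y : H.X n) :
    S.beta h (S.ger.br h1 x y) = m.negOnePow • S.act h2 x (S.beta hn y) -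
      (m * n + n).negOnePow • S.act h3 y (S.beta hm x) := by
  subst h1
  obtain rfl : m' = m - 1 := by omega
  obtain rfl : n' = n - 1 := by omega
  exact S.beta_br h x y

lemma ScAlgebra.beta_ger_mul' (h1 : m + n - 1 = mn) (h : r + 1 = mn)
    (x : H.X m) (y : H.X n) : S.beta h (S.ger.mul h1 x y) = 0 := by
  subst h1
  exact S.beta_ger_mul h x y

lemma ScAlgebra.diff_act' (h : m + n = r) (hm : m' + 1 = m)
    (hn : n' + 1 = n) (hr : s + 1 = r) (h1 : m' + n = s) (h1' : n + m' = s) (h2 : m + n' = s)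
    (x : H.X m) (a : A.X n) :
    (A.d r s).hom (S.act h x a) = S.assoc.mul h1 (S.beta hm x) a -
        (m' * n).negOnePow • S.assoc.mul h1' a (S.beta hm x) +
        (S.act h1 ((H.d m m').hom x) a + m.negOnePow • S.act h2 x ((A.d n n').hom a)) := by
  obtain rfl : m' = m - 1 := by omega
  obtain rfl : n' = n - 1 := by omega
  obtain rfl : s = r - 1 := by omega
  exact S.diff_act h x a

end Flexible

lemma diff_bin {x y d : Color} {p q m n m' n' r s : ℤ} (hq : q + 1 = p)
    (F : ∀ {m n r : ℤ}, p + (m + n) = r → ((V x).X m →ₗ[k] (V y).X n →ₗ[k] (V d).X r))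
    (a : (V x).X m) (b : (V y).X n) (hm : m' + 1 = m) (hn : n' + 1 = n) (hr : s + 1 = r)
    (h : p + (m + n) = r) : (endDiff hq (binOp F)).1 [⟨x, m, a⟩, ⟨y, n, b⟩] s =
      ((V d).d r s).hom (F h a b) - p.negOnePow • (F (by omega) (((V x).d m m').hom a) b +
        m.negOnePow • F (by omega) a (((V y).d n n').hom b)) := by
  obtain rfl : m' = m - 1 := by omega
  obtain rfl : n' = n - 1 := by omega
  subst hr
  rw [endDiff_apply]
  simp only [dSumL, HomEl.diff, smul_zero, add_zero]
  rw [binOp_apply F _ _ h, binOp_apply F _ _ (by omega), binOp_apply F _ _ (by omega)]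

lemma diff_un {x d : Color} {p q m m' r s : ℤ} (hq : q + 1 = p)
    (F : ∀ {m r : ℤ}, p + m = r → ((V x).X m →ₗ[k] (V d).X r))
    (a : (V x).X m) (hm : m' + 1 = m) (hr : s + 1 = r)
    (h : p + m = r) : (endDiff hq (unOp F)).1 [⟨x, m, a⟩] s =
      ((V d).d r s).hom (F h a) - p.negOnePow • F (by omega) (((V x).d m m').hom a) := by
  obtain rfl : m' = m - 1 := by omega
  subst hr
  rw [endDiff_apply]
  simp only [dSumL, HomEl.diff, smul_zero, add_zero]
  rw [unOp_apply F _ h, unOp_apply F _ (by omega)]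

lemma LambdaGerAlgebra.endDiff_br (G : LambdaGerAlgebra (V cl)) : endDiff (V := V) (q := -1)
    (by norm_num) (binOp (p := 0) fun h => G.br (by omega)) = 0 := by
  refine EndObj.ext fun v hv => ?_
  obtain ⟨m, n, a, b, rfl⟩ := eq_of_cols_two hv
  refine (diff_bin (r := m + n) _ _ a b (sub_add_cancel m 1) (sub_add_cancel n 1) (by simp <;> omega)
    (by simp)).trans (sub_eq_zero.2 ?_)
  rw [Int.negOnePow_zero, one_smul]
  exact G.diff_br' _ (sub_add_cancel m 1) (sub_add_cancel n 1) (by simp <;> omega) _ _ a b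

lemma LambdaGerAlgebra.endDiff_mul (G : LambdaGerAlgebra (V cl)) : endDiff (V := V) (q := -2)
    (by norm_num) (binOp (p := -1) fun h => G.mul (by omega)) = 0 := by
  refine EndObj.ext fun v hv => ?_
  obtain ⟨m, n, a, b, rfl⟩ := eq_of_cols_two hv
  refine (diff_bin (r := m + n - 1) _ _ a b (sub_add_cancel m 1) (sub_add_cancel n 1)
    (by simp <;> omega) (by omega)).trans (sub_eq_zero.2 ?_)
  rw [show (-1 : ℤ).negOnePow = -1 by simp, Units.neg_smul, one_smul]
  exact G.diff_mul' _ (sub_add_cancel m 1) (sub_add_cancel n 1) (by simp <;> omega) _ _ a b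

lemma DGAssocAlgebra.endDiff_mul (R : DGAssocAlgebra (V op)) : endDiff (V := V) (q := -1)
    (by norm_num) (binOp (p := 0) fun h => R.mul (by omega)) = 0 := by
  refine EndObj.ext fun v hv => ?_
  obtain ⟨m, n, a, b, rfl⟩ := eq_of_cols_two hv
  refine (diff_bin (r := m + n) _ _ a b (sub_add_cancel m 1) (sub_add_cancel n 1) (by simp <;> omega)
    (by simp)).trans (sub_eq_zero.2 ?_)
  rw [Int.negOnePow_zero, one_smul]
  exact R.diff_mul' _ (sub_add_cancel m 1) (sub_add_cancel n 1) (by simp <;> omega) _ _ a b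

lemma endDiff_unOp {f : ∀ {m n : ℤ}, n + 1 = m → ((V cl).X m →ₗ[k] (V op).X n)}
    (hf : ∀ {m n : ℤ} (h : n + 1 = m) (x : (V cl).X m), ((V op).d n (n - 1)).hom (f h x) =
      -f (by omega) (((V cl).d m (m - 1)).hom x)) :
    endDiff (V := V) (q := -2) (by norm_num) (unOp (p := -1) fun h => f (by omega)) = 0 := by
  refine EndObj.ext fun v hv => ?_
  obtain ⟨m, a, rfl⟩ := eq_of_cols_one hv
  rw [show -2 + degs [(⟨cl, m, a⟩ : HomEl V)] = m - 1 - 1 by simp; omega]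
  refine (diff_un (r := m - 1) _ _ a (sub_add_cancel m 1)
    (by omega) (by omega)).trans (sub_eq_zero.2 ?_)
  rw [show (-1 : ℤ).negOnePow = -1 by simp, Units.neg_smul, one_smul]
  exact hf _ a

variable (S : ScAlgebra (V cl) (V op))

namespace ScAlgebra

lemma gens_l2_symm : endAct (l := [cl, cl]) (l' := [cl, cl])
    (Equiv.swap (0 : Fin 2) 1) (by decide) S.gens.l2 = -S.gens.l2 := by
  refine EndObj.ext fun v hv => ?_
  obtain ⟨m, n, a, b, rfl⟩ := eq_of_cols_two hv
  rw [act_swap_two rfl rfl _ _ (by decide)]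
  change _ = -(S.gens.l2.1 _ _)
  simp only [gens]
  rw [binOp_apply _ _ _ (by simp <;> omega), binOp_apply _ _ _ (by simp),
    S.ger.br_symm (m := m), neg_neg]

lemma gens_c2_symm : endAct (l := [cl, cl]) (l' := [cl, cl])
    (Equiv.swap (0 : Fin 2) 1) (by decide) S.gens.c2 = -S.gens.c2 := by
  refine EndObj.ext fun v hv => ?_
  obtain ⟨m, n, a, b, rfl⟩ := eq_of_cols_two hv
  rw [act_swap_two rfl rfl _ _ (by decide)]
  change _ = -(S.gens.c2.1 _ _)
  simp only [gens]
  rw [binOp_apply _ _ _ (by simp <;> omega), binOp_apply _ _ _ (by simp),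
    S.ger.mul_symm (m := m), neg_neg]

lemma gens_c2_assoc :
    endComp (l' := [cl, cl, cl]) (r := -2) [cl] [] rfl rfl rfl S.gens.c2 S.gens.c2 =
    -endComp (l' := [cl, cl, cl]) (r := -2) [] [cl] rfl rfl rfl S.gens.c2 S.gens.c2 := by
  refine EndObj.ext fun v hv => ?_
  obtain ⟨m, n, p, a, b, c, rfl⟩ := eq_of_cols_three hv
  refine (comp_bin_right rfl (by norm_num) _ _ a b c (by simp <;> omega)).trans ?_
  refine Eq.trans ?_ (congrArg Neg.neg
    (comp_bin_left rfl (by norm_num) _ _ a b c (by simp <;> omega))).symm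
  rw [show ((-1 : ℤ) * m).negOnePow = m.negOnePow by simp]
  exact S.ger.mul_assoc' _ _ _ _ a b c

lemma gens_jacobi :
    endComp (l' := [cl, cl, cl]) (r := 0) [] [cl] rfl rfl rfl S.gens.l2 S.gens.l2 +
    endAct (l := [cl, cl, cl]) (l' := [cl, cl, cl]) (finRotate 3) (by decide)
      (endComp (l' := [cl, cl, cl]) (r := 0) [] [cl] rfl rfl rfl S.gens.l2 S.gens.l2) +
    endAct (l := [cl, cl, cl]) (l' := [cl, cl, cl]) (finRotate 3).symm (by decide)
      (endComp (l' := [cl, cl, cl]) (r := 0) [] [cl] rfl rfl rfl S.gens.l2 S.gens.l2)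
      = 0 := by
  refine EndObj.ext fun v hv => ?_
  obtain ⟨m, n, p, a, b, c, rfl⟩ := eq_of_cols_three hv
  have key : ∀ {m n p s : ℤ} (a : (V cl).X m) (b : (V cl).X n) (c : (V cl).X p)
      (h : 0 + (m + n + p) = s), (endComp (l' := [cl, cl, cl]) (r := 0) [] [cl] rfl rfl
        rfl S.gens.l2 S.gens.l2).1 [⟨cl, m, a⟩, ⟨cl, n, b⟩, ⟨cl, p, c⟩] s =
      S.ger.br (by omega) (S.ger.br (r := 0 + (m + n)) (by omega) a b) c :=
    fun a b c h => comp_bin_left rfl (by norm_num) _ _ a b c h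
  have hd : 0 + degs [(⟨cl, m, a⟩ : HomEl V), ⟨cl, n, b⟩, ⟨cl, p, c⟩] = m + n + p := by
    simp [add_assoc]
  rw [hd]
  refine (congrArg₂ (fun a b : (V cl).X (m + n + p) => a + b) (congrArg₂ (fun a b : (V cl).X (m + n + p) => a + b)
    (key a b c (by omega))
    ((act_rotate _ ⟨cl, m, a⟩ ⟨cl, n, b⟩ ⟨cl, p, c⟩ rfl rfl rfl _).trans
      (congrArg _ (key (s := m + n + p) c a b (by omega)))))
    ((act_rotate_symm _ ⟨cl, m, a⟩ ⟨cl, n, b⟩ ⟨cl, p, c⟩ rfl rfl rfl _).trans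
      (congrArg _ (key (s := m + n + p) b c a (by omega))))).trans ?_
  refine (add_right_comm _ _ _).trans ?_
  exact S.ger.jacobi' _ _ _ _ _ _ a b c

lemma gens_leibniz :
    endComp (l' := [cl, cl, cl]) (r := -1) [cl] [] rfl rfl rfl S.gens.l2 S.gens.c2 =
    endComp (l' := [cl, cl, cl]) (r := -1) [] [cl] rfl rfl rfl S.gens.c2 S.gens.l2 +
    endAct (l := [cl, cl, cl]) (l' := [cl, cl, cl]) (Equiv.swap (0 : Fin 3) 1) (by decide)
      (endComp (l' := [cl, cl, cl]) (r := -1) [cl] [] rfl rfl rfl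
        S.gens.c2 S.gens.l2) := by
  refine EndObj.ext fun v hv => ?_
  obtain ⟨m, n, p, a, b, c, rfl⟩ := eq_of_cols_three hv
  refine (comp_bin_right rfl (by norm_num) _ _ a b c (by simp <;> omega)).trans ?_
  refine Eq.trans ?_ (congrArg₂ (· + ·) (comp_bin_left rfl (by norm_num) _ _ a b c
    (by simp <;> omega)) ((act_swap_three rfl rfl _ _ (by decide) _ a b c).trans
    (congrArg _ (comp_bin_right rfl (by norm_num) _ _ b a c (by simp <;> omega))))).symm
  simp only [zero_mul, Int.negOnePow_zero, one_smul]
  rw [show ((-1 : ℤ) * m).negOnePow = m.negOnePow by simp]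
  exact S.ger.leibniz' _ _ _ _ _ _ a b c

lemma gens_n02_assoc :
    endComp (l' := [op, op, op]) (r := 0) [op] [] rfl rfl rfl S.gens.n02 S.gens.n02 =
    endComp (l' := [op, op, op]) (r := 0) [] [op] rfl rfl rfl S.gens.n02 S.gens.n02 := by
  refine EndObj.ext fun v hv => ?_
  obtain ⟨m, n, p, a, b, c, rfl⟩ := eq_of_cols_three hv
  refine (comp_bin_right rfl (by norm_num) _ _ a b c (by simp <;> omega)).trans ?_
  refine Eq.trans ?_ (comp_bin_left rfl (by norm_num) _ _ a b c (by simp <;> omega)).symm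
  simp only [zero_mul, Int.negOnePow_zero, one_smul]
  exact S.assoc.mul_assoc' _ _ _ _ a b c

lemma gens_n11_l2 :
    endComp (l' := [cl, cl, op]) (r := 0) [] [op] rfl rfl rfl S.gens.n11 S.gens.l2 =
    endComp (l' := [cl, cl, op]) (r := 0) [cl] [] rfl rfl rfl S.gens.n11 S.gens.n11 -
    endAct (l := [cl, cl, op]) (l' := [cl, cl, op]) (Equiv.swap (0 : Fin 3) 1) (by decide)
      (endComp (l' := [cl, cl, op]) (r := 0) [cl] [] rfl rfl rfl
        S.gens.n11 S.gens.n11) := by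
  refine EndObj.ext fun v hv => ?_
  obtain ⟨m, n, p, a, b, c, rfl⟩ := eq_of_cols_three hv
  refine (comp_bin_left rfl (by norm_num) _ _ a b c (by simp <;> omega)).trans ?_
  refine Eq.trans ?_ (congrArg₂ (· - ·) (comp_bin_right rfl (by norm_num) _ _ a b c
    (by simp <;> omega)) ((act_swap_three rfl rfl _ _ (by decide) _ a b c).trans
    (congrArg _ (comp_bin_right rfl (by norm_num) _ _ b a c (by simp <;> omega))))).symm
  simp only [zero_mul, Int.negOnePow_zero, one_smul]
  exact S.act_br' _ _ _ _ _ _ a b c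

lemma gens_n11_n02 :
    endComp (l' := [cl, op, op]) (r := 0) [cl] [] rfl rfl rfl S.gens.n11 S.gens.n02 =
    endComp (l' := [cl, op, op]) (r := 0) [] [op] rfl rfl rfl S.gens.n02 S.gens.n11 +
    endAct (l := [op, cl, op]) (l' := [cl, op, op]) (Equiv.swap (0 : Fin 3) 1) (by decide)
      (endComp (l' := [op, cl, op]) (r := 0) [op] [] rfl rfl rfl
        S.gens.n02 S.gens.n11) := by
  refine EndObj.ext fun v hv => ?_
  obtain ⟨m, n, p, a, b, c, rfl⟩ := eq_of_cols_three hv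
  refine (comp_bin_right rfl (by norm_num) _ _ a b c (by simp <;> omega)).trans ?_
  refine Eq.trans ?_ (congrArg₂ (· + ·) (comp_bin_left rfl (by norm_num) _ _ a b c
    (by simp <;> omega)) ((act_swap_three rfl rfl _ _ (by decide) _ a b c).trans
    (congrArg _ (comp_bin_right rfl (by norm_num) _ _ b a c (by simp <;> omega))))).symm
  simp only [zero_mul, Int.negOnePow_zero, one_smul]
  exact S.act_mul' _ _ _ _ _ _ a b c

lemma gens_n11_c2 :
    endComp (l' := [cl, cl, op]) (r := -1) [] [op] rfl rfl rfl
      S.gens.n11 S.gens.c2 = 0 := by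
  refine EndObj.ext fun v hv => ?_
  obtain ⟨m, n, p, a, b, c, rfl⟩ := eq_of_cols_three hv
  refine (comp_bin_left rfl (by norm_num) _ _ a b c (by simp <;> omega)).trans ?_
  exact S.act_ger_mul' _ _ a b c

lemma gens_n10_l2 :
    endComp (l' := [cl, cl]) (r := -1) [] [] rfl rfl rfl S.gens.n10 S.gens.l2 =
    endComp (l' := [cl, cl]) (r := -1) [cl] [] rfl rfl rfl S.gens.n11 S.gens.n10 -
    endAct (l := [cl, cl]) (l' := [cl, cl]) (Equiv.swap (0 : Fin 2) 1) (by decide)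
      (endComp (l' := [cl, cl]) (r := -1) [cl] [] rfl rfl rfl
        S.gens.n11 S.gens.n10) := by
  refine EndObj.ext fun v hv => ?_
  obtain ⟨m, n, a, b, rfl⟩ := eq_of_cols_two hv
  refine (comp_un_bin rfl (by norm_num) _ _ a b (by simp)).trans ?_
  refine Eq.trans ?_ (congrArg₂ (· - ·) (comp_bin_un_right rfl (by norm_num) _ _ a b
    (by simp)) ((act_swap_two rfl rfl _ _ (by decide) _ a b).trans
    (congrArg _ (comp_bin_un_right rfl (by norm_num) _ _ b a (by simp <;> omega))))).symm
  rw [show ((-1 : ℤ) * m).negOnePow = m.negOnePow by simp,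
    show ((-1 : ℤ) * n).negOnePow = n.negOnePow by simp, smul_smul, ← Int.negOnePow_add]
  exact S.beta_br' _ _ _ _ _ _ a b

lemma gens_n10_c2 :
    endComp (l' := [cl, cl]) (r := -2) [] [] rfl rfl rfl S.gens.n10 S.gens.c2 = 0 := by
  refine EndObj.ext fun v hv => ?_
  obtain ⟨m, n, a, b, rfl⟩ := eq_of_cols_two hv
  refine (comp_un_bin rfl (by norm_num) _ _ a b (by simp)).trans ?_
  exact S.beta_ger_mul' _ _ a b

lemma gens_diff_n11 :
    endDiff (show (-1 : ℤ) + 1 = 0 by norm_num) S.gens.n11 =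
    endComp (l' := [cl, op]) (r := -1) [] [op] rfl rfl (by norm_num) S.gens.n02 S.gens.n10 -
    endAct (l := [op, cl]) (l' := [cl, op]) (Equiv.swap (0 : Fin 2) 1) (by decide)
      (endComp (l' := [op, cl]) (r := -1) [op] [] rfl rfl rfl
        S.gens.n02 S.gens.n10) := by
  refine EndObj.ext fun v hv => ?_
  obtain ⟨m, n, a, b, rfl⟩ := eq_of_cols_two hv
  refine (diff_bin (r := m + n) _ _ a b (show -1 + m + 1 = m by omega) (sub_add_cancel n 1) (by simp <;> omega)
    (by simp)).trans ?_
  refine Eq.trans ?_ (congrArg₂ (· - ·) (comp_bin_un_left rfl (by norm_num) _ _ a b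
    (by simp)) ((act_swap_two rfl rfl _ _ (by decide) _ a b).trans
    (congrArg _ (comp_bin_un_right rfl (by norm_num) _ _ b a (by simp <;> omega))))).symm
  rw [Int.negOnePow_zero, one_smul, smul_smul, ← Int.negOnePow_add, sub_eq_iff_eq_add,
    show m * n + -1 * n = (-1 + m) * n by ring]
  exact S.diff_act' _ _ (sub_add_cancel n 1) (by simp <;> omega) _ _ _ a b

/-- The operations of an algebra over `sc^!` satisfy the defining relations. -/
def data : ScDualData S.gens.operad := by
  refine
    { l2 := S.gens.term .l2, c2 := S.gens.term .c2, n02 := S.gens.term .n02,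
      n11 := S.gens.term .n11, n10 := S.gens.term .n10, l2_symm := ?_, c2_symm := ?_, c2_assoc :=
      ?_, jacobi := ?_, leibniz := ?_, n02_assoc := ?_, n11_l2 := ?_, n11_n02 := ?_, n11_c2 := ?_,
      n10_l2 := ?_, n10_c2 := ?_, diff_l2 := ?_, diff_c2 := ?_, diff_n02 := ?_, diff_n10 := ?_,
      diff_n11 := ?_ } <;>
    refine S.gens.incl_injective ?_ <;>
    simp only [map_neg, map_add, map_sub, map_zero, S.gens.incl_act, S.gens.incl_comp,
      S.gens.incl_diff, S.gens.incl_term] <;>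
    try erw [S.gens.incl_term]
  · exact S.gens_l2_symm
  · exact S.gens_c2_symm
  · exact S.gens_c2_assoc
  · exact S.gens_jacobi
  · exact S.gens_leibniz
  · exact S.gens_n02_assoc
  · exact S.gens_n11_l2
  · exact S.gens_n11_n02
  · exact S.gens_n11_c2
  · exact S.gens_n10_l2
  · exact S.gens_n10_c2
  · exact S.ger.endDiff_br
  · exact S.ger.endDiff_mul
  · exact S.assoc.endDiff_mul
  · exact endDiff_unOp S.diff_beta
  · exact S.gens_diff_n11

variable {l l' b : List Color} {x d : Color} {p q r : ℤ}

/-- The action of an element of `sc^!` on an algebra over `sc^!`. -/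
def ev : (scDual k).obj l d p →ₗ[k] EndObj V l d p :=
  S.gens.toEnd ∘ₗ ScTerm.objEval S.data

lemma ev_l2 : S.ev (scDualGens k).l2 = S.gens.l2 := S.gens.incl_term _

lemma ev_c2 : S.ev (scDualGens k).c2 = S.gens.c2 := S.gens.incl_term _

lemma ev_n02 : S.ev (scDualGens k).n02 = S.gens.n02 := S.gens.incl_term _

lemma ev_n11 : S.ev (scDualGens k).n11 = S.gens.n11 := S.gens.incl_term _

lemma ev_n10 : S.ev (scDualGens k).n10 = S.gens.n10 := S.gens.incl_term _

lemma ev_comp (l₁ l₂ : List Color) (hl : l = l₁ ++ x :: l₂)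
    (hl' : l' = l₁ ++ b ++ l₂) (hr : p + q = r) (f : (scDual k).obj l d p)
    (g : (scDual k).obj b x q) : S.ev ((scDual k).comp l₁ l₂ hl hl' hr f g) =
      endComp l₁ l₂ hl hl' hr (S.ev f) (S.ev g) :=
  (congrArg S.gens.toEnd (ScTerm.objEval_comp S.data l₁ l₂ hl hl' hr f g)).trans
    (S.gens.toEnd_comp ..)

lemma ev_diff (h : q + 1 = p) (f : (scDual k).obj l d p) :
    S.ev ((scDual k).diff h f) = endDiff h (S.ev f) :=
  (congrArg S.gens.toEnd (ScTerm.objEval_diff S.data h f)).trans (S.gens.toEnd_diff h _)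

lemma ev_act (e : Fin l'.length ≃ Fin l.length) (he : ∀ i, l'.get i = l.get (e i))
    (f : (scDual k).obj l d p) : S.ev ((scDual k).act e he f) = endAct e he (S.ev f) :=
  (congrArg S.gens.toEnd (ScTerm.objEval_act S.data e he f)).trans (S.gens.toEnd_act e he _)

lemma ev_one (x : Color) : S.ev ((scDual k).one x) = endOne x := S.gens.toEnd_one x

end ScAlgebra

end ScAlgebra

section GraftPermutation

variable {k : Type u} [Field k] (P : DGOperad k)
variable {l m b c lb mc : List Color} {x d : Color} {p q r : ℤ}

lemma get_eq_getD {α : Type*} (v : List α) (z : α) (i : Fin v.length) :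
    v.get i = v.getD i z := by
  simp

/-- The permutation of the equivariance of composition exists. -/
lemma DGOperad.exists_comp_act (l₁ l₂ m1 m2 : List Color)
    (hl : l = l₁ ++ x :: l₂) (hm : m = m1 ++ x :: m2)
    (hlb : lb = l₁ ++ b ++ l₂) (hmc : mc = m1 ++ c ++ m2) (hr : p + q = r)
    (e : Fin m.length ≃ Fin l.length) (he : ∀ i, m.get i = l.get (e i))
    (t : Fin c.length ≃ Fin b.length) (ht : ∀ i, c.get i = b.get (t i))
    (H1 : ∀ j : Fin m.length, (j : ℕ) = m1.length → (e j : ℕ) = l₁.length) :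
    ∃ (s : Fin mc.length ≃ Fin lb.length) (hs : ∀ i, mc.get i = lb.get (s i)),
      (∀ (j : Fin m.length) (i : Fin mc.length), (j : ℕ) ≠ m1.length →
        (i : ℕ) = graftPos m1.length c.length j →
          (s i : ℕ) = graftPos l₁.length b.length (e j)) ∧
      ∀ (f : P.obj l d p) (g : P.obj b x q),
        P.comp m1 m2 hm hmc hr (P.act e he f) (P.act t ht g) =
          P.act s hs (P.comp l₁ l₂ hl hlb hr f g) := by
  have lm : m.length = m1.length + m2.length + 1 := by rw [hm]; simp; omega
  have ll : l.length = l₁.length + l₂.length + 1 := by rw [hl]; simp; omega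
  have lmc : mc.length = m1.length + m2.length + c.length := by rw [hmc]; simp; omega
  have llb : lb.length = l₁.length + l₂.length + b.length := by rw [hlb]; simp; omega
  obtain ⟨E, hE1, hE2⟩ := exists_graftEquiv m1.length c.length (m1.length + m2.length) (by omega)
  obtain ⟨F, hF1, hF2⟩ := exists_graftEquiv l₁.length b.length (l₁.length + l₂.length) (by omega)
  let e' : {j : Fin (m1.length + m2.length + 1) // j ≠ ⟨m1.length, by omega⟩} ≃
      {j : Fin (l₁.length + l₂.length + 1) // j ≠ ⟨l₁.length, by omega⟩} :=
    ((finCongr lm.symm).trans (e.trans (finCongr ll))).subtypeEquiv fun j => by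
      have h0 := H1 ⟨m1.length, by omega⟩ rfl
      constructor
      · intro hj hj'
        apply hj
        have : e (finCongr lm.symm j) = e ⟨m1.length, by omega⟩ :=
          Fin.ext ((congrArg Fin.val hj').trans h0.symm)
        have h₂ := congrArg Fin.val (e.injective this)
        exact Fin.ext h₂
      · rintro hj rfl
        exact hj (Fin.ext h0)
  let s : Fin mc.length ≃ Fin lb.length := (finCongr lmc).trans (E.symm.trans
    ((Equiv.sumCongr e' t).trans (F.trans (finCongr llb.symm))))
  have hs1 : ∀ (j : Fin m.length) (i : Fin mc.length), (j : ℕ) ≠ m1.length →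
      (i : ℕ) = graftPos m1.length c.length j →
        (s i : ℕ) = graftPos l₁.length b.length (e j) := by
    intro j i hj hi
    have : (finCongr lmc) i = E (.inl ⟨finCongr lm j, fun h => hj (congrArg Fin.val h)⟩) := by
      refine Fin.ext ?_
      rw [hE1]
      simpa using hi
    simp only [s, Equiv.trans_apply, this, Equiv.symm_apply_apply, Equiv.sumCongr_apply,
      Sum.map_inl, finCongr_apply, Fin.val_cast, hF1]
    rfl
  have hs2 : ∀ (j : Fin c.length) (i : Fin mc.length),
      (i : ℕ) = m1.length + j → (s i : ℕ) = l₁.length + t j := by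
    intro j i hi
    have : (finCongr lmc) i = E (.inr j) := by
      refine Fin.ext ?_
      rw [hE2]
      simpa using hi
    simp only [s, Equiv.trans_apply, this, Equiv.symm_apply_apply, Equiv.sumCongr_apply,
      Sum.map_inr, finCongr_apply, Fin.val_cast, hF2]
  have hs : ∀ i, mc.get i = lb.get (s i) := by
    intro i
    obtain ⟨a, ha⟩ := E.surjective (finCongr lmc i)
    rcases a with ⟨j, hj⟩ | j
    · have hj' : (j : ℕ) ≠ m1.length := fun h => hj (Fin.ext h)
      have hi : (i : ℕ) = graftPos m1.length c.length j := by
        rw [← hE1 ⟨j, hj⟩, ha]; rfl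
      have h1 := hs1 (finCongr lm.symm j) i hj' hi
      have hne : (e (finCongr lm.symm j) : ℕ) ≠ l₁.length := fun h => by
        have h0 := H1 ⟨m1.length, by omega⟩ rfl
        exact hj' (congrArg Fin.val (e.injective (Fin.ext (h.trans h0.symm))))
      rw [get_eq_getD _ Color.cl, get_eq_getD _ Color.cl, h1, hi]
      have h2 := he (finCongr lm.symm j)
      rw [get_eq_getD _ Color.cl, get_eq_getD _ Color.cl] at h2
      simp only [hmc, hlb]
      rw [getD_graftPos _ _ _ x _ rfl rfl hj', getD_graftPos _ _ _ x _ rfl rfl hne, ← hm, ← hl]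
      exact h2
    · have hi : (i : ℕ) = m1.length + j := by
        rw [← hE2 j, ha]; rfl
      have h1 := hs2 j i hi
      have h2 := ht j
      rw [get_eq_getD _ Color.cl, get_eq_getD _ Color.cl] at h2
      rw [get_eq_getD _ Color.cl, get_eq_getD _ Color.cl, h1, hi]
      simp only [hmc, hlb]
      rw [getD_block _ _ _ _ rfl j.2, getD_block _ _ _ _ rfl (t j).2]
      exact h2
  exact ⟨s, hs, hs1, fun f g => P.comp_act l₁ l₂ m1 m2 hl hm hlb hmc hr e he t ht s hs H1 hs1
    hs2 f g⟩

lemma DGOperad.exists_comp_act_right (l₁ l₂ : List Color)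
    (hl : l = l₁ ++ x :: l₂) (hlb : lb = l₁ ++ b ++ l₂) (hmc : mc = l₁ ++ c ++ l₂) (hr : p + q = r)
    (t : Fin c.length ≃ Fin b.length) (ht : ∀ i, c.get i = b.get (t i)) :
    ∃ (s : Fin mc.length ≃ Fin lb.length) (hs : ∀ i, mc.get i = lb.get (s i)),
      (∀ (j : Fin l.length) (i : Fin mc.length), (j : ℕ) ≠ l₁.length →
        (i : ℕ) = graftPos l₁.length c.length j → (s i : ℕ) = graftPos l₁.length b.length j) ∧
      ∀ (f : P.obj l d p) (g : P.obj b x q), P.comp l₁ l₂ hl hmc hr f (P.act t ht g) =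
          P.act s hs (P.comp l₁ l₂ hl hlb hr f g) := by
  obtain ⟨s, hs, H', H⟩ := P.exists_comp_act (d := d) l₁ l₂ l₁ l₂ hl hl hlb hmc hr (Equiv.refl _)
    (fun _ => rfl) t ht (fun j h => h)
  refine ⟨s, hs, H', fun f g => ?_⟩
  rw [← H, P.act_refl]

lemma DGOperad.exists_comp_act_left (l₁ l₂ m1 m2 : List Color) (hl : l = l₁ ++ x :: l₂)
    (hm : m = m1 ++ x :: m2) (hlb : lb = l₁ ++ b ++ l₂) (hmc : mc = m1 ++ b ++ m2) (hr : p + q = r)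
    (e : Fin m.length ≃ Fin l.length) (he : ∀ i, m.get i = l.get (e i))
    (H1 : ∀ j : Fin m.length, (j : ℕ) = m1.length → (e j : ℕ) = l₁.length) :
    ∃ (s : Fin mc.length ≃ Fin lb.length) (hs : ∀ i, mc.get i = lb.get (s i)),
      (∀ (j : Fin m.length) (i : Fin mc.length), (j : ℕ) ≠ m1.length →
        (i : ℕ) = graftPos m1.length b.length j →
          (s i : ℕ) = graftPos l₁.length b.length (e j)) ∧
      ∀ (f : P.obj l d p) (g : P.obj b x q), P.comp m1 m2 hm hmc hr (P.act e he f) g =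
          P.act s hs (P.comp l₁ l₂ hl hlb hr f g) := by
  obtain ⟨s, hs, H', H⟩ := P.exists_comp_act (d := d) l₁ l₂ m1 m2 hl hm hlb hmc hr e
    he (Equiv.refl _) (fun _ => rfl) H1
  refine ⟨s, hs, H', fun f g => ?_⟩
  rw [← H, P.act_refl]

lemma exists_split_at {l m : List Color} {m1 m2 : List Color} {x : Color}
    (hm : m = m1 ++ x :: m2) (e : Fin m.length ≃ Fin l.length)
    (he : ∀ i, m.get i = l.get (e i)) :
    ∃ l₁ l₂, l = l₁ ++ x :: l₂ ∧
      ∀ j : Fin m.length, (j : ℕ) = m1.length → (e j : ℕ) = l₁.length := by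
  have h : m1.length < m.length := by rw [hm]; simp
  have hx : l.get (e ⟨m1.length, h⟩) = x := by
    rw [← he]
    subst hm
    simp
  refine ⟨l.take (e ⟨m1.length, h⟩), l.drop (e ⟨m1.length, h⟩ + 1), ?_, ?_⟩
  · conv_lhs => rw [← List.take_append_drop (e ⟨m1.length, h⟩) l]
    rw [List.drop_eq_getElem_cons (e ⟨m1.length, h⟩).2]
    congr 2
  · rintro ⟨j, hj⟩ rfl
    rw [List.length_take, min_eq_left (e _).2.le]

end GraftPermutation

section BinaryComposition

variable {k : Type u} [Field k] (P : DGOperad k)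
variable {b1 b2 b3 l l' : List Color} {x y z d : Color} {p p1 p2 p3 q r : ℤ}

namespace DGOperad

/-- The composition `γ (f1 ⊗ f2)` of a binary operation with two operations. -/
def bin (hl' : l' = b1 ++ b2) (hr : p + p1 + p2 = r) (γ : P.obj [x, y] d p)
    (f1 : P.obj b1 x p1) (f2 : P.obj b2 y p2) : P.obj l' d r :=
  P.comp (l := b1 ++ [y]) b1 [] rfl (by simp [hl']) hr
    (P.comp (l := [x, y]) [] [y] rfl (by simp) rfl γ f1) f2

section

variable (hl' : l' = b1 ++ b2) (hr : p + p1 + p2 = r) (γ γ' : P.obj [x, y] d p)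
  (f1 f1' : P.obj b1 x p1) (f2 f2' : P.obj b2 y p2) (a : k)

lemma bin_zero_left : P.bin hl' hr γ (0 : P.obj b1 x p1) f2 = 0 := by simp [bin]

lemma bin_zero_right : P.bin hl' hr γ f1 (0 : P.obj b2 y p2) = 0 := by simp [bin]

lemma bin_add_left :
    P.bin hl' hr γ (f1 + f1') f2 = P.bin hl' hr γ f1 f2 + P.bin hl' hr γ f1' f2 := by simp [bin]

lemma bin_add_right :
    P.bin hl' hr γ f1 (f2 + f2') = P.bin hl' hr γ f1 f2 + P.bin hl' hr γ f1 f2' := by simp [bin]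

lemma bin_smul_left : P.bin hl' hr γ (a • f1) f2 = a • P.bin hl' hr γ f1 f2 := by simp [bin]

lemma bin_smul_right : P.bin hl' hr γ f1 (a • f2) = a • P.bin hl' hr γ f1 f2 := by simp [bin]

lemma bin_gen_sub :
    P.bin hl' hr (γ - γ') f1 f2 = P.bin hl' hr γ f1 f2 - P.bin hl' hr γ' f1 f2 := by simp [bin]

lemma bin_gen_zero : P.bin hl' hr (0 : P.obj [x, y] d p) f1 f2 = 0 := by simp [bin]

end

lemma bin_act_right {c : List Color} (hl : l = b1 ++ b2) (hl' : l' = b1 ++ c)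
    (hr : p + p1 + p2 = r) (γ : P.obj [x, y] d p) (f1 : P.obj b1 x p1) (f2 : P.obj b2 y p2)
    (t : Fin c.length ≃ Fin b2.length) (ht : ∀ i, c.get i = b2.get (t i)) :
    ∃ (s : Fin l'.length ≃ Fin l.length) (hs : ∀ i, l'.get i = l.get (s i)),
      P.bin hl' hr γ f1 (P.act t ht f2) = P.act s hs (P.bin hl hr γ f1 f2) := by
  obtain ⟨s, hs, -, H⟩ := P.exists_comp_act_right (d := d) (l := b1 ++ [y]) (lb := l) (mc := l') b1 []
    rfl (by simp [hl]) (by simp [hl']) hr t ht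
  exact ⟨s, hs, H _ _⟩

lemma bin_act_left {c : List Color} (hl : l = b1 ++ b2) (hl' : l' = c ++ b2)
    (hr : p + p1 + p2 = r) (γ : P.obj [x, y] d p) (f1 : P.obj b1 x p1) (f2 : P.obj b2 y p2)
    (t : Fin c.length ≃ Fin b1.length) (ht : ∀ i, c.get i = b1.get (t i)) :
    ∃ (s : Fin l'.length ≃ Fin l.length) (hs : ∀ i, l'.get i = l.get (s i)),
      P.bin hl' hr γ (P.act t ht f1) f2 = P.act s hs (P.bin hl hr γ f1 f2) := by
  obtain ⟨s, hs, H', H⟩ := P.exists_comp_act_right (d := d) (l := [x, y]) (p := p) (q := p1)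
    (lb := b1 ++ [y]) (mc := c ++ [y]) [] [y] rfl rfl rfl rfl t ht
  obtain ⟨s', hs', -, K⟩ := P.exists_comp_act_left (d := d) (p := p + p1) (b := b2) (lb := l) (mc := l')
    b1 [] c [] rfl rfl (by simp [hl]) (by simp [hl']) hr s hs (fun j hj => by
      have := H' ⟨1, by simp⟩ j (by simp) (by simp [graftPos, hj])
      simpa [graftPos] using this)
  refine ⟨s', hs', ?_⟩
  rw [bin, H, K]
  rfl

lemma comp_congr {b : List Color} {l₁ l₁' l₂ l₂' : List Color} (h1 : l₁ = l₁')
    (h2 : l₂ = l₂') (hl : l = l₁ ++ x :: l₂) (hl' : l' = l₁ ++ b ++ l₂) (hr : p + q = r)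
    (f : P.obj l d p) (g : P.obj b x q) : P.comp l₁ l₂ hl hl' hr f g =
      P.comp l₁' l₂' (by rw [hl, h1, h2]) (by rw [hl', h1, h2]) hr f g := by
  subst h1 h2
  rfl

lemma bin_eq {s : ℤ} {c : List Color} (hl' : l' = b1 ++ b2) (hr : p + p1 + p2 = r)
    (γ : P.obj [x, y] d p) (f1 : P.obj b1 x p1) (f2 : P.obj b2 y p2) (hs : p + p1 = s)
    (hs' : s + p2 = r) (hc : c = b1 ++ [y]) :
    P.bin hl' hr γ f1 f2 = P.comp (l := c) b1 [] hc (by simp [hl']) hs'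
      (P.comp (l := [x, y]) [] [y] rfl (by simp [hc]) hs γ f1) f2 := by
  subst hs hc
  rfl

lemma units_comp {b : List Color} (l₁ l₂ : List Color) (hl : l = l₁ ++ x :: l₂)
    (hl' : l' = l₁ ++ b ++ l₂) (hr : p + q = r) (s : ℤˣ) (f : P.obj l d p) (g : P.obj b x q) :
    P.comp l₁ l₂ hl hl' hr (s • f) g = s • P.comp l₁ l₂ hl hl' hr f g := by
  simp [Units.smul_def]

lemma act_units (s : ℤˣ) (e : Fin l'.length ≃ Fin l.length)
    (he : ∀ i, l'.get i = l.get (e i)) (f : P.obj l d p) :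
    P.act e he (s • f) = s • P.act e he f := by
  simp [Units.smul_def]

/-- Parallel associativity, up to sign. -/
lemma exists_comp_comm {b c lb lc lbc : List Color} {q pq pr pqr : ℤ}
    (l₁ l₂ l3 : List Color)
    (hx : l = l₁ ++ x :: (l₂ ++ y :: l3)) (hy : l = (l₁ ++ x :: l₂) ++ y :: l3)
    (hlb : lb = l₁ ++ b ++ (l₂ ++ y :: l3)) (hlb' : lb = (l₁ ++ b ++ l₂) ++ y :: l3)
    (hlc : lc = (l₁ ++ x :: l₂) ++ c ++ l3) (hlc' : lc = l₁ ++ x :: (l₂ ++ c ++ l3))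
    (hlbc : lbc = (l₁ ++ b ++ l₂) ++ c ++ l3) (hlbc' : lbc = l₁ ++ b ++ (l₂ ++ c ++ l3))
    (hpq : p + q = pq) (hpr : p + r = pr) (h1 : pq + r = pqr) (h2 : pr + q = pqr)
    (f : P.obj l d p) (g : P.obj b x q) (h : P.obj c y r) :
    ∃ s : ℤˣ, P.comp l₁ (l₂ ++ c ++ l3) hlc' hlbc' h2 (P.comp (l₁ ++ x :: l₂) l3 hy hlc hpr f h) g =
      s • P.comp (l₁ ++ b ++ l₂) l3 hlb' hlbc h1 (P.comp l₁ (l₂ ++ y :: l3) hx hlb hpq f g) h := by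
  refine ⟨(q * r).negOnePow, ?_⟩
  rw [P.comp_comm l₁ l₂ l3 hx hy hlb hlb' hlc hlc' hlbc hlbc' hpq hpr h1 h2, smul_smul,
    Int.units_mul_self, one_smul]

lemma comp_bin_right {b : List Color} {r' p2' : ℤ} (l₁ l₂ : List Color)
    (hb2 : b2 = l₁ ++ z :: l₂) (hl : l = b1 ++ b2) (hr : p + p1 + p2 = r) (γ : P.obj [x, y] d p)
    (f1 : P.obj b1 x p1) (f2 : P.obj b2 y p2) (g : P.obj b z q) {c : List Color}
    (hc : c = l₁ ++ b ++ l₂)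
    (hl' : l' = b1 ++ c) (hr' : r + q = r') (h2 : p2 + q = p2') (h : p + p1 + p2' = r') :
    P.comp (b1 ++ l₁) l₂ (by simp [hl, hb2]) (by simp [hl', hc]) hr' (P.bin hl hr γ f1 f2) g =
      P.bin hl' h γ f1 (P.comp l₁ l₂ hb2 hc h2 f2 g) := by
  have := P.comp_comp (lm := l) (lmb := l') b1 [] l₁ l₂ (l := b1 ++ [y]) rfl hb2 (by simp [hl]) hc
    (by simp [hl, hb2]) (by simp [hl', hc]) (by simp [hl']) hr h2 hr' h
    (P.comp (l := [x, y]) [] [y] rfl (by simp) rfl γ f1) f2 g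
  rw [P.comp_congr rfl (List.append_nil l₂)] at this
  exact this

lemma comp_bin_left {b : List Color} {r' p1' : ℤ} (l₁ l₂ : List Color)
    (hb1 : b1 = l₁ ++ z :: l₂) (hl : l = b1 ++ b2) (hr : p + p1 + p2 = r) (γ : P.obj [x, y] d p)
    (f1 : P.obj b1 x p1) (f2 : P.obj b2 y p2) (g : P.obj b z q) {c : List Color}
    (hc : c = l₁ ++ b ++ l₂)
    (hl' : l' = c ++ b2) (hr' : r + q = r') (h1 : p1 + q = p1') (h : p + p1' + p2 = r') :
    ∃ s : ℤˣ, P.comp l₁ (l₂ ++ b2) (by simp [hl, hb1]) (by simp [hl', hc]) hr'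
      (P.bin hl hr γ f1 f2) g = s • P.bin hl' h γ (P.comp l₁ l₂ hb1 hc h1 f1 g) f2 := by
  obtain ⟨s, hs⟩ := P.exists_comp_comm (l := b1 ++ [y]) (lc := l) (lb := c ++ [y]) (lbc := l')
    (pqr := r') (q := q) (pq := p + p1') (pr := r) l₁ l₂ []
    (by simp [hb1]) (by simp [hb1]) (by simp [hc]) (by simp [hc]) (by simp [hl, hb1])
    (by simp [hl, hb1]) (by simp [hl', hc]) (by simp [hl', hc]) (by omega) hr h hr'
    (P.comp (l := [x, y]) [] [y] rfl (by simp) rfl γ f1) g f2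
  refine ⟨s, ?_⟩
  rw [P.comp_congr rfl (List.append_nil (l₂ ++ b2))] at hs
  rw [P.bin_eq hl hr γ f1 f2 rfl hr rfl]
  rw [P.comp_congr (l₁ := l₁ ++ z :: l₂) (l₁' := b1) hb1.symm rfl] at hs
  refine hs.trans ?_
  congr 1
  rw [P.bin_eq hl' h γ _ f2 rfl h (c := c ++ [y]) rfl, P.comp_congr (l₁' := c) (by simp [hc]) rfl]
  congr 2
  exact P.comp_comp [] [y] l₁ l₂ (l := [x, y]) rfl hb1 (by simp) hc (by simp [hb1]) (by simp [hc])
    (by simp) rfl h1 _ rfl γ f1 g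

lemma comp_un {b c m : List Color} {s t : ℤ} (l₁ l₂ : List Color)
    (hm : m = l₁ ++ z :: l₂) (ν : P.obj [x] d p) (f : P.obj m x p1) (g : P.obj b z q)
    (hc : c = l₁ ++ b ++ l₂) (hr : p + p1 = r) (h1 : r + q = t) (h2 : p1 + q = s)
    (h3 : p + s = t) :
    P.comp l₁ l₂ hm hc h1 (P.comp [] [] rfl (by simp) hr ν f) g =
      P.comp [] [] rfl (by simp) h3 ν (P.comp l₁ l₂ hm hc h2 f g) := by
  have := P.comp_comp (lm := m) (lmb := c) [] [] l₁ l₂ (l := [x]) rfl hm (by simp) hc (by simp [hm])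
    (by simp [hc]) (by simp) hr h2 h1 h3 ν f g
  rw [P.comp_congr rfl (List.append_nil l₂)] at this
  exact this

lemma bin_comp_un (ν : P.obj [z] d q) (δ : P.obj [x, y] z p) (f1 : P.obj b1 x p1)
    (f2 : P.obj b2 y p2) (hl' : l' = b1 ++ b2) {s t : ℤ} (h1 : q + p = s) (h2 : s + p1 + p2 = t)
    (hr : p + p1 + p2 = r) (h3 : q + r = t) :
    P.bin hl' h2 (P.comp [] [] rfl rfl h1 ν δ) f1 f2 =
      P.comp [] [] rfl (by simp) h3 ν (P.bin hl' hr δ f1 f2) := by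
  rw [bin, bin]
  have e1 := P.comp_un (c := b1 ++ [y]) [] [y] rfl ν δ f1 rfl h1 rfl rfl (show q + (p + p1) = s + p1 by omega)
  rw [e1]
  exact P.comp_un b1 [] rfl ν _ f2 (by simp [hl']) _ _ _ _

lemma bin_comp_right_un (γ : P.obj [x, y] d p) (ν : P.obj [z] y q)
    (f1 : P.obj b1 x p1) (f2 : P.obj b2 z p2) (hl' : l' = b1 ++ b2) {s t u : ℤ}
    (h1 : p + q = s) (h2 : s + p1 + p2 = t) (h3 : q + p2 = u) (h4 : p + p1 + u = t) :
    ∃ ε : ℤˣ, P.bin hl' h2 (P.comp (l' := [x, z]) [x] [] rfl rfl h1 γ ν) f1 f2 =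
      ε • P.bin hl' h4 γ f1 (P.comp [] [] rfl (by simp) h3 ν f2) := by
  obtain ⟨ε, h⟩ := P.exists_comp_comm (l := [x, y]) (lc := [x, z]) (lb := b1 ++ [y])
    (lbc := b1 ++ [z]) (pqr := s + p1) [] [] [] rfl rfl (by simp) (by simp) rfl rfl (by simp)
    (by simp) rfl h1 (show p + p1 + q = s + p1 by omega) rfl γ f1 ν
  refine ⟨ε, ?_⟩
  rw [bin]
  refine (congrArg (fun f => P.comp b1 [] _ _ h2 f f2) h).trans ?_
  rw [P.units_comp]
  congr 1
  rw [P.comp_congr (l₁ := [] ++ b1 ++ []) (l₁' := b1) (by simp) rfl, bin]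
  have := P.comp_comp (mb := b2) (l := b1 ++ [y]) (lm := b1 ++ [z]) (lmb := l') b1 [] [] [] rfl rfl (by simp)
    (by simp) (by simp) (by simp [hl']) (by simp [hl']) (show p + p1 + q = s + p1 by omega) h3 h2 h4
    (P.comp (l := [x, y]) [] [y] rfl (by simp) rfl γ f1) ν f2
  rw [P.comp_congr (List.append_nil b1) rfl] at this
  exact this

/-- The composition `τ (f1 ⊗ f2 ⊗ f3)` of a ternary operation with three operations. -/
def tri (hl' : l' = b1 ++ b2 ++ b3) (hr : p + p1 + p2 + p3 = r) (τ : P.obj [x, y, z] d p)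
    (f1 : P.obj b1 x p1) (f2 : P.obj b2 y p2) (f3 : P.obj b3 z p3) : P.obj l' d r :=
  P.comp (l := b1 ++ b2 ++ [z]) (b1 ++ b2) [] rfl (by simp [hl']) hr
    (P.comp (l := b1 ++ [y, z]) b1 [z] rfl rfl rfl
      (P.comp (l := [x, y, z]) [] [y, z] rfl rfl rfl τ f1) f2) f3

variable {x1 x2 : Color}

lemma tri_comp_left (γ : P.obj [x, z] d p) (δ : P.obj [x1, x2] x q)
    (f1 : P.obj b1 x1 p1) (f2 : P.obj b2 x2 p2) (f3 : P.obj b3 z p3) {c : List Color}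
    (hl' : l' = b1 ++ b2 ++ b3) (hc : c = b1 ++ b2) (hl'' : l' = c ++ b3) {s t u : ℤ}
    (h1 : p + q = s) (h2 : s + p1 + p2 + p3 = t)
    (h3 : q + p1 + p2 = u) (h4 : p + u + p3 = t) :
    P.tri hl' h2 (P.comp (l' := [x1, x2, z]) [] [z] rfl rfl h1 γ δ) f1 f2 f3 =
      P.bin hl'' h4 γ (P.bin hc h3 δ f1 f2) f3 := by
  have e1 := P.comp_comp (l := [x, z]) (lmb := b1 ++ [x2, z]) [] [z] [] [x2] rfl rfl rfl
    (show b1 ++ [x2] = [] ++ b1 ++ [x2] by simp) (show [x1, x2, z] = _ from rfl) rfl (by simp) h1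
    rfl rfl (show p + (q + p1) = s + p1 by omega) γ δ f1
  have e2 := P.comp_comp (l := [x, z]) (lm := b1 ++ [x2, z]) (lmb := b1 ++ b2 ++ [z]) [] [z] b1 [] rfl
    (show b1 ++ [x2] = _ from rfl) (by simp) (show c = _ by simp [hc]) (by simp) (by simp) (by simp [hc])
    (show p + (q + p1) = s + p1 by omega) h3 (show s + p1 + p2 = s + p1 + p2 from rfl) (by omega)
    γ (P.comp (l := [x1, x2]) [] [x2] rfl (by simp) rfl δ f1) f2
  rw [tri]
  refine (congrArg (fun f => P.comp (b1 ++ b2) [] _ _ h2 (P.comp b1 [z] _ _ _ f f2) f3) e1).trans ?_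
  refine (congrArg (fun f => P.comp (b1 ++ b2) [] _ _ h2 f f3) e2).trans ?_
  rw [P.bin_eq hl'' h4 γ _ f3 (show p + u = s + p1 + p2 by omega) h2 (c := b1 ++ b2 ++ [z])
    (by simp [hc])]
  subst hc
  rfl

lemma tri_comp_right {w : Color} (γ : P.obj [x, w] d p) (δ : P.obj [y, z] w q)
    (f1 : P.obj b1 x p1) (f2 : P.obj b2 y p2) (f3 : P.obj b3 z p3) {c : List Color}
    (hl' : l' = b1 ++ b2 ++ b3) (hc : c = b2 ++ b3) (hl'' : l' = b1 ++ c) {s t u : ℤ}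
    (h1 : p + q = s) (h2 : s + p1 + p2 + p3 = t)
    (h3 : q + p2 + p3 = u) (h4 : p + p1 + u = t) :
    ∃ ε : ℤˣ, P.tri hl' h2 (P.comp (l' := [x, y, z]) [x] [] rfl rfl h1 γ δ) f1 f2 f3 =
      ε • P.bin hl'' h4 γ f1 (P.bin hc h3 δ f2 f3) := by
  obtain ⟨ε, h⟩ := P.exists_comp_comm (l := [x, w]) (lc := [x, y, z]) (lb := b1 ++ [w])
    (lbc := b1 ++ [y, z]) (pqr := s + p1) [] [] [] rfl rfl (by simp) (by simp) rfl rfl (by simp)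
    (by simp) rfl h1 (show p + p1 + q = s + p1 by omega) rfl γ f1 δ
  refine ⟨ε, ?_⟩
  rw [tri]
  refine (congrArg (fun f => P.comp (b1 ++ b2) [] _ _ h2 (P.comp b1 [z] _ _ _ f f2) f3) h).trans ?_
  rw [P.units_comp, P.units_comp]
  congr 1
  rw [P.comp_congr (l₁ := [] ++ b1 ++ []) (l₁' := b1) (by simp) rfl]
  have e1 := P.comp_comp (l := b1 ++ [w]) (lm := b1 ++ [y, z]) (lmb := b1 ++ b2 ++ [z]) b1 [] [] [z]
    rfl rfl (by simp) (show b2 ++ [z] = _ by simp) (by simp) (by simp) (by simp)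
    (show p + p1 + q = s + p1 by omega) rfl rfl (show p + p1 + (q + p2) = s + p1 + p2 by omega)
    (P.comp (l := [x, w]) [] [w] rfl (by simp) rfl γ f1) δ f2
  rw [P.comp_congr (List.append_nil b1) rfl] at e1
  refine (congrArg (fun f => P.comp (b1 ++ b2) [] _ _ h2 f f3) e1).trans ?_
  have e2 := P.comp_comp (l := b1 ++ [w]) (lm := b1 ++ b2 ++ [z]) (lmb := l') b1 [] b2 []
    rfl (show b2 ++ [z] = _ from rfl) (by simp) (show c = _ by simp [hc]) (by simp) (by simp [hl'])
    (by simp [hl'']) (show p + p1 + (q + p2) = s + p1 + p2 by omega) h3 h2 h4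
    (P.comp (l := [x, w]) [] [w] rfl (by simp) rfl γ f1)
    (P.comp (l := [y, z]) [] [z] rfl (by simp) rfl δ f2) f3
  exact e2

lemma tri_act (e : Fin [x, y, z].length ≃ Fin [y, x, z].length)
    (he : ∀ i, [x, y, z].get i = [y, x, z].get (e i)) (h0 : (e 0 : ℕ) = 1) (h1 : (e 1 : ℕ) = 0)
    (h2 : (e 2 : ℕ) = 2) (τ : P.obj [y, x, z] d p)
    (f1 : P.obj b1 x p1) (f2 : P.obj b2 y p2) (f3 : P.obj b3 z p3)
    (hl' : l' = b1 ++ b2 ++ b3) (hl : l = b2 ++ b1 ++ b3) (hr : p + p1 + p2 + p3 = r)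
    (hr' : p + p2 + p1 + p3 = r) :
    ∃ (ε : ℤˣ) (s : Fin l'.length ≃ Fin l.length) (hs : ∀ i, l'.get i = l.get (s i)),
      P.tri hl' hr (P.act e he τ) f1 f2 f3 = ε • P.act s hs (P.tri hl hr' τ f2 f1 f3) := by
  obtain ⟨s1, hs1, H1, E1⟩ := P.exists_comp_act_left (d := d) (b := b1) (p := p) (q := p1)
    (mc := b1 ++ [y, z]) (lb := [y] ++ b1 ++ [z]) [y] [z] [] [y, z] rfl rfl rfl rfl rfl e he
    (by rintro ⟨j, hj⟩ rfl; exact h0)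
  have a1 : ∀ j : Fin (b1 ++ [y, z]).length, (j : ℕ) = b1.length → (s1 j : ℕ) = 0 := by
    intro j hj
    rw [H1 ⟨1, by simp⟩ j (by simp) (by simp [graftPos, hj])]
    rw [show e ⟨1, by simp⟩ = e 1 from rfl, h1]
    rfl
  have a2 : ∀ j : Fin (b1 ++ [y, z]).length, (j : ℕ) = b1.length + 1 →
      (s1 j : ℕ) = b1.length + 1 := by
    intro j hj
    rw [H1 ⟨2, by simp⟩ j (by simp) (by simp [graftPos, hj] <;> omega)]
    rw [show e ⟨2, by simp⟩ = e 2 from rfl, h2]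
    simp [graftPos] <;> omega
  obtain ⟨s2, hs2, H2, E2⟩ := P.exists_comp_act_left (d := d) (b := b2) (p := p + p1) (q := p2)
    (mc := b1 ++ b2 ++ [z]) (lb := b2 ++ b1 ++ [z]) [] (b1 ++ [z]) b1 [z] rfl rfl (by simp) rfl rfl
    s1 hs1 a1
  have a3 : ∀ j : Fin (b1 ++ b2 ++ [z]).length, (j : ℕ) = (b1 ++ b2).length →
      (s2 j : ℕ) = (b2 ++ b1).length := by
    intro j hj
    simp only [List.length_append] at hj
    rw [H2 ⟨b1.length + 1, by simp⟩ j (by simp) (by simp [graftPos, hj] <;> omega),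
      a2 _ rfl]
    simp [graftPos] <;> omega
  obtain ⟨s3, hs3, -, E3⟩ := P.exists_comp_act_left (d := d) (b := b3) (p := p + p1 + p2) (q := p3)
    (mc := l') (lb := l) (b2 ++ b1) [] (b1 ++ b2) [] rfl rfl (by simp [hl]) (by simp [hl'])
    hr s2 hs2 a3
  obtain ⟨ε, h⟩ := P.exists_comp_comm (l := [y, x, z]) (lc := [y] ++ b1 ++ [z])
    (lb := b2 ++ [x, z]) (lbc := b2 ++ b1 ++ [z]) (pqr := p + p1 + p2) (p := p) (q := p2) (r := p1)
    [] [] [z] rfl rfl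
    (by simp) (by simp) rfl rfl (by simp) (by simp) rfl rfl (show p + p2 + p1 = _ by omega) rfl
    τ f2 f1
  refine ⟨ε, s3, hs3, ?_⟩
  rw [tri, E1, E2, E3, ← P.act_units]
  congr 1
  refine (congrArg (fun f => P.comp (b2 ++ b1) [] _ _ hr f f3) h).trans ?_
  rw [P.units_comp]
  congr 1
  rw [tri, P.comp_congr (l₁ := [] ++ b2 ++ []) (l₁' := b2) (by simp) rfl]
  have key : ∀ {s s' : ℤ} (hs : s = s') (h₁ : p + p2 + p1 = s) (h₂ : s + p3 = r)
      (h1' : p + p2 + p1 = s') (h2' : s' + p3 = r) (X : P.obj (b2 ++ [x, z]) d (p + p2)),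
      P.comp (l := b2 ++ b1 ++ [z]) (l' := l) (b2 ++ b1) [] rfl (by simp [hl]) h₂
        (P.comp b2 [z] rfl rfl h₁ X f1) f3 =
      P.comp (l := b2 ++ b1 ++ [z]) (l' := l) (b2 ++ b1) [] rfl (by simp [hl]) h2'
        (P.comp b2 [z] rfl rfl h1' X f1) f3 := by
    rintro s s' rfl _ _ _ _ _
    rfl
  exact key (by omega) _ _ _ _ _

lemma bin_act (e : Fin [x, y].length ≃ Fin [y, x].length)
    (he : ∀ i, [x, y].get i = [y, x].get (e i)) (h0 : (e 0 : ℕ) = 1) (h1 : (e 1 : ℕ) = 0)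
    (τ : P.obj [y, x] d p) (f1 : P.obj b1 x p1) (f2 : P.obj b2 y p2)
    (hl' : l' = b1 ++ b2) (hl : l = b2 ++ b1) (hr : p + p1 + p2 = r)
    (hr' : p + p2 + p1 = r) :
    ∃ (ε : ℤˣ) (s : Fin l'.length ≃ Fin l.length) (hs : ∀ i, l'.get i = l.get (s i)),
      P.bin hl' hr (P.act e he τ) f1 f2 = ε • P.act s hs (P.bin hl hr' τ f2 f1) := by
  obtain ⟨s1, hs1, H1, E1⟩ := P.exists_comp_act_left (d := d) (b := b1) (p := p) (q := p1)
    (mc := b1 ++ [y]) (lb := [y] ++ b1) [y] [] [] [y] rfl rfl (by simp) rfl rfl e he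
    (by rintro ⟨j, hj⟩ rfl; exact h0)
  have a1 : ∀ j : Fin (b1 ++ [y]).length, (j : ℕ) = b1.length → (s1 j : ℕ) = 0 := by
    intro j hj
    rw [H1 ⟨1, by simp⟩ j (by simp) (by simp [graftPos, hj])]
    rw [show e ⟨1, by simp⟩ = e 1 from rfl, h1]
    rfl
  obtain ⟨s2, hs2, H2, E2⟩ := P.exists_comp_act_left (d := d) (b := b2) (p := p + p1) (q := p2)
    (mc := l') (lb := l) [] b1 b1 [] rfl rfl (by simp [hl]) (by simp [hl']) hr
    s1 hs1 a1
  obtain ⟨ε, h⟩ := P.exists_comp_comm (l := [y, x]) (lc := [y] ++ b1)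
    (lb := b2 ++ [x]) (lbc := l) (pqr := r) (p := p) (q := p2) (r := p1)
    [] [] [] rfl rfl
    (by simp) (by simp) (by simp) (by simp) (by simp [hl]) (by simp [hl]) rfl rfl hr' hr
    τ f2 f1
  refine ⟨ε, s2, hs2, ?_⟩
  rw [bin, E1, E2, ← P.act_units]
  congr 1
  rw [P.comp_congr (l₂ := [] ++ b1 ++ []) (l₂' := b1) rfl (by simp)] at h
  refine h.trans ?_
  rw [bin, P.comp_congr (l₁ := [] ++ b2 ++ []) (l₁' := b2) (by simp) rfl]
  rfl

end DGOperad

end BinaryComposition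

section Spanning

variable {k : Type u} [Field k]

open Color

variable {l l' : List Color} {d : Color} {p r : ℤ} {f g : (scDual k).obj l d p}

/-- The generator `l2` of `sc^!`. -/
abbrev opL2 := (scDualGens k).l2

/-- The generator `c2` of `sc^!`. -/
abbrev opC2 := (scDualGens k).c2

/-- The generator `n02` of `sc^!`. -/
abbrev opN02 := (scDualGens k).n02

/-- The generator `n11` of `sc^!`. -/
abbrev opN11 := (scDualGens k).n11

/-- The generator `n10` of `sc^!`. -/
abbrev opN10 := (scDualGens k).n10

/-- The binary generators of `sc^!`. -/
inductive IsBinaryGen : ∀ {x y d : Color} {p : ℤ}, (scDual k).obj [x, y] d p → Prop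
  | l2 : IsBinaryGen (scDualGens k).l2
  | c2 : IsBinaryGen (scDualGens k).c2
  | n02 : IsBinaryGen (scDualGens k).n02
  | n11 : IsBinaryGen (scDualGens k).n11

/-- Linear combinations of trees of generators, built from the root. -/
inductive Built : ∀ {l : List Color} {d : Color} {p : ℤ}, (scDual k).obj l d p → Prop
  | zero {l : List Color} {d : Color} {p : ℤ} : Built (0 : (scDual k).obj l d p)
  | add {l : List Color} {d : Color} {p : ℤ} {f g : (scDual k).obj l d p} :
      Built f → Built g → Built (f + g)
  | smul {l : List Color} {d : Color} {p : ℤ} (a : k) {f : (scDual k).obj l d p} :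
      Built f → Built (a • f)
  | one (x : Color) : Built ((scDual k).one x)
  | act {l l' : List Color} {d : Color} {p : ℤ} (e : Fin l'.length ≃ Fin l.length)
      (he : ∀ i, l'.get i = l.get (e i)) {f : (scDual k).obj l d p} :
      Built f → Built ((scDual k).act e he f)
  | un {l : List Color} {p r : ℤ} (hr : -1 + p = r) {f : (scDual k).obj l cl p} :
      Built f → Built ((scDual k).comp (l' := l) [] [] rfl (by simp) hr (scDualGens k).n10 f)
  | bin {b1 b2 l' : List Color} {x y d : Color} {p p1 p2 r : ℤ} (hl' : l' = b1 ++ b2)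
      (hr : p + p1 + p2 = r) {γ : (scDual k).obj [x, y] d p} {f1 : (scDual k).obj b1 x p1}
      {f2 : (scDual k).obj b2 y p2} : IsBinaryGen γ → Built f1 → Built f2 →
      Built ((scDual k).bin hl' hr γ f1 f2)

lemma Built.units (h : Built f)
    (s : ℤˣ) : Built (s • f) := by
  rcases Int.units_eq_one_or s with rfl | rfl
  · rwa [one_smul]
  · rw [Units.neg_smul, one_smul, ← neg_one_smul k]
    exact h.smul _

lemma Built.sub (h : Built f)
    (h' : Built g) : Built (f - g) := by
  rw [sub_eq_add_neg, ← neg_one_smul k]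
  exact h.add (h'.smul _)

lemma Built.comp (hf : Built f) :
    ∀ {b l' : List Color} {x : Color} {q r : ℤ} (l₁ l₂ : List Color) (hl : l = l₁ ++ x :: l₂)
      (hl' : l' = l₁ ++ b ++ l₂) (hr : p + q = r) {g : (scDual k).obj b x q}, Built g →
      Built ((scDual k).comp l₁ l₂ hl hl' hr f g) := by
  induction hf with
  | zero =>
    intros
    rw [map_zero, LinearMap.zero_apply]
    exact .zero
  | add _ _ ih ih' =>
    intro _ _ _ _ _ l₁ l₂ hl hl' hr g hg
    rw [map_add, LinearMap.add_apply]
    exact (ih l₁ l₂ hl hl' hr hg).add (ih' l₁ l₂ hl hl' hr hg)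
  | smul a _ ih =>
    intro _ _ _ _ _ l₁ l₂ hl hl' hr g hg
    rw [map_smul, LinearMap.smul_apply]
    exact (ih l₁ l₂ hl hl' hr hg).smul a
  | one y =>
    intro b l' x q r l₁ l₂ hl hl' hr g hg
    obtain ⟨rfl, rfl, rfl⟩ : l₁ = [] ∧ y = x ∧ l₂ = [] := by
      cases l₁ with
      | nil => simpa using hl
      | cons => simp at hl
    obtain rfl : l' = b := by simpa using hl'
    obtain rfl : q = r := by omega
    rw [(scDual k).one_comp]
    exact hg
  | act e he _ ih =>
    intro b l' x q r m1 m2 hm hl' hr g hg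
    obtain ⟨l₁, l₂, hl, H⟩ := exists_split_at hm e he
    obtain ⟨s, hs, -, K⟩ := (scDual k).exists_comp_act_left (lb := l₁ ++ b ++ l₂) l₁ l₂ m1 m2 hl hm
      rfl hl' hr e he H
    rw [K]
    exact (ih l₁ l₂ hl rfl hr hg).act s hs
  | un hr0 _ ih =>
    intro b l' x q r l₁ l₂ hl hl' hr g hg
    rw [(scDual k).comp_un l₁ l₂ hl _ _ g hl' hr0 hr rfl (by omega)]
    exact (ih l₁ l₂ hl hl' rfl hg).un _
  | @bin b1 b2 l x1 x2 d p p1 p2 r0 hl0 hr0 γ f1 f2 hγ hf1 hf2 ih1 ih2 =>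
    intro b l' x q r l₁ l₂ hl hl' hr g hg
    have right : ∀ a, l₁ = b1 ++ a → b2 = a ++ x :: l₂ →
        Built ((scDual k).comp l₁ l₂ hl hl' hr ((scDual k).bin hl0 hr0 γ f1 f2) g) := by
      intro a h1 h2
      subst h1
      rw [(scDual k).comp_bin_right (c := a ++ b ++ l₂) (l' := l') a l₂ h2 hl0 hr0 γ f1 f2 g rfl
        (by simp [hl']) hr rfl (by omega)]
      exact .bin _ _ hγ hf1 (ih2 a l₂ h2 rfl rfl hg)
    rcases List.append_eq_append_iff.1 (hl0.symm.trans hl) with ⟨a, h1, h2⟩ | ⟨c, h1, h2⟩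
    · exact right a h1 h2
    · cases c with
      | nil => exact right [] (by simpa using h1.symm) (by simpa using h2.symm)
      | cons z c =>
        simp only [List.cons_append, List.cons.injEq] at h2
        obtain ⟨rfl, rfl⟩ := h2
        obtain ⟨s, hs⟩ := (scDual k).comp_bin_left (c := l₁ ++ b ++ c) (l' := l') l₁ c h1 hl0 hr0
          γ f1 f2 g rfl (by simp [hl']) hr rfl (by omega)
        rw [hs]
        exact (Built.bin _ _ hγ (ih1 l₁ c h1 rfl rfl hg) hf2).units s

lemma Built.n10 : Built (opN10 (k := k)) := by
  have := Built.un (k := k) (r := -1) (by norm_num) (Built.one cl)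
  rwa [(scDual k).comp_one] at this

lemma DGOperad.bin_one_left (P : DGOperad k) {b l' : List Color} {x y d : Color} {p q r : ℤ}
    (hl' : l' = [x] ++ b) (hr : p + 0 + q = r) (h : p + q = r) (γ : P.obj [x, y] d p)
    (f : P.obj b y q) :
    P.bin hl' hr γ (P.one x) f = P.comp [x] [] rfl (by simp [hl']) h γ f := by
  rw [P.bin_eq hl' hr γ (P.one x) f (add_zero p) h rfl]
  congr 2
  exact P.comp_one [] [y] rfl rfl _ γ

lemma IsBinaryGen.built {x y d : Color} {p : ℤ} {γ : (scDual k).obj [x, y] d p}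
    (h : IsBinaryGen γ) : Built γ := by
  have := Built.bin (l' := [x, y]) (r := p) rfl (by norm_num) h (.one x) (.one y)
  rwa [(scDual k).bin_one_left _ _ (add_zero p), (scDual k).comp_one] at this

lemma IsBinaryGen.diff_built {x y d : Color} {p q : ℤ} (hq : q + 1 = p)
    {γ : (scDual k).obj [x, y] d p} (h : IsBinaryGen γ) : Built ((scDual k).diff hq γ) := by
  cases h with
  | l2 =>
    obtain rfl : q = -1 := by omega
    rw [(scDualGens k).diff_l2]
    exact .zero
  | c2 =>
    obtain rfl : q = -2 := by omega
    rw [(scDualGens k).diff_c2]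
    exact .zero
  | n02 =>
    obtain rfl : q = -1 := by omega
    rw [(scDualGens k).diff_n02]
    exact .zero
  | n11 =>
    obtain rfl : q = -1 := by omega
    rw [(scDualGens k).diff_n11]
    exact (IsBinaryGen.n02.built.comp _ _ _ _ _ .n10).sub
      ((IsBinaryGen.n02.built.comp _ _ _ _ _ .n10).act _ _)

lemma Built.diff (hf : Built f) :
    ∀ {q : ℤ} (hq : q + 1 = p), Built ((scDual k).diff hq f) := by
  induction hf with
  | zero =>
    intros
    rw [map_zero]
    exact .zero
  | add _ _ ih ih' =>
    intro q hq
    rw [map_add]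
    exact (ih hq).add (ih' hq)
  | smul a _ ih =>
    intro q hq
    rw [map_smul]
    exact (ih hq).smul a
  | one y =>
    intro q hq
    rw [(scDual k).diff_one]
    exact .zero
  | act e he _ ih =>
    intro q hq
    rw [(scDual k).diff_act]
    exact (ih hq).act e he
  | un hr0 hf ih =>
    intro q hq
    rw [(scDual k).diff_comp (p' := -2) [] [] _ _ hr0 (by norm_num) (sub_add_cancel _ 1) hq
      (by omega) (by omega), (scDualGens k).diff_n10, map_zero, LinearMap.zero_apply, zero_add]
    exact ((ih _).un _).units _
  | bin hl' hr0 hγ hf1 hf2 ih1 ih2 =>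
    intro q hq
    rw [DGOperad.bin, (scDual k).diff_comp _ _ _ _ hr0 (sub_add_cancel _ 1) (sub_add_cancel _ 1) hq
      (by omega) (by omega), (scDual k).diff_comp _ _ _ _ _ (sub_add_cancel _ 1)
      (sub_add_cancel _ 1) (sub_add_cancel _ 1) (by omega) (by omega)]
    refine Built.add (Built.comp (Built.add ?_ ?_) _ _ _ _ _ hf2) (Built.units ?_ _)
    · exact (hγ.diff_built _).comp _ _ _ _ _ hf1
    · exact (hγ.built.comp _ _ _ _ _ (ih1 _)).units _
    · exact (hγ.built.comp _ _ _ _ _ hf1).comp _ _ _ _ _ (ih2 _)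

lemma built_mk (t : ScTerm k l d p) :
    Built (k := k) (Quotient.mk (ScTerm.setoid k l d p) t) := by
  induction t with
  | l2 => exact IsBinaryGen.l2.built
  | c2 => exact IsBinaryGen.c2.built
  | n02 => exact IsBinaryGen.n02.built
  | n11 => exact IsBinaryGen.n11.built
  | n10 => exact .n10
  | zero => exact .zero
  | add f g ihf ihg => exact ihf.add ihg
  | smul a f ih => exact ih.smul a
  | diff h f ih => exact ih.diff h
  | one x => exact .one x
  | act e he f ih => exact ih.act e he
  | comp l₁ l₂ hl hl' hr f g ihf ihg => exact ihf.comp l₁ l₂ hl hl' hr ihg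

lemma built (f : (scDual k).obj l d p) : Built f := by
  induction f using Quotient.ind
  exact built_mk _

/-- The suboperad generated by `l2`, `c2`, `n02`, `n10`. -/
inductive Gen : ∀ {l : List Color} {d : Color} {p : ℤ}, (scDual k).obj l d p → Prop
  | l2 : Gen (scDualGens k).l2
  | c2 : Gen (scDualGens k).c2
  | n02 : Gen (scDualGens k).n02
  | n10 : Gen (scDualGens k).n10
  | zero {l : List Color} {d : Color} {p : ℤ} : Gen (0 : (scDual k).obj l d p)
  | add {l : List Color} {d : Color} {p : ℤ} {f g : (scDual k).obj l d p} :
      Gen f → Gen g → Gen (f + g)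
  | smul {l : List Color} {d : Color} {p : ℤ} (a : k) {f : (scDual k).obj l d p} :
      Gen f → Gen (a • f)
  | one (x : Color) : Gen ((scDual k).one x)
  | act {l l' : List Color} {d : Color} {p : ℤ} (e : Fin l'.length ≃ Fin l.length)
      (he : ∀ i, l'.get i = l.get (e i)) {f : (scDual k).obj l d p} :
      Gen f → Gen ((scDual k).act e he f)
  | comp {l b l' : List Color} {x d : Color} {p q r : ℤ} (l₁ l₂ : List Color)
      (hl : l = l₁ ++ x :: l₂) (hl' : l' = l₁ ++ b ++ l₂) (hr : p + q = r)
      {f : (scDual k).obj l d p} {g : (scDual k).obj b x q} :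
      Gen f → Gen g → Gen ((scDual k).comp l₁ l₂ hl hl' hr f g)

lemma Gen.bin {b1 b2 l' : List Color} {x y d : Color} {p p1 p2 r : ℤ} (hl' : l' = b1 ++ b2)
      (hr : p + p1 + p2 = r) {γ : (scDual k).obj [x, y] d p} {f1 : (scDual k).obj b1 x p1}
      {f2 : (scDual k).obj b2 y p2} (h : Gen γ) (h1 : Gen f1) (h2 : Gen f2) :
      Gen ((scDual k).bin hl' hr γ f1 f2) :=
  (h.comp _ _ _ _ _ h1).comp _ _ _ _ _ h2

lemma Gen.diff (hf : Gen f) :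
    ∀ {q : ℤ} (hq : q + 1 = p), (scDual k).diff hq f = 0 := by
  induction hf with
  | l2 =>
    intro q hq
    obtain rfl : q = -1 := by omega
    exact (scDualGens k).diff_l2
  | c2 =>
    intro q hq
    obtain rfl : q = -2 := by omega
    exact (scDualGens k).diff_c2
  | n02 =>
    intro q hq
    obtain rfl : q = -1 := by omega
    exact (scDualGens k).diff_n02
  | n10 =>
    intro q hq
    obtain rfl : q = -2 := by omega
    exact (scDualGens k).diff_n10
  | zero => intros; exact map_zero _
  | add _ _ ih ih' => intro q hq; rw [map_add, ih, ih', add_zero]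
  | smul a _ ih => intro q hq; rw [map_smul, ih, smul_zero]
  | one x => intro q hq; exact (scDual k).diff_one _
  | act e he _ ih => intro q hq; rw [(scDual k).diff_act, ih, map_zero]
  | comp l₁ l₂ hl hl' hr _ _ ih ih' =>
    intro q hq
    rw [(scDual k).diff_comp _ _ _ _ hr (sub_add_cancel _ 1) (sub_add_cancel _ 1) hq
      (by omega) (by omega), ih, ih']
    simp

lemma Built.gen_of_closed
    (hf : Built f) : d = cl → Gen f ∧ (op ∈ l → f = 0) := by
  induction hf with
  | zero => exact fun _ => ⟨.zero, fun _ => rfl⟩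
  | add _ _ ih ih' =>
    intro h
    refine ⟨(ih h).1.add (ih' h).1, fun hl => ?_⟩
    rw [(ih h).2 hl, (ih' h).2 hl, add_zero]
  | smul a _ ih =>
    intro h
    refine ⟨(ih h).1.smul a, fun hl => ?_⟩
    rw [(ih h).2 hl, smul_zero]
  | one x =>
    rintro rfl
    exact ⟨.one _, fun h => by simp at h⟩
  | @act l l' d p e he f _ ih =>
    intro h
    refine ⟨(ih h).1.act e he, fun hl => ?_⟩
    obtain ⟨i, hi⟩ := List.get_of_mem hl
    rw [(ih h).2 (by rw [← hi, he]; exact List.get_mem _ _), map_zero]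
  | un => intro h; cases h
  | bin hl' hr hγ _ _ ih1 ih2 =>
    rintro rfl
    have key : ∀ {b1 b2 l' : List Color} {p p1 p2 r : ℤ} (hl' : l' = b1 ++ b2)
        (hr : p + p1 + p2 = r) {γ : (scDual k).obj [cl, cl] cl p} {f1 : (scDual k).obj b1 cl p1}
        {f2 : (scDual k).obj b2 cl p2}, Gen γ → (Gen f1 ∧ (op ∈ b1 → f1 = 0)) →
        (Gen f2 ∧ (op ∈ b2 → f2 = 0)) →
        Gen ((scDual k).bin hl' hr γ f1 f2) ∧ (op ∈ l' → (scDual k).bin hl' hr γ f1 f2 = 0) := by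
      intro b1 b2 l' p p1 p2 r hl' hr γ f1 f2 hγ h1 h2
      refine ⟨.bin _ _ hγ h1.1 h2.1, fun h => ?_⟩
      rw [hl', List.mem_append] at h
      rcases h with h | h
      · rw [h1.2 h, DGOperad.bin_zero_left]
      · rw [h2.2 h, DGOperad.bin_zero_right]
    cases hγ with
    | l2 => exact key hl' hr .l2 (ih1 rfl) (ih2 rfl)
    | c2 => exact key hl' hr .c2 (ih1 rfl) (ih2 rfl)

lemma gen_of_closed {l : List Color} {p : ℤ} (f : (scDual k).obj l cl p) : Gen f :=
  ((built f).gen_of_closed rfl).1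

/-- The input colours of the operation of a block: `n` closed inputs and a last input of colour
`c`. -/
def blockCols : ℕ → Color → List Color
  | 0, c => [c]
  | n + 1, c => cl :: blockCols n c

/-- The degree of the operation of a block. -/
def endDeg : Color → ℤ
  | cl => -1
  | op => 0

variable (k) in
/-- The operation `n11 (id ⊗ n11 (id ⊗ ⋯))` of a block, with innermost operation `n10` or the
identity. -/
def blockOp : (n : ℕ) → (c : Color) → (scDual k).obj (blockCols n c) op (endDeg c)
  | 0, cl => opN10
  | 0, op => (scDual k).one op
  | n + 1, c => (scDual k).comp [cl] [] rfl (by simp [blockCols]) (zero_add _) opN11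
      (blockOp n c)

/-- The input colours of a product of blocks. -/
def wordCols : ℕ × Color → List (ℕ × Color) → List Color
  | b, [] => blockCols b.1 b.2
  | b, c :: w => blockCols b.1 b.2 ++ wordCols c w

/-- The degree of a product of blocks. -/
def wordDeg : ℕ × Color → List (ℕ × Color) → ℤ
  | b, [] => endDeg b.2
  | b, c :: w => 0 + endDeg b.2 + wordDeg c w

variable (k) in
/-- The product of the operations of a list of blocks. -/
def wordOp : (b : ℕ × Color) → (w : List (ℕ × Color)) → (scDual k).obj (wordCols b w) op (wordDeg b w)
  | b, [] => blockOp k b.1 b.2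
  | b, c :: w => (scDual k).bin rfl rfl opN02 (blockOp k b.1 b.2) (wordOp c w)

/-- Linear combinations of products of blocks with permuted inputs. -/
inductive WordSpan : ∀ {l : List Color} {d : Color} {p : ℤ}, (scDual k).obj l d p → Prop
  | zero {l : List Color} {d : Color} {p : ℤ} : WordSpan (0 : (scDual k).obj l d p)
  | add {l : List Color} {d : Color} {p : ℤ} {f g : (scDual k).obj l d p} :
      WordSpan f → WordSpan g → WordSpan (f + g)
  | smul {l : List Color} {d : Color} {p : ℤ} (a : k) {f : (scDual k).obj l d p} :
      WordSpan f → WordSpan (a • f)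
  | word {l : List Color} (b : ℕ × Color) (w : List (ℕ × Color))
      (e : Fin l.length ≃ Fin (wordCols b w).length) (he : ∀ i, l.get i = (wordCols b w).get (e i)) :
      WordSpan ((scDual k).act e he (wordOp k b w))

lemma WordSpan.units (h : WordSpan f) (s : ℤˣ) : WordSpan (s • f) := by
  rcases Int.units_eq_one_or s with rfl | rfl
  · rwa [one_smul]
  · rw [Units.neg_smul, one_smul, ← neg_one_smul k]
    exact h.smul _

lemma WordSpan.sub (h : WordSpan f) (h' : WordSpan g) : WordSpan (f - g) := by
  rw [sub_eq_add_neg, ← neg_one_smul k]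
  exact h.add (h'.smul _)

lemma WordSpan.act (h : WordSpan f) (e : Fin l'.length ≃ Fin l.length) (he : ∀ i, l'.get i = l.get (e i)) :
    WordSpan ((scDual k).act e he f) := by
  induction h with
  | zero => rw [map_zero]; exact .zero
  | add _ _ ih ih' => rw [map_add]; exact ih.add ih'
  | smul a _ ih => rw [map_smul]; exact ih.smul a
  | word b w e0 he0 =>
    rw [(scDual k).act_act]
    exact .word b w _ _

lemma WordSpan.of_wordOp (b : ℕ × Color) (w : List (ℕ × Color)) : WordSpan (wordOp k b w) := by
  have := WordSpan.word (k := k) b w (Equiv.refl _) (fun _ => rfl)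
  rwa [(scDual k).act_refl] at this

lemma WordSpan.of_eq (h : WordSpan f) (hf : f = g) : WordSpan g := hf ▸ h

lemma WordSpan.block_bin (h : WordSpan f) : ∀ (b : ℕ × Color) (hl' : l' = blockCols b.1 b.2 ++ l)
    (hr : 0 + endDeg b.2 + p = r) (hd : d = op), WordSpan ((scDual k).bin hl' hr
      opN02 (blockOp k b.1 b.2) (hd ▸ f)) := by
  induction h generalizing l' r with
  | zero =>
    intro b hl' hr hd
    subst hd
    rw [DGOperad.bin_zero_right]
    exact .zero
  | add _ _ ih ih' =>
    intro b hl' hr hd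
    subst hd
    rw [DGOperad.bin_add_right]
    exact (ih b hl' hr rfl).add (ih' b hl' hr rfl)
  | smul a _ ih =>
    intro b hl' hr hd
    subst hd
    rw [DGOperad.bin_smul_right]
    exact (ih b hl' hr rfl).smul a
  | word c w e0 he0 =>
    intro b hl' hr hd
    obtain ⟨s, hs, H⟩ := (scDual k).bin_act_right (hl := rfl) hl' hr opN02
      (blockOp k b.1 b.2) (wordOp k c w) e0 he0
    subst hr
    exact of_eq (WordSpan.act (WordSpan.of_wordOp b (c :: w)) s hs) H.symm

lemma DGOperad.bin_n02_assoc {b1 b2 b3 c c' l' : List Color} {p1 p2 p3 t u u' : ℤ}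
    (f1 : (scDual k).obj b1 op p1) (f2 : (scDual k).obj b2 op p2)
    (f3 : (scDual k).obj b3 op p3) (hc : c = b1 ++ b2) (hl' : l' = c ++ b3) (hc' : c' = b2 ++ b3)
    (hl'' : l' = b1 ++ c') (h1 : 0 + p1 + p2 = u) (h2 : 0 + u + p3 = t) (h3 : 0 + p2 + p3 = u')
    (h4 : 0 + p1 + u' = t) :
    ∃ ε : ℤˣ, (scDual k).bin hl' h2 opN02
      ((scDual k).bin hc h1 opN02 f1 f2) f3 = ε • (scDual k).bin hl'' h4
        opN02 f1 ((scDual k).bin hc' h3 opN02 f2 f3) := by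
  have e1 := (scDual k).tri_comp_left opN02 opN02 f1 f2 f3 (l' := l')
    (by rw [hl', hc]) hc hl' (add_zero 0) (t := t) (by omega) h1 h2
  obtain ⟨ε, e2⟩ := (scDual k).tri_comp_right opN02 opN02 f1 f2 f3
    (l' := l') (by rw [hl', hc]) hc' hl'' (add_zero 0) (t := t) (by omega)
    h3 h4
  refine ⟨ε, ?_⟩
  rw [← e1, ← e2, (scDualGens k).n02_assoc]

lemma WordSpan.wordOp_bin (b : ℕ × Color) (w : List (ℕ × Color)) : ∀ {l l' : List Color} {p r : ℤ}
    {f : (scDual k).obj l op p} (_ : WordSpan f) (hl' : l' = wordCols b w ++ l)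
    (hr : 0 + wordDeg b w + p = r), WordSpan ((scDual k).bin hl' hr
      opN02 (wordOp k b w) f) := by
  induction w generalizing b with
  | nil =>
    intro l l' p r f h hl' hr
    exact h.block_bin b hl' hr rfl
  | cons c w ih =>
    intro l l' p r f h hl' hr
    have hr' : 0 + endDeg b.2 + wordDeg c w + p = r := by rw [← hr]; simp [wordDeg]
    obtain ⟨ε, H⟩ := DGOperad.bin_n02_assoc (blockOp k b.1 b.2) (wordOp k c w) f
      rfl hl' rfl (by simp [hl', wordCols]) rfl hr rfl (by omega)
    refine of_eq (((ih c h rfl rfl).block_bin b _ _ rfl).units ε) H.symm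

lemma WordSpan.bin_n02 {b1 b2 l' : List Color} {d : Color} {p1 p2 r : ℤ}
    {f1 : (scDual k).obj b1 d p1} {f2 : (scDual k).obj b2 op p2} (h1 : WordSpan f1)
    (h2 : WordSpan f2) : ∀ (hl' : l' = b1 ++ b2) (hr : 0 + p1 + p2 = r) (hd : d = op),
    WordSpan ((scDual k).bin hl' hr opN02 (hd ▸ f1) f2) := by
  induction h1 generalizing l' r with
  | zero =>
    intro hl' hr hd
    subst hd
    rw [DGOperad.bin_zero_left]
    exact .zero
  | add _ _ ih ih' =>
    intro hl' hr hd
    subst hd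
    rw [DGOperad.bin_add_left]
    exact (ih hl' hr rfl).add (ih' hl' hr rfl)
  | smul a _ ih =>
    intro hl' hr hd
    subst hd
    rw [DGOperad.bin_smul_left]
    exact (ih hl' hr rfl).smul a
  | word c w e0 he0 =>
    intro hl' hr hd
    obtain ⟨s, hs, H⟩ := (scDual k).bin_act_left (hl := rfl) hl' hr opN02
      (wordOp k c w) f2 e0 he0
    exact of_eq (WordSpan.act (WordSpan.wordOp_bin c w h2 rfl hr) s hs) H.symm

section

variable (P : DGOperad k) {b1 b2 b3 l' : List Color} {x y z d : Color} {p p1 p2 p3 r : ℤ}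
  (hl' : l' = b1 ++ b2 ++ b3) (hr : p + p1 + p2 + p3 = r) (τ τ' : P.obj [x, y, z] d p)
  (f1 : P.obj b1 x p1) (f2 : P.obj b2 y p2) (f3 : P.obj b3 z p3)

lemma DGOperad.tri_sub :
    P.tri hl' hr (τ - τ') f1 f2 f3 = P.tri hl' hr τ f1 f2 f3 - P.tri hl' hr τ' f1 f2 f3 := by
  simp [tri]

lemma DGOperad.tri_add :
    P.tri hl' hr (τ + τ') f1 f2 f3 = P.tri hl' hr τ f1 f2 f3 + P.tri hl' hr τ' f1 f2 f3 := by
  simp [tri]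

lemma DGOperad.tri_zero : P.tri hl' hr (0 : P.obj [x, y, z] d p) f1 f2 f3 = 0 := by simp [tri]

end

lemma WordSpan.n11_one_wordOp (b : ℕ × Color) (w : List (ℕ × Color)) : ∀ {l' : List Color} {r : ℤ}
    (hl' : l' = [cl] ++ wordCols b w) (hr : 0 + 0 + wordDeg b w = r),
    WordSpan ((scDual k).bin hl' hr opN11 ((scDual k).one cl)
      (wordOp k b w)) := by
  have block : ∀ (b : ℕ × Color) (h : endDeg b.2 = endDeg b.2), (scDual k).bin
      (l' := [cl] ++ blockCols b.1 b.2) rfl (by omega : 0 + 0 + endDeg b.2 = endDeg b.2)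
      opN11 ((scDual k).one cl) (blockOp k b.1 b.2) = blockOp k (b.1 + 1) b.2 := by
    intro b h
    rw [(scDual k).bin_one_left _ _ (zero_add _)]
    rfl
  induction w generalizing b with
  | nil =>
    intro l' r hl' hr
    obtain rfl : endDeg b.2 = r := by rw [← hr]; simp [wordDeg]
    subst hl'
    refine of_eq (WordSpan.of_wordOp (b.1 + 1, b.2) []) (block b rfl).symm
  | cons c w ih =>
    intro l' r hl' hr
    have hr' : 0 + endDeg b.2 + wordDeg c w = r := by rw [← hr]; simp [wordDeg]
    have hl1 : l' = [cl] ++ blockCols b.1 b.2 ++ wordCols c w := by simp [hl', wordCols]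
    obtain ⟨ε1, e1⟩ := (scDual k).tri_comp_right opN11 opN02
      ((scDual k).one cl) (blockOp k b.1 b.2) (wordOp k c w) hl1 rfl hl'
      (add_zero 0) (t := r) (by omega) rfl hr
    have e2 := (scDual k).tri_comp_left opN02 opN11
      ((scDual k).one cl) (blockOp k b.1 b.2) (wordOp k c w) hl1 rfl hl1
      (add_zero 0) (t := r) (u := endDeg b.2) (by omega) (by omega) hr'
    obtain ⟨ε3, s, hs, e3⟩ := (scDual k).tri_act (l := blockCols b.1 b.2 ++ [cl] ++ wordCols c w)
      (x := cl) (y := op) (z := op)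
      (Equiv.swap (0 : Fin 3) 1) (by decide)
      (by decide) (by decide) (by decide) ((scDual k).comp (l' := [op, cl, op]) (r := 0) [op] []
        rfl rfl rfl opN02 opN11) ((scDual k).one cl)
      (blockOp k b.1 b.2) (wordOp k c w) hl1 rfl (r := r) (by omega) (by omega)
    obtain ⟨ε4, e4⟩ := (scDual k).tri_comp_right opN02 opN11
      (blockOp k b.1 b.2) ((scDual k).one cl) (wordOp k c w)
      (l' := blockCols b.1 b.2 ++ [cl] ++ wordCols c w) (c := [cl] ++ wordCols c w) rfl rfl
      (by simp)
      (add_zero 0) (t := r) (u := wordDeg c w) (by omega) (by omega) hr'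
    have e5 : ∀ (hl : l' = [cl] ++ blockCols b.1 b.2 ++ wordCols c w) (h : 0 + 0 + endDeg b.2 + wordDeg c w = r),
        WordSpan ((scDual k).tri (r := r) hl (by omega) ((scDual k).comp (l' := [cl, op, op]) (r := 0) [cl] []
          rfl rfl rfl opN11 opN02) ((scDual k).one cl)
          (blockOp k b.1 b.2) (wordOp k c w)) := by
      intro hl h
      rw [(scDualGens k).n11_n02]
      rw [DGOperad.tri_add, e3, e2, e4]
      refine WordSpan.add ?_ (((WordSpan.units ?_ _).act _ _).units _)
      · have := block b rfl
        rw [this]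
        exact (WordSpan.of_wordOp c w).block_bin (b.1 + 1, b.2) _ _ rfl
      · exact (ih c _ _).block_bin b _ _ rfl
    have := e5 hl1 (by omega)
    rw [e1] at this
    have h2 := this.units ε1
    rw [smul_smul, Int.units_mul_self, one_smul] at h2
    exact h2

lemma WordSpan.n11_one (h : WordSpan f) : ∀ (hl' : l' = [cl] ++ l) (hr : 0 + 0 + p = r) (hd : d = op),
    WordSpan ((scDual k).bin hl' hr opN11 ((scDual k).one cl) (hd ▸ f)) := by
  induction h generalizing l' r with
  | zero =>
    intro hl' hr hd
    subst hd
    rw [DGOperad.bin_zero_right]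
    exact .zero
  | add _ _ ih ih' =>
    intro hl' hr hd
    subst hd
    rw [DGOperad.bin_add_right]
    exact (ih hl' hr rfl).add (ih' hl' hr rfl)
  | smul a _ ih =>
    intro hl' hr hd
    subst hd
    rw [DGOperad.bin_smul_right]
    exact (ih hl' hr rfl).smul a
  | word c w e0 he0 =>
    intro hl' hr hd
    obtain ⟨s, hs, H⟩ := (scDual k).bin_act_right (hl := rfl) hl' hr opN11
      ((scDual k).one cl) (wordOp k c w) e0 he0
    exact of_eq (WordSpan.act (WordSpan.n11_one_wordOp c w rfl hr) s hs) H.symm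

lemma Built.n11_wordSpan {b1 : List Color} {d : Color} {p1 : ℤ} {x : (scDual k).obj b1 d p1}
    (hx : Built x) : ∀ {b2 l' : List Color} {p2 r : ℤ} {f : (scDual k).obj b2 op p2} (_ : WordSpan f)
    (hl' : l' = b1 ++ b2) (hr : 0 + p1 + p2 = r) (hd : d = cl),
    WordSpan ((scDual k).bin hl' hr opN11 (hd ▸ x) f) := by
  induction hx with
  | zero =>
    intro b2 l' p2 r f hf hl' hr hd
    subst hd
    rw [DGOperad.bin_zero_left]
    exact .zero
  | add _ _ ih ih' =>
    intro b2 l' p2 r f hf hl' hr hd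
    subst hd
    rw [DGOperad.bin_add_left]
    exact (ih hf hl' hr rfl).add (ih' hf hl' hr rfl)
  | smul a _ ih =>
    intro b2 l' p2 r f hf hl' hr hd
    subst hd
    rw [DGOperad.bin_smul_left]
    exact (ih hf hl' hr rfl).smul a
  | one y =>
    intro b2 l' p2 r f hf hl' hr hd
    subst hd
    exact hf.n11_one hl' hr rfl
  | @act l l₁ d p e he x _ ih =>
    intro b2 l' p2 r f hf hl' hr hd
    subst hd
    obtain ⟨s, hs, H⟩ := (scDual k).bin_act_left (hl := rfl) hl' hr opN11 x f e he
    refine WordSpan.of_eq ((ih hf rfl hr rfl).act s hs) H.symm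
  | un => intro _ _ _ _ _ _ _ _ hd; cases hd
  | @bin c1 c₂ c y1 y2 d p q1 q2 q hc hq γ x1 x2 hγ _ _ ih1 ih2 =>
    intro b2 l' p2 r f hf hl' hr hd
    subst hd
    cases hγ with
    | l2 =>
      have hl1 : l' = c1 ++ c₂ ++ b2 := by rw [hl', hc]
      have e1 := (scDual k).tri_comp_left opN11 opL2 x1 x2 f hl1 hc hl'
        (add_zero 0) (t := r) (by omega) hq hr
      obtain ⟨ε2, e2⟩ := (scDual k).tri_comp_right opN11 opN11 x1 x2 f
        (c := c₂ ++ b2) hl1 rfl (by simp [hl1])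
        (add_zero 0) (t := r) (by omega) rfl (by omega)
      obtain ⟨ε3, s, hs, e3⟩ := (scDual k).tri_act (l := c₂ ++ c1 ++ b2)
        (Equiv.swap (0 : Fin 3) 1) (by decide)
        (by decide) (by decide) (by decide) ((scDual k).comp (l' := [cl, cl, op]) (r := 0) [cl] []
          rfl rfl rfl opN11 opN11) x1 x2 f hl1 rfl (r := r)
        (by omega) (by omega)
      obtain ⟨ε4, e4⟩ := (scDual k).tri_comp_right opN11 opN11 x2 x1 f
        (l' := c₂ ++ c1 ++ b2) (c := c1 ++ b2) rfl rfl (by simp)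
        (add_zero 0) (t := r) (by omega) rfl (by omega)
      refine WordSpan.of_eq (f := (scDual k).bin hl' hr opN11
        ((scDual k).bin hc hq opL2 x1 x2) f) ?_ rfl
      rw [← e1, (scDualGens k).n11_l2, DGOperad.tri_sub, e3, e2, e4]
      refine WordSpan.sub (WordSpan.units ?_ _) (((WordSpan.units ?_ _).act _ _).units _)
      · exact ih1 (ih2 hf _ _ rfl) _ _ rfl
      · exact ih2 (ih1 hf _ _ rfl) _ _ rfl
    | c2 =>
      have hl1 : l' = c1 ++ c₂ ++ b2 := by rw [hl', hc]
      have e1 := (scDual k).tri_comp_left opN11 opC2 x1 x2 f hl1 hc hl'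
        (zero_add (-1)) (t := r) (by omega) hq hr
      refine WordSpan.of_eq (f := (scDual k).bin hl' hr opN11
        ((scDual k).bin hc hq opC2 x1 x2) f) ?_ rfl
      rw [← e1, (scDualGens k).n11_c2, DGOperad.tri_zero]
      exact .zero

lemma Built.n10_wordSpan {b : List Color} {d : Color} {p : ℤ} {x : (scDual k).obj b d p}
    (hx : Built x) : ∀ {r : ℤ} (hr : -1 + p = r) (hd : d = cl),
    WordSpan ((scDual k).comp (l' := b) [] [] rfl (by simp) hr opN10
      (hd ▸ x : (scDual k).obj b cl p)) := by
  induction hx with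
  | zero =>
    intro r hr hd
    subst hd
    rw [map_zero]
    exact .zero
  | add _ _ ih ih' =>
    intro r hr hd
    subst hd
    rw [map_add]
    exact (ih hr rfl).add (ih' hr rfl)
  | smul a _ ih =>
    intro r hr hd
    subst hd
    rw [map_smul]
    exact (ih hr rfl).smul a
  | one y =>
    intro r hr hd
    subst hd
    obtain rfl : r = -1 := by omega
    refine WordSpan.of_eq (WordSpan.of_wordOp (0, cl) []) ?_
    exact ((scDual k).comp_one [] [] rfl rfl _ opN10).symm
  | @act l l₁ d p e he x _ ih =>
    intro r hr hd
    subst hd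
    obtain ⟨s, hs, -, H⟩ := (scDual k).exists_comp_act_right (d := op) (l := [cl]) (lb := l)
      (mc := l₁) [] [] rfl (by simp) (by simp) hr e he
    refine WordSpan.of_eq ((ih hr rfl).act s hs) ?_
    exact (H _ _).symm
  | un => intro _ _ hd; cases hd
  | @bin c1 c₂ c y1 y2 d p q1 q2 q hc hq γ x1 x2 hγ h1 h2 ih1 ih2 =>
    intro r hr hd
    subst hd
    cases hγ with
    | l2 =>
      have e1 := (scDual k).bin_comp_un opN10 opL2 x1 x2 hc
        (add_zero (-1)) (t := r) (by omega) hq hr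
      obtain ⟨ε2, e2⟩ := (scDual k).bin_comp_right_un opN11 opN10 x1 x2
        hc (zero_add (-1)) (t := r) (by omega) rfl (by omega)
      obtain ⟨ε3, s, hs, e3⟩ := (scDual k).bin_act (l := c₂ ++ c1)
        (Equiv.swap (0 : Fin 2) 1) (by decide)
        (by decide) (by decide) ((scDual k).comp (l' := [cl, cl]) (r := -1) [cl] []
          rfl rfl rfl opN11 opN10) x1 x2 hc rfl (r := r)
        (by omega) (by omega)
      obtain ⟨ε4, e4⟩ := (scDual k).bin_comp_right_un opN11 opN10 x2 x1
        (l' := c₂ ++ c1) rfl (zero_add (-1)) (t := r) (by omega) rfl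
        (by omega)
      refine WordSpan.of_eq (f := (scDual k).comp (l' := c) [] [] rfl (by simp) hr
        opN10 ((scDual k).bin hc hq opL2 x1 x2)) ?_ rfl
      rw [← e1, (scDualGens k).n10_l2, DGOperad.bin_gen_sub, e3, e2, e4]
      refine WordSpan.sub (WordSpan.units ?_ _) (((WordSpan.units ?_ _).act _ _).units _)
      · exact h1.n11_wordSpan (ih2 _ rfl) _ _ rfl
      · exact h2.n11_wordSpan (ih1 _ rfl) _ _ rfl
    | c2 =>
      have e1 := (scDual k).bin_comp_un opN10 opC2 x1 x2 hc
        (show (-1 : ℤ) + -1 = -2 by norm_num) (t := r) (by omega) hq hr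
      refine WordSpan.of_eq (f := (scDual k).comp (l' := c) [] [] rfl (by simp) hr
        opN10 ((scDual k).bin hc hq opC2 x1 x2)) ?_ rfl
      rw [← e1, (scDualGens k).n10_c2, DGOperad.bin_gen_zero]
      exact .zero

lemma Built.wordSpan
    (hf : Built f) : d = op → WordSpan f := by
  induction hf with
  | zero => exact fun _ => .zero
  | add _ _ ih ih' => exact fun h => (ih h).add (ih' h)
  | smul a _ ih => exact fun h => (ih h).smul a
  | one x =>
    rintro rfl
    exact WordSpan.of_wordOp (0, op) []
  | act e he _ ih => exact fun h => (ih h).act e he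
  | un hr hf _ => exact fun _ => hf.n10_wordSpan hr rfl
  | bin hl' hr hγ h1 h2 ih1 ih2 =>
    rintro rfl
    cases hγ with
    | n02 => exact (ih1 rfl).bin_n02 (ih2 rfl) hl' hr rfl
    | n11 => exact h1.n11_wordSpan (ih2 rfl) hl' hr rfl

/-- Operations with open output are linear combinations of products of blocks. -/
lemma wordSpan {l : List Color} {p : ℤ} (f : (scDual k).obj l op p) : WordSpan f :=
  (built f).wordSpan rfl

end Spanning

section FreeModel

/-- A block `x1 ⋯ xₙ t`: closed letters `xᵢ` followed by a closed (`inl`) or open (`inr`) letter. -/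
abbrev Block : Type := List ℕ × (ℕ ⊕ ℕ)

/-- Put a closed letter in front of a block. -/
def Block.cons (x : ℕ) (b : Block) : Block := (x :: b.1, b.2)

/-- The block of a single letter. -/
def Block.letter (t : ℕ ⊕ ℕ) : Block := ([], t)

lemma Block.rec_cons {P : Block → Prop} (letter : ∀ t, P (Block.letter t))
    (cons : ∀ x b, P b → P (Block.cons x b)) (b : Block) : P b := by
  obtain ⟨a, t⟩ := b
  induction a with
  | nil => exact letter t
  | cons x a ih => exact cons x (a, t) ih

/-- The degree of a block. -/
def Block.deg (b : Block) : ℤ := b.2.elim (fun _ => -1) (fun _ => 0)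

@[simp] lemma Block.deg_cons (x : ℕ) (b : Block) : (Block.cons x b).deg = b.deg := rfl
@[simp] lemma Block.deg_inl (x : ℕ) : (Block.letter (.inl x)).deg = -1 := rfl
@[simp] lemma Block.deg_inr (x : ℕ) : (Block.letter (.inr x)).deg = 0 := rfl

/-- The degree of a word. -/
def wdeg (W : List Block) : ℤ := (W.map Block.deg).sum

@[simp] lemma wdeg_nil : wdeg [] = 0 := rfl
@[simp] lemma wdeg_cons (b : Block) (W : List Block) : wdeg (b :: W) = b.deg + wdeg W := by
  simp [wdeg]
@[simp] lemma wdeg_append (W W' : List Block) : wdeg (W ++ W') = wdeg W + wdeg W' := by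
  simp [wdeg]

variable (k : Type u) [Field k]

/-- Linear combinations of words. -/
abbrev WordSpace : Type u := List Block →₀ k

/-- A word as a basis element. -/
def wd (W : List Block) : WordSpace k := Finsupp.single W 1

/-- The sign of degree `n`. -/
def sg (n : ℤ) : k := ((n.negOnePow : ℤ) : k)

variable {k}

lemma sg_add (m n : ℤ) : sg k (m + n) = sg k m * sg k n := by
  simp [sg, Int.negOnePow_add]

@[simp] lemma sg_zero : sg k 0 = 1 := by simp [sg]

@[simp] lemma sg_neg_one : sg k (-1) = -1 := by simp [sg]

lemma sg_mul_self (m : ℤ) : sg k m * sg k m = 1 := by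
  rw [← sg_add, sg, Int.negOnePow_even _ (by simp)]
  simp

lemma sg_smul {M : Type*} [AddCommGroup M] [Module k M] (n : ℤ) (x : M) :
    sg k n • x = n.negOnePow • x := by
  rw [sg, Units.smul_def, Int.cast_smul_eq_zsmul]

lemma ws_induction {P : WordSpace k → Prop} (u : WordSpace k) (zero : P 0)
    (add : ∀ u v, P u → P v → P (u + v)) (smul : ∀ (c : k) u, P u → P (c • u))
    (word : ∀ W, P (wd k W)) : P u := by
  induction u using Finsupp.induction_linear with
  | zero => exact zero
  | add u v hu hv => exact add u v hu hv
  | single W c =>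
    have := smul c _ (word W)
    rwa [wd, Finsupp.smul_single, smul_eq_mul, mul_one] at this

variable (k) in
/-- The linear map with given values on words. -/
def wlift {M : Type*} [AddCommGroup M] [Module k M] (f : List Block → M) :
    WordSpace k →ₗ[k] M :=
  Finsupp.linearCombination k f

@[simp] lemma wlift_wd {M : Type*} [AddCommGroup M] [Module k M] (f : List Block → M)
    (W : List Block) : wlift k f (wd k W) = f W := by
  simp [wlift, wd]

lemma ws_ext {M : Type*} [AddCommGroup M] [Module k M] {f g : WordSpace k →ₗ[k] M}
    (h : ∀ W, f (wd k W) = g (wd k W)) : f = g :=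
  Finsupp.lhom_ext' fun W => LinearMap.ext_ring (h W)

variable (k) in
/-- Concatenation. -/
def cat : WordSpace k →ₗ[k] WordSpace k →ₗ[k] WordSpace k :=
  wlift k fun W => wlift k fun W' => wd k (W ++ W')

@[simp] lemma cat_wd (W W' : List Block) : cat k (wd k W) (wd k W') = wd k (W ++ W') := by
  simp [cat]

lemma cat_assoc (u v w : WordSpace k) : cat k (cat k u v) w = cat k u (cat k v w) := by
  induction u using ws_induction with
  | zero => simp
  | add u u' h h' => simp [h, h']
  | smul c u h => simp [h]
  | word W =>
    induction v using ws_induction with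
    | zero => simp
    | add u u' h h' => simp [h, h']
    | smul c u h => simp [h]
    | word W' =>
      induction w using ws_induction with
      | zero => simp
      | add u u' h h' => simp only [map_add, h, h']
      | smul c u h => simp only [map_smul, h]
      | word W'' => simp

@[simp] lemma cat_nil_left (u : WordSpace k) : cat k (wd k []) u = u := by
  induction u using ws_induction with
  | zero => simp
  | add u u' h h' => simp [h, h']
  | smul c u h => simp [h]
  | word W => simp

@[simp] lemma cat_nil_right (u : WordSpace k) : cat k u (wd k []) = u := by
  induction u using ws_induction with
  | zero => simp
  | add u u' h h' => simp [h, h']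
  | smul c u h => simp [h]
  | word W => simp

variable (k) in
/-- The parity operator. -/
def par : WordSpace k →ₗ[k] WordSpace k := wlift k fun W => sg k (wdeg W) • wd k W

@[simp] lemma par_wd (W : List Block) : par k (wd k W) = sg k (wdeg W) • wd k W := by
  simp [par]

lemma par_par (u : WordSpace k) : par k (par k u) = u := by
  induction u using ws_induction with
  | zero => simp
  | add u u' h h' => simp [h, h']
  | smul c u h => simp [h]
  | word W => simp [smul_smul, sg_mul_self]

lemma par_cat (u v : WordSpace k) : par k (cat k u v) = cat k (par k u) (par k v) := by
  induction u using ws_induction with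
  | zero => simp
  | add u u' h h' => simp [h, h']
  | smul c u h => simp [h]
  | word W =>
    induction v using ws_induction with
    | zero => simp
    | add u u' h h' => simp [h, h']
    | smul c u h => simp [h]
    | word W' => simp [smul_smul, sg_add, mul_comm]

variable (k) in
/-- The derivation `D_x`, on a word. -/
def derWord (x : ℕ) : List Block → WordSpace k
  | [] => 0
  | b :: W => wd k (b.cons x :: W) + cat k (wd k [b]) (derWord x W)

variable (k) in
/-- The derivation `D_x`, which puts `x` in front of a block. -/
def der (x : ℕ) : WordSpace k →ₗ[k] WordSpace k := wlift k (derWord k x)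

lemma der_nil (x : ℕ) : der k x (wd k []) = 0 := by simp [der, derWord]

lemma der_cons (x : ℕ) (b : Block) (W : List Block) : der k x (wd k (b :: W)) =
    wd k (b.cons x :: W) + cat k (wd k [b]) (der k x (wd k W)) := by
  simp [der, derWord]

lemma der_block (x : ℕ) (b : Block) : der k x (wd k [b]) = wd k [b.cons x] := by
  simp [der_cons, der_nil]

/-- Even derivations. -/
def IsDer (D : WordSpace k →ₗ[k] WordSpace k) : Prop :=
  ∀ u v, D (cat k u v) = cat k (D u) v + cat k u (D v)

/-- Derivations of degree `-1`. -/
def IsOddDer (d : WordSpace k →ₗ[k] WordSpace k) : Prop :=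
  ∀ u v, d (cat k u v) = cat k (d u) v + cat k (par k u) (d v)

lemma wd_cons (b : Block) (W : List Block) : wd k (b :: W) = cat k (wd k [b]) (wd k W) := by
  simp

lemma isDer_der (x : ℕ) : IsDer (der k x) := by
  intro u v
  induction v using ws_induction with
  | zero => simp
  | add v v' h h' => simp only [map_add, h, h']; abel
  | smul c v h => simp [h]
  | word V =>
    induction u using ws_induction with
    | zero => simp
    | add u u' h h' => simp only [map_add, LinearMap.add_apply, h, h']; abel
    | smul c u h => simp [h]
    | word W =>
      induction W with
      | nil => simp [der_nil]
      | cons b W ih =>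
        rw [cat_wd] at ih ⊢
        rw [List.cons_append, der_cons, ih, der_cons, map_add, map_add, LinearMap.add_apply,
          ← cat_assoc, ← cat_assoc, add_assoc]
        simp

lemma IsDer.ext {D D' : WordSpace k →ₗ[k] WordSpace k} (h : IsDer D) (h' : IsDer D')
    (H : ∀ b, D (wd k [b]) = D' (wd k [b])) : D = D' := by
  have nil : ∀ {D : WordSpace k →ₗ[k] WordSpace k}, IsDer D → D (wd k []) = 0 := by
    intro D h
    have := h (wd k []) (wd k [])
    simpa using this
  refine ws_ext fun W => ?_
  induction W with
  | nil => rw [nil h, nil h']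
  | cons b W ih => rw [wd_cons, h, h', ih, H]

variable (k) in
/-- The differential of a block. -/
def dBlock : List ℕ → ℕ ⊕ ℕ → WordSpace k
  | [], _ => 0
  | x :: a, t => der k x (dBlock a t) + wd k [Block.letter (.inl x), (a, t)] -
      sg k (Block.deg (a, t)) • wd k [(a, t), Block.letter (.inl x)]

variable (k) in
/-- The differential of a word. -/
def dWord : List Block → WordSpace k
  | [] => 0
  | b :: W => cat k (dBlock k b.1 b.2) (wd k W) + sg k b.deg • cat k (wd k [b]) (dWord W)

variable (k) in
/-- The differential. -/
def dW : WordSpace k →ₗ[k] WordSpace k := wlift k (dWord k)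

lemma dW_nil : dW k (wd k []) = 0 := by simp [dW, dWord]

lemma dW_block (b : Block) : dW k (wd k [b]) = dBlock k b.1 b.2 := by simp [dW, dWord]

lemma dW_cons (b : Block) (W : List Block) : dW k (wd k (b :: W)) =
    cat k (dW k (wd k [b])) (wd k W) + sg k b.deg • cat k (wd k [b]) (dW k (wd k W)) := by
  rw [dW_block]
  simp [dW, dWord]

lemma dW_letter (t : ℕ ⊕ ℕ) : dW k (wd k [Block.letter t]) = 0 := by
  rw [dW_block]
  rfl

lemma isOddDer_dW : IsOddDer (dW k) := by
  intro u v
  induction v using ws_induction with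
  | zero => simp
  | add v v' h h' => simp only [map_add, h, h']; abel
  | smul c v h => simp [h]
  | word V =>
    induction u using ws_induction with
    | zero => simp
    | add u u' h h' => simp only [map_add, LinearMap.add_apply, h, h']; abel
    | smul c u h => simp [h]
    | word W =>
      induction W with
      | nil => simp [dW_nil]
      | cons b W ih =>
        rw [cat_wd] at ih ⊢
        rw [List.cons_append, dW_cons, ih, dW_cons b W, wd_cons b W, par_cat, par_wd [b]]
        simp only [map_add, LinearMap.add_apply, cat_assoc, map_smul, LinearMap.smul_apply,
          smul_add, wdeg_cons, wdeg_nil, add_zero, cat_wd W V]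
        abel

/-- The supercommutator with an odd element. -/
def ad (b : WordSpace k) : WordSpace k →ₗ[k] WordSpace k :=
  cat k b - (cat k).flip b ∘ₗ par k

lemma ad_apply (b u : WordSpace k) : ad b u = cat k b u - cat k (par k u) b := rfl

lemma dW_block_cons (x : ℕ) (b : Block) : dW k (wd k [b.cons x]) =
    der k x (dW k (wd k [b])) + ad (wd k [Block.letter (Sum.inl x)]) (wd k [b]) := by
  rw [dW_block, dW_block, ad_apply]
  simp only [Block.cons, dBlock, cat_wd, par_wd, map_smul, LinearMap.smul_apply]
  simp [add_sub_assoc, wdeg]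

lemma isDer_par {D : WordSpace k →ₗ[k] WordSpace k} (h : IsDer D) (b : WordSpace k)
    (hb : par k b = -b) (hD : ∀ u, par k (D u) = D (par k u))
    (H : ∀ c, dW k (D (wd k [c])) = D (dW k (wd k [c])) + ad b (wd k [c])) (u : WordSpace k) :
    dW k (D u) = D (dW k u) + ad b u := by
  have nil : D (wd k []) = 0 := by simpa using h (wd k []) (wd k [])
  induction u using ws_induction with
  | zero => simp
  | add u u' h h' => simp only [map_add, h, h']; abel
  | smul c u h => simp [h]
  | word W =>
    induction W with
    | nil => simp [nil, dW_nil, ad_apply]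
    | cons c W ih =>
      rw [wd_cons, h, map_add, isOddDer_dW, isOddDer_dW, ih, H, isOddDer_dW, map_add D, h, h,
        ad_apply, ad_apply, ad_apply, hD, par_cat]
      simp only [map_add, map_sub, LinearMap.add_apply, LinearMap.sub_apply, cat_assoc]
      abel

lemma par_der (x : ℕ) (u : WordSpace k) : par k (der k x u) = der k x (par k u) := by
  induction u using ws_induction with
  | zero => simp
  | add u u' h h' => simp only [map_add, h, h']
  | smul c u h => simp [h]
  | word W =>
    induction W with
    | nil => simp [der_nil]
    | cons b W ih =>
      rw [der_cons, map_add, par_cat, ih, par_wd, par_wd, par_wd, par_wd, map_smul, map_smul,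
        map_smul (der k x) _ (wd k (b :: W)), der_cons]
      simp only [map_smul, LinearMap.smul_apply, smul_smul, smul_add, wdeg_cons, wdeg_nil,
        Block.deg_cons, add_zero, sg_add, mul_comm]

lemma dW_der (x : ℕ) (u : WordSpace k) : dW k (der k x u) =
    der k x (dW k u) + ad (wd k [Block.letter (Sum.inl x)]) u := by
  refine isDer_par (isDer_der x) _ (by simp) (par_der x) (fun c => ?_) u
  rw [der_block, dW_block_cons]

lemma par_ad (b u : WordSpace k) (hb : par k b = -b) : par k (ad b u) = -ad b (par k u) := by
  rw [ad_apply, ad_apply, map_sub, par_cat, par_cat, hb]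
  simp only [map_neg, LinearMap.neg_apply]
  abel

lemma par_dW (u : WordSpace k) : par k (dW k u) = -dW k (par k u) := by
  have block : ∀ b : Block, par k (dW k (wd k [b])) = -dW k (par k (wd k [b])) := by
    intro b
    induction b using Block.rec_cons with
    | letter t => simp [dW_letter]
    | cons x b ih =>
      rw [dW_block_cons, map_add, par_der, ih, par_ad _ _ (by simp), par_wd, par_wd, map_smul,
        map_smul, map_smul, dW_block_cons]
      simp only [map_neg, map_smul, smul_add, neg_add, wdeg_cons, Block.deg_cons]
  induction u using ws_induction with
  | zero => simp
  | add u u' h h' => simp only [map_add, h, h', neg_add]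
  | smul c u h => simp [h]
  | word W =>
    induction W with
    | nil => simp [dW_nil]
    | cons b W ih =>
      rw [wd_cons, isOddDer_dW, par_cat, map_add, par_cat, par_cat, block, ih, isOddDer_dW]
      simp only [map_neg, LinearMap.neg_apply, neg_add]

lemma dW_dW (u : WordSpace k) : dW k (dW k u) = 0 := by
  have der : IsDer (dW k ∘ₗ dW k) := by
    intro u v
    simp only [LinearMap.comp_apply]
    rw [isOddDer_dW, map_add, isOddDer_dW, isOddDer_dW, par_par, par_dW]
    simp only [map_neg, LinearMap.neg_apply]
    abel
  have zero : IsDer (0 : WordSpace k →ₗ[k] WordSpace k) := fun u v => by simp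
  have := der.ext zero fun b => by
    induction b using Block.rec_cons with
    | letter t => simp [dW_letter]
    | cons x b ih =>
      simp only [LinearMap.comp_apply, LinearMap.zero_apply] at ih ⊢
      rw [dW_block_cons, map_add, dW_der, ih, ad_apply, ad_apply, map_sub, isOddDer_dW,
        isOddDer_dW, dW_letter, par_par, par_dW]
      simp
  exact LinearMap.congr_fun this u

lemma ad_der {D : WordSpace k →ₗ[k] WordSpace k} (h : IsDer D)
    (hD : ∀ u, par k (D u) = D (par k u)) (b u : WordSpace k) :
    D (ad b u) = ad (D b) u + ad b (D u) := by
  rw [ad_apply, ad_apply, ad_apply, map_sub, h, h, hD]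
  abel

end FreeModel

section Marks

variable {k : Type u} [Field k]

variable (k) in
/-- Linear combinations of words with a given property. -/
def SP (P : List Block → Prop) : Submodule k (WordSpace k) := Finsupp.supported k k {W | P W}

variable {P Q : List Block → Prop}

lemma wd_mem_SP {W : List Block} (h : P W) : wd k W ∈ SP k P :=
  Finsupp.single_mem_supported k 1 h

lemma SP_le {M : Submodule k (WordSpace k)} (h : ∀ W, P W → wd k W ∈ M) : SP k P ≤ M := by
  rw [SP, Finsupp.supported_eq_span_single, Submodule.span_le]
  rintro _ ⟨W, hW, rfl⟩
  exact h W hW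

lemma map_mem_of_SP {N : Type*} [AddCommGroup N] [Module k N] (f : WordSpace k →ₗ[k] N)
    {M : Submodule k N} (h : ∀ W, P W → f (wd k W) ∈ M) {u : WordSpace k} (hu : u ∈ SP k P) :
    f u ∈ M :=
  SP_le (M := M.comap f) h hu

lemma SP_mono (h : ∀ W, P W → Q W) : SP k P ≤ SP k Q := SP_le fun W hW => wd_mem_SP (h W hW)

lemma mem_SP_and {u : WordSpace k} (h : u ∈ SP k P) (h' : u ∈ SP k Q) :
    u ∈ SP k (fun W => P W ∧ Q W) :=
  (Finsupp.mem_supported _ _).2 fun _ hW =>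
    ⟨(Finsupp.mem_supported _ _).1 h hW, (Finsupp.mem_supported _ _).1 h' hW⟩

lemma SP_eq_of_eq {N : Type*} [AddCommGroup N] [Module k N] {f g : WordSpace k →ₗ[k] N}
    (h : ∀ W, P W → f (wd k W) = g (wd k W)) {u : WordSpace k} (hu : u ∈ SP k P) : f u = g u := by
  have := map_mem_of_SP (f - g) (M := ⊥) (fun W hW => by simp [h W hW]) hu
  simpa [sub_eq_zero] using this

/-- The letters of a block. -/
def Block.letters (b : Block) : List (ℕ ⊕ ℕ) := b.1.map Sum.inl ++ [b.2]

@[simp] lemma Block.letters_cons (x : ℕ) (b : Block) :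
    (b.cons x).letters = Sum.inl x :: b.letters := rfl
@[simp] lemma Block.letters_letter (t : ℕ ⊕ ℕ) : (Block.letter t).letters = [t] := rfl

/-- The letters of a word. -/
def wletters (W : List Block) : List (ℕ ⊕ ℕ) := W.flatMap Block.letters

@[simp] lemma wletters_nil : wletters [] = [] := rfl
@[simp] lemma wletters_cons (b : Block) (W : List Block) :
    wletters (b :: W) = b.letters ++ wletters W := rfl
@[simp] lemma wletters_append (W W' : List Block) :
    wletters (W ++ W') = wletters W ++ wletters W' := by
  simp [wletters]

lemma cat_mem_SP {R : List Block → Prop} (h : ∀ W W', P W → Q W' → R (W ++ W'))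
    {u v : WordSpace k} (hu : u ∈ SP k P) (hv : v ∈ SP k Q) : cat k u v ∈ SP k R := by
  refine map_mem_of_SP ((cat k).flip v) (fun W hW => ?_) hu
  refine map_mem_of_SP (cat k (wd k W)) (fun W' hW' => ?_) hv
  rw [cat_wd]
  exact wd_mem_SP (h W W' hW hW')

/-- Words with given letters, up to order. -/
def HasLetters (s : List (ℕ ⊕ ℕ)) (W : List Block) : Prop := (wletters W).Perm s

lemma der_cont (x : ℕ) {s : List (ℕ ⊕ ℕ)} {u : WordSpace k} (hu : u ∈ SP k (HasLetters s)) :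
    der k x u ∈ SP k (HasLetters (Sum.inl x :: s)) := by
  refine map_mem_of_SP _ (fun W hW => ?_) hu
  refine SP_mono (P := HasLetters (Sum.inl x :: wletters W)) (fun W' h => h.trans (hW.cons _)) ?_
  clear hW
  induction W with
  | nil => rw [der_nil]; exact zero_mem _
  | cons b W ih =>
    rw [der_cons]
    refine add_mem (wd_mem_SP ?_) (cat_mem_SP (P := fun W => W = [b])
      (fun W1 W' h h' => ?_) (wd_mem_SP rfl) ih)
    · simp [HasLetters]
    · subst h
      simp only [HasLetters, List.singleton_append, wletters_cons] at h' ⊢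
      exact (h'.append_left _).trans List.perm_middle

lemma dW_block_cont (b : Block) : dW k (wd k [b]) ∈ SP k (HasLetters b.letters) := by
  induction b using Block.rec_cons with
  | letter t => rw [dW_letter]; exact zero_mem _
  | cons x b ih =>
    rw [dW_block_cons, ad_apply, par_wd, map_smul, LinearMap.smul_apply, cat_wd, cat_wd]
    refine add_mem (der_cont x ih) (sub_mem (wd_mem_SP ?_) (Submodule.smul_mem _ _ (wd_mem_SP ?_)))
    · simp [HasLetters]
    · simp [HasLetters]

lemma dW_cont {s : List (ℕ ⊕ ℕ)} {u : WordSpace k} (hu : u ∈ SP k (HasLetters s)) :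
    dW k u ∈ SP k (HasLetters s) := by
  refine map_mem_of_SP _ (fun W hW => ?_) hu
  refine SP_mono (P := HasLetters (wletters W)) (fun W' h => h.trans hW) ?_
  clear hW
  induction W with
  | nil => rw [dW_nil]; exact zero_mem _
  | cons b W ih =>
    rw [dW_cons]
    refine add_mem (cat_mem_SP (Q := fun V => V = W) (fun W1 W' h h' => ?_)
      (dW_block_cont b) (wd_mem_SP rfl)) (Submodule.smul_mem _ _ (cat_mem_SP (P := fun W => W = [b])
      (fun W1 W' h h' => ?_) (wd_mem_SP rfl) ih))
    · subst h'
      simp only [HasLetters, wletters_append, wletters_cons] at h ⊢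
      exact h.append_right _
    · subst h
      simp only [HasLetters, List.singleton_append, wletters_cons] at h' ⊢
      exact h'.append_left _

/-- The length of a block. -/
def Block.len (b : Block) : ℕ := b.1.length + 1

@[simp] lemma Block.len_cons (x : ℕ) (b : Block) : (b.cons x).len = b.len + 1 := rfl
@[simp] lemma Block.len_letter (t : ℕ ⊕ ℕ) : (Block.letter t).len = 1 := rfl

/-- The position of the first special letter of a block, as the pair of the numbers of letters
before and after it.  The special letters are the open letters and `z`. -/
def markAux (z : Option ℕ) : List ℕ → ℕ ⊕ ℕ → Option (ℕ × ℕ)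
  | [], .inl x => if z = some x then some (0, 0) else none
  | [], .inr _ => some (0, 0)
  | x :: a, t => if z = some x then some (0, a.length + 1) else
      (markAux z a t).map fun p => (p.1 + 1, p.2)

/-- See `markAux`. -/
def Block.mark (z : Option ℕ) (b : Block) : Option (ℕ × ℕ) := markAux z b.1 b.2

variable {z : Option ℕ}

lemma mark_cons_self {x : ℕ} (h : z = some x) (b : Block) :
    (b.cons x).mark z = some (0, b.len) := if_pos h

lemma mark_cons_ne {x : ℕ} (h : z ≠ some x) (b : Block) :
    (b.cons x).mark z = (b.mark z).map fun p => (p.1 + 1, p.2) := if_neg h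

lemma mark_inl_self {x : ℕ} (h : z = some x) : (Block.letter (.inl x)).mark z = some (0, 0) :=
  if_pos h

lemma mark_inl_ne {x : ℕ} (h : z ≠ some x) : (Block.letter (.inl x)).mark z = none := if_neg h

lemma mark_inr (y : ℕ) : (Block.letter (.inr y)).mark z = some (0, 0) := rfl

lemma ne_of_mark_cons {x : ℕ} {b : Block} (h : (b.cons x).mark z = none) :
    z ≠ some x ∧ b.mark z = none := by
  by_cases hx : z = some x
  · rw [mark_cons_self hx] at h
    cases h
  · rw [mark_cons_ne hx] at h
    exact ⟨hx, by simpa using h⟩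

/-- Words whose first marked block has its special letter not in front, or not too far from the
end. -/
def Low (z : Option ℕ) : ℕ → List Block → Prop
  | _, [] => False
  | m, b :: q => match b.mark z with
    | some (i, j) => 0 < i ∨ 2 * j < m
    | none => Low z (m - b.len) q

/-- Words whose first marked block has its special letter not in front, of bounded size. -/
def NBound (z : Option ℕ) : ℕ → List Block → Prop
  | _, [] => False
  | m, b :: q => match b.mark z with
    | some (i, j) => 0 < i ∧ i + 2 * j < m
    | none => NBound z (m - b.len) q

lemma low_some {b : Block} {i j : ℕ} (h : b.mark z = some (i, j)) (m : ℕ) (q : List Block) :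
    Low z m (b :: q) ↔ 0 < i ∨ 2 * j < m := by
  simp [Low, h]

lemma low_none {b : Block} (h : b.mark z = none) (m : ℕ) (q : List Block) :
    Low z m (b :: q) ↔ Low z (m - b.len) q := by
  simp [Low, h]

lemma nbound_some {b : Block} {i j : ℕ} (h : b.mark z = some (i, j)) (m : ℕ) (q : List Block) :
    NBound z m (b :: q) ↔ 0 < i ∧ i + 2 * j < m := by
  simp [NBound, h]

lemma nbound_none {b : Block} (h : b.mark z = none) (m : ℕ) (q : List Block) :
    NBound z m (b :: q) ↔ NBound z (m - b.len) q := by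
  simp [NBound, h]

lemma Low.mono {m m' : ℕ} {W : List Block} (h : Low z m W) (hm : m ≤ m') : Low z m' W := by
  induction W generalizing m m' with
  | nil => exact h
  | cons b q ih =>
    rcases hb : b.mark z with _ | ⟨i, j⟩
    · rw [low_none hb] at h ⊢
      exact ih h (by omega)
    · rw [low_some hb] at h ⊢
      omega

lemma NBound.mono {m m' : ℕ} {W : List Block} (h : NBound z m W) (hm : m ≤ m') :
    NBound z m' W := by
  induction W generalizing m m' with
  | nil => exact h
  | cons b q ih =>
    rcases hb : b.mark z with _ | ⟨i, j⟩
    · rw [nbound_none hb] at h ⊢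
      exact ih h (by omega)
    · rw [nbound_some hb] at h ⊢
      omega

lemma not_nbound_zero (W : List Block) : ¬NBound z 0 W := by
  induction W with
  | nil => exact id
  | cons b q ih =>
    rcases hb : b.mark z with _ | ⟨i, j⟩
    · rw [nbound_none hb, Nat.zero_sub]
      exact ih
    · rw [nbound_some hb]
      omega

lemma Low.exists_nbound {W : List Block} (h : Low z 0 W) : ∃ m, NBound z m W := by
  induction W with
  | nil => exact h.elim
  | cons b q ih =>
    rcases hb : b.mark z with _ | ⟨i, j⟩
    · rw [low_none hb, Nat.zero_sub] at h
      obtain ⟨m, hm⟩ := ih h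
      refine ⟨m + b.len, ?_⟩
      rw [nbound_none hb, Nat.add_sub_cancel]
      exact hm
    · rw [low_some hb] at h
      refine ⟨i + 2 * j + 1, ?_⟩
      rw [nbound_some hb]
      omega

lemma NBound.low {m : ℕ} {W : List Block} (h : NBound z m W) : Low z 0 W := by
  induction W generalizing m with
  | nil => exact h
  | cons b q ih =>
    rcases hb : b.mark z with _ | ⟨i, j⟩
    · rw [nbound_none hb] at h
      rw [low_none hb, Nat.zero_sub]
      exact ih h
    · rw [nbound_some hb] at h
      rw [low_some hb]
      omega

lemma Low.append {m : ℕ} {W : List Block} (h : Low z m W) (q : List Block) :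
    Low z m (W ++ q) := by
  induction W generalizing m with
  | nil => exact h.elim
  | cons b W ih =>
    rw [List.cons_append]
    rcases hb : b.mark z with _ | ⟨i, j⟩
    · rw [low_none hb] at h ⊢
      exact ih h
    · rw [low_some hb] at h ⊢
      exact h

lemma cat_low_some {b : Block} {i j m : ℕ} (h : b.mark z = some (i, j)) (hm : 0 < i ∨ 2 * j < m)
    (u : WordSpace k) : cat k (wd k [b]) u ∈ SP k (Low z m) := by
  induction u using ws_induction with
  | zero => simp
  | add u v hu hv => rw [map_add]; exact add_mem hu hv
  | smul c u hu => rw [map_smul]; exact Submodule.smul_mem _ _ hu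
  | word W => rw [cat_wd]; exact wd_mem_SP ((low_some h m _).2 hm)

lemma cat_low_none {b : Block} {m m' : ℕ} (h : b.mark z = none) (hm : m ≤ m' - b.len)
    {u : WordSpace k} (hu : u ∈ SP k (Low z m)) : cat k (wd k [b]) u ∈ SP k (Low z m') := by
  refine cat_mem_SP (P := fun W => W = [b]) (fun W W' hW hW' => ?_) (wd_mem_SP rfl) hu
  subst hW
  exact (low_none h _ _).2 (hW'.mono hm)

lemma der_low {x : ℕ} (hx : z ≠ some x) {m m' : ℕ} (hm : m = 0 ∨ m < m') {u : WordSpace k}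
    (hu : u ∈ SP k (Low z m)) : der k x u ∈ SP k (Low z m') := by
  refine map_mem_of_SP _ (fun W hW => ?_) hu
  clear hu
  induction W generalizing m m' with
  | nil => exact hW.elim
  | cons b W ih =>
    rw [der_cons]
    rcases hb : b.mark z with _ | ⟨i, j⟩
    · have hb' : (b.cons x).mark z = none := by rw [mark_cons_ne hx, hb]; rfl
      rw [low_none hb] at hW
      refine add_mem (wd_mem_SP ?_) (cat_low_none hb le_rfl (ih ?_ hW))
      · rw [low_none hb', Block.len_cons]
        exact hW.mono (by omega)
      · omega
    · have hb' : (b.cons x).mark z = some (i + 1, j) := by rw [mark_cons_ne hx, hb]; rfl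
      rw [low_some hb] at hW
      refine add_mem (wd_mem_SP ?_) (cat_low_some hb (by omega) _)
      rw [low_some hb']
      omega

/-- Words of two unmarked blocks of total length `n`. -/
def TwoBlocks (z : Option ℕ) (n : ℕ) (W : List Block) : Prop :=
  ∃ u v : Block, W = [u, v] ∧ u.mark z = none ∧ v.mark z = none ∧ u.len + v.len = n

lemma dW_none {b : Block} (hb : b.mark z = none) : dW k (wd k [b]) ∈ SP k (TwoBlocks z b.len) := by
  induction b using Block.rec_cons with
  | letter t => rw [dW_letter]; exact zero_mem _
  | cons x b ih =>
    obtain ⟨hx, hb⟩ := ne_of_mark_cons hb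
    have hx' := mark_inl_ne hx
    rw [dW_block_cons, ad_apply, par_wd, map_smul, LinearMap.smul_apply, cat_wd, cat_wd]
    refine add_mem (map_mem_of_SP _ (fun W hW => ?_) (ih hb)) (sub_mem (wd_mem_SP ?_)
      (Submodule.smul_mem _ _ (wd_mem_SP ?_)))
    · obtain ⟨u, v, rfl, hu, hv, hl⟩ := hW
      rw [der_cons, der_block, cat_wd]
      refine add_mem (wd_mem_SP ⟨u.cons x, v, rfl, ?_, hv, ?_⟩)
        (wd_mem_SP ⟨u, v.cons x, rfl, hu, ?_, ?_⟩)
      · rw [mark_cons_ne hx, hu]; rfl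
      · simp only [Block.len_cons]; omega
      · rw [mark_cons_ne hx, hv]; rfl
      · simp only [Block.len_cons]; omega
    · exact ⟨_, _, rfl, hx', hb, by simp only [Block.len_cons, Block.len_letter]; omega⟩
    · exact ⟨_, _, rfl, hb, hx', by simp only [Block.len_cons, Block.len_letter]⟩

lemma Block.len_pos (b : Block) : 0 < b.len := Nat.succ_pos _

lemma dW_cons_self {x : ℕ} (hz : z = some x) {b : Block} (hb : b.mark z = none) :
    dW k (wd k [b.cons x]) ∈ SP k (Low z (2 * b.len)) := by
  have hx' := mark_inl_self hz
  have := b.len_pos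
  rw [dW_block_cons, ad_apply, par_wd, map_smul, LinearMap.smul_apply, cat_wd, cat_wd]
  refine add_mem (map_mem_of_SP _ (fun W hW => ?_) (dW_none hb)) (sub_mem (wd_mem_SP ?_)
    (Submodule.smul_mem _ _ (wd_mem_SP ?_)))
  · obtain ⟨u, v, rfl, hu, hv, hl⟩ := hW
    have := u.len_pos
    have := v.len_pos
    rw [der_cons, der_block, cat_wd]
    refine add_mem (wd_mem_SP ?_) (wd_mem_SP ?_)
    · rw [low_some (mark_cons_self hz u)]
      omega
    · rw [List.singleton_append, low_none hu, low_some (mark_cons_self hz v)]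
      omega
  · rw [List.singleton_append, low_some hx']
    omega
  · rw [List.singleton_append, low_none hb, low_some hx']
    omega

/-- In the presence of a closed special letter, the letters are different and closed. -/
def GoodLetters (z : Option ℕ) (s : List (ℕ ⊕ ℕ)) : Prop :=
  ∀ x, z = some x → s.Nodup ∧ ∀ y, Sum.inr y ∉ s

lemma mark_none_of_not_mem {x : ℕ} (hz : z = some x) {b : Block} (hx : Sum.inl x ∉ b.letters)
    (h : ∀ y, Sum.inr y ∉ b.letters) : b.mark z = none := by
  induction b using Block.rec_cons with
  | letter t =>
    rcases t with t | t
    · refine mark_inl_ne fun h => hx ?_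
      obtain rfl : x = t := Option.some.inj (hz.symm.trans h)
      simp
    · exact absurd (by simp) (h t)
  | cons y b ih =>
    simp only [Block.letters_cons, List.mem_cons, not_or] at hx h
    rw [mark_cons_ne, ih hx.2 fun y => (h y).2]
    · rfl
    · intro h'
      exact hx.1 (by rw [Option.some.inj (hz.symm.trans h')])

lemma dW_some_zero {b : Block} {j : ℕ} (hb : b.mark z = some (0, j))
    (hg : GoodLetters z b.letters) : dW k (wd k [b]) ∈ SP k (Low z (2 * j)) := by
  induction b using Block.rec_cons with
  | letter t => rw [dW_letter]; exact zero_mem _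
  | cons x b =>
    by_cases hx : z = some x
    · rw [mark_cons_self hx] at hb
      obtain rfl : b.len = j := by simpa using hb
      refine dW_cons_self hx ?_
      obtain ⟨h1, h2⟩ := hg x hx
      simp only [Block.letters_cons, List.nodup_cons, List.mem_cons, not_or] at h1 h2
      exact mark_none_of_not_mem hx h1.1 fun y => (h2 y).2
    · rw [mark_cons_ne hx] at hb
      rcases h : b.mark z with _ | p <;> simp [h] at hb

/-- The concatenation of a block with closed last letter and a block. -/
def Block.join (u b : Block) : Block := (u.1 ++ (u.2.elim (fun x => [x]) fun _ => []) ++ b.1, b.2)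

@[simp] lemma Block.join_cons (x : ℕ) (u b : Block) : (u.cons x).join b = (u.join b).cons x := rfl
@[simp] lemma Block.join_letter (x : ℕ) (b : Block) : (letter (.inl x)).join b = b.cons x := rfl

lemma mark_join {u b : Block} {j : ℕ} (hu : u.mark z = none) (hb : b.mark z = some (0, j)) :
    (u.join b).mark z = some (u.len, j) := by
  induction u using Block.rec_cons with
  | letter t =>
    rcases t with t | t
    · rw [Block.join_letter, mark_cons_ne, hb]
      · rfl
      · intro h
        rw [mark_inl_self h] at hu
        cases hu
    · cases hu
  | cons x u ih =>
    obtain ⟨hx, hu⟩ := ne_of_mark_cons hu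
    rw [Block.join_cons, mark_cons_ne hx, ih hu]
    rfl

lemma exists_join {b : Block} {i j : ℕ} (hb : b.mark z = some (i + 1, j)) :
    ∃ u b0 : Block, b = u.join b0 ∧ u.mark z = none ∧ b0.mark z = some (0, j) ∧ u.len = i + 1 := by
  induction b using Block.rec_cons generalizing i with
  | letter t =>
    rcases t with t | t
    · by_cases h : z = some t
      · simp [mark_inl_self h] at hb
      · simp [mark_inl_ne h] at hb
    · simp [mark_inr] at hb
  | cons x b ih =>
    by_cases hx : z = some x
    · simp [mark_cons_self hx] at hb
    · rw [mark_cons_ne hx] at hb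
      rcases h : b.mark z with _ | ⟨i', j'⟩ <;> simp only [h, Option.map_none, Option.map_some,
        Option.some.injEq, Prod.mk.injEq, reduceCtorEq, Nat.add_right_cancel_iff] at hb
      obtain ⟨rfl, rfl⟩ := hb
      cases i' with
      | zero => exact ⟨_, _, (Block.join_letter x b).symm, mark_inl_ne hx, h, rfl⟩
      | succ i =>
        obtain ⟨u, b0, rfl, hu, hb0, hl⟩ := ih h
        refine ⟨u.cons x, b0, rfl, ?_, hb0, ?_⟩
        · rw [mark_cons_ne hx, hu]; rfl
        · rw [Block.len_cons, hl]

lemma GoodLetters.sublist {s t : List (ℕ ⊕ ℕ)} (h : GoodLetters z s) (hs : t.Sublist s) :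
    GoodLetters z t := fun x hx =>
  ⟨(h x hx).1.sublist hs, fun y hy => (h x hx).2 y (hs.subset hy)⟩

lemma dW_join {u b : Block} {j : ℕ} (hu : u.mark z = none) (hb : b.mark z = some (0, j))
    (hg : GoodLetters z (u.join b).letters) :
    dW k (wd k [u.join b]) - wd k [u, b] ∈ SP k (Low z (u.len + 2 * j)) := by
  induction u using Block.rec_cons with
  | letter t =>
    rcases t with x | t
    · have hx : z ≠ some x := by
        intro h
        rw [mark_inl_self h] at hu
        cases hu
      rw [Block.join_letter] at hg ⊢
      rw [dW_block_cons, ad_apply, par_wd, map_smul, LinearMap.smul_apply, cat_wd, cat_wd,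
        List.singleton_append, add_sub_assoc, sub_sub_cancel_left]
      refine add_mem (der_low hx (m := 2 * j) (by simp <;> omega) (dW_some_zero hb
        (hg.sublist (List.sublist_cons_self _ _)))) (neg_mem (Submodule.smul_mem _ _
        (wd_mem_SP ?_)))
      rw [List.singleton_append, low_some hb, Block.len_letter]
      omega
    · cases hu
  | cons x u ih =>
    obtain ⟨hx, hu⟩ := ne_of_mark_cons hu
    rw [Block.join_cons] at hg ⊢
    have ih := ih hu (hg.sublist (List.sublist_cons_self _ _))
    have hj := mark_join hu hb
    have hu' : (u.cons x).mark z = none := by rw [mark_cons_ne hx, hu]; rfl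
    have e : dW k (wd k [(u.join b).cons x]) - wd k [u.cons x, b] =
        der k x (dW k (wd k [u.join b]) - wd k [u, b]) + wd k [u, b.cons x] +
        (wd k [Block.letter (.inl x), u.join b] -
          sg k (wdeg [u.join b]) • wd k [u.join b, Block.letter (.inl x)]) := by
      rw [dW_block_cons, map_sub, der_cons, der_block, ad_apply, par_wd, map_smul,
        LinearMap.smul_apply, cat_wd, cat_wd, cat_wd]
      simp only [List.singleton_append]
      abel
    rw [e]
    refine add_mem (add_mem (der_low hx (Or.inr ?_) ih) (wd_mem_SP ?_)) (sub_mem (wd_mem_SP ?_)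
      (Submodule.smul_mem _ _ (wd_mem_SP ?_)))
    · rw [Block.len_cons]; omega
    · have hb' : (b.cons x).mark z = some (1, j) := by rw [mark_cons_ne hx, hb]; rfl
      rw [low_none hu, low_some hb']
      omega
    · rw [low_none (mark_inl_ne hx), low_some hj]
      exact Or.inl u.len_pos
    · rw [low_some hj]
      exact Or.inl u.len_pos

/-- `Lead z m ε W W'`: the leading term of the differential of `W'` is `ε • W`. -/
inductive Lead (z : Option ℕ) : ℕ → k → List Block → List Block → Prop
  | here {u b : Block} {j : ℕ} (q : List Block) (hu : u.mark z = none)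
      (hb : b.mark z = some (0, j)) : Lead z (u.len + 2 * j) 1 (u :: b :: q) (u.join b :: q)
  | there {b : Block} {m : ℕ} {ε : k} {W W' : List Block} (hb : b.mark z = none) :
      Lead z m ε W W' → Lead z (b.len + m) (sg k b.deg * ε) (b :: W) (b :: W')

lemma Lead.nbound {m : ℕ} {ε : k} {W W' : List Block} (h : Lead z m ε W W') :
    NBound z (m + 1) W' := by
  induction h with
  | @here u b j q hu hb =>
    rw [nbound_some (mark_join hu hb)]
    have := u.len_pos
    omega
  | @there b m ε W W' hb h ih =>
    rw [nbound_none hb]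
    exact ih.mono (by omega)

lemma Lead.mul_self {m : ℕ} {ε : k} {W W' : List Block} (h : Lead z m ε W W') : ε * ε = 1 := by
  induction h with
  | here => exact mul_one 1
  | there hb h ih => rw [mul_mul_mul_comm, ih, sg_mul_self, mul_one]

lemma Lead.dW_sub {m : ℕ} {ε : k} {W W' : List Block} (h : Lead z m ε W W')
    (hg : GoodLetters z (wletters W')) : dW k (wd k W') - ε • wd k W ∈ SP k (Low z m) := by
  induction h with
  | @here u b j q hu hb =>
    have hj := mark_join hu hb
    have e : dW k (wd k (u.join b :: q)) - (1 : k) • wd k (u :: b :: q) =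
        cat k (dW k (wd k [u.join b]) - wd k [u, b]) (wd k q) +
          sg k (u.join b).deg • cat k (wd k [u.join b]) (dW k (wd k q)) := by
      rw [dW_cons, map_sub, LinearMap.sub_apply, cat_wd, one_smul]
      simp only [List.cons_append, List.nil_append]
      abel
    rw [e]
    refine add_mem (cat_mem_SP (Q := fun _ => True) (fun W W' h _ => h.append W')
      (dW_join hu hb (hg.sublist (List.sublist_append_left _ _))) (wd_mem_SP trivial))
      (Submodule.smul_mem _ _ (cat_low_some hj (Or.inl u.len_pos) _))
  | @there b m ε W W' hb h ih =>
    have e : dW k (wd k (b :: W')) - (sg k b.deg * ε) • wd k (b :: W) =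
        cat k (dW k (wd k [b])) (wd k W') +
          sg k b.deg • cat k (wd k [b]) (dW k (wd k W') - ε • wd k W) := by
      rw [dW_cons, map_sub, smul_sub, mul_smul, map_smul, cat_wd]
      simp only [List.cons_append, List.nil_append]
      abel
    rw [e]
    refine add_mem (cat_mem_SP (Q := fun V => V = W') (fun V V' hV hV' => ?_) (dW_none hb)
      (wd_mem_SP rfl)) (Submodule.smul_mem _ _ (cat_low_none hb (by omega) (ih
      (hg.sublist (List.sublist_append_right _ _)))))
    obtain ⟨u, v, rfl, hu, hv, -⟩ := hV
    subst hV'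
    simp only [List.cons_append, List.nil_append]
    rw [low_none hu, low_none hv]
    exact h.nbound.low.mono (Nat.zero_le _)

/-- Words that start with a special letter. -/
def Front (z : Option ℕ) : List Block → Prop
  | [] => False
  | b :: _ => ∃ j, b.mark z = some (0, j)

lemma NBound.exists_lead (k : Type u) [Field k] {m : ℕ} {W' : List Block} (h : NBound z m W') :
    ∃ (n : ℕ) (ε : k) (W : List Block), n < m ∧ Lead z n ε W W' := by
  induction W' generalizing m with
  | nil => exact h.elim
  | cons b q ih =>
    rcases hb : b.mark z with _ | ⟨i, j⟩
    · rw [nbound_none hb] at h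
      obtain ⟨n, ε, W, hn, hl⟩ := ih h
      exact ⟨_, _, _, by omega, hl.there hb⟩
    · rw [nbound_some hb] at h
      obtain ⟨i, rfl⟩ : ∃ i', i = i' + 1 := ⟨i - 1, by omega⟩
      obtain ⟨u, b0, rfl, hu, hb0, hl⟩ := exists_join hb
      exact ⟨_, _, _, by omega, Lead.here q hu hb0⟩

lemma Low.cases (k : Type u) [Field k] {m : ℕ} {W : List Block} (h : Low z m W) :
    Low z 0 W ∨ Front z W ∨ ∃ (n : ℕ) (ε : k) (W' : List Block), n < m ∧ Lead z n ε W W' := by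
  induction W generalizing m with
  | nil => exact h.elim
  | cons b q ih =>
    rcases hb : b.mark z with _ | ⟨i, j⟩
    · rw [low_none hb] at h ⊢
      rcases ih h with h' | h' | ⟨n, ε, W', hn, hl⟩
      · exact Or.inl (h'.mono (Nat.zero_le _))
      · cases q with
        | nil => exact h'.elim
        | cons b0 q =>
          obtain ⟨j, hj⟩ := h'
          rw [low_some hj] at h
          exact Or.inr (Or.inr ⟨_, _, _, by omega, Lead.here q hb hj⟩)
      · exact Or.inr (Or.inr ⟨_, _, _, by omega, hl.there hb⟩)
    · rw [low_some hb] at h ⊢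
      rcases Nat.eq_zero_or_pos i with rfl | hi
      · exact Or.inr (Or.inl ⟨j, hb⟩)
      · exact Or.inl (Or.inl hi)

variable (k) in
/-- The contracting homotopy, on a word. -/
def homotWord (z : Option ℕ) : List Block → WordSpace k
  | [] => 0
  | [_] => 0
  | b :: b0 :: q => match b.mark z, b0.mark z with
    | none, some (0, _) => wd k (b.join b0 :: q)
    | none, none => sg k b.deg • cat k (wd k [b]) (homotWord z (b0 :: q))
    | _, _ => 0

lemma homotWord_some {b : Block} {i j : ℕ} (h : b.mark z = some (i, j)) (q : List Block) :
    homotWord k z (b :: q) = 0 := by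
  cases q <;> simp [homotWord, h]

lemma Lead.homot {m : ℕ} {ε : k} {W W' : List Block} (h : Lead z m ε W W') :
    homotWord k z W = ε • wd k W' := by
  induction h with
  | here q hu hb => simp [homotWord, hu, hb]
  | @there b m ε W W' hb h ih =>
    have : ∃ b0 q, W = b0 :: q ∧ b0.mark z = none := by
      cases h with
      | here q hu hb => exact ⟨_, _, rfl, hu⟩
      | there hb h => exact ⟨_, _, rfl, hb⟩
    obtain ⟨b0, q, rfl, hb0⟩ := this
    rw [homotWord, hb, hb0]
    simp only
    rw [ih, map_smul, cat_wd, smul_smul]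
    rfl

lemma Low.homot {W : List Block} (h : Low z 0 W) : homotWord k z W = 0 := by
  induction W with
  | nil => rfl
  | cons b q ih =>
    rcases hb : b.mark z with _ | ⟨i, j⟩
    · rw [low_none hb, Nat.zero_sub] at h
      cases q with
      | nil => rfl
      | cons b0 q =>
        rw [homotWord, hb]
        rcases hb0 : b0.mark z with _ | ⟨_ | i, j⟩
        · simp only
          rw [ih h, map_zero, smul_zero]
        · rw [low_some hb0] at h
          omega
        · rfl
    · exact homotWord_some hb q

lemma homot_low {m : ℕ} {u : WordSpace k} (hu : u ∈ SP k (Low z m)) :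
    wlift k (homotWord k z) u ∈ SP k (NBound z m) := by
  refine map_mem_of_SP _ (fun W hW => ?_) hu
  rw [wlift_wd]
  rcases hW.cases k with h | h | ⟨n, ε, W', hn, hl⟩
  · rw [h.homot]
    exact zero_mem _
  · cases W with
    | nil => exact h.elim
    | cons b q =>
      rw [homotWord_some h.choose_spec]
      exact zero_mem _
  · rw [hl.homot]
    exact Submodule.smul_mem _ _ (wd_mem_SP (hl.nbound.mono hn))

lemma homot_dW {s : List (ℕ ⊕ ℕ)} (hg : ∀ W, HasLetters s W → GoodLetters z (wletters W)) {m : ℕ}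
    {u : WordSpace k} (hu : u ∈ SP k (fun W => NBound z (m + 1) W ∧ HasLetters s W)) :
    wlift k (homotWord k z) (dW k u) - u ∈ SP k (NBound z m) := by
  refine map_mem_of_SP (wlift k (homotWord k z) ∘ₗ dW k - LinearMap.id) (fun W' hW => ?_) hu
  obtain ⟨n, ε, W, hn, hl⟩ := hW.1.exists_lead k
  have e : (wlift k (homotWord k z) ∘ₗ dW k - LinearMap.id : WordSpace k →ₗ[k] WordSpace k)
      (wd k W') =
      wlift k (homotWord k z) (dW k (wd k W') - ε • wd k W) := by
    rw [map_sub, map_smul, wlift_wd, hl.homot, smul_smul, hl.mul_self, one_smul]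
    rfl
  rw [e]
  exact SP_mono (fun W h => h.mono (by omega)) (homot_low (hl.dW_sub (hg W' hW.2)))

lemma eq_zero_of_homot_dW {s : List (ℕ ⊕ ℕ)}
    (hg : ∀ W, HasLetters s W → GoodLetters z (wletters W)) {u : WordSpace k}
    (hu : u ∈ SP k (fun W => Low z 0 W ∧ HasLetters s W))
    (h : wlift k (homotWord k z) (dW k u) = 0) : u = 0 := by
  have hc : u ∈ SP k (HasLetters s) := SP_mono (fun W h => h.2) hu
  have step : ∀ m, u ∈ SP k (NBound z m) → u = 0 := by
    intro m
    induction m with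
    | zero =>
      intro hm
      rw [← Submodule.mem_bot k]
      exact SP_le (fun W hW => (not_nbound_zero W hW).elim) hm
    | succ m ih =>
      intro hm
      refine ih ?_
      have := homot_dW hg (mem_SP_and hm hc)
      rw [h, zero_sub] at this
      exact neg_mem_iff.1 this
  have bound : ∃ m, u ∈ SP k (NBound z m) := by
    have hN : ∀ W ∈ u.support, ∃ m, NBound z m W := fun W hW =>
      ((Finsupp.mem_supported _ _).1 hu hW).1.exists_nbound
    choose! f hf using hN
    refine ⟨u.support.sup f, (Finsupp.mem_supported _ _).2 fun W hW => ?_⟩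
    exact (hf W hW).mono (Finset.le_sup hW)
  obtain ⟨m, hm⟩ := bound
  exact step m hm

end Marks

section Decomposition

variable {k : Type u} [Field k] {z : Option ℕ}

/-- Blocks that start with a special letter. -/
def Block.IsFront (z : Option ℕ) (b : Block) : Prop := ∃ j, b.mark z = some (0, j)

/-- Cycles `κ b` with leading term `b`, for the blocks `b` which start with a special letter. -/
structure FrontCycles (z : Option ℕ) (κ : Block → WordSpace k) : Prop where
  lead : ∀ b : Block, b.IsFront z → GoodLetters z b.letters →
    κ b - wd k [b] ∈ SP k (fun W => ∃ c : Block, W = [c] ∧ Low z 0 W)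
  letters : ∀ b : Block, b.IsFront z → GoodLetters z b.letters →
    κ b ∈ SP k (HasLetters b.letters)
  diff : ∀ b : Block, b.IsFront z → GoodLetters z b.letters → dW k (κ b) = 0
  par : ∀ b : Block, b.IsFront z → GoodLetters z b.letters → par k (κ b) = sg k b.deg • κ b

variable (κ : Block → WordSpace k)

/-- Replace the first block `b` by `κ b`. -/
def thetaWord : List Block → WordSpace k
  | [] => 0
  | b :: q => cat k (κ b) (wd k q)

/-- The differential of all blocks but the first. -/
def tailDiffWord : List Block → WordSpace k
  | [] => 0
  | b :: q => sg k b.deg • cat k (wd k [b]) (dW k (wd k q))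

/-- Remove a given first block. -/
def stripWord (b : Block) : List Block → WordSpace k
  | [] => 0
  | c :: q => if c = b then wd k q else 0

lemma theta_cat (b : Block) (u : WordSpace k) :
    wlift k (thetaWord κ) (cat k (wd k [b]) u) = cat k (κ b) u := by
  induction u using ws_induction with
  | zero => simp
  | add u v hu hv => simp only [map_add, hu, hv]
  | smul c u hu => simp only [map_smul, hu]
  | word W => simp [thetaWord]

lemma strip_cat (b c : Block) (u : WordSpace k) :
    wlift k (stripWord (k := k) b) (cat k (wd k [c]) u) = if c = b then u else 0 := by
  induction u using ws_induction with
  | zero => simp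
  | add u v hu hv => simp only [map_add, hu, hv]; split_ifs <;> simp
  | smul c u hu => simp only [map_smul, hu]; split_ifs <;> simp
  | word W => simp [stripWord]

lemma strip_tailDiff (b : Block) (u : WordSpace k) :
    wlift k (stripWord (k := k) b) (wlift k (tailDiffWord (k := k)) u) =
      sg k b.deg • dW k (wlift k (stripWord (k := k) b) u) := by
  induction u using ws_induction with
  | zero => simp
  | add u v hu hv => simp only [map_add, hu, hv, smul_add]
  | smul c u hu => simp only [map_smul, hu, smul_comm c]
  | word W =>
    rw [wlift_wd, wlift_wd]
    cases W with
    | nil => simp [tailDiffWord, stripWord]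
    | cons c W =>
      rw [tailDiffWord, map_smul, strip_cat, stripWord]
      split_ifs with h
      · rw [h]
      · simp

/-- Words of given letters that start with a special letter. -/
abbrev FrontLetters (z : Option ℕ) (s : List (ℕ ⊕ ℕ)) (W : List Block) : Prop :=
  Front z W ∧ HasLetters s W

variable {κ} {s : List (ℕ ⊕ ℕ)}

lemma theta_low (h : FrontCycles z κ) (hg : ∀ W, HasLetters s W → GoodLetters z (wletters W))
    {b : Block} {q : List Block} (hW : FrontLetters z s (b :: q)) :
    cat k (κ b) (wd k q) - wd k (b :: q) ∈ SP k (fun W => Low z 0 W ∧ HasLetters s W) := by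
  have hgb : GoodLetters z b.letters := (hg _ hW.2).sublist (List.sublist_append_left _ _)
  have h1 : cat k (κ b) (wd k q) - wd k (b :: q) = cat k (κ b - wd k [b]) (wd k q) := by
    rw [map_sub, LinearMap.sub_apply, cat_wd]
    rfl
  refine mem_SP_and ?_ ?_
  · rw [h1]
    refine cat_mem_SP (Q := fun _ => True) (fun W V hV _ => ?_) (h.lead b hW.1 hgb)
      (wd_mem_SP trivial)
    obtain ⟨c, rfl, hc⟩ := hV
    exact hc.append V
  · refine sub_mem (cat_mem_SP (Q := fun V => V = q) (fun V V' hV hV' => ?_)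
      (h.letters b hW.1 hgb) (wd_mem_SP rfl)) (wd_mem_SP hW.2)
    subst hV'
    refine List.Perm.trans ?_ hW.2
    rw [wletters_append]
    exact hV.append_right _

lemma theta_dW (h : FrontCycles z κ) (hg : ∀ W, HasLetters s W → GoodLetters z (wletters W))
    {g : WordSpace k} (hW : g ∈ SP k (FrontLetters z s)) :
    dW k (wlift k (thetaWord κ) g) = wlift k (thetaWord κ) (wlift k (tailDiffWord (k := k)) g) := by
  refine SP_eq_of_eq (f := dW k ∘ₗ wlift k (thetaWord κ)) (g := wlift k (thetaWord κ) ∘ₗ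
    wlift k (tailDiffWord (k := k))) (fun W hW => ?_) hW
  simp only [LinearMap.comp_apply, wlift_wd]
  cases W with
  | nil => simp [thetaWord, tailDiffWord]
  | cons b q =>
    have hgb : GoodLetters z b.letters := (hg _ hW.2).sublist (List.sublist_append_left _ _)
    rw [thetaWord, tailDiffWord, isOddDer_dW, h.diff b hW.1 hgb, h.par b hW.1 hgb, map_smul,
      map_smul, theta_cat]
    simp

lemma tailDiff_front {g : WordSpace k} (hW : g ∈ SP k (FrontLetters z s)) :
    wlift k (tailDiffWord (k := k)) g ∈ SP k (FrontLetters z s) := by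
  refine map_mem_of_SP _ (fun W hW => ?_) hW
  rw [wlift_wd]
  cases W with
  | nil => exact hW.1.elim
  | cons b q =>
    refine Submodule.smul_mem _ _ (cat_mem_SP (P := fun V => V = [b]) (fun V V' hV hV' => ?_)
      (wd_mem_SP rfl) (dW_cont (wd_mem_SP (List.Perm.refl _))))
    subst hV
    refine ⟨hW.1, List.Perm.trans ?_ hW.2⟩
    exact hV'.append_left _

open Classical in
/-- The projection to the words that start with a special letter. -/
def frontWord (z : Option ℕ) (W : List Block) : WordSpace k :=
  if Front z W then wd k W else 0

lemma not_front_of_low {W : List Block} (h : Low z 0 W) : ¬Front z W := by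
  cases W with
  | nil => exact h.elim
  | cons b q =>
    rintro ⟨j, hj⟩
    rw [low_some hj] at h
    omega

lemma front_theta (h : FrontCycles z κ) (hg : ∀ W, HasLetters s W → GoodLetters z (wletters W))
    {g : WordSpace k} (hW : g ∈ SP k (FrontLetters z s)) :
    wlift k (frontWord (k := k) z) (wlift k (thetaWord κ) g) = g := by
  refine SP_eq_of_eq (f := wlift k (frontWord (k := k) z) ∘ₗ wlift k (thetaWord κ)) (g := LinearMap.id)
    (fun W hW => ?_) hW
  cases W with
  | nil => exact hW.1.elim
  | cons b q =>
    simp only [LinearMap.comp_apply, wlift_wd, LinearMap.id_apply, thetaWord]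
    have := theta_low h hg hW
    have h2 := map_mem_of_SP (wlift k (frontWord (k := k) z)) (M := ⊥) (fun W hW => by
      rw [wlift_wd, frontWord, if_neg (not_front_of_low hW.1)]
      exact zero_mem _) this
    rw [Submodule.mem_bot, map_sub, sub_eq_zero, wlift_wd, frontWord, if_pos hW.1] at h2
    exact h2

lemma homot_theta (h : FrontCycles z κ) (hg : ∀ W, HasLetters s W → GoodLetters z (wletters W))
    {g : WordSpace k} (hW : g ∈ SP k (FrontLetters z s)) :
    wlift k (homotWord k z) (wlift k (thetaWord κ) g) = 0 := by
  refine SP_eq_of_eq (f := wlift k (homotWord k z) ∘ₗ wlift k (thetaWord κ)) (g := 0)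
    (fun W hW => ?_) hW
  cases W with
  | nil => exact hW.1.elim
  | cons b q =>
    simp only [LinearMap.comp_apply, wlift_wd, LinearMap.zero_apply, thetaWord]
    have := theta_low h hg hW
    have h2 := map_mem_of_SP (wlift k (homotWord k z)) (M := ⊥) (fun W hW => by
      rw [wlift_wd, hW.1.homot]
      exact zero_mem _) this
    rw [Submodule.mem_bot, map_sub, sub_eq_zero, wlift_wd, homotWord_some hW.1.choose_spec] at h2
    exact h2

lemma exists_decomposition_word (h : FrontCycles z κ)
    (hg : ∀ W, HasLetters s W → GoodLetters z (wletters W)) (m : ℕ) :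
    SP k (fun W => Low z m W ∧ HasLetters s W) ≤
      (SP k (FrontLetters z s)).map (wlift k (thetaWord κ)) ⊔
        (SP k (fun W => Low z 0 W ∧ HasLetters s W) ⊔ (SP k (fun W => Low z 0 W ∧
          HasLetters s W)).map (dW k)) := by
  induction m using Nat.strong_induction_on with
  | _ m ih =>
    refine SP_le fun W hW => ?_
    rcases hW.1.cases k with h0 | h0 | ⟨n, ε, W', hn, hl⟩
    · exact Submodule.mem_sup_right (Submodule.mem_sup_left (wd_mem_SP ⟨h0, hW.2⟩))
    · cases W with
      | nil => exact h0.elim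
      | cons b q =>
        have h1 := theta_low h hg ⟨h0, hW.2⟩
        rw [← sub_sub_cancel (cat k (κ b) (wd k q)) (wd k (b :: q))]
        refine sub_mem (Submodule.mem_sup_left ⟨wd k (b :: q), wd_mem_SP ⟨h0, hW.2⟩, ?_⟩)
          (Submodule.mem_sup_right (Submodule.mem_sup_left h1))
        rw [wlift_wd, thetaWord]
    · have hW' : HasLetters s W' := by
        refine List.Perm.trans ?_ hW.2
        clear hn ih hW
        induction hl with
        | @here u b j q hu hb =>
          rcases u with ⟨a, x | y⟩
          · simp [Block.letters, Block.join]
          · exfalso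
            clear hb
            induction a with
            | nil => cases hu
            | cons x a ih => exact ih (ne_of_mark_cons (b := (a, Sum.inr y)) hu).2
        | there hb _ ih => exact ih.append_left _
      have h1 := mem_SP_and (hl.dW_sub (hg W' hW')) (sub_mem (dW_cont (wd_mem_SP hW'))
        (Submodule.smul_mem _ ε (wd_mem_SP hW.2)))
      have e : wd k W = ε • dW k (wd k W') - ε • (dW k (wd k W') - ε • wd k W) := by
        rw [smul_sub, smul_smul, hl.mul_self, one_smul, sub_sub_cancel]
      rw [e]
      refine sub_mem (Submodule.smul_mem _ _ (Submodule.mem_sup_right (Submodule.mem_sup_right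
        ⟨_, wd_mem_SP ⟨hl.nbound.low, hW'⟩, rfl⟩))) (Submodule.smul_mem _ _ (ih n hn h1))

lemma exists_low_of_mem {t : ℕ ⊕ ℕ} {W : List Block} (ht : t ∈ wletters W)
    (hsp : ∀ x, t = Sum.inl x → z = some x) : ∃ m, Low z m W := by
  have block : ∀ b : Block, t ∈ b.letters → b.mark z ≠ none := by
    intro b hb hn
    induction b using Block.rec_cons with
    | letter t' =>
      obtain rfl : t = t' := by simpa using hb
      rcases t with x | y
      · rw [mark_inl_self (hsp x rfl)] at hn
        cases hn
      · cases hn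
    | cons x b ih =>
      obtain ⟨hx, hn⟩ := ne_of_mark_cons hn
      rw [Block.letters_cons, List.mem_cons] at hb
      rcases hb with rfl | hb
      · exact hx (hsp x rfl)
      · exact ih hb hn
  induction W with
  | nil => simp at ht
  | cons b q ih =>
    rcases hb : b.mark z with _ | ⟨i, j⟩
    · rw [wletters_cons, List.mem_append] at ht
      obtain ⟨m, hm⟩ := ih (ht.resolve_left fun h => block b h hb)
      refine ⟨m + b.len, ?_⟩
      rw [low_none hb, Nat.add_sub_cancel]
      exact hm
    · exact ⟨2 * j + 1, (low_some hb _ _).2 (by omega)⟩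

/-- A cycle is homologous to a combination of products of a cycle `κ b` with other cycles. -/
lemma exists_decomposition (h : FrontCycles z κ)
    (hg : ∀ W, HasLetters s W → GoodLetters z (wletters W)) {t : ℕ ⊕ ℕ} (ht : t ∈ s)
    (hsp : ∀ x, t = Sum.inl x → z = some x) {f : WordSpace k} (hf : f ∈ SP k (HasLetters s))
    (hdf : dW k f = 0) :
    ∃ g ∈ SP k (FrontLetters z s), ∃ n ∈ SP k (HasLetters s),
      f = wlift k (thetaWord κ) g + dW k n ∧ wlift k (tailDiffWord (k := k)) g = 0 := by
  have h1 : f ∈ (SP k (FrontLetters z s)).map (wlift k (thetaWord κ)) ⊔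
        (SP k (fun W => Low z 0 W ∧ HasLetters s W) ⊔ (SP k (fun W => Low z 0 W ∧
          HasLetters s W)).map (dW k)) := by
    refine SP_le (fun W hW => ?_) hf
    obtain ⟨m, hm⟩ := exists_low_of_mem (hW.mem_iff.2 ht) hsp
    exact exists_decomposition_word h hg m (wd_mem_SP ⟨hm, hW⟩)
  obtain ⟨_, ⟨g, hg', rfl⟩, f2, hf2, rfl⟩ := Submodule.mem_sup.1 h1
  obtain ⟨n, hn, _, ⟨n', hn', rfl⟩, rfl⟩ := Submodule.mem_sup.1 hf2
  have h2 : dW k n = -wlift k (thetaWord κ) (wlift k (tailDiffWord (k := k)) g) := by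
    rw [map_add, map_add, dW_dW, theta_dW h hg hg', add_zero] at hdf
    rw [eq_neg_iff_add_eq_zero, add_comm]
    exact hdf
  have h3 : n = 0 := by
    refine eq_zero_of_homot_dW hg hn ?_
    rw [h2, map_neg, homot_theta h hg (tailDiff_front hg'), neg_zero]
  refine ⟨g, hg', n', SP_mono (fun W h => h.2) hn', by rw [h3, zero_add], ?_⟩
  rw [h3, map_zero] at h2
  rw [← front_theta h hg (tailDiff_front hg'), ← neg_eq_zero, ← map_neg, ← h2, map_zero]

lemma theta_eq_sum (κ : Block → WordSpace k) (g : WordSpace k) : ∃ S : Finset Block,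
    wlift k (thetaWord κ) g = ∑ b ∈ S, cat k (κ b) (wlift k (stripWord (k := k) b) g) := by
  classical
  have key : ∀ S : Finset Block, g ∈ SP k (fun W => ∀ b q, W = b :: q → b ∈ S) →
      wlift k (thetaWord κ) g = ∑ b ∈ S, cat k (κ b) (wlift k (stripWord (k := k) b) g) := by
    intro S hS
    have := SP_eq_of_eq (f := wlift k (thetaWord κ))
      (g := ∑ b ∈ S, cat k (κ b) ∘ₗ wlift k (stripWord (k := k) b)) (fun W hW => ?_) hS
    · rw [this]
      simp
    · cases W with
      | nil => simp [thetaWord, stripWord]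
      | cons b q =>
        simp only [wlift_wd, thetaWord, LinearMap.sum_apply, LinearMap.comp_apply, stripWord,
          apply_ite, map_zero]
        rw [Finset.sum_ite_eq, if_pos (hW b q rfl)]
  refine ⟨(g.support.toList.flatMap fun W => W.take 1).toFinset, key _ ?_⟩
  refine (Finsupp.mem_supported _ _).2 ?_
  rintro W hW b q rfl
  simp only [List.mem_toFinset, List.mem_flatMap, Finset.mem_toList]
  exact ⟨_, hW, by simp⟩

end Decomposition

section LieElements

variable {k : Type u} [Field k]

/-- Words of degree `n`. -/
def HasDeg (n : ℤ) (W : List Block) : Prop := wdeg W = n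

lemma par_of_deg {n : ℤ} {u : WordSpace k} (hu : u ∈ SP k (HasDeg n)) :
    par k u = sg k n • u := by
  refine SP_eq_of_eq (f := par k) (g := sg k n • LinearMap.id) (fun W hW => ?_) hu
  rw [par_wd, hW]
  rfl

lemma cat_deg {m n r : ℤ} (h : m + n = r) {u v : WordSpace k} (hu : u ∈ SP k (HasDeg m))
    (hv : v ∈ SP k (HasDeg n)) : cat k u v ∈ SP k (HasDeg r) := by
  refine cat_mem_SP (fun W W' hW hW' => ?_) hu hv
  rw [HasDeg, wdeg_append, hW, hW', h]

lemma der_deg (x : ℕ) {n : ℤ} {u : WordSpace k} (hu : u ∈ SP k (HasDeg n)) :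
    der k x u ∈ SP k (HasDeg n) := by
  refine map_mem_of_SP _ (fun W hW => ?_) hu
  clear hu
  subst hW
  induction W with
  | nil => rw [der_nil]; exact zero_mem _
  | cons b W ih =>
    rw [der_cons]
    refine add_mem (wd_mem_SP ?_) (cat_deg (m := b.deg) ?_ (wd_mem_SP ?_) ih)
    · simp [HasDeg]
    · simp
    · simp [HasDeg]

lemma dW_deg {m n : ℤ} (h : m + 1 = n) {u : WordSpace k} (hu : u ∈ SP k (HasDeg n)) :
    dW k u ∈ SP k (HasDeg m) := by
  have block : ∀ b : Block, dW k (wd k [b]) ∈ SP k (HasDeg (b.deg - 1)) := by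
    intro b
    induction b using Block.rec_cons with
    | letter t => rw [dW_letter]; exact zero_mem _
    | cons x b ih =>
      rw [dW_block_cons, ad_apply, par_wd, map_smul, LinearMap.smul_apply, cat_wd, cat_wd]
      refine add_mem (der_deg x ih) (sub_mem (wd_mem_SP ?_) (Submodule.smul_mem _ _
        (wd_mem_SP ?_)))
      · simp [HasDeg]; ring
      · simp [HasDeg]; ring
  refine map_mem_of_SP _ (fun W hW => ?_) hu
  clear hu
  obtain rfl : m = n - 1 := by omega
  clear h
  subst hW
  induction W with
  | nil => rw [dW_nil]; exact zero_mem _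
  | cons b W ih =>
    rw [dW_cons]
    refine add_mem (cat_deg (m := b.deg - 1) (n := wdeg W) ?_ (block b) (wd_mem_SP rfl))
      (Submodule.smul_mem _ _ (cat_deg (m := b.deg) ?_ (wd_mem_SP ?_) ih))
    · simp; ring
    · simp; ring
    · simp [HasDeg]

variable (k) in
/-- Pairs of a derivation `D` and an element `b` that are closed operations: `[d, D] = [b, -]`. -/
structure IsClosedOp (p : (WordSpace k →ₗ[k] WordSpace k) × WordSpace k) : Prop where
  der : IsDer p.1
  deg : ∀ {n : ℤ} {u : WordSpace k}, u ∈ SP k (HasDeg n) → p.1 u ∈ SP k (HasDeg n)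
  deg_snd : p.2 ∈ SP k (HasDeg (-1))
  diff_snd : dW k p.2 = 0
  comm : ∀ u, dW k (p.1 u) = p.1 (dW k u) + ad p.2 u

variable {p q : (WordSpace k →ₗ[k] WordSpace k) × WordSpace k}

lemma IsClosedOp.par (hp : IsClosedOp k p) (u : WordSpace k) : par k (p.1 u) = p.1 (par k u) := by
  induction u using ws_induction with
  | zero => simp
  | add u v hu hv => simp only [map_add, hu, hv]
  | smul c u hu => simp only [map_smul, hu]
  | word W => rw [par_of_deg (hp.deg (n := wdeg W) (wd_mem_SP rfl)), par_wd, map_smul]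

lemma IsClosedOp.par_snd (hp : IsClosedOp k p) : _root_.par k p.2 = -p.2 := by
  rw [par_of_deg hp.deg_snd]
  simp

/-- The bracket of closed operations. -/
def closedBr (p q : (WordSpace k →ₗ[k] WordSpace k) × WordSpace k) :
    (WordSpace k →ₗ[k] WordSpace k) × WordSpace k :=
  (p.1 ∘ₗ q.1 - q.1 ∘ₗ p.1, p.1 q.2 - q.1 p.2)

lemma IsClosedOp.br (hp : IsClosedOp k p) (hq : IsClosedOp k q) :
    IsClosedOp k (closedBr p q) where
  der u v := by
    simp only [closedBr, LinearMap.sub_apply, LinearMap.comp_apply, hp.der u v, hq.der u v,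
      map_add, hp.der _ _, hq.der _ _, map_sub]
    abel
  deg hu := sub_mem (hp.deg (hq.deg hu)) (hq.deg (hp.deg hu))
  deg_snd := sub_mem (hp.deg hq.deg_snd) (hq.deg hp.deg_snd)
  diff_snd := by
    simp only [closedBr]
    rw [map_sub, hp.comm, hq.comm, hp.diff_snd, hq.diff_snd, ad_apply, ad_apply, hp.par_snd,
      hq.par_snd]
    simp only [map_zero, map_neg, LinearMap.neg_apply]
    abel
  comm u := by
    simp only [closedBr, LinearMap.sub_apply, LinearMap.comp_apply]
    rw [map_sub, hp.comm, hq.comm, hq.comm, hp.comm, map_add, map_add, ad_der hp.der hp.par,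
      ad_der hq.der hq.par]
    simp only [ad_apply, map_sub, LinearMap.sub_apply]
    abel

variable (k) in
/-- The closed operation of a closed letter. -/
def closedLetter (x : ℕ) : (WordSpace k →ₗ[k] WordSpace k) × WordSpace k :=
  (_root_.der k x, wd k [Block.letter (.inl x)])

lemma isClosedOp_letter (x : ℕ) : IsClosedOp k (closedLetter k x) where
  der := isDer_der x
  deg hu := der_deg x hu
  deg_snd := wd_mem_SP rfl
  diff_snd := dW_letter _
  comm u := dW_der x u

variable (k) in
/-- The iterated bracket `[⋯[[x, v1], v2], ⋯]`. -/
def lieWord (x : ℕ) (v : List ℕ) :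
    (WordSpace k →ₗ[k] WordSpace k) × WordSpace k :=
  v.foldl (fun p y => closedBr p (closedLetter k y)) (closedLetter k x)

lemma lieWord_nil (x : ℕ) : lieWord k x [] = closedLetter k x := rfl

lemma lieWord_concat (x : ℕ) (v : List ℕ) (y : ℕ) :
    lieWord k x (v ++ [y]) = closedBr (lieWord k x v) (closedLetter k y) := by
  simp [lieWord]

lemma isClosedOp_lieWord (x : ℕ) (v : List ℕ) : IsClosedOp k (lieWord k x v) := by
  induction v using List.reverseRecOn with
  | nil => exact isClosedOp_letter x
  | append_singleton v y ih =>
    rw [lieWord_concat]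
    exact ih.br (isClosedOp_letter y)

lemma lieWord_letters (x : ℕ) (v : List ℕ) :
    (∀ {s : List (ℕ ⊕ ℕ)} {u : WordSpace k}, u ∈ SP k (HasLetters s) →
      (lieWord k x v).1 u ∈ SP k (HasLetters ((x :: v).map Sum.inl ++ s))) ∧
    (lieWord k x v).2 ∈ SP k (HasLetters ((x :: v).map Sum.inl)) := by
  induction v using List.reverseRecOn with
  | nil => exact ⟨fun hu => der_cont x hu, wd_mem_SP (List.Perm.refl _)⟩
  | append_singleton v y ih =>
    have perm : ∀ s : List (ℕ ⊕ ℕ), ((x :: (v ++ [y])).map Sum.inl ++ s).Perm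
        (Sum.inl y :: ((x :: v).map Sum.inl ++ s)) := by
      intro s
      simp only [List.map_cons, List.map_append, List.map_nil, List.cons_append, List.append_assoc,
        List.nil_append]
      exact ((List.perm_middle).cons _).trans (List.Perm.swap _ _ _)
    rw [lieWord_concat]
    refine ⟨fun {s u} hu => sub_mem ?_ ?_, sub_mem ?_ ?_⟩
    · refine SP_mono (fun W h => h.trans ?_) (ih.1 (der_cont y hu))
      simp
    · exact SP_mono (fun W h => h.trans (perm s).symm) (der_cont y (ih.1 hu))
    · refine SP_mono (fun W h => h.trans ?_) (ih.1 (s := [Sum.inl y]) (wd_mem_SP ?_))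
      · exact List.Perm.refl _
      · simp
    · have := perm []
      simp only [List.append_nil] at this
      exact SP_mono (fun W h => h.trans this.symm) (der_cont y ih.2)

/-- Put closed letters in front of a block. -/
def Block.pre (l : List ℕ) (b : Block) : Block := (l ++ b.1, b.2)

/-- The block of closed letters `x v1 v2 ⋯`. -/
def Block.closed : ℕ → List ℕ → Block
  | x, [] => Block.letter (.inl x)
  | x, y :: v => (Block.closed y v).cons x

lemma Block.closed_concat (x : ℕ) (v : List ℕ) (y : ℕ) :
    Block.closed x (v ++ [y]) = Block.pre (x :: v) (Block.letter (.inl y)) := by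
  induction v generalizing x with
  | nil => rfl
  | cons x' v ih =>
    rw [List.cons_append, Block.closed, ih]
    rfl

lemma Block.letters_closed (x : ℕ) (v : List ℕ) :
    (Block.closed x v).letters = (x :: v).map Sum.inl := by
  induction v generalizing x with
  | nil => rfl
  | cons y v ih => rw [Block.closed, Block.letters_cons, ih]; rfl

lemma Block.deg_closed (x : ℕ) (v : List ℕ) : (Block.closed x v).deg = -1 := by
  induction v generalizing x with
  | nil => rfl
  | cons y v ih => rw [Block.closed, Block.deg_cons, ih]

lemma Block.exists_closed (b : Block) (h : ∀ y, Sum.inr y ∉ b.letters) :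
    ∃ x v, b = Block.closed x v := by
  induction b using Block.rec_cons with
  | letter t =>
    rcases t with x | y
    · exact ⟨x, [], rfl⟩
    · exact absurd (by simp) (h y)
  | cons x b ih =>
    simp only [Block.letters_cons, List.mem_cons, not_or] at h
    obtain ⟨y, v, rfl⟩ := ih fun y => (h y).2
    exact ⟨x, y :: v, rfl⟩

variable {x : ℕ}

lemma der_oneBlock {y : ℕ} (hy : some x ≠ some y) {u : WordSpace k}
    (hu : u ∈ SP k (fun W => ∃ c : Block, W = [c] ∧ c.mark (some x) ≠ none)) :
    der k y u ∈ SP k (fun W => ∃ c : Block, W = [c] ∧ Low (some x) 0 W) := by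
  refine map_mem_of_SP _ (fun W hW => ?_) hu
  obtain ⟨c, rfl, hc⟩ := hW
  rw [der_block]
  refine wd_mem_SP ⟨_, rfl, ?_⟩
  rcases hm : c.mark (some x) with _ | ⟨i, j⟩
  · exact absurd hm hc
  · have : (c.cons y).mark (some x) = some (i + 1, j) := by rw [mark_cons_ne hy, hm]; rfl
    rw [low_some this]
    omega

lemma mark_ne_none_of_low {u : WordSpace k}
    (hu : u ∈ SP k (fun W => ∃ c : Block, W = [c] ∧ Low (some x) 0 W)) :
    u ∈ SP k (fun W => ∃ c : Block, W = [c] ∧ c.mark (some x) ≠ none) := by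
  refine SP_mono (fun W => ?_) hu
  rintro ⟨c, rfl, hc⟩
  refine ⟨c, rfl, fun h => ?_⟩
  rw [low_none h] at hc
  exact hc

lemma lieWord_lead {v : List ℕ} (hv : x ∉ v) :
    (∀ b : Block, b.mark (some x) = none → (lieWord k x v).1 (wd k [b]) -
      wd k [b.pre (x :: v)] ∈ SP k (fun W => ∃ c : Block, W = [c] ∧ Low (some x) 0 W)) ∧
    (lieWord k x v).2 - wd k [Block.closed x v] ∈
      SP k (fun W => ∃ c : Block, W = [c] ∧ Low (some x) 0 W) := by
  induction v using List.reverseRecOn with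
  | nil =>
    refine ⟨fun b hb => ?_, ?_⟩
    · rw [lieWord_nil]
      simp only [closedLetter]
      rw [der_block]
      simp only [Block.cons, Block.pre, List.cons_append, List.nil_append, sub_self]
      exact zero_mem _
    · rw [lieWord_nil]
      simp only [closedLetter, Block.closed, sub_self]
      exact zero_mem _
  | append_singleton v y ih =>
    simp only [List.mem_append, List.mem_singleton, not_or] at hv
    have hy : some x ≠ some y := fun h => hv.2 (Option.some.inj h)
    obtain ⟨ih1, ih2⟩ := ih hv.1
    have one : ∀ {u : WordSpace k} {c : Block}, c.mark (some x) ≠ none → u - wd k [c] ∈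
        SP k (fun W => ∃ c : Block, W = [c] ∧ Low (some x) 0 W) → der k y u ∈
        SP k (fun W => ∃ c : Block, W = [c] ∧ Low (some x) 0 W) := by
      intro u c hc hu
      refine der_oneBlock hy ?_
      have := add_mem (mark_ne_none_of_low hu) (wd_mem_SP (k := k)
        (P := fun W => ∃ c : Block, W = [c] ∧ c.mark (some x) ≠ none) ⟨c, rfl, hc⟩)
      rwa [sub_add_cancel] at this
    have mark_pre : ∀ (v : List ℕ) (b : Block), (b.pre (x :: v)).mark (some x) ≠ none := by
      intro v b
      rw [show b.pre (x :: v) = (b.pre v).cons x from rfl, mark_cons_self rfl]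
      simp
    have mark_closed : (Block.closed x v).mark (some x) ≠ none := by
      cases v with
      | nil => rw [Block.closed, mark_inl_self rfl]; simp
      | cons y v => rw [Block.closed, mark_cons_self rfl]; simp
    rw [lieWord_concat]
    simp only [closedBr, closedLetter, LinearMap.sub_apply, LinearMap.comp_apply]
    refine ⟨fun b hb => ?_, ?_⟩
    · have hb' : (b.cons y).mark (some x) = none := by rw [mark_cons_ne hy, hb]; rfl
      have h1 := sub_mem (ih1 _ hb') (one (mark_pre v b) (ih1 b hb))
      rw [der_block]
      have e : (b.cons y).pre (x :: v) = b.pre (x :: (v ++ [y])) := by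
        simp [Block.pre, Block.cons]
      rw [e] at h1
      rwa [sub_right_comm]
    · have h1 := sub_mem (ih1 _ (mark_inl_ne hy)) (one mark_closed ih2)
      rw [Block.closed_concat]
      rwa [sub_right_comm]

/-- The closed letters of a block. -/
def Block.closedList (b : Block) : List ℕ := b.1 ++ b.2.elim (fun x => [x]) fun _ => []

lemma Block.closedList_closed (x : ℕ) (v : List ℕ) : (Block.closed x v).closedList = x :: v := by
  induction v generalizing x with
  | nil => rfl
  | cons y v ih => exact congrArg (x :: ·) (ih y)

variable (k) in
/-- The cycles with leading term a given block. -/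
def frontCycle : Option ℕ → Block → WordSpace k
  | none, b => wd k [b]
  | some x, b => (lieWord k x b.closedList.tail).2

lemma isFront_none {b : Block} (h : b.IsFront none) : ∃ y, b = Block.letter (.inr y) := by
  obtain ⟨j, hj⟩ := h
  induction b using Block.rec_cons with
  | letter t =>
    rcases t with x | y
    · rw [mark_inl_ne (by simp)] at hj
      cases hj
    · exact ⟨y, rfl⟩
  | cons x b ih =>
    rw [mark_cons_ne (by simp)] at hj
    rcases h : b.mark none with _ | p <;> simp [h] at hj

lemma isFront_some {b : Block} (h : b.IsFront (some x)) (hg : GoodLetters (some x) b.letters) :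
    ∃ v, b = Block.closed x v ∧ x ∉ v := by
  obtain ⟨h1, h2⟩ := hg x rfl
  obtain ⟨y, v, rfl⟩ := b.exists_closed h2
  have hy : some x = some y := by
    by_contra hy
    obtain ⟨j, hj⟩ := h
    cases v with
    | nil =>
      rw [Block.closed, mark_inl_ne hy] at hj
      cases hj
    | cons y' v =>
      rw [Block.closed, mark_cons_ne hy] at hj
      rcases h : (Block.closed y' v).mark (some x) with _ | p <;> simp [h] at hj
  obtain rfl := Option.some.inj hy
  refine ⟨v, rfl, ?_⟩
  rw [Block.letters_closed] at h1
  have := List.Nodup.of_map _ h1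
  exact (List.nodup_cons.1 this).1

lemma frontCycles (z : Option ℕ) : FrontCycles z (frontCycle k z) := by
  rcases z with _ | x
  · refine ⟨fun b h _ => ?_, fun b h _ => ?_, fun b h _ => ?_, fun b h _ => ?_⟩
    · rw [frontCycle, sub_self]
      exact zero_mem _
    · refine wd_mem_SP ?_
      simp [HasLetters]
    · obtain ⟨y, rfl⟩ := isFront_none h
      exact dW_letter _
    · simp [frontCycle]
  · refine ⟨fun b h hg => ?_, fun b h hg => ?_, fun b h hg => ?_, fun b h hg => ?_⟩ <;>
      obtain ⟨v, rfl, hv⟩ := isFront_some h hg <;>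
      simp only [frontCycle, Block.closedList_closed, List.tail_cons]
    · exact (lieWord_lead hv).2
    · rw [Block.letters_closed]
      exact (lieWord_letters x v).2
    · exact (isClosedOp_lieWord x v).diff_snd
    · rw [Block.deg_closed, sg_neg_one, neg_one_smul]
      exact (isClosedOp_lieWord x v).par_snd

/-- Combinations of products of open letters and of the elements of iterated brackets of closed
letters. -/
inductive GenVal : List (ℕ ⊕ ℕ) → WordSpace k → Prop
  | zero {s : List (ℕ ⊕ ℕ)} : GenVal s 0
  | add {s : List (ℕ ⊕ ℕ)} {u v : WordSpace k} : GenVal s u → GenVal s v → GenVal s (u + v)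
  | smul {s : List (ℕ ⊕ ℕ)} (c : k) {u : WordSpace k} : GenVal s u → GenVal s (c • u)
  | unit : GenVal [] (wd k [])
  | op {s : List (ℕ ⊕ ℕ)} {u : WordSpace k} (y : ℕ) :
      GenVal s u → GenVal (Sum.inr y :: s) (cat k (wd k [Block.letter (.inr y)]) u)
  | cl {s : List (ℕ ⊕ ℕ)} {u : WordSpace k} (x : ℕ) (v : List ℕ) :
      GenVal s u → GenVal ((x :: v).map Sum.inl ++ s) (cat k (lieWord k x v).2 u)
  | perm {s s' : List (ℕ ⊕ ℕ)} {u : WordSpace k} : s.Perm s' → GenVal s u → GenVal s' u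

lemma GenVal.frontCycle {z : Option ℕ} {b : Block} (hb : b.IsFront z)
    (hg : GoodLetters z b.letters) {s : List (ℕ ⊕ ℕ)} {u : WordSpace k} (hu : GenVal s u) :
    GenVal (b.letters ++ s) (cat k (frontCycle k z b) u) := by
  rcases z with _ | x
  · obtain ⟨y, rfl⟩ := isFront_none hb
    exact hu.op y
  · obtain ⟨v, rfl, hv⟩ := isFront_some hb hg
    rw [Block.letters_closed]
    simp only [_root_.frontCycle, Block.closedList_closed, List.tail_cons]
    exact hu.cl x v

variable (k) in
/-- The combinations of such products and boundaries. -/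
def genValSub (s : List (ℕ ⊕ ℕ)) : Submodule k (WordSpace k) where
  carrier := {u | GenVal s u}
  zero_mem' := .zero
  add_mem' := .add
  smul_mem' c _ := .smul c

lemma Block.letters_ne_nil (b : Block) : b.letters ≠ [] := by
  simp [Block.letters]

lemma cycle_mem (n : ℕ) : ∀ {s : List (ℕ ⊕ ℕ)}, s.length = n → s.Nodup → ∀ {f : WordSpace k},
    f ∈ SP k (HasLetters s) → dW k f = 0 →
    f ∈ genValSub k s ⊔ (SP k (HasLetters s)).map (dW k) := by
  induction n using Nat.strong_induction_on with
  | _ n ih =>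
    intro s hn hs f hf hdf
    rcases s with _ | ⟨t0, s0⟩
    · refine Submodule.mem_sup_left (SP_le (M := genValSub k []) (fun W hW => ?_) hf)
      have : W = [] := by
        rcases W with _ | ⟨b, W⟩
        · rfl
        · have := List.append_eq_nil_iff.1 hW.eq_nil
          exact absurd this.1 b.letters_ne_nil
      subst this
      exact GenVal.unit
    obtain ⟨z, t, ht, hsp, hz⟩ : ∃ (z : Option ℕ) (t : ℕ ⊕ ℕ), t ∈ t0 :: s0 ∧
        (∀ x, t = Sum.inl x → z = some x) ∧ ∀ x, z = some x → ∀ y, Sum.inr y ∉ t0 :: s0 := by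
      by_cases h : ∃ y, Sum.inr y ∈ t0 :: s0
      · obtain ⟨y, hy⟩ := h
        exact ⟨none, Sum.inr y, hy, by simp, by simp⟩
      · push Not at h
        rcases t0 with x | y
        · exact ⟨some x, Sum.inl x, by simp, by simp, fun _ _ => h⟩
        · exact absurd (by simp) (h y)
    set s := t0 :: s0 with hs_def
    have hg : ∀ W, HasLetters s W → GoodLetters z (wletters W) := fun W hW x hx =>
      ⟨hW.nodup_iff.2 hs, fun y hy => hz x hx y (hW.mem_iff.1 hy)⟩
    obtain ⟨g, hg', n', hn', rfl, htd⟩ := exists_decomposition (frontCycles z) hg ht hsp hf hdf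
    refine add_mem ?_ (Submodule.mem_sup_right ⟨n', hn', rfl⟩)
    obtain ⟨S, hS⟩ := theta_eq_sum (frontCycle k z) g
    rw [hS]
    refine sum_mem fun b _ => ?_
    have hd : dW k (wlift k (stripWord (k := k) b) g) = 0 := by
      have := strip_tailDiff b g
      rw [htd, map_zero] at this
      have h2 := congrArg (sg k b.deg • ·) this.symm
      simpa [smul_smul, sg_mul_self] using h2
    have hst : wlift k (stripWord (k := k) b) g ∈
        SP k (fun q => b.IsFront z ∧ HasLetters s (b :: q)) := by
      refine map_mem_of_SP _ (fun W hW => ?_) hg'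
      rw [wlift_wd]
      cases W with
      | nil => exact zero_mem _
      | cons c q =>
        rw [stripWord]
        split_ifs with h
        · subst h
          exact wd_mem_SP hW
        · exact zero_mem _
    by_cases hzero : wlift k (stripWord (k := k) b) g = 0
    · rw [hzero, map_zero]
      exact zero_mem _
    obtain ⟨q, hq⟩ := Finsupp.support_nonempty_iff.2 hzero
    obtain ⟨hb, hq⟩ := (Finsupp.mem_supported _ _).1 hst hq
    have hgb : GoodLetters z b.letters := (hg _ hq).sublist (List.sublist_append_left _ _)
    have hst' : wlift k (stripWord (k := k) b) g ∈ SP k (HasLetters (wletters q)) :=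
      SP_mono (fun q' h => (List.perm_append_left_iff _).1 (h.2.trans hq.symm)) hst
    have hlen : (wletters q).length < n := by
      rw [← hn, ← hq.length_eq, wletters_cons, List.length_append]
      have := List.length_pos_iff.2 b.letters_ne_nil
      omega
    have hnd : (wletters q).Nodup := (hq.nodup_iff.2 hs).sublist (List.sublist_append_right _ _)
    obtain ⟨x, hx, _, ⟨m, hm, rfl⟩, he⟩ := Submodule.mem_sup.1 (ih _ hlen rfl hnd hst' hd)
    rw [← he, map_add]
    refine add_mem (Submodule.mem_sup_left ?_) (Submodule.mem_sup_right
      ⟨sg k b.deg • cat k (frontCycle k z b) m, Submodule.smul_mem _ _ (cat_mem_SP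
        (fun W W' hW hW' => ?_) ((frontCycles z).letters b hb hgb) hm), ?_⟩)
    · exact (GenVal.frontCycle hb hgb hx).perm hq
    · refine List.Perm.trans ?_ hq
      rw [wletters_append]
      exact hW.append hW'
    · rw [map_smul, isOddDer_dW, (frontCycles z).diff b hb hgb, (frontCycles z).par b hb hgb]
      simp [smul_smul, sg_mul_self]

end LieElements

section FreeAlgebraModel

variable {k : Type u} [Field k]

lemma closedBr_add_left (p p' q : (WordSpace k →ₗ[k] WordSpace k) × WordSpace k) :
    closedBr (p + p') q = closedBr p q + closedBr p' q := by
  refine Prod.ext (LinearMap.ext fun u => ?_) ?_ <;>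
    simp only [closedBr, Prod.fst_add, Prod.snd_add, LinearMap.sub_apply, LinearMap.add_apply,
      LinearMap.comp_apply, map_add] <;> abel

lemma closedBr_smul_left (c : k) (p q : (WordSpace k →ₗ[k] WordSpace k) × WordSpace k) :
    closedBr (c • p) q = c • closedBr p q := by
  refine Prod.ext (LinearMap.ext fun u => ?_) ?_ <;>
    simp only [closedBr, Prod.smul_fst, Prod.smul_snd, LinearMap.sub_apply, LinearMap.smul_apply,
      LinearMap.comp_apply, map_smul, smul_sub]

lemma closedBr_symm (p q : (WordSpace k →ₗ[k] WordSpace k) × WordSpace k) :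
    closedBr p q = -closedBr q p := by
  refine Prod.ext (LinearMap.ext fun u => ?_) ?_ <;> simp [closedBr]

lemma closedBr_add_right (p q q' : (WordSpace k →ₗ[k] WordSpace k) × WordSpace k) :
    closedBr p (q + q') = closedBr p q + closedBr p q' := by
  refine Prod.ext (LinearMap.ext fun u => ?_) ?_ <;>
    simp only [closedBr, Prod.fst_add, Prod.snd_add, LinearMap.sub_apply, LinearMap.add_apply,
      LinearMap.comp_apply, map_add] <;> abel

lemma closedBr_smul_right (c : k) (p q : (WordSpace k →ₗ[k] WordSpace k) × WordSpace k) :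
    closedBr p (c • q) = c • closedBr p q := by
  refine Prod.ext (LinearMap.ext fun u => ?_) ?_ <;>
    simp only [closedBr, Prod.smul_fst, Prod.smul_snd, LinearMap.sub_apply, LinearMap.smul_apply,
      LinearMap.comp_apply, map_smul, smul_sub]

lemma closedBr_zero_left (p : (WordSpace k →ₗ[k] WordSpace k) × WordSpace k) :
    closedBr 0 p = 0 := by
  simpa using closedBr_smul_left (0 : k) 0 p

lemma closedBr_zero_right (p : (WordSpace k →ₗ[k] WordSpace k) × WordSpace k) :
    closedBr p 0 = 0 := by
  simpa using closedBr_smul_right (0 : k) p 0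

lemma closedBr_jacobi (p q r : (WordSpace k →ₗ[k] WordSpace k) × WordSpace k) :
    closedBr (closedBr p q) r + closedBr (closedBr q r) p + closedBr (closedBr r p) q = 0 := by
  refine Prod.ext (LinearMap.ext fun u => ?_) ?_ <;>
    simp only [closedBr, Prod.fst_add, Prod.snd_add, LinearMap.sub_apply, LinearMap.add_apply,
      LinearMap.comp_apply, map_sub, Prod.fst_zero, Prod.snd_zero, LinearMap.zero_apply] <;> abel

variable (k) in
/-- The closed operations, in degree `0`. -/
def closedSub (n : ℤ) : Submodule k ((WordSpace k →ₗ[k] WordSpace k) × WordSpace k) where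
  carrier := {p | IsClosedOp k p ∧ (n ≠ 0 → p = 0)}
  zero_mem' := by
    refine ⟨⟨fun u v => ?_, fun _ => zero_mem _, zero_mem _, map_zero _, fun u => ?_⟩, fun _ => rfl⟩
    · simp
    · simp [ad_apply]
  add_mem' := by
    rintro p q ⟨hp, hp'⟩ ⟨hq, hq'⟩
    refine ⟨⟨fun u v => ?_, fun hu => add_mem (hp.deg hu) (hq.deg hu),
      add_mem hp.deg_snd hq.deg_snd, ?_, fun u => ?_⟩, fun h => by simp [hp' h, hq' h]⟩
    · simp only [Prod.fst_add, LinearMap.add_apply, hp.der u v, hq.der u v, map_add]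
      abel
    · simp [hp.diff_snd, hq.diff_snd]
    · simp only [Prod.fst_add, Prod.snd_add, LinearMap.add_apply, map_add, hp.comm, hq.comm,
        ad_apply]
      abel
  smul_mem' := by
    rintro c p ⟨hp, hp'⟩
    refine ⟨⟨fun u v => ?_, fun hu => Submodule.smul_mem _ _ (hp.deg hu),
      Submodule.smul_mem _ _ hp.deg_snd, ?_, fun u => ?_⟩, fun h => by simp [hp' h]⟩
    · simp [hp.der u v]
    · simp [hp.diff_snd]
    · simp only [Prod.smul_fst, Prod.smul_snd, LinearMap.smul_apply, map_smul, hp.comm, ad_apply,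
        smul_add, smul_sub]

instance (n : ℤ) : AddCommGroup (closedSub k n) :=
  Module.addCommMonoidToAddCommGroup k

variable (k) in
/-- The closed part of the free model. -/
def freeClosed : ChainComplex (ModuleCat.{u} k) ℤ where
  X n := ModuleCat.of k (closedSub k n)
  d _ _ := 0
  shape _ _ _ := rfl
  d_comp_d' _ _ _ _ _ := by simp

variable (k) in
/-- The open part of the free model. -/
def freeOpen : ChainComplex (ModuleCat.{u} k) ℤ where
  X n := ModuleCat.of k (SP k (HasDeg n))
  d i j := if h : j + 1 = i then ModuleCat.ofHom ((dW k).restrict fun _ hu => dW_deg h hu) else 0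
  shape i j h := dif_neg h
  d_comp_d' i j l h h' := by
    rw [dif_pos (show j + 1 = i from h), dif_pos (show l + 1 = j from h')]
    refine ModuleCat.hom_ext (LinearMap.ext fun x => Subtype.ext ?_)
    exact dW_dW x.1

/-- The value of an element of the closed part of the free model. -/
def clVal {n : ℤ} : (freeClosed k).X n →ₗ[k] (WordSpace k →ₗ[k] WordSpace k) × WordSpace k :=
  (closedSub k n).subtype

/-- The value of an element of the open part of the free model. -/
def opVal {n : ℤ} : (freeOpen k).X n →ₗ[k] WordSpace k := (SP k (HasDeg n)).subtype

lemma clVal_injective {n : ℤ} : Function.Injective (clVal (k := k) (n := n)) :=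
  Subtype.val_injective

lemma opVal_injective {n : ℤ} : Function.Injective (opVal (k := k) (n := n)) :=
  Subtype.val_injective

lemma clVal_mem {n : ℤ} (x : (freeClosed k).X n) : clVal x ∈ closedSub k n := Subtype.property x

lemma opVal_mem {n : ℤ} (x : (freeOpen k).X n) : opVal x ∈ SP k (HasDeg n) := Subtype.property x

/-- An element of the closed part of the free model. -/
def clMk {n : ℤ} (p : (WordSpace k →ₗ[k] WordSpace k) × WordSpace k) (h : p ∈ closedSub k n) :
    (freeClosed k).X n := Subtype.mk p h

/-- An element of the open part of the free model. -/
def opMk {n : ℤ} (p : WordSpace k) (h : p ∈ SP k (HasDeg n)) : (freeOpen k).X n := Subtype.mk p h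

@[simp] lemma clVal_mk {n : ℤ} (p : (WordSpace k →ₗ[k] WordSpace k) × WordSpace k)
    (h : p ∈ closedSub k n) : clVal (clMk p h) = p := rfl

@[simp] lemma opVal_mk {n : ℤ} (p : WordSpace k) (h : p ∈ SP k (HasDeg n)) :
    opVal (opMk p h) = p := rfl

lemma opVal_d {i j : ℤ} (h : j + 1 = i) (x : (freeOpen k).X i) :
    opVal (((freeOpen k).d i j).hom x) = dW k (opVal x) := by
  have : (freeOpen k).d i j = ModuleCat.ofHom ((dW k).restrict fun _ hu => dW_deg h hu) :=
    dif_pos h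
  rw [this]
  rfl

lemma freeClosed_d {i j : ℤ} (x : (freeClosed k).X i) : ((freeClosed k).d i j).hom x = 0 := rfl

lemma eq_zero_of_deg {n : ℤ} (h : n ≠ 0) (x : (freeClosed k).X n) : x = 0 :=
  clVal_injective (((clVal_mem x).2 h).trans (map_zero _).symm)

/-- The bracket of the free model. -/
def freeBr {m n r : ℤ} (h : m + n = r) :
    (freeClosed k).X m →ₗ[k] (freeClosed k).X n →ₗ[k] (freeClosed k).X r :=
  LinearMap.mk₂ k (fun x y => clMk (closedBr (clVal x) (clVal y))
      ⟨(clVal_mem x).1.br (clVal_mem y).1, fun hr => by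
        by_cases hm : m = 0
        · rw [(clVal_mem y).2 (by omega), closedBr_zero_right]
        · rw [(clVal_mem x).2 hm, closedBr_zero_left]⟩)
    (fun x x' y => clVal_injective (closedBr_add_left (clVal x) (clVal x') (clVal y)))
    (fun c x y => clVal_injective (closedBr_smul_left c (clVal x) (clVal y)))
    (fun x y y' => clVal_injective (closedBr_add_right (clVal x) (clVal y) (clVal y')))
    (fun c x y => clVal_injective (closedBr_smul_right c (clVal x) (clVal y)))

@[simp] lemma clVal_freeBr {m n r : ℤ} (h : m + n = r) (x : (freeClosed k).X m)
    (y : (freeClosed k).X n) : clVal (freeBr h x y) = closedBr (clVal x) (clVal y) := rfl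

/-- The product of the free model. -/
def freeMul {m n r : ℤ} (h : m + n = r) :
    (freeOpen k).X m →ₗ[k] (freeOpen k).X n →ₗ[k] (freeOpen k).X r :=
  LinearMap.mk₂ k (fun x y => opMk (cat k (opVal x) (opVal y))
      (cat_deg h (opVal_mem x) (opVal_mem y)))
    (fun x x' y => opVal_injective (by simp))
    (fun c x y => opVal_injective (by simp))
    (fun x y y' => opVal_injective (by simp))
    (fun c x y => opVal_injective (by simp))

@[simp] lemma opVal_freeMul {m n r : ℤ} (h : m + n = r) (x : (freeOpen k).X m)
    (y : (freeOpen k).X n) : opVal (freeMul h x y) = cat k (opVal x) (opVal y) := rfl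

/-- The action of the free model. -/
def freeAct {m n r : ℤ} (h : m + n = r) :
    (freeClosed k).X m →ₗ[k] (freeOpen k).X n →ₗ[k] (freeOpen k).X r :=
  LinearMap.mk₂ k (fun x y => opMk ((clVal x).1 (opVal y)) (by
        by_cases hm : m = 0
        · obtain rfl : n = r := by omega
          exact (clVal_mem x).1.deg (opVal_mem y)
        · rw [(clVal_mem x).2 hm]
          exact zero_mem _))
    (fun x x' y => opVal_injective (by simp))
    (fun c x y => opVal_injective (by simp))
    (fun x y y' => opVal_injective (by simp))
    (fun c x y => opVal_injective (by simp))

@[simp] lemma opVal_freeAct {m n r : ℤ} (h : m + n = r) (x : (freeClosed k).X m)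
    (y : (freeOpen k).X n) : opVal (freeAct h x y) = (clVal x).1 (opVal y) := rfl

/-- The map from the closed to the open part of the free model. -/
def freeBeta {m n : ℤ} (h : n + 1 = m) :
    (freeClosed k).X m →ₗ[k] (freeOpen k).X n where
  toFun x := opMk (clVal x).2 (by
    by_cases hm : m = 0
    · obtain rfl : n = -1 := by omega
      exact (clVal_mem x).1.deg_snd
    · rw [(clVal_mem x).2 hm]
      exact zero_mem _)
  map_add' x y := opVal_injective (by simp)
  map_smul' c x := opVal_injective (by simp)

@[simp] lemma opVal_freeBeta {m n : ℤ} (h : n + 1 = m) (x : (freeClosed k).X m) :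
    opVal (freeBeta h x) = (clVal x).2 := rfl

lemma map_units {M N : Type*} [AddCommGroup M] [Module k M] [AddCommGroup N] [Module k N]
    (f : M →ₗ[k] N) (s : ℤˣ) (x : M) : f (s • x) = s • f x := by
  simp [Units.smul_def]

variable (k) in
/-- The Lie algebra structure on the closed part of the free model, with zero product. -/
def freeGer : LambdaGerAlgebra (freeClosed k) where
  br := freeBr
  mul _ := 0
  br_symm {m n r} h x y := by
    by_cases hm : m = 0
    · subst hm
      refine clVal_injective ?_
      simpa using closedBr_symm _ _
    · rw [eq_zero_of_deg hm x]
      simp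
  mul_symm _ _ _ := by simp
  mul_assoc _ _ _ _ := by simp
  jacobi {m n p r} h x y z := by
    by_cases hm : m = 0
    · by_cases hp : p = 0
      · subst hm hp
        refine clVal_injective ?_
        simpa using closedBr_jacobi _ _ _
      · rw [eq_zero_of_deg hp z]
        simp
    · rw [eq_zero_of_deg hm x]
      simp
  leibniz _ _ _ _ := by simp
  diff_br _ _ _ := by simp [freeClosed_d]
  diff_mul _ _ _ := by simp [freeClosed_d]

variable (k) in
/-- The associative algebra structure on the open part of the free model. -/
def freeAssoc : DGAssocAlgebra (freeOpen k) where
  mul := freeMul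
  mul_assoc h a b c := opVal_injective (by simp [cat_assoc])
  diff_mul {m n r} h a b := opVal_injective (by
    rw [opVal_d (sub_add_cancel r 1), map_add, map_units, opVal_freeMul, opVal_freeMul,
      opVal_freeMul, opVal_d (sub_add_cancel m 1), opVal_d (sub_add_cancel n 1), isOddDer_dW,
      par_of_deg (opVal_mem a), map_smul, LinearMap.smul_apply, sg_smul])

variable (k) in
/-- The free model is an algebra over `sc^!`. -/
def freeSc : ScAlgebra (freeClosed k) (freeOpen k) where
  ger := freeGer k
  assoc := freeAssoc k
  act := freeAct
  beta := freeBeta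
  act_br {m n p r} h x y a := by
    by_cases hm : m = 0
    · subst hm
      refine opVal_injective ?_
      simp [freeGer, closedBr]
    · rw [eq_zero_of_deg hm x]
      simp
  act_mul {m n p r} h x a b := by
    by_cases hm : m = 0
    · subst hm
      refine opVal_injective ?_
      simpa [freeAssoc] using (clVal_mem x).1.der _ _
    · rw [eq_zero_of_deg hm x]
      simp
  act_ger_mul h x y a := by simp [freeGer]
  beta_br {m n r} h x y := by
    by_cases hm : m = 0
    · by_cases hn : n = 0
      · subst hm hn
        refine opVal_injective ?_
        simp [freeGer, closedBr]
      · rw [eq_zero_of_deg hn y]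
        simp
    · rw [eq_zero_of_deg hm x]
      simp
  beta_ger_mul h x y := by simp [freeGer]
  diff_beta {m n} h x := by
    rw [freeClosed_d, map_zero, neg_zero]
    refine opVal_injective ?_
    rw [opVal_d (sub_add_cancel n 1), opVal_freeBeta, (clVal_mem x).1.diff_snd, map_zero]
  diff_act {m n r} h x a := by
    by_cases hm : m = 0
    · subst hm
      obtain rfl : n = r := by omega
      refine opVal_injective ?_
      rw [freeClosed_d, map_zero, LinearMap.zero_apply, zero_add, opVal_d (sub_add_cancel n 1),
        opVal_freeAct, (clVal_mem x).1.comm, map_add, map_sub, map_units, map_units, opVal_freeAct,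
        opVal_d (sub_add_cancel n 1), ad_apply, par_of_deg (opVal_mem a), map_smul,
        LinearMap.smul_apply, sg_smul]
      simp only [freeAssoc, opVal_freeMul, opVal_freeBeta, Int.negOnePow_zero, one_smul]
      rw [show ((0 - 1) * n).negOnePow = n.negOnePow by simp, add_comm]
    · rw [eq_zero_of_deg hm x]
      simp

end FreeAlgebraModel

section LetterEvaluation

open Color

section

variable {k : Type u} [Field k] {V : Color → ChainComplex (ModuleCat.{w} k) ℤ}
  (S : ScAlgebra (V cl) (V op))

lemma ScAlgebra.ev_bin {b1 b2 l' : List Color} {x y d : Color} {p p1 p2 r n s : ℤ}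
    (hl' : l' = b1 ++ b2) (hr : p + p1 + p2 = r) {γ : (scDual k).obj [x, y] d p}
    (f1 : (scDual k).obj b1 x p1) (f2 : (scDual k).obj b2 y p2)
    (F : ∀ {m n r : ℤ}, p + (m + n) = r → ((V x).X m →ₗ[k] (V y).X n →ₗ[k] (V d).X r))
    (hγ : S.ev γ = binOp F) {u v : List (HomEl V)} (hu : cols u = b1) (hv : cols v = b2)
    (hu' : degs u = 0) (hn : p2 + degs v = n) (hs : p + (p1 + n) = s) :
    (S.ev ((scDual k).bin hl' hr γ f1 f2)).1 (u ++ v) s =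
      F hs ((S.ev f1).1 u p1) ((S.ev f2).1 v n) := by
  have e1 := endComp_apply (l := b1 ++ [y]) (l' := l') b1 [] rfl (by simp [hl']) hr
    (S.ev ((scDual k).comp (l := [x, y]) [] [y] rfl (by simp) rfl γ f1)) (S.ev f2) u v [] s hu hv rfl
  have e2 := endComp_apply (l := [x, y]) (l' := b1 ++ [y]) (b := b1) [] [y] rfl (by simp) rfl
    (S.ev γ) (S.ev f1) [] u [HomEl.out y ((S.ev f2).1 v) (p2 + degs v)] s rfl hu rfl
  rw [DGOperad.bin, S.ev_comp]
  rw [show u ++ v ++ [] = u ++ v from List.append_nil _] at e1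
  refine e1.trans ?_
  rw [hu', mul_zero, Int.negOnePow_zero, one_smul]
  rw [S.ev_comp]
  refine e2.trans ?_
  rw [degs_nil, mul_zero, Int.negOnePow_zero, one_smul, hγ, HomEl.out_eq _ hn,
    HomEl.out_eq _ (show p1 + degs u = p1 by omega)]
  exact binOp_apply F _ _ hs

lemma ScAlgebra.ev_un {b l' : List Color} {x d : Color} {p q r n s : ℤ}
    (hl' : l' = [] ++ b ++ []) (hr : p + q = r) {γ : (scDual k).obj [x] d p} (f : (scDual k).obj b x q)
    (F : ∀ {m r : ℤ}, p + m = r → ((V x).X m →ₗ[k] (V d).X r))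
    (hγ : S.ev γ = unOp F) {v : List (HomEl V)} (hv : cols v = b) (hn : q + degs v = n)
    (hs : p + n = s) :
    (S.ev ((scDual k).comp [] [] rfl hl' hr γ f)).1 v s = F hs ((S.ev f).1 v n) := by
  have e1 := endComp_apply (l := [x]) [] [] rfl hl' hr (S.ev γ) (S.ev f) [] v [] s rfl hv rfl
  rw [S.ev_comp]
  rw [show [] ++ v ++ [] = v from List.append_nil _] at e1
  refine e1.trans ?_
  rw [degs_nil, mul_zero, Int.negOnePow_zero, one_smul, hγ, HomEl.out_eq _ hn]
  exact unOp_apply F _ hs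

lemma dSumL_eq_zero {l : List Color} {d : Color} {p : ℤ} {F : List (HomEl V) → ∀ r, (V d).X r}
    (hF : IsMultiOp l d p F) (s : ℤ) (v : List (HomEl V)) (hv : ∀ a ∈ v, a.diff.val = 0) :
    ∀ u, dSumL v (fun v' => F (u ++ v') s) = 0 := by
  induction v with
  | nil => exact fun _ => rfl
  | cons a v ih =>
    intro u
    have h := ih (fun b hb => hv b (List.mem_cons_of_mem _ hb)) (u ++ [a])
    simp only [List.append_assoc, List.singleton_append] at h
    rw [dSumL, h, smul_zero, add_zero]
    have := hF.map_zero u a.diff.col a.diff.deg v s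
    rwa [← hv a List.mem_cons_self] at this

end

variable (k : Type u) [Field k]

/-- The free model. -/
def freeV : Color → ChainComplex (ModuleCat.{u} k) ℤ
  | cl => freeClosed k
  | op => freeOpen k

/-- The colour of a letter. -/
def lcol : ℕ ⊕ ℕ → Color := Sum.elim (fun _ => cl) fun _ => op

lemma isClosed_mem {p : (WordSpace k →ₗ[k] WordSpace k) × WordSpace k} (h : IsClosedOp k p) :
    p ∈ closedSub k 0 := ⟨h, fun h => absurd rfl h⟩

/-- A letter as an element of the free model. -/
def letterEl : ℕ ⊕ ℕ → HomEl (freeV k)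
  | .inl i => ⟨cl, 0, clMk (closedLetter k i) (isClosed_mem k (isClosedOp_letter i))⟩
  | .inr i => ⟨op, 0, opMk (wd k [Block.letter (.inr i)]) (wd_mem_SP (by simp [HasDeg]))⟩

/-- A list of letters as elements of the free model. -/
def letterEls (s : List (ℕ ⊕ ℕ)) : List (HomEl (freeV k)) := s.map (letterEl k)

variable {k}

lemma cols_letterEls (s : List (ℕ ⊕ ℕ)) : cols (letterEls k s) = s.map lcol := by
  simp only [cols, letterEls, List.map_map]
  refine List.map_congr_left fun t _ => ?_
  cases t <;> rfl

lemma letterEl_deg (t : ℕ ⊕ ℕ) : (letterEl k t).deg = 0 := by cases t <;> rfl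

lemma degs_letterEls (s : List (ℕ ⊕ ℕ)) : degs (letterEls k s) = 0 := by
  refine List.sum_eq_zero fun x hx => ?_
  simp only [letterEls, List.map_map, List.mem_map] at hx
  obtain ⟨t, -, rfl⟩ := hx
  exact letterEl_deg t

lemma letterEl_diff (t : ℕ ⊕ ℕ) : (letterEl k t).diff.val = 0 := by
  cases t with
  | inl i => rfl
  | inr i =>
    refine opVal_injective ((opVal_d (sub_add_cancel 0 1) _).trans ?_)
    exact (dW_letter _).trans (map_zero _).symm

variable (k) in
/-- The free model as an algebra over `sc^!`. -/
def freeAlg : ScAlgebra (freeV k cl) (freeV k op) := freeSc k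

variable (k) in
/-- The action of `sc^!` on the free model. -/
def freeEv {l : List Color} {d : Color} {p : ℤ} :
    (scDual k).obj l d p →ₗ[k] EndObj (freeV k) l d p :=
  (freeAlg k).ev

/-- The value of an operation with open output on letters. -/
def wev (s : List (ℕ ⊕ ℕ)) {l : List Color} {p : ℤ} :
    (scDual k).obj l op p →ₗ[k] WordSpace k where
  toFun f := opVal ((freeEv k f).1 (letterEls k s) p)
  map_add' f g := by rw [map_add]; rfl
  map_smul' c f := by rw [map_smul]; rfl

/-- The value of an operation with closed output on letters. -/
def cev (s : List (ℕ ⊕ ℕ)) {l : List Color} {p : ℤ}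
    (f : (scDual k).obj l cl p) : (WordSpace k →ₗ[k] WordSpace k) × WordSpace k :=
  clVal ((freeEv k f).1 (letterEls k s) p)

variable {s t : List (ℕ ⊕ ℕ)} {l l' b1 b2 : List Color} {p q r p1 p2 : ℤ}

lemma wev_deg (f : (scDual k).obj l op p) : wev s f ∈ SP k (HasDeg p) := opVal_mem _

lemma wev_n02 (hl' : l' = b1 ++ b2) (hr : 0 + p1 + p2 = r) (f : (scDual k).obj b1 op p1)
    (g : (scDual k).obj b2 op p2) (hs : s.map lcol = b1) (ht : t.map lcol = b2) :
    wev (s ++ t) ((scDual k).bin hl' hr (scDualGens k).n02 f g) = cat k (wev s f) (wev t g) := by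
  have := (freeAlg k).ev_bin hl' hr f g
    (fun h => (freeAlg k).assoc.mul (by omega)) (freeAlg k).ev_n02
    (u := letterEls k s) (v := letterEls k t) (s := r) ((cols_letterEls s).trans hs)
    ((cols_letterEls t).trans ht) (degs_letterEls s) (show p2 + _ = p2 by simp [degs_letterEls])
    (by omega)
  simp only [letterEls, ← List.map_append] at this
  exact congrArg opVal this

lemma wev_n11 (hl' : l' = b1 ++ b2) (hr : 0 + 0 + p2 = r) (f : (scDual k).obj b1 cl 0)
    (g : (scDual k).obj b2 op p2) (hs : s.map lcol = b1) (ht : t.map lcol = b2) :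
    wev (s ++ t) ((scDual k).bin hl' hr (scDualGens k).n11 f g) = (cev s f).1 (wev t g) := by
  have := (freeAlg k).ev_bin hl' hr f g
    (fun h => (freeAlg k).act (by omega)) (freeAlg k).ev_n11
    (u := letterEls k s) (v := letterEls k t) (s := r) ((cols_letterEls s).trans hs)
    ((cols_letterEls t).trans ht) (degs_letterEls s) (show p2 + _ = p2 by simp [degs_letterEls])
    (by omega)
  simp only [letterEls, ← List.map_append] at this
  exact congrArg opVal this

lemma cev_l2 (hl' : l' = b1 ++ b2) (hr : 0 + 0 + 0 = r) (f : (scDual k).obj b1 cl 0)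
    (g : (scDual k).obj b2 cl 0) (hs : s.map lcol = b1) (ht : t.map lcol = b2) :
    cev (s ++ t) ((scDual k).bin hl' hr (scDualGens k).l2 f g) = closedBr (cev s f) (cev t g) := by
  have := (freeAlg k).ev_bin hl' hr f g
    (fun h => (freeAlg k).ger.br (by omega)) (freeAlg k).ev_l2
    (u := letterEls k s) (v := letterEls k t) (s := r) ((cols_letterEls s).trans hs)
    ((cols_letterEls t).trans ht) (degs_letterEls s) (show 0 + _ = 0 by simp [degs_letterEls])
    (by omega)
  simp only [letterEls, ← List.map_append] at this
  exact congrArg clVal this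

lemma wev_n10 (hl' : l = [] ++ l ++ []) (f : (scDual k).obj l cl 0) (hs : s.map lcol = l) :
    wev s ((scDual k).comp [] [] rfl hl' (add_zero _) (scDualGens k).n10 f) = (cev s f).2 :=
  congrArg opVal ((freeAlg k).ev_un (p := -1) hl' (add_zero _) f
    (fun h => (freeAlg k).beta (by omega)) (freeAlg k).ev_n10 (v := letterEls k s) (s := -1) ((cols_letterEls s).trans hs)
    (show 0 + _ = 0 by simp [degs_letterEls]) (by omega))

lemma cev_one (i : ℕ) : cev [.inl i] ((scDual k).one cl) = closedLetter k i := by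
  have : (freeEv k ((scDual k).one cl)).1 (letterEls k [.inl i]) 0 =
      clMk (closedLetter k i) (isClosed_mem k (isClosedOp_letter i)) :=
    (congrArg (fun G : EndObj (freeV k) [cl] cl 0 => G.1 _ 0) ((freeAlg k).ev_one cl)).trans
      (endOne_apply (V := freeV k) (x := cl) _)
  exact congrArg clVal this

lemma wev_one (i : ℕ) : wev [.inr i] ((scDual k).one op) = wd k [Block.letter (.inr i)] := by
  have : (freeEv k ((scDual k).one op)).1 (letterEls k [.inr i]) 0 =
      opMk (wd k [Block.letter (.inr i)]) (wd_mem_SP (by simp [HasDeg])) :=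
    (congrArg (fun G : EndObj (freeV k) [op] op 0 => G.1 _ 0) ((freeAlg k).ev_one op)).trans
      (endOne_apply (V := freeV k) (x := op) _)
  exact congrArg opVal this

lemma wev_diff (h : q + 1 = p) (f : (scDual k).obj l op p) :
    wev s ((scDual k).diff h f) = dW k (wev s f) := by
  subst h
  have h1 := (congrArg (fun G : EndObj (freeV k) l op q => G.1 (letterEls k s) q)
    ((freeAlg k).ev_diff rfl f)).trans (endDiff_apply rfl _ _ _)
  have h2 := dSumL_eq_zero (V := freeV k) (freeEv k f).2 q (letterEls k s) (fun a ha => by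
    simp only [letterEls, List.mem_map] at ha
    obtain ⟨t, -, rfl⟩ := ha
    exact letterEl_diff t) []
  simp only [List.nil_append] at h2
  refine (congrArg opVal (h1.trans ((congrArg _ (congrArg _ h2)).trans ?_))).trans
    (opVal_d rfl ((freeEv k f).1 (letterEls k s) (q + 1)))
  rw [smul_zero, sub_zero]
  rfl

lemma wev_act (e : Fin l'.length ≃ Fin l.length) (he : ∀ i, l'.get i = l.get (e i))
    (f : (scDual k).obj l op p) (hs : s.map lcol = l') (ht : t.map lcol = l)
    (h : ∀ i, t[e i]? = s[i]?) : wev s ((scDual k).act e he f) = wev t f := by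
  have h1 := (congrArg (fun G : EndObj (freeV k) l' op p => G.1 (letterEls k s) p)
    ((freeAlg k).ev_act e he f)).trans
    (endAct_apply e he _ _ _ ((cols_letterEls s).trans hs))
  have h2 : permSign e (letterEls k s) = 1 := by
    refine koszul_zero _ _ _ fun i => ?_
    simp only [degVec, letterEls, List.map_map, List.getD_eq_getElem?_getD, List.getElem?_map]
    cases s[i]? with
    | none => rfl
    | some a => exact letterEl_deg a
  have h3 : permL e (letterEls k s) = letterEls k t := by
    refine List.ext_getElem (by simp [letterEls, ← ht]) fun j h1 h2 => ?_
    have h3 := h (e.symm ⟨j, by simpa using h1⟩)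
    rw [e.apply_symm_apply] at h3
    rw [permL_getElem, ← List.getD_eq_getElem _ default h2]
    simp only [letterEls, List.getElem?_map, List.getD_eq_getElem?_getD]
    simp only [Fin.getElem?_fin] at h3
    rw [← h3]
  refine congrArg opVal (h1.trans ?_)
  rw [h2, h3, one_smul]
  rfl

end LetterEvaluation

section Generation

open Color

variable {k : Type u} [Field k]

/-- The shape of a block. -/
def Block.shape (b : Block) : ℕ × Color := (b.1.length, lcol b.2)

@[simp] lemma Block.shape_cons (x : ℕ) (b : Block) :
    (b.cons x).shape = (b.shape.1 + 1, b.shape.2) := rfl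

lemma blockCols_shape (b : Block) : b.letters.map lcol = blockCols b.shape.1 b.shape.2 := by
  induction b using Block.rec_cons with
  | letter t => rfl
  | cons x b ih => simpa [blockCols, lcol] using ih

lemma wordCols_shape (b : Block) (W : List Block) :
    (wletters (b :: W)).map lcol = wordCols b.shape (W.map Block.shape) := by
  induction W generalizing b with
  | nil => simpa [wordCols] using blockCols_shape b
  | cons c W ih =>
    rw [wletters_cons, List.map_append, ih, blockCols_shape]
    rfl

lemma exists_block (n : ℕ) (c : Color) (s : List (ℕ ⊕ ℕ)) (hs : s.map lcol = blockCols n c) :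
    ∃ b : Block, b.shape = (n, c) ∧ b.letters = s := by
  induction n generalizing s with
  | zero =>
    obtain ⟨t, rfl, rfl⟩ : ∃ t, s = [t] ∧ lcol t = c := by
      simpa [blockCols, List.map_eq_cons_iff] using hs
    exact ⟨Block.letter t, rfl, rfl⟩
  | succ n ih =>
    obtain ⟨t, s', rfl, ht, hs'⟩ := List.map_eq_cons_iff.1 hs
    obtain ⟨b, hb, rfl⟩ := ih s' hs'
    cases t with
    | inl x => exact ⟨b.cons x, by simp [hb], by simp⟩
    | inr y => cases ht

lemma exists_word (b : ℕ × Color) (w : List (ℕ × Color)) (s : List (ℕ ⊕ ℕ))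
    (hs : s.map lcol = wordCols b w) :
    ∃ (B : Block) (W : List Block), B.shape = b ∧ W.map Block.shape = w ∧ wletters (B :: W) = s := by
  induction w generalizing b s with
  | nil =>
    obtain ⟨B, hB, rfl⟩ := exists_block b.1 b.2 s hs
    exact ⟨B, [], hB, rfl, by simp⟩
  | cons c w ih =>
    obtain ⟨s1, s2, rfl, h1, h2⟩ := List.map_eq_append_iff.1 hs
    obtain ⟨B, hB, rfl⟩ := exists_block b.1 b.2 s1 h1
    obtain ⟨C, W, hC, hW, rfl⟩ := ih c s2 h2
    exact ⟨B, C :: W, hB, by simp [hC, hW], by simp⟩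

lemma wev_block (b : Block) : wev b.letters (blockOp k b.shape.1 b.shape.2) = wd k [b] := by
  induction b using Block.rec_cons with
  | letter t =>
    cases t with
    | inl x =>
      have := (wev_n10 (s := [.inl x]) rfl ((scDual k).one cl) rfl).trans
        (congrArg Prod.snd (cev_one (k := k) x))
      erw [(scDual k).comp_one] at this
      exact this
    | inr y => exact wev_one y
  | cons x b ih =>
    have := wev_n11 (s := [.inl x]) (t := b.letters) rfl (zero_add _) ((scDual k).one cl)
      (blockOp k b.shape.1 b.shape.2) rfl (blockCols_shape b)
    rw [(scDual k).bin_one_left _ _ (zero_add _), cev_one, ih] at this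
    exact this.trans (der_block x b)

lemma wev_word (b : Block) (W : List Block) :
    wev (wletters (b :: W)) (wordOp k b.shape (W.map Block.shape)) = wd k (b :: W) := by
  induction W generalizing b with
  | nil =>
    rw [wletters_cons, wletters_nil, List.append_nil]
    exact wev_block b
  | cons c W ih =>
    rw [wletters_cons]
    refine (wev_n02 rfl rfl (blockOp k b.shape.1 b.shape.2) (wordOp k c.shape (W.map Block.shape))
      (blockCols_shape b) (wordCols_shape c W)).trans ?_
    rw [ih, wev_block, cat_wd]
    rfl

lemma perm_of_equiv {α : Type*} {s t : List α} {a b : ℕ} (hs : a = s.length) (ht : b = t.length)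
    (e : Fin a ≃ Fin b) (h : ∀ i, t[e i]? = s[i]?) : t.Perm s := by
  obtain rfl : a = b := by simpa using Fintype.card_congr e
  subst hs
  have h1 : s = List.ofFn ((fun i : Fin s.length => t[i]) ∘ e) := by
    refine List.ext_getElem (by simp) fun i h1 h2 => ?_
    have := h ⟨i, h1⟩
    simp only [Fin.getElem?_fin, List.getElem?_eq_getElem h1] at this
    rw [List.getElem?_eq_getElem (by omega)] at this
    simpa using this.symm
  have h2 : t = List.ofFn (fun i : Fin s.length => t[i]) :=
    List.ext_getElem (by simp [ht]) fun i h1 h2 => by simp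
  have h3 := Equiv.Perm.ofFn_comp_perm e (fun i : Fin s.length => t[i])
  rw [← h1, ← h2] at h3
  exact h3.symm

lemma exists_equiv_of_perm {α : Type*} [DecidableEq α] {s t : List α} {a b : ℕ}
    (hs : a = s.length) (ht : b = t.length) (h : t.Perm s) (hn : s.Nodup) :
    ∃ e : Fin a ≃ Fin b, ∀ i, t[e i]? = s[i]? := by
  subst hs ht
  refine ⟨(hn.getEquiv s).trans ((Equiv.subtypeEquivRight fun a => h.mem_iff.symm).trans
    ((h.nodup_iff.2 hn).getEquiv t).symm), fun i => ?_⟩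
  have hi : s[i] ∈ t := h.mem_iff.2 (List.getElem_mem _)
  have hi' : t.idxOf s[(i : ℕ)] < t.length := List.idxOf_lt_length_iff.2 hi
  simp [List.getElem?_eq_getElem hi']

/-- The operation of the word `W` with inputs in the order of the letters `s`. -/
inductive WordAt (s : List (ℕ ⊕ ℕ)) :
    ∀ {p : ℤ}, (scDual k).obj (s.map lcol) op p → List Block → Prop
  | mk (B : Block) (W : List Block)
      (e : Fin (s.map lcol).length ≃ Fin (wordCols B.shape (W.map Block.shape)).length)
      (he : ∀ i, (s.map lcol).get i = (wordCols B.shape (W.map Block.shape)).get (e i))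
      (h : ∀ i, (wletters (B :: W))[e i]? = s[i]?) :
      WordAt s ((scDual k).act e he (wordOp k B.shape (W.map Block.shape))) (B :: W)

variable {s : List (ℕ ⊕ ℕ)} {p : ℤ}

lemma WordAt.wev {f : (scDual k).obj (s.map lcol) op p} {W : List Block} (h : WordAt s f W) :
    wev s f = wd k W := by
  cases h with
  | mk B W e he h => rw [wev_act e he _ rfl (wordCols_shape B W) h, wev_word]

lemma WordAt.perm {f : (scDual k).obj (s.map lcol) op p} {W : List Block} (h : WordAt s f W) :
    HasLetters s W := by
  cases h with
  | mk B W e he h =>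
    refine perm_of_equiv (List.length_map _) ?_ e h
    rw [← wordCols_shape, List.length_map]

lemma WordAt.unique (hs : s.Nodup) {q : ℤ} {f : (scDual k).obj (s.map lcol) op p}
    {g : (scDual k).obj (s.map lcol) op q} {W : List Block} (hf : WordAt s f W)
    (hg : WordAt s g W) : HEq f g := by
  cases hf with
  | mk B W e he h =>
    cases hg with
    | mk _ _ e' he' h' =>
      obtain rfl : e = e' := by
        refine Equiv.symm_bijective.injective (Equiv.ext fun j => ?_)
        have h1 := h (e.symm j)
        have h2 := h' (e'.symm j)
        rw [Equiv.apply_symm_apply] at h1 h2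
        rw [h1] at h2
        exact Fin.ext ((List.getElem?_inj (by simpa using (e.symm j).isLt) hs).1 h2)
      rfl


open Classical in
/-- The operation with a given value. -/
def readWord (s : List (ℕ ⊕ ℕ)) (p : ℤ) :
    WordSpace k →ₗ[k] (scDual k).obj (s.map lcol) op p :=
  wlift k fun W => if h : ∃ f : (scDual k).obj (s.map lcol) op p, WordAt s f W then h.choose else 0

lemma WordAt.read (hs : s.Nodup) {f : (scDual k).obj (s.map lcol) op p} {W : List Block}
    (h : WordAt s f W) : readWord s p (wd k W) = f := by
  have h' : ∃ f : (scDual k).obj (s.map lcol) op p, WordAt s f W := ⟨f, h⟩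
  rw [readWord, wlift_wd, dif_pos h']
  exact eq_of_heq (WordAt.unique hs h'.choose_spec h)

lemma exists_wordAt {l : List Color} (b : ℕ × Color) (w : List (ℕ × Color))
    (e : Fin l.length ≃ Fin (wordCols b w).length) (he : ∀ i, l.get i = (wordCols b w).get (e i))
    (hl : l = s.map lcol) : ∃ W, WordAt s (hl ▸ (scDual k).act e he (wordOp k b w)) W := by
  subst hl
  have h : ∃ t : List (ℕ ⊕ ℕ), t.map lcol = wordCols b w ∧ ∀ i, t[e i]? = s[i]? := by
    refine ⟨List.ofFn fun j : Fin (wordCols b w).length => s.getD (e.symm j) (.inl 0),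
      List.ext_getElem (by simp) fun j h1 h2 => ?_, fun i => ?_⟩
    · have := he (e.symm ⟨j, h2⟩)
      rw [e.apply_symm_apply] at this
      simp only [List.get_eq_getElem, List.getElem_map] at this
      rw [← this]
      simp [List.getElem?_eq_getElem (show (e.symm ⟨j, h2⟩ : ℕ) < s.length by
        simpa using (e.symm ⟨j, h2⟩).isLt)]
    · simp [List.getElem?_eq_getElem (show (i : ℕ) < s.length by simpa using i.isLt)]
  obtain ⟨t, ht, h⟩ := h
  obtain ⟨B, W, rfl, rfl, rfl⟩ := exists_word b w t ht
  exact ⟨_, WordAt.mk B W e he h⟩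

lemma WordSpan.read_wev (hs : s.Nodup) {l : List Color} {d : Color}
    {f : (scDual k).obj l d p} (hf : WordSpan f) : ∀ (hl : l = s.map lcol) (hd : d = op),
    (∀ f' : (scDual k).obj (s.map lcol) op p, HEq f f' → readWord s p (wev s f') = f' ∧
      wev s f' ∈ SP k (HasLetters s)) := by
  induction hf with
  | zero =>
    rintro rfl rfl f' hf
    obtain rfl := eq_of_heq hf
    simp
  | add _ _ ih ih' =>
    rintro rfl rfl f' hf
    obtain rfl := eq_of_heq hf
    obtain ⟨h1, h2⟩ := ih rfl rfl _ HEq.rfl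
    obtain ⟨h1', h2'⟩ := ih' rfl rfl _ HEq.rfl
    exact ⟨by rw [map_add, map_add, h1, h1'], by rw [map_add]; exact add_mem h2 h2'⟩
  | smul a _ ih =>
    rintro rfl rfl f' hf
    obtain rfl := eq_of_heq hf
    obtain ⟨h1, h2⟩ := ih rfl rfl _ HEq.rfl
    exact ⟨by rw [map_smul, map_smul, h1], by rw [map_smul]; exact Submodule.smul_mem _ _ h2⟩
  | word b w e he =>
    rintro rfl _ f' hf
    obtain rfl := eq_of_heq hf
    obtain ⟨W, hW⟩ := exists_wordAt (k := k) (s := s) b w e he rfl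
    rw [WordAt.wev hW]
    exact ⟨hW.read hs, wd_mem_SP hW.perm⟩

lemma wev_injective (hs : s.Nodup) {f g : (scDual k).obj (s.map lcol) op p}
    (h : wev s f = wev s g) : f = g := by
  rw [← ((wordSpan f).read_wev hs rfl rfl f HEq.rfl).1, h,
    ((wordSpan g).read_wev hs rfl rfl g HEq.rfl).1]

lemma wev_letters (hs : s.Nodup) (f : (scDual k).obj (s.map lcol) op p) :
    wev s f ∈ SP k (HasLetters s) :=
  ((wordSpan f).read_wev hs rfl rfl f HEq.rfl).2

lemma exists_wev_eq_wd (hs : s.Nodup) (hs' : s ≠ []) {W : List Block} (hW : HasLetters s W) :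
    ∃ (p : ℤ) (f : (scDual k).obj (s.map lcol) op p), wev s f = wd k W := by
  rcases W with _ | ⟨B, W⟩
  · exact absurd (List.nil_perm.1 hW) hs'
  obtain ⟨e, he⟩ := exists_equiv_of_perm (a := (s.map lcol).length)
    (b := (wordCols B.shape (W.map Block.shape)).length) (by simp)
    (by rw [← wordCols_shape, List.length_map]) hW hs
  refine ⟨_, (scDual k).act e (fun i => ?_) (wordOp k B.shape (W.map Block.shape)), ?_⟩
  · have h1 : ((wletters (B :: W)).map lcol)[(e i : ℕ)]? = (s.map lcol)[(i : ℕ)]? := by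
      rw [List.getElem?_map, List.getElem?_map]
      exact congrArg _ (he i)
    rw [wordCols_shape, List.getElem?_eq_getElem i.isLt, List.getElem?_eq_getElem (e i).isLt] at h1
    exact (Option.some.inj h1).symm
  · exact (wev_act e _ _ rfl (wordCols_shape B W) he).trans (wev_word B W)

/-- Values of elements of the suboperad generated by cycles, including the unit for no letters. -/
def genImage (k : Type u) [Field k] (s : List (ℕ ⊕ ℕ)) : Submodule k (WordSpace k) :=
  Submodule.span k {x | (s = [] ∧ x = wd k []) ∨
    ∃ (p : ℤ) (g : (scDual k).obj (s.map lcol) op p), Gen g ∧ wev s g = x}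

lemma Gen.cast {l l' : List Color} {p : ℤ} (h : l = l') {f : (scDual k).obj l op p} (hf : Gen f) :
    ∃ g : (scDual k).obj l' op p, Gen g ∧ ∀ s, wev s g = wev s f := by
  subst h
  exact ⟨f, hf, fun _ => rfl⟩

lemma cat_mem_genImage {t : List (ℕ ⊕ ℕ)} {x y : WordSpace k} {p : ℤ}
    {g : (scDual k).obj (s.map lcol) op p} (hg : Gen g) (hx : wev s g = x)
    (hy : y ∈ genImage k t) : cat k x y ∈ genImage k (s ++ t) := by
  induction hy using Submodule.span_induction with
  | zero => rw [map_zero]; exact zero_mem _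
  | add _ _ _ _ h h' => rw [map_add]; exact add_mem h h'
  | smul c _ _ h => rw [map_smul]; exact Submodule.smul_mem _ c h
  | mem y hy =>
    refine Submodule.subset_span (Or.inr ?_)
    rcases hy with ⟨rfl, rfl⟩ | ⟨q, g', hg', rfl⟩
    · rw [List.append_nil, cat_nil_right]
      exact ⟨p, g, hg, hx⟩
    · obtain ⟨f, hf, hf'⟩ := (Gen.bin (l' := s.map lcol ++ t.map lcol) rfl rfl Gen.n02 hg hg').cast
        (List.map_append (f := lcol)).symm
      refine ⟨_, f, hf, ?_⟩
      rw [hf', ← hx]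
      exact wev_n02 rfl rfl g g' rfl rfl

lemma exists_lieWord (x : ℕ) (v : List ℕ) : ∃ g : (scDual k).obj
    (((x :: v).map Sum.inl).map lcol) cl 0, Gen g ∧ cev ((x :: v).map Sum.inl) g = lieWord k x v := by
  induction v using List.reverseRecOn with
  | nil => exact ⟨(scDual k).one cl, .one cl, cev_one x⟩
  | append_singleton v y ih =>
    obtain ⟨g, hg, h⟩ := ih
    have e : (x :: (v ++ [y])).map (Sum.inl (β := ℕ)) = (x :: v).map Sum.inl ++ [Sum.inl y] := by
      simp
    rw [e, List.map_append]
    refine ⟨(scDual k).bin rfl rfl (scDualGens k).l2 g ((scDual k).one cl),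
      .bin rfl rfl .l2 hg (.one cl), ?_⟩
    refine (cev_l2 rfl rfl g ((scDual k).one cl) rfl rfl).trans ?_
    rw [h, cev_one, lieWord_concat]

lemma GenVal.mem_genImage {x : WordSpace k} (h : GenVal s x) : s.Nodup → x ∈ genImage k s := by
  induction h with
  | zero => exact fun _ => zero_mem _
  | add _ _ ih ih' => exact fun hs => add_mem (ih hs) (ih' hs)
  | smul c _ ih => exact fun hs => Submodule.smul_mem _ c (ih hs)
  | unit => exact fun _ => Submodule.subset_span (Or.inl ⟨rfl, rfl⟩)
  | op y _ ih =>
    intro hs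
    exact cat_mem_genImage (s := [.inr y]) (.one Color.op) (wev_one y) (ih hs.of_cons)
  | cl x v _ ih =>
    intro hs
    obtain ⟨g, hg, h⟩ := exists_lieWord (k := k) x v
    refine cat_mem_genImage (.comp [] [] rfl (List.append_nil _).symm (add_zero _) .n10 hg)
      ((wev_n10 (List.append_nil _).symm g rfl).trans (congrArg Prod.snd h)) (ih ?_)
    exact (List.nodup_append.1 hs).2.1
  | @perm s s' u hp _ ih =>
    intro hs
    have h := ih (hp.nodup_iff.2 hs)
    refine Submodule.span_mono ?_ h
    rintro x (⟨rfl, rfl⟩ | ⟨p, g, hg, rfl⟩)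
    · exact Or.inl ⟨List.nil_perm.1 hp, rfl⟩
    · obtain ⟨e, he⟩ := exists_equiv_of_perm (a := (s'.map lcol).length)
        (b := (s.map lcol).length) (by simp) (by simp) hp hs
      have he' : ∀ i, (s'.map lcol).get i = (s.map lcol).get (e i) := fun i => by
        have h1 : (s.map lcol)[(e i : ℕ)]? = (s'.map lcol)[(i : ℕ)]? := by
          rw [List.getElem?_map, List.getElem?_map]
          exact congrArg _ (he i)
        rw [List.getElem?_eq_getElem i.isLt, List.getElem?_eq_getElem (e i).isLt] at h1
        exact (Option.some.inj h1).symm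
      exact Or.inr ⟨p, _, hg.act e he', wev_act e he' g rfl rfl he⟩

open Classical in
/-- The component of degree `p`. -/
def degProj (p : ℤ) : WordSpace k →ₗ[k] WordSpace k :=
  wlift k fun W => if wdeg W = p then wd k W else 0

lemma degProj_same {u : WordSpace k} (hu : u ∈ SP k (HasDeg p)) : degProj p u = u := by
  refine SP_eq_of_eq (f := degProj p) (g := LinearMap.id) (fun W hW => ?_) hu
  simp [degProj, if_pos (show wdeg W = p from hW)]

lemma degProj_ne {q : ℤ} (hq : q ≠ p) {u : WordSpace k} (hu : u ∈ SP k (HasDeg q)) :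
    degProj p u = 0 := by
  refine SP_eq_of_eq (f := degProj p) (g := 0) (fun W hW => ?_) hu
  have : wdeg W ≠ p := fun h => hq ((show wdeg W = q from hW).symm.trans h)
  simp [degProj, if_neg this]

lemma exists_degProj_gen (hs : s ≠ []) {x : WordSpace k} (hx : x ∈ genImage k s) :
    ∃ g : (scDual k).obj (s.map lcol) op p, Gen g ∧ wev s g = degProj p x := by
  induction hx using Submodule.span_induction with
  | zero => exact ⟨0, .zero, by simp⟩
  | add _ _ _ _ h h' =>
    obtain ⟨g, hg, e⟩ := h
    obtain ⟨g', hg', e'⟩ := h'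
    exact ⟨g + g', hg.add hg', by rw [map_add, map_add, e, e']⟩
  | smul c _ _ h =>
    obtain ⟨g, hg, e⟩ := h
    exact ⟨c • g, hg.smul c, by rw [map_smul, map_smul, e]⟩
  | mem x hx =>
    rcases hx with ⟨h, -⟩ | ⟨q, g, hg, rfl⟩
    · exact absurd h hs
    · by_cases hq : q = p
      · subst hq
        exact ⟨g, hg, (degProj_same (wev_deg g)).symm⟩
      · exact ⟨0, .zero, by rw [degProj_ne hq (wev_deg g), map_zero]⟩

lemma exists_degProj_diff (hs : s ≠ []) (hn : s.Nodup) {x : WordSpace k}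
    (hx : x ∈ SP k (HasLetters s)) : ∃ g : (scDual k).obj (s.map lcol) op (p + 1),
      wev s ((scDual k).diff rfl g) = degProj p (dW k x) := by
  let M : Submodule k (WordSpace k) :=
    (LinearMap.range (wev s ∘ₗ (scDual k).diff (l := s.map lcol) (p := p + 1) rfl)).comap
      (degProj p ∘ₗ dW k)
  refine SP_le (M := M) (fun W hW => ?_) hx
  obtain ⟨q, f, hf⟩ := exists_wev_eq_wd (k := k) hn hs hW
  change degProj p (dW k (wd k W)) ∈
    LinearMap.range (wev s ∘ₗ (scDual k).diff (l := s.map lcol) (p := p + 1) rfl)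
  rw [← hf]
  by_cases hq : q = p + 1
  · subst hq
    refine ⟨f, ?_⟩
    rw [← wev_diff rfl f, degProj_same (wev_deg _)]
    rfl
  · rw [degProj_ne (q := q - 1) (by omega) (dW_deg (by omega) (wev_deg f))]
    exact zero_mem _

/-- A list of distinct letters of given colours. -/
lemma exists_letters (l : List Color) : ∃ s : List (ℕ ⊕ ℕ), s.Nodup ∧ s.map lcol = l := by
  let c : ℕ × Color → ℕ ⊕ ℕ := fun x => match x.2 with
    | cl => .inl x.1
    | op => .inr x.1
  have hc : Function.Injective c := by
    rintro ⟨i, _ | _⟩ ⟨j, _ | _⟩ h <;> simp_all [c]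
  refine ⟨(l.zipIdx.map Prod.swap).map c, List.Nodup.map hc ?_, ?_⟩
  · refine List.Nodup.of_map Prod.fst ?_
    simpa [Function.comp_def] using List.nodup_range'
  · refine List.ext_getElem (by simp) fun i h1 h2 => ?_
    have : ∀ x, lcol (c x) = x.2 := by rintro ⟨i, _ | _⟩ <;> rfl
    simp [this]

lemma eq_zero_of_no_inputs (f : (scDual k).obj [] op p) : f = 0 := by
  have : ∀ {l : List Color} {d : Color} {p : ℤ} {f : (scDual k).obj l d p}, WordSpan f → l = [] →
      f = 0 := by
    intro l d p f hf
    induction hf with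
    | zero => exact fun _ => rfl
    | add _ _ ih ih' => exact fun h => by rw [ih h, ih' h, add_zero]
    | smul a _ ih => exact fun h => by rw [ih h, smul_zero]
    | word b w e he =>
      rintro rfl
      have h : (wordCols b w).length = 0 := by simpa using (Fintype.card_congr e).symm
      have hb : ∀ n c, blockCols n c ≠ [] := by rintro (_ | n) c <;> simp [blockCols]
      cases w <;> simp [wordCols, hb] at h
  exact this (wordSpan f) rfl

/-- Every cycle of `sc^!` is homologous to an element of the suboperad generated by the generators
which are cycles. -/
lemma exists_gen_of_cycle {l : List Color} {d : Color} {q : ℤ} (hq : q + 1 = p)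
    (f : (scDual k).obj l d p) (hf : (scDual k).diff hq f = 0) :
    ∃ g, Gen g ∧ ∃ b : (scDual k).obj l d (p + 1), f = g + (scDual k).diff rfl b := by
  cases d with
  | cl => exact ⟨f, gen_of_closed f, 0, by rw [map_zero, add_zero]⟩
  | op =>
    obtain ⟨s, hn, rfl⟩ := exists_letters l
    by_cases hs : s = []
    · subst hs
      exact ⟨0, .zero, 0, by rw [map_zero, add_zero]; exact eq_zero_of_no_inputs f⟩
    · have h := cycle_mem _ rfl hn (wev_letters hn f) (by rw [← wev_diff hq, hf, map_zero])
      obtain ⟨x, hx, _, ⟨y, hy, rfl⟩, h⟩ := Submodule.mem_sup.1 h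
      obtain ⟨g, hg, e⟩ := exists_degProj_gen (p := p) hs (GenVal.mem_genImage hx hn)
      obtain ⟨b, e'⟩ := exists_degProj_diff (p := p) hs hn hy
      refine ⟨g, hg, b, wev_injective hn ?_⟩
      rw [map_add, e, e', ← map_add, h, degProj_same (wev_deg f)]

end Generation

section PolynomialModel

variable {k : Type u} [Field k]

section

variable {M N P : Type w} [AddCommGroup M] [Module k M] [AddCommGroup N] [Module k N]
  [AddCommGroup P] [Module k P]

/-- The extension of a bilinear map to polynomials without constant term; `single i x` stands for
`x t ^ (i + 1)`. -/
def polyMap (B : M →ₗ[k] N →ₗ[k] P) : (ℕ →₀ M) →ₗ[k] (ℕ →₀ N) →ₗ[k] (ℕ →₀ P) :=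
  Finsupp.lsum k fun i => (Finsupp.lsum k fun j =>
    ((B.compr₂ (Finsupp.lsingle (i + j + 1))).flip : N →ₗ[k] M →ₗ[k] (ℕ →₀ P))).flip

@[simp] lemma polyMap_single (B : M →ₗ[k] N →ₗ[k] P) (i j : ℕ) (x : M) (y : N) :
    polyMap B (Finsupp.single i x) (Finsupp.single j y) = Finsupp.single (i + j + 1) (B x y) := by
  simp [polyMap]

/-- The Euler derivation. -/
def polyEuler : (ℕ →₀ M) →ₗ[k] (ℕ →₀ M) :=
  Finsupp.lsum k fun i => ((i : k) + 1) • Finsupp.lsingle i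

@[simp] lemma polyEuler_single (i : ℕ) (x : M) :
    polyEuler (k := k) (Finsupp.single i x) = Finsupp.single i (((i : k) + 1) • x) := by
  simp [polyEuler]

/-- The value at `t = 1`. -/
def polyVal : (ℕ →₀ M) →ₗ[k] M := Finsupp.lsum k fun _ => LinearMap.id

@[simp] lemma polyVal_single (i : ℕ) (x : M) : polyVal (k := k) (Finsupp.single i x) = x := by
  simp [polyVal]

/-- The integral of `f / t` from `0` to `1`. -/
def polyInt : (ℕ →₀ M) →ₗ[k] M :=
  Finsupp.lsum k fun i => ((i : k) + 1)⁻¹ • LinearMap.id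

@[simp] lemma polyInt_single (i : ℕ) (x : M) :
    polyInt (k := k) (Finsupp.single i x) = ((i : k) + 1)⁻¹ • x := by
  simp [polyInt]

lemma polyInt_euler [CharZero k] (x : ℕ →₀ M) : polyInt (k := k) (polyEuler (k := k) x) =
    polyVal (k := k) x := by
  induction x using Finsupp.induction_linear with
  | zero => simp
  | add x y hx hy => simp [hx, hy]
  | single i x => simp [smul_smul, inv_mul_cancel₀ (Nat.cast_add_one_ne_zero (R := k) i)]

lemma poly_induction₂ {Q : (ℕ →₀ M) → (ℕ →₀ N) → Prop} (zero_left : ∀ y, Q 0 y)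
    (add_left : ∀ x x' y, Q x y → Q x' y → Q (x + x') y) (zero_right : ∀ x, Q x 0)
    (add_right : ∀ x y y', Q x y → Q x y' → Q x (y + y'))
    (single : ∀ i x j y, Q (.single i x) (.single j y)) (x : ℕ →₀ M) (y : ℕ →₀ N) : Q x y := by
  induction x using Finsupp.induction_linear with
  | zero => exact zero_left y
  | add x x' h h' => exact add_left _ _ _ h h'
  | single i x =>
    induction y using Finsupp.induction_linear with
    | zero => exact zero_right _
    | add y y' h h' => exact add_right _ _ _ h h'
    | single j y => exact single i x j y

lemma polyVal_map (B : M →ₗ[k] N →ₗ[k] P) (x : ℕ →₀ M) (y : ℕ →₀ N) :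
    polyVal (k := k) (polyMap B x y) = B (polyVal (k := k) x) (polyVal (k := k) y) := by
  induction x, y using poly_induction₂ with
  | zero_left y => simp
  | add_left x x' y h h' => simp [h, h']
  | zero_right x => simp
  | add_right x y y' h h' => simp [h, h']
  | single i x j y => simp

lemma polyEuler_map (B : M →ₗ[k] N →ₗ[k] P) (x : ℕ →₀ M) (y : ℕ →₀ N) :
    polyEuler (k := k) (polyMap B x y) =
      polyMap B (polyEuler (k := k) x) y + polyMap B x (polyEuler (k := k) y) := by
  induction x, y using poly_induction₂ with
  | zero_left y => simp
  | add_left x x' y h h' => simp only [map_add, LinearMap.add_apply, h, h']; abel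
  | zero_right x => simp
  | add_right x y y' h h' => simp only [map_add, h, h']; abel
  | single i x j y =>
    simp only [polyMap_single, polyEuler_single, map_smul, LinearMap.smul_apply,
      ← Finsupp.single_add, ← add_smul]
    push_cast
    congr 2
    ring

lemma polyMap_symm (s : ℤˣ) {B : M →ₗ[k] N →ₗ[k] P} {B' : N →ₗ[k] M →ₗ[k] P}
    (h : ∀ x y, B x y = -(s • B' y x)) (x : ℕ →₀ M) (y : ℕ →₀ N) :
    polyMap B x y = -(s • polyMap B' y x) := by
  induction x, y using poly_induction₂ with
  | zero_left y => simp
  | add_left x x' y h h' => simp only [map_add, LinearMap.add_apply, h, h', smul_add]; abel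
  | zero_right x => simp
  | add_right x y y' h h' => simp only [map_add, LinearMap.add_apply, h, h', smul_add]; abel
  | single i x j y => simp [Units.smul_def, h, add_comm i j]

variable {L M1 M2 M3 : Type w} [AddCommGroup L] [Module k L] [AddCommGroup M1] [Module k M1]
  [AddCommGroup M2] [Module k M2] [AddCommGroup M3] [Module k M3]

lemma poly_induction₃ {Q : (ℕ →₀ M) → (ℕ →₀ N) → (ℕ →₀ P) → Prop} (zero₁ : ∀ y z, Q 0 y z)
    (add1 : ∀ x x' y z, Q x y z → Q x' y z → Q (x + x') y z) (zero₂ : ∀ x z, Q x 0 z)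
    (add2 : ∀ x y y' z, Q x y z → Q x y' z → Q x (y + y') z) (zero₃ : ∀ x y, Q x y 0)
    (add3 : ∀ x y z z', Q x y z → Q x y z' → Q x y (z + z'))
    (single : ∀ i x j y l z, Q (.single i x) (.single j y) (.single l z)) (x : ℕ →₀ M) (y : ℕ →₀ N)
    (z : ℕ →₀ P) : Q x y z := by
  induction z using Finsupp.induction_linear with
  | zero => exact zero₃ _ _
  | add z z' h h' => exact add3 _ _ _ _ h h'
  | single l z =>
    induction x, y using poly_induction₂ with
    | zero_left y => exact zero₁ _ _
    | add_left x x' y h h' => exact add1 _ _ _ _ h h'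
    | zero_right x => exact zero₂ _ _
    | add_right x y y' h h' => exact add2 _ _ _ _ h h'
    | single i x j y => exact single i x j y l z

lemma polyMap_assoc (s : ℤˣ) {B1 : M →ₗ[k] M1 →ₗ[k] L} {B2 : N →ₗ[k] P →ₗ[k] M1}
    {B3 : M2 →ₗ[k] P →ₗ[k] L} {B4 : M →ₗ[k] N →ₗ[k] M2}
    (h : ∀ x y z, s • B1 x (B2 y z) = -B3 (B4 x y) z) (x : ℕ →₀ M) (y : ℕ →₀ N) (z : ℕ →₀ P) :
    s • polyMap B1 x (polyMap B2 y z) = -polyMap B3 (polyMap B4 x y) z := by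
  induction x, y, z using poly_induction₃ with
  | zero₁ | zero₂ | zero₃ => simp
  | add1 _ _ _ _ h h' | add2 _ _ _ _ h h' | add3 _ _ _ _ h h' =>
    simp only [map_add, LinearMap.add_apply, h, h', smul_add]; abel
  | single i x j y l z =>
    have := h x y z
    simp only [Units.smul_def] at this
    simp only [Units.smul_def, polyMap_single, Finsupp.smul_single, this, ← Finsupp.single_neg]
    congr 1
    omega

lemma polyMap_jacobi (s t : ℤˣ) {B1 : M1 →ₗ[k] P →ₗ[k] L} {B2 : M →ₗ[k] N →ₗ[k] M1}
    {B3 : M2 →ₗ[k] M →ₗ[k] L} {B4 : N →ₗ[k] P →ₗ[k] M2} {B5 : M3 →ₗ[k] N →ₗ[k] L}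
    {B6 : P →ₗ[k] M →ₗ[k] M3}
    (h : ∀ x y z, B1 (B2 x y) z + s • B3 (B4 y z) x + t • B5 (B6 z x) y = 0)
    (x : ℕ →₀ M) (y : ℕ →₀ N) (z : ℕ →₀ P) :
    polyMap B1 (polyMap B2 x y) z + s • polyMap B3 (polyMap B4 y z) x +
      t • polyMap B5 (polyMap B6 z x) y = 0 := by
  induction x, y, z using poly_induction₃ with
  | zero₁ | zero₂ | zero₃ => simp
  | add1 _ _ _ _ h h' | add2 _ _ _ _ h h' | add3 _ _ _ _ h h' =>
    simp only [map_add, LinearMap.add_apply, smul_add]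
    rw [← add_zero (0 : ℕ →₀ L)]
    nth_rw 1 [← h, ← h']
    abel
  | single i x j y l z =>
    have := h x y z
    simp only [Units.smul_def] at this
    simp only [Units.smul_def, polyMap_single, Finsupp.smul_single]
    rw [show j + l + 1 + i + 1 = i + j + 1 + l + 1 by omega,
      show l + i + 1 + j + 1 = i + j + 1 + l + 1 by omega, ← Finsupp.single_add,
      ← Finsupp.single_add, this, Finsupp.single_zero]

lemma polyMap_leibniz (s t : ℤˣ) {B1 : M →ₗ[k] M1 →ₗ[k] L} {B2 : N →ₗ[k] P →ₗ[k] M1}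
    {B3 : M2 →ₗ[k] P →ₗ[k] L} {B4 : M →ₗ[k] N →ₗ[k] M2} {B5 : N →ₗ[k] M3 →ₗ[k] L}
    {B6 : M →ₗ[k] P →ₗ[k] M3}
    (h : ∀ x y z, s • B1 x (B2 y z) = B3 (B4 x y) z + t • B5 y (B6 x z))
    (x : ℕ →₀ M) (y : ℕ →₀ N) (z : ℕ →₀ P) :
    s • polyMap B1 x (polyMap B2 y z) =
      polyMap B3 (polyMap B4 x y) z + t • polyMap B5 y (polyMap B6 x z) := by
  induction x, y, z using poly_induction₃ with
  | zero₁ | zero₂ | zero₃ => simp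
  | add1 _ _ _ _ h h' | add2 _ _ _ _ h h' | add3 _ _ _ _ h h' =>
    simp only [map_add, LinearMap.add_apply, h, h', smul_add]; abel
  | single i x j y l z =>
    have := h x y z
    simp only [Units.smul_def] at this
    simp only [Units.smul_def, polyMap_single, Finsupp.smul_single, this]
    rw [show i + (j + l + 1) + 1 = i + j + 1 + l + 1 by omega,
      show j + (i + l + 1) + 1 = i + j + 1 + l + 1 by omega, ← Finsupp.single_add]

end

variable {H : ChainComplex (ModuleCat.{w} k) ℤ}

variable (H) in
/-- The complex of polynomials without constant term with coefficients in `H` and zero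
differential. -/
def polyComplex : ChainComplex (ModuleCat.{w} k) ℤ where
  X n := ModuleCat.of k (ℕ →₀ H.X n)
  d _ _ := 0
  shape _ _ _ := rfl
  d_comp_d' _ _ _ _ _ := by simp

/-- The bracket of polynomials. -/
def polyBr (G : LambdaGerAlgebra H) {m n r : ℤ} (h : m + n = r) :
    (polyComplex H).X m →ₗ[k] (polyComplex H).X n →ₗ[k] (polyComplex H).X r :=
  polyMap (G.br h)

/-- The product of polynomials. -/
def polyMul (G : LambdaGerAlgebra H) {m n r : ℤ} (h : m + n - 1 = r) :
    (polyComplex H).X m →ₗ[k] (polyComplex H).X n →ₗ[k] (polyComplex H).X r :=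
  polyMap (G.mul h)

lemma polyComplex_d {i j : ℤ} (z : (polyComplex H).X i) : ((polyComplex H).d i j).hom z = 0 :=
  rfl

/-- The polynomials with coefficients in a `ΛGer`-algebra. -/
def polyGer (G : LambdaGerAlgebra H) : LambdaGerAlgebra (polyComplex H) where
  br := polyBr G
  mul := polyMul G
  br_symm {m n _} h := polyMap_symm (M := H.X m) (N := H.X n) _ (G.br_symm h)
  mul_symm {m n _} h := polyMap_symm (M := H.X m) (N := H.X n) _ (G.mul_symm h)
  mul_assoc {m n p _} h :=
    polyMap_assoc (M := H.X m) (N := H.X n) (P := H.X p) _ (G.mul_assoc h)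
  jacobi {m n p _} h :=
    polyMap_jacobi (M := H.X m) (N := H.X n) (P := H.X p) _ _ (G.jacobi h)
  leibniz {m n p _} h :=
    polyMap_leibniz (M := H.X m) (N := H.X n) (P := H.X p) _ _ (G.leibniz h)
  diff_br {m n r} h x y := by
    rw [polyComplex_d, polyComplex_d, polyComplex_d, map_zero, map_zero, LinearMap.zero_apply,
      smul_zero, add_zero]
  diff_mul {m n r} h x y := by
    rw [polyComplex_d, polyComplex_d, polyComplex_d, map_zero, map_zero, LinearMap.zero_apply,
      smul_zero, add_zero, neg_zero]

variable {m n r : ℤ}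

/-- The Euler derivation on the complex of polynomials. -/
def eulerMap : (polyComplex H).X m →ₗ[k] (polyComplex H).X m :=
  polyEuler (M := H.X m)

/-- The value at `t = 1` on the complex of polynomials. -/
def evalOne : (polyComplex H).X m →ₗ[k] H.X m := polyVal (M := H.X m)

/-- The integral on the complex of polynomials. -/
def integral : (polyComplex H).X m →ₗ[k] H.X m := polyInt (M := H.X m)

/-- The monomial `x t`. -/
def monomialOne : H.X m →ₗ[k] (polyComplex H).X m := Finsupp.lsingle (M := H.X m) 0

lemma evalOne_monomialOne (x : H.X m) : evalOne (monomialOne x) = x := polyVal_single 0 x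

lemma integral_eulerMap [CharZero k] (x : (polyComplex H).X m) :
    integral (eulerMap x) = evalOne x := polyInt_euler (M := H.X m) x

lemma evalOne_br (G : LambdaGerAlgebra H) (h : m + n = r) (x : (polyComplex H).X m)
    (y : (polyComplex H).X n) :
    evalOne ((polyGer G).br h x y) = G.br h (evalOne x) (evalOne y) :=
  polyVal_map (M := H.X m) (N := H.X n) _ x y

lemma evalOne_mul (G : LambdaGerAlgebra H) (h : m + n - 1 = r) (x : (polyComplex H).X m)
    (y : (polyComplex H).X n) :
    evalOne ((polyGer G).mul h x y) = G.mul h (evalOne x) (evalOne y) :=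
  polyVal_map (M := H.X m) (N := H.X n) _ x y

lemma eulerMap_br (G : LambdaGerAlgebra H) (h : m + n = r) (x : (polyComplex H).X m)
    (y : (polyComplex H).X n) : eulerMap ((polyGer G).br h x y) =
      (polyGer G).br h (eulerMap x) y + (polyGer G).br h x (eulerMap y) :=
  polyEuler_map (M := H.X m) (N := H.X n) _ x y

lemma eulerMap_mul (G : LambdaGerAlgebra H) (h : m + n - 1 = r) (x : (polyComplex H).X m)
    (y : (polyComplex H).X n) : eulerMap ((polyGer G).mul h x y) =
      (polyGer G).mul h (eulerMap x) y + (polyGer G).mul h x (eulerMap y) :=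
  polyEuler_map (M := H.X m) (N := H.X n) _ x y

lemma beta_integral_mul {A : ChainComplex (ModuleCat.{w} k) ℤ} (T : CentralTriple H A) {s : ℤ}
    (h : m + n - 1 = r) (h' : s + 1 = r) (x : (polyComplex H).X m) (y : (polyComplex H).X n) :
    T.beta h' (integral ((polyGer T.ger).mul h x y)) = 0 := by
  have : ∀ (x : ℕ →₀ H.X m) (y : ℕ →₀ H.X n),
      T.beta h' (polyInt (k := k) (polyMap (T.ger.mul h) x y)) = 0 := by
    intro x y
    induction x, y using poly_induction₂ with
    | zero_left y => simp
    | add_left x x' y h h' => simp [h, h']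
    | zero_right x => simp
    | add_right x y y' h h' => simp [h, h']
    | single i x j y => simp [T.beta_mul]
  exact this x y

end PolynomialModel

section Jets

variable {k : Type u} [Field k] {H A : ChainComplex (ModuleCat.{w} k) ℤ}

variable (H A) in
/-- Functions on lists of homogeneous elements of `H`; the value at `x1, …, xₙ` stands for the value
at the base point of `xₙ · (⋯ (x1 · φ))`. -/
abbrev JetFn : Type w := List (Σ m : ℤ, H.X m) → ∀ r : ℤ, A.X r

/-- The action of a homogeneous element of `H`. -/
def jetShift (x : Σ m : ℤ, H.X m) (φ : JetFn H A) : JetFn H A := fun l => φ (x :: l)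

variable (G : LambdaGerAlgebra H) (R : DGAssocAlgebra A) {m n r p : ℤ}

/-- Functions of degree `n` which are linear and on which brackets act as commutators and products
as zero. -/
structure IsJet (n : ℤ) (φ : JetFn H A) : Prop where
  deg : ∀ l r, n + (l.map Sigma.fst).sum ≠ r → φ l r = 0
  add : ∀ l m (x y : H.X m) l',
    φ (l ++ ⟨m, x + y⟩ :: l') = φ (l ++ ⟨m, x⟩ :: l') + φ (l ++ ⟨m, y⟩ :: l')
  smul : ∀ l m (c : k) (x : H.X m) l', φ (l ++ ⟨m, c • x⟩ :: l') = c • φ (l ++ ⟨m, x⟩ :: l')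
  br : ∀ l {m n r : ℤ} (h : m + n = r) (x : H.X m) (y : H.X n) l',
    φ (l ++ ⟨r, G.br h x y⟩ :: l') = φ (l ++ ⟨n, y⟩ :: ⟨m, x⟩ :: l') -
      (m * n).negOnePow • φ (l ++ ⟨m, x⟩ :: ⟨n, y⟩ :: l')
  mul : ∀ l {m n r : ℤ} (h : m + n - 1 = r) (x : H.X m) (y : H.X n) l',
    φ (l ++ ⟨r, G.mul h x y⟩ :: l') = 0

variable {G}

lemma IsJet.shift {φ : JetFn H A} (hφ : IsJet G n φ) (x : Σ m : ℤ, H.X m) (h : n + x.1 = r) :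
    IsJet G r (jetShift x φ) where
  deg l r' h' := hφ.deg (x :: l) r' (by simp; omega)
  add l := hφ.add (x :: l)
  smul l := hφ.smul (x :: l)
  br l := hφ.br (x :: l)
  mul l := hφ.mul (x :: l)

variable (G A) in
/-- The space of jets of degree `n`. -/
def jetSub (n : ℤ) : Submodule k (JetFn H A) where
  carrier := {φ | IsJet G n φ}
  zero_mem' := ⟨fun _ _ _ => rfl, by simp, by simp, by simp, by simp⟩
  add_mem' := fun {φ ψ} hφ hψ =>
    ⟨fun l r h => by simp [hφ.deg l r h, hψ.deg l r h],
      fun l m x y l' => by simp only [Pi.add_apply, hφ.add, hψ.add]; abel,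
      fun l m c x l' => by simp only [Pi.add_apply, hφ.smul, hψ.smul, smul_add],
      fun l m n r h x y l' => by simp only [Pi.add_apply, hφ.br, hψ.br, smul_add]; abel,
      fun l m n r h x y l' => by simp [hφ.mul, hψ.mul]⟩
  smul_mem' := fun c φ hφ =>
    ⟨fun l r h => by simp [hφ.deg l r h],
      fun l m x y l' => by simp only [Pi.smul_apply, hφ.add, smul_add],
      fun l m c x l' => by simp only [Pi.smul_apply, hφ.smul, smul_comm c],
      fun l m n r h x y l' => by
        simp only [Pi.smul_apply, hφ.br, smul_sub, Units.smul_def, smul_comm c],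
      fun l m n r h x y l' => by simp [hφ.mul]⟩

/-- The product of jets. -/
def jetProd : List (Σ m : ℤ, H.X m) → ℤ → ℤ → JetFn H A → JetFn H A → ∀ r : ℤ, A.X r
  | [], m, n, φ, ψ => fun r => if h : m + n = r then R.mul h (φ [] m) (ψ [] n) else 0
  | x :: l, m, n, φ, ψ => jetProd l (m + x.1) n (jetShift x φ) ψ +
      (x.1 * m).negOnePow • jetProd l m (n + x.1) φ (jetShift x ψ)

variable {R}

lemma jetProd_add_left (l) (m n : ℤ) (φ φ' ψ : JetFn H A) :
    jetProd R l m n (φ + φ') ψ = jetProd R l m n φ ψ + jetProd R l m n φ' ψ := by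
  induction l generalizing m n φ φ' ψ with
  | nil =>
    funext r
    by_cases h : m + n = r <;> simp [jetProd, h]
  | cons x l ih =>
    have : jetShift x (φ + φ') = jetShift x φ + jetShift x φ' := rfl
    simp only [jetProd, this, ih, smul_add]
    abel

lemma jetProd_add_right (l) (m n : ℤ) (φ ψ ψ' : JetFn H A) :
    jetProd R l m n φ (ψ + ψ') = jetProd R l m n φ ψ + jetProd R l m n φ ψ' := by
  induction l generalizing m n φ ψ ψ' with
  | nil =>
    funext r
    by_cases h : m + n = r <;> simp [jetProd, h]
  | cons x l ih =>
    have : jetShift x (ψ + ψ') = jetShift x ψ + jetShift x ψ' := rfl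
    simp only [jetProd, this, ih, smul_add]
    abel

lemma jetProd_smul_left (l) (m n : ℤ) (c : k) (φ ψ : JetFn H A) :
    jetProd R l m n (c • φ) ψ = c • jetProd R l m n φ ψ := by
  induction l generalizing m n φ ψ with
  | nil =>
    funext r
    by_cases h : m + n = r <;> simp [jetProd, h]
  | cons x l ih =>
    have : jetShift x (c • φ) = c • jetShift x φ := rfl
    simp only [jetProd, this, ih, smul_add, Units.smul_def, smul_comm c]

lemma jetProd_smul_right (l) (m n : ℤ) (c : k) (φ ψ : JetFn H A) :
    jetProd R l m n φ (c • ψ) = c • jetProd R l m n φ ψ := by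
  induction l generalizing m n φ ψ with
  | nil =>
    funext r
    by_cases h : m + n = r <;> simp [jetProd, h]
  | cons x l ih =>
    have : jetShift x (c • ψ) = c • jetShift x ψ := rfl
    simp only [jetProd, this, ih, smul_add, Units.smul_def, smul_comm c]

variable (R) in
/-- The product of jets as a bilinear map. -/
def jetMul (m n : ℤ) : JetFn H A →ₗ[k] JetFn H A →ₗ[k] JetFn H A :=
  LinearMap.mk₂ k (fun φ ψ l => jetProd R l m n φ ψ)
    (fun _ _ _ => funext fun l => jetProd_add_left l m n _ _ _)
    (fun _ _ _ => funext fun l => jetProd_smul_left l m n _ _ _)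
    (fun _ _ _ => funext fun l => jetProd_add_right l m n _ _ _)
    (fun _ _ _ => funext fun l => jetProd_smul_right l m n _ _ _)

lemma jetMul_nil (h : m + n = r) (φ ψ : JetFn H A) :
    jetMul R m n φ ψ [] r = R.mul h (φ [] m) (ψ [] n) := dif_pos h

lemma jetMul_cons (x : Σ m : ℤ, H.X m) (l) (φ ψ : JetFn H A) :
    jetMul R m n φ ψ (x :: l) = jetMul R (m + x.1) n (jetShift x φ) ψ l +
      (x.1 * m).negOnePow • jetMul R m (n + x.1) φ (jetShift x ψ) l := rfl

lemma jetShift_mul (x : Σ m : ℤ, H.X m) (φ ψ : JetFn H A) :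
    jetShift x (jetMul R m n φ ψ) = jetMul R (m + x.1) n (jetShift x φ) ψ +
      (x.1 * m).negOnePow • jetMul R m (n + x.1) φ (jetShift x ψ) := rfl

lemma jetMul_units_left (s : ℤˣ) (φ ψ : JetFn H A) :
    jetMul R m n (s • φ) ψ = s • jetMul R m n φ ψ := by simp [Units.smul_def]

lemma jetMul_units_right (s : ℤˣ) (φ ψ : JetFn H A) :
    jetMul R m n φ (s • ψ) = s • jetMul R m n φ ψ := by simp [Units.smul_def]

lemma jetMul_assoc (φ ψ χ : JetFn H A) (l) {mn np : ℤ} (h1 : m + n = mn) (h2 : n + p = np) :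
    jetMul R m np φ (jetMul R n p ψ χ) l = jetMul R mn p (jetMul R m n φ ψ) χ l := by
  induction l generalizing m n p mn np φ ψ χ with
  | nil =>
    funext r
    by_cases h : m + np = r
    · rw [jetMul_nil h, jetMul_nil (show mn + p = r by omega), jetMul_nil h1, jetMul_nil h2,
        R.mul_assoc' h1 h2]
    · have h' : ¬mn + p = r := by omega
      have e1 : jetMul R m np φ (jetMul R n p ψ χ) [] r = 0 := dif_neg h
      have e2 : jetMul R mn p (jetMul R m n φ ψ) χ [] r = 0 := dif_neg h'
      rw [e1, e2]
  | cons x l ih =>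
    simp only [jetMul_cons, jetShift_mul, map_add, LinearMap.add_apply, jetMul_units_left,
      jetMul_units_right, Pi.add_apply, Pi.smul_apply, smul_add, smul_smul]
    rw [ih _ _ _ (mn := mn + x.1) (by omega) h2, ih _ _ _ (mn := mn + x.1) (by omega) (by omega),
      ih _ _ _ h1 (by omega), ← Int.negOnePow_add, ← mul_add, h1, add_assoc]

lemma IsJet.jetMul {φ ψ : JetFn H A} (hφ : IsJet G m φ) (hψ : IsJet G n ψ) (h : m + n = r) :
    IsJet G r (jetMul R m n φ ψ) where
  deg l r' h' := by
    induction l generalizing m n r φ ψ with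
    | nil => exact dif_neg (by simp at h'; omega)
    | cons x l ih =>
      simp only [List.map_cons, List.sum_cons] at h'
      rw [jetMul_cons, Pi.add_apply, Pi.smul_apply,
        ih (hφ.shift x rfl) hψ (r := r + x.1) (by omega) (by omega),
        ih hφ (hψ.shift x rfl) (r := r + x.1) (by omega) (by omega), smul_zero, add_zero]
  add l a x y l' := by
    induction l generalizing m n r φ ψ with
    | nil =>
      have h1 : jetShift ⟨a, x + y⟩ φ = jetShift ⟨a, x⟩ φ + jetShift ⟨a, y⟩ φ :=
        funext fun l' => hφ.add [] a x y l'
      have h2 : jetShift ⟨a, x + y⟩ ψ = jetShift ⟨a, x⟩ ψ + jetShift ⟨a, y⟩ ψ :=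
        funext fun l' => hψ.add [] a x y l'
      simp only [List.nil_append, jetMul_cons, h1, h2, map_add, LinearMap.add_apply, Pi.add_apply,
        smul_add]
      abel
    | cons z l ih =>
      simp only [List.cons_append, jetMul_cons]
      rw [ih (hφ.shift z rfl) hψ rfl, ih hφ (hψ.shift z rfl) rfl, smul_add]
      abel
  smul l a c x l' := by
    induction l generalizing m n r φ ψ with
    | nil =>
      have h1 : jetShift ⟨a, c • x⟩ φ = c • jetShift ⟨a, x⟩ φ :=
        funext fun l' => hφ.smul [] a c x l'
      have h2 : jetShift ⟨a, c • x⟩ ψ = c • jetShift ⟨a, x⟩ ψ :=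
        funext fun l' => hψ.smul [] a c x l'
      simp only [List.nil_append, jetMul_cons, h1, h2, map_smul, LinearMap.smul_apply,
        Pi.smul_apply, smul_add, Units.smul_def, smul_comm c]
    | cons z l ih =>
      simp only [List.cons_append, jetMul_cons]
      rw [ih (hφ.shift z rfl) hψ rfl, ih hφ (hψ.shift z rfl) rfl]
      simp only [smul_add, Units.smul_def, smul_comm c]
  br l a b c h' x y l' := by
    induction l generalizing m n r φ ψ with
    | nil =>
      have h1 : jetShift ⟨c, G.br h' x y⟩ φ = jetShift ⟨a, x⟩ (jetShift ⟨b, y⟩ φ) -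
          (a * b).negOnePow • jetShift ⟨b, y⟩ (jetShift ⟨a, x⟩ φ) :=
        funext fun l' => hφ.br [] h' x y l'
      have h2 : jetShift ⟨c, G.br h' x y⟩ ψ = jetShift ⟨a, x⟩ (jetShift ⟨b, y⟩ ψ) -
          (a * b).negOnePow • jetShift ⟨b, y⟩ (jetShift ⟨a, x⟩ ψ) :=
        funext fun l' => hψ.br [] h' x y l'
      simp only [List.nil_append, jetMul_cons, h1, h2, map_sub, LinearMap.sub_apply, Pi.sub_apply,
        jetMul_units_left, jetMul_units_right, Pi.smul_apply, smul_sub, smul_add, smul_smul]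
      rw [show m + b + a = m + c by omega, show m + a + b = m + c by omega,
        show n + b + a = n + c by omega, show n + a + b = n + c by omega]
      simp only [← h', mul_add, add_mul, Int.negOnePow_add, mul_comm b a]
      rcases Int.units_eq_one_or (a * b).negOnePow with e | e <;>
        rcases Int.units_eq_one_or (a * m).negOnePow with e' | e' <;>
        rcases Int.units_eq_one_or (b * m).negOnePow with e'' | e'' <;>
        simp only [e, e', e'', one_mul, mul_one, one_smul, neg_mul, neg_neg, mul_neg,
          Units.neg_smul] <;> abel
    | cons z l ih =>
      simp only [List.cons_append, jetMul_cons]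
      rw [ih (hφ.shift z rfl) hψ rfl, ih hφ (hψ.shift z rfl) rfl]
      simp only [smul_add, smul_sub, smul_smul, mul_comm]
      abel
  mul l a b c h' x y l' := by
    induction l generalizing m n r φ ψ with
    | nil =>
      have h1 : jetShift ⟨c, G.mul h' x y⟩ φ = 0 := funext fun l' => hφ.mul [] h' x y l'
      have h2 : jetShift ⟨c, G.mul h' x y⟩ ψ = 0 := funext fun l' => hψ.mul [] h' x y l'
      simp [jetMul_cons, h1, h2]
    | cons z l ih =>
      simp only [List.cons_append, jetMul_cons]
      rw [ih (hφ.shift z rfl) hψ rfl, ih hφ (hψ.shift z rfl) rfl, smul_zero, add_zero]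

variable (A) in
/-- The function with value `a` at the empty list. -/
def jetConst (a : A.X n) : JetFn H A
  | [], r => if h : n = r then h ▸ a else 0
  | _ :: _, _ => 0

lemma isJet_const (a : A.X n) : IsJet G n (jetConst (H := H) A a) where
  deg l r h := by
    cases l with
    | nil => exact dif_neg (by simpa using h)
    | cons x l => rfl
  add l m x y l' := by cases l <;> exact (add_zero _).symm
  smul l m c x l' := by cases l <;> exact (smul_zero _).symm
  br l m n r h x y l' := by
    have h0 : ∀ z l, jetConst (H := H) A a (z :: l) = 0 := fun _ _ => rfl
    cases l <;> simp [h0]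
  mul l m n r h x y l' := by cases l <;> rfl

lemma jetConst_nil (a : A.X n) : jetConst (H := H) A a [] n = a := dif_pos rfl

section Central

variable (G) (B : ∀ {m n : ℤ}, n + 1 = m → (H.X m →ₗ[k] A.X n))

/-- The jet of `B` at `y`. -/
def genJet : List (Σ m : ℤ, H.X m) → {m : ℤ} → H.X m → ∀ r : ℤ, A.X r
  | [], m, y => fun r => if h : r + 1 = m then B h y else 0
  | x :: l, m, y => x.1.negOnePow • genJet l (G.br (r := x.1 + m) rfl x.2 y)

variable {G} {B}

lemma genJet_add (l) (x y : H.X m) : genJet G B l (x + y) = genJet G B l x + genJet G B l y := by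
  induction l generalizing m with
  | nil =>
    funext r
    by_cases h : r + 1 = m <;> simp [genJet, h]
  | cons z l ih => simp only [genJet, map_add, ih, smul_add]

lemma genJet_smul (l) (c : k) (y : H.X m) : genJet G B l (c • y) = c • genJet G B l y := by
  induction l generalizing m with
  | nil =>
    funext r
    by_cases h : r + 1 = m <;> simp [genJet, h]
  | cons z l ih => simp only [genJet, map_smul, ih, Units.smul_def, smul_comm c]

variable (G B) in
/-- The jet of `B` as a linear map. -/
def genMap (m : ℤ) : H.X m →ₗ[k] JetFn H A where
  toFun y l := genJet G B l y
  map_add' x y := funext fun l => genJet_add l x y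
  map_smul' c y := funext fun l => genJet_smul l c y

lemma genMap_cons (x : Σ m : ℤ, H.X m) (l) (y : H.X m) (h : x.1 + m = n) :
    genMap G B m y (x :: l) = x.1.negOnePow • genMap G B n (G.br h x.2 y) l := by
  subst h
  rfl

lemma genMap_nil (h : r + 1 = m) (y : H.X m) : genMap G B m y [] r = B h y := dif_pos h

lemma jetShift_genMap (x : Σ m : ℤ, H.X m) (y : H.X m) (h : x.1 + m = n) :
    jetShift x (genMap G B m y) = x.1.negOnePow • genMap G B n (G.br h x.2 y) :=
  funext fun l => genMap_cons x l y h

lemma genMap_units (s : ℤˣ) (y : H.X m) : genMap G B m (s • y) = s • genMap G B m y := by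
  simp [Units.smul_def]

lemma genMap_mul (hB : ∀ {m n r s : ℤ} (h : m + n - 1 = r) (h' : s + 1 = r) (x : H.X m)
    (y : H.X n), B h' (G.mul h x y) = 0) (h : m + n - 1 = r) (x : H.X m) (y : H.X n) :
    genMap G B r (G.mul h x y) = 0 := by
  funext l
  induction l generalizing m n r with
  | nil =>
    funext s
    by_cases h' : s + 1 = r
    · rw [genMap_nil h', hB]
      rfl
    · exact dif_neg h'
  | cons z l ih =>
    rw [genMap_cons z l _ rfl, ← Pi.smul_apply, ← genMap_units, G.leibniz' (mn := z.1 + m)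
      (mp := z.1 + n) rfl h rfl (by omega) rfl (by omega), map_add, genMap_units, Pi.add_apply,
      Pi.smul_apply, ih, ih]
    simp

lemma LambdaGerAlgebra.br_br (G : LambdaGerAlgebra H) {a b c ab bc ac s : ℤ} (h1 : a + b = ab)
    (h2 : b + c = bc) (h3 : a + c = ac) (h1' : ab + c = s) (h2' : a + bc = s) (h3' : b + ac = s)
    (x : H.X a) (y : H.X b) (z : H.X c) : G.br h1' (G.br h1 x y) z =
      G.br h2' x (G.br h2 y z) - (a * b).negOnePow • G.br h3' y (G.br h3 x z) := by
  have := G.jacobi' h1 h2 (show c + a = ac by omega) h1' (by omega) (by omega) x y z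
  rw [add_assoc] at this
  rw [eq_neg_of_add_eq_zero_left this, G.br_symm (by omega : bc + a = s),
    G.br_symm (by omega : ac + b = s), G.br_symm (by omega : c + a = ac)]
  simp only [map_neg, map_units, smul_neg, neg_neg, smul_smul, neg_add, ← h2, ← h3, add_mul,
    mul_add, Int.negOnePow_add, mul_comm b a, mul_comm c a, mul_comm c b]
  rcases Int.units_eq_one_or (a * b).negOnePow with e | e <;>
    rcases Int.units_eq_one_or (a * c).negOnePow with e' | e' <;>
    rcases Int.units_eq_one_or (b * c).negOnePow with e'' | e'' <;>
    simp [e, e', e'', sub_eq_add_neg]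

lemma isJet_genMap (hB : ∀ {m n r s : ℤ} (h : m + n - 1 = r) (h' : s + 1 = r) (x : H.X m)
    (y : H.X n), B h' (G.mul h x y) = 0) (h : n + 1 = m) (y : H.X m) :
    IsJet G n (genMap G B m y) where
  deg l r h' := by
    induction l generalizing m n with
    | nil => exact dif_neg (by simp at h'; omega)
    | cons x l ih =>
      simp only [List.map_cons, List.sum_cons] at h'
      rw [genMap_cons x l y rfl, Pi.smul_apply, ih (n := n + x.1) (by omega) _ (by omega), smul_zero]
  add l a x z l' := by
    induction l generalizing m n with
    | nil =>
      simp only [List.nil_append, genMap_cons _ _ y rfl, map_add, LinearMap.add_apply,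
        Pi.add_apply, smul_add]
    | cons x l ih =>
      simp only [List.cons_append, genMap_cons _ _ y rfl]
      rw [ih (n := n + x.1) (by omega), smul_add]
  smul l a c x l' := by
    induction l generalizing m n with
    | nil =>
      simp only [List.nil_append, genMap_cons _ _ y rfl, map_smul, LinearMap.smul_apply,
        Pi.smul_apply, Units.smul_def, smul_comm c]
    | cons x l ih =>
      simp only [List.cons_append, genMap_cons _ _ y rfl]
      rw [ih (n := n + x.1) (by omega)]
      simp only [Units.smul_def, smul_comm c]
  br l a b c h' x z l' := by
    induction l generalizing m n with
    | nil =>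
      rw [List.nil_append, List.nil_append, List.nil_append, genMap_cons _ _ y rfl,
        genMap_cons _ _ y rfl, genMap_cons (n := c + m) _ _ _ (by simp; omega),
        genMap_cons _ _ y rfl, genMap_cons (n := c + m) _ _ _ (by simp; omega),
        G.br_br (bc := b + m) (ac := a + m) h' rfl rfl rfl (by omega) (by omega), map_sub,
        genMap_units, Pi.sub_apply, Pi.smul_apply, smul_sub, smul_smul, smul_smul, smul_smul,
        smul_smul]
      have hc : c.negOnePow = b.negOnePow * a.negOnePow := by
        rw [← h', Int.negOnePow_add, mul_comm]
      change c.negOnePow • _ - (c.negOnePow * _) • _ = _ - (_ * a.negOnePow * b.negOnePow) • _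
      rw [hc, mul_comm (b.negOnePow * a.negOnePow) (a * b).negOnePow,
        mul_assoc (a * b).negOnePow a.negOnePow, mul_comm a.negOnePow b.negOnePow]
    | cons x l ih =>
      simp only [List.cons_append, genMap_cons _ _ y rfl]
      rw [ih (n := n + x.1) (by omega), smul_sub, smul_comm]
  mul l a b c h' x z l' := by
    induction l generalizing m n with
    | nil =>
      rw [List.nil_append, genMap_cons _ _ y rfl, G.br_symm]
      have := G.leibniz' (mn := m + a) (mp := m + b) (r := c + m) rfl h' rfl (by omega) (by omega)
        (by omega) y x z
      have h0 : genMap G B (c + m) (m.negOnePow • G.br (by omega) y (G.mul h' x z)) l' = 0 := by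
        rw [this, map_add, genMap_units, genMap_mul hB, genMap_mul hB]
        simp
      rw [genMap_units, Pi.smul_apply, smul_eq_zero_iff_eq] at h0
      rw [map_neg, genMap_units, Pi.neg_apply, Pi.smul_apply, h0]
      simp
    | cons x l ih =>
      simp only [List.cons_append, genMap_cons _ _ y rfl]
      rw [ih (n := n + x.1) (by omega), smul_zero]

lemma genMap_central (hB : ∀ {m n p r : ℤ} (h : n + 1 = m) (h' : n + p = r) (x : H.X m)
    (a : A.X p), R.mul h' (B h x) a = (p * n).negOnePow • R.mul (by omega) a (B h x))
    (h : n + 1 = m) (y : H.X m) (φ : JetFn H A) : jetMul R n p (genMap G B m y) φ =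
      (p * n).negOnePow • jetMul R p n φ (genMap G B m y) := by
  funext l
  induction l generalizing m n p φ with
  | nil =>
    funext r
    by_cases h' : n + p = r
    · rw [jetMul_nil h', genMap_nil h, hB, Pi.smul_apply, Pi.smul_apply,
        jetMul_nil (show p + n = r by omega), genMap_nil h]
    · have e1 : jetMul R n p (genMap G B m y) φ [] r = 0 := dif_neg h'
      have e2 : jetMul R p n φ (genMap G B m y) [] r = 0 := dif_neg (by omega)
      rw [e1, Pi.smul_apply, Pi.smul_apply, e2, smul_zero]
  | cons x l ih =>
    have e1 := ih (n := n + x.1) (p := p) (by omega) (G.br (add_comm x.1 m) x.2 y) φ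
    have e2 := ih (p := p + x.1) h y (jetShift x φ)
    rw [Pi.smul_apply] at e1 e2 ⊢
    rw [jetMul_cons, jetMul_cons, jetShift_genMap x y (add_comm x.1 m), jetMul_units_left,
      jetMul_units_right, Pi.smul_apply, Pi.smul_apply, e1, e2, smul_add, smul_smul, smul_smul,
      smul_smul, smul_smul, add_comm]
    simp only [mul_add, add_mul, Int.negOnePow_add, mul_comm x.1 n, mul_comm x.1 p]
    rcases Int.units_eq_one_or (n * x.1).negOnePow with e | e <;>
      rcases Int.units_eq_one_or (p * x.1).negOnePow with e' | e' <;>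
      rcases Int.units_eq_one_or (p * n).negOnePow with e'' | e'' <;>
      simp only [e, e', e'', one_mul, mul_one, neg_mul, mul_neg, neg_neg, one_smul,
        Units.neg_smul]

end Central

end Jets

section Deformation

variable {k : Type u} [Field k] {H A : ChainComplex (ModuleCat.{w} k) ℤ}

variable (A) in
/-- The complex of jets, with zero differential. -/
def jetComplex (G : LambdaGerAlgebra H) : ChainComplex (ModuleCat.{w} k) ℤ where
  X n := ModuleCat.of k (jetSub A G n)
  d _ _ := 0
  shape _ _ _ := rfl
  d_comp_d' _ _ _ _ _ := by simp

variable {G : LambdaGerAlgebra H} {m n r p : ℤ}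

/-- The function of a jet. -/
def jetVal : (jetComplex A G).X n →ₗ[k] JetFn H A := (jetSub A G n).subtype

/-- The jet of a function. -/
def jetMk (φ : JetFn H A) (h : IsJet G n φ) : (jetComplex A G).X n := Subtype.mk φ h

@[simp] lemma jetVal_mk (φ : JetFn H A) (h : IsJet G n φ) : jetVal (jetMk φ h) = φ := rfl

lemma isJet_val (φ : (jetComplex A G).X n) : IsJet G n (jetVal φ) := Subtype.property φ

lemma jetVal_injective : Function.Injective (jetVal (A := A) (G := G) (n := n)) :=
  Subtype.val_injective

lemma jetComplex_d {i j : ℤ} (z : (jetComplex A G).X i) : ((jetComplex A G).d i j).hom z = 0 :=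
  rfl

/-- The algebra of jets. -/
def jetAssoc (R : DGAssocAlgebra A) : DGAssocAlgebra (jetComplex A G) where
  mul {m n r} h := LinearMap.mk₂ k
    (fun φ ψ => jetMk (jetMul R m n (jetVal φ) (jetVal ψ)) ((isJet_val φ).jetMul (isJet_val ψ) h))
    (fun _ _ _ => jetVal_injective (by simp)) (fun _ _ _ => jetVal_injective (by simp))
    (fun _ _ _ => jetVal_injective (by simp)) (fun _ _ _ => jetVal_injective (by simp))
  mul_assoc h φ ψ χ := jetVal_injective (funext fun l => jetMul_assoc _ _ _ l rfl rfl)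
  diff_mul h φ ψ := by
    simp only [jetComplex_d, map_zero, LinearMap.zero_apply, smul_zero, add_zero]

@[simp] lemma jetVal_mul (R : DGAssocAlgebra A) (h : m + n = r) (φ : (jetComplex A G).X m)
    (ψ : (jetComplex A G).X n) :
    jetVal ((jetAssoc R).mul h φ ψ) = jetMul R m n (jetVal φ) (jetVal ψ) := rfl

/-- The action on jets. -/
def jetAct (h : m + n = r) : H.X m →ₗ[k] (jetComplex A G).X n →ₗ[k] (jetComplex A G).X r :=
  LinearMap.mk₂ k
    (fun x φ => jetMk (jetShift ⟨m, x⟩ (jetVal φ)) ((isJet_val φ).shift ⟨m, x⟩ (by simp; omega)))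
    (fun x y φ => jetVal_injective (funext fun l => (isJet_val φ).add [] m x y l))
    (fun c x φ => jetVal_injective (funext fun l => (isJet_val φ).smul [] m c x l))
    (fun _ _ _ => rfl) (fun _ _ _ => rfl)

@[simp] lemma jetVal_act (h : m + n = r) (x : H.X m) (φ : (jetComplex A G).X n) :
    jetVal (jetAct h x φ) = jetShift ⟨m, x⟩ (jetVal φ) := rfl

variable (T : CentralTriple H A)

/-- The jets of `β`. -/
def jetGen (h : n + 1 = m) :
    (polyComplex H).X m →ₗ[k] (jetComplex A (polyGer T.ger)).X n where
  toFun y := jetMk (genMap (polyGer T.ger) (fun h => T.beta h ∘ₗ integral) m y)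
    (isJet_genMap (fun h h' x y => beta_integral_mul T h h' x y) h y)
  map_add' x y := jetVal_injective (map_add (genMap (polyGer T.ger) _ m) x y)
  map_smul' c y := jetVal_injective (map_smul (genMap (polyGer T.ger) _ m) c y)

lemma jetVal_gen (h : n + 1 = m) (y : (polyComplex H).X m) : jetVal (jetGen T h y) =
    genMap (polyGer T.ger) (fun h => T.beta h ∘ₗ integral) m y := rfl

lemma jetAct_gen (h : m + n = r) (h' : n + 1 = p) (x : (polyComplex H).X m)
    (y : (polyComplex H).X p) {q : ℤ} (h'' : r + 1 = q) :
    jetAct h x (jetGen T h' y) =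
      m.negOnePow • jetGen T h'' ((polyGer T.ger).br (by omega) x y) := by
  refine jetVal_injective ?_
  rw [map_units, jetVal_act, jetVal_gen, jetVal_gen]
  exact jetShift_genMap _ y _

lemma jetGen_mul (h : m + n - 1 = r) (h' : p + 1 = r) (x : (polyComplex H).X m)
    (y : (polyComplex H).X n) : jetGen T h' ((polyGer T.ger).mul h x y) = 0 :=
  jetVal_injective ((genMap_mul (G := polyGer T.ger) (B := fun h => T.beta h ∘ₗ integral)
    (fun h h' x y => beta_integral_mul T h h' x y) h x y).trans (map_zero jetVal).symm)

/-- The algebra over `sc^!` with zero differential attached to a triple. -/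
def deformation : ScAlgebra (polyComplex H) (jetComplex A (polyGer T.ger)) where
  ger := polyGer T.ger
  assoc := jetAssoc T.assoc
  act := jetAct
  beta h := jetGen T h ∘ₗ eulerMap
  act_br {m n p r} h x y a := by
    refine jetVal_injective ?_
    rw [map_sub, map_units]
    exact funext fun l => (isJet_val a).br [] rfl x y l
  act_mul {m n p r} h x a b := by
    refine jetVal_injective ?_
    rw [map_add, map_units]
    simp only [jetVal_act, jetVal_mul, jetShift_mul, add_comm m]
  act_ger_mul h x y a := jetVal_injective (funext fun l => (isJet_val a).mul [] _ x y l)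
  beta_br {m n r} h x y := by
    simp only [LinearMap.comp_apply]
    rw [eulerMap_br, map_add, jetAct_gen T _ _ _ _ h, jetAct_gen T _ _ _ _ h, smul_smul, smul_smul,
      negOnePow_mul_self, one_smul, Int.negOnePow_add, mul_assoc, negOnePow_mul_self, mul_one,
      (polyGer T.ger).br_symm _ (eulerMap x) y, map_neg, map_units, add_comm, sub_eq_add_neg]
  beta_ger_mul h x y := by
    simp only [LinearMap.comp_apply]
    rw [eulerMap_mul, map_add, jetGen_mul, jetGen_mul, add_zero]
  diff_beta h x := by rw [jetComplex_d, polyComplex_d, map_zero, neg_zero]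
  diff_act {m n r} h x a := by
    simp only [jetComplex_d, polyComplex_d, map_zero, LinearMap.zero_apply, smul_zero, add_zero]
    rw [eq_comm, sub_eq_zero]
    refine jetVal_injective ?_
    rw [map_units, jetVal_mul, jetVal_mul, mul_comm]
    exact genMap_central (G := polyGer T.ger) (B := fun h => T.beta h ∘ₗ integral)
      (m := m) (n := m - 1) (p := n) (fun h h' x a => T.beta_central h h' _ a) (by omega) _ _

/-- The projection from jets. -/
def jetBase : (jetComplex A G).X n →ₗ[k] A.X n := LinearMap.proj n ∘ₗ LinearMap.proj [] ∘ₗ jetVal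

/-- Constant jets. -/
def jetSection (a : A.X n) : (jetComplex A G).X n := jetMk (jetConst A a) (isJet_const a)

lemma jetBase_section (a : A.X n) : jetBase (jetSection (G := G) a) = a :=
  jetConst_nil (H := H) a

lemma jetBase_mul (R : DGAssocAlgebra A) (h : m + n = r) (φ : (jetComplex A G).X m)
    (ψ : (jetComplex A G).X n) :
    jetBase ((jetAssoc R).mul h φ ψ) = R.mul h (jetBase φ) (jetBase ψ) := jetMul_nil h _ _

lemma jetBase_beta [CharZero k] (h : n + 1 = m) (y : (polyComplex H).X m) :
    jetBase ((deformation T).beta h y) = T.beta h (evalOne y) := by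
  rw [← integral_eulerMap]
  exact genMap_nil (G := polyGer T.ger) (B := fun h => T.beta h ∘ₗ integral) h _

end Deformation

section Intertwine

variable {k : Type u} [Field k] {V' V : Color → ChainComplex (ModuleCat.{w} k) ℤ}
variable (π : ∀ x n, (V' x).X n →ₗ[k] (V x).X n)
variable {l l' b : List Color} {x d : Color} {p q r : ℤ}

/-- The image of a homogeneous element. -/
def HomEl.map (a : HomEl V') : HomEl V := ⟨a.col, a.deg, π _ _ a.val⟩

@[simp] lemma cols_map (v : List (HomEl V')) : cols (v.map (HomEl.map π)) = cols v := by
  simp [cols, HomEl.map, Function.comp_def]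

@[simp] lemma degs_map (v : List (HomEl V')) : degs (v.map (HomEl.map π)) = degs v := by
  simp [degs, HomEl.map, Function.comp_def]

/-- The maps `π` take the operation `F'` to `F`. -/
def Intertwines (F' : EndObj V' l d p) (F : EndObj V l d p) : Prop :=
  ∀ v r, cols v = l → π d r (F'.1 v r) = F.1 (v.map (HomEl.map π)) r

variable {π} {F' G' : EndObj V' l d p} {F G : EndObj V l d p}

lemma Intertwines.add (hF : Intertwines π F' F) (hG : Intertwines π G' G) :
    Intertwines π (F' + G') (F + G) := fun v r hv =>
  (map_add _ _ _).trans (congrArg₂ _ (hF v r hv) (hG v r hv))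

lemma Intertwines.smul (c : k) (hF : Intertwines π F' F) : Intertwines π (c • F') (c • F) :=
  fun v r hv => (map_smul _ _ _).trans (congrArg _ (hF v r hv))

lemma Intertwines.one (x : Color) : Intertwines π (endOne x) (endOne x) := by
  intro v r hv
  obtain ⟨m, a, rfl⟩ := eq_of_cols_one hv
  by_cases h : m = r
  · subst h
    exact (congrArg _ (endOne_apply a)).trans (endOne_apply (π x m a)).symm
  · rw [(endOne x).2.degs_ne _ _ (by simpa using h), map_zero,
      (endOne x).2.degs_ne _ _ (by simpa [HomEl.map] using h)]

lemma Intertwines.act (e : Fin l'.length ≃ Fin l.length) (he : ∀ i, l'.get i = l.get (e i))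
    (hF : Intertwines π F' F) : Intertwines π (endAct e he F') (endAct e he F) := by
  intro v r hv
  have h : permL e (v.map (HomEl.map π)) = (permL e v).map (HomEl.map π) := by
    refine List.ext_getElem (by simp) fun i h1 h2 => ?_
    rw [permL_getElem, List.getElem_map, permL_getElem]
    refine Eq.trans ?_ (List.getD_map _ _ (HomEl.map π))
    rw [show HomEl.map π default = default from congrArg (HomEl.mk _ _) (map_zero _)]
  rw [endAct_apply e he F' v r hv, map_units, hF _ _ (cols_permL e he v hv),
    endAct_apply e he F _ r ((cols_map π v).trans hv), h,
    show permSign e (v.map (HomEl.map π)) = permSign e v by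
      unfold permSign degVec; simp [HomEl.map, Function.comp_def]]

lemma Intertwines.comp {E' : EndObj V' b x q} {E : EndObj V b x q} (l₁ l₂ : List Color)
    (hl : l = l₁ ++ x :: l₂) (hl' : l' = l₁ ++ b ++ l₂) (hr : p + q = r) (hF : Intertwines π F' F)
    (hE : Intertwines π E' E) :
    Intertwines π (endComp l₁ l₂ hl hl' hr F' E') (endComp l₁ l₂ hl hl' hr F E) := by
  intro v r hv
  obtain ⟨u, v, w, rfl, h1, h2, h3⟩ := exists_split _ _ _ _ (hv.trans hl')
  rw [endComp_apply l₁ l₂ hl hl' hr _ _ u v w _ h1 h2 h3, map_units,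
    hF _ _ (by simp [h1, h3, hl]), List.map_append (l₁ := u ++ v), List.map_append (l₁ := u) (l₂ := v),
    endComp_apply l₁ l₂ hl hl' hr _ _ _ _ _ _ ((cols_map π u).trans h1)
      ((cols_map π v).trans h2) ((cols_map π w).trans h3), List.map_append, List.map_cons,
    degs_map, degs_map]
  rw [show HomEl.map π (HomEl.out x (E'.1 v) (q + degs v)) = HomEl.out x _ _ from
    congrArg (HomEl.mk x _) (hE v _ h2)]
  rfl

lemma Intertwines.unique (hπ : ∀ x n, Function.Surjective (π x n)) (hF : Intertwines π F' F)
    (hG : Intertwines π F' G) : F = G := by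
  refine EndObj.ext' fun v r hv => ?_
  obtain ⟨v, rfl⟩ : ∃ v' : List (HomEl V'), v'.map (HomEl.map π) = v := by
    refine List.map_surjective_iff.2 (fun a => ?_) v
    obtain ⟨b, hb⟩ := hπ _ _ a.val
    exact ⟨⟨a.col, a.deg, b⟩, congrArg (HomEl.mk _ _) hb⟩
  rw [cols_map] at hv
  exact (hF v r hv).symm.trans (hG v r hv)

lemma Intertwines.bin {x y : Color}
    {f : ∀ {m n r : ℤ}, p + (m + n) = r → ((V x).X m →ₗ[k] (V y).X n →ₗ[k] (V d).X r)}
    {f' : ∀ {m n r : ℤ}, p + (m + n) = r → ((V' x).X m →ₗ[k] (V' y).X n →ₗ[k] (V' d).X r)}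
    (h : ∀ {m n r : ℤ} (h : p + (m + n) = r) (a : (V' x).X m) (b : (V' y).X n),
      π d r (f' h a b) = f h (π x m a) (π y n b)) : Intertwines π (binOp f') (binOp f) := by
  intro v r hv
  obtain ⟨m, n, a, b, rfl⟩ := eq_of_cols_two hv
  by_cases hr : p + (m + n) = r
  · exact (congrArg _ (binOp_apply f' a b hr)).trans ((h hr a b).trans
      (binOp_apply f (π x m a) (π y n b) hr).symm)
  · rw [(binOp f').2.degs_ne _ _ (by simpa using hr), map_zero,
      (binOp f).2.degs_ne _ _ (by simpa [HomEl.map] using hr)]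

lemma Intertwines.un {x : Color} {f : ∀ {m r : ℤ}, p + m = r → ((V x).X m →ₗ[k] (V d).X r)}
    {f' : ∀ {m r : ℤ}, p + m = r → ((V' x).X m →ₗ[k] (V' d).X r)}
    (h : ∀ {m r : ℤ} (h : p + m = r) (a : (V' x).X m), π d r (f' h a) = f h (π x m a)) :
    Intertwines π (unOp f') (unOp f) := by
  intro v r hv
  obtain ⟨m, a, rfl⟩ := eq_of_cols_one hv
  by_cases hr : p + m = r
  · exact (congrArg _ (unOp_apply f' a hr)).trans ((h hr a).trans
      (unOp_apply f (π x m a) hr).symm)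
  · rw [(unOp f').2.degs_ne _ _ (by simpa using hr), map_zero,
      (unOp f).2.degs_ne _ _ (by simpa [HomEl.map] using hr)]

end Intertwine

section TripleOps

open Color

variable {k : Type u} [Field k] {V : Color → ChainComplex (ModuleCat.{w} k) ℤ}
variable (T : CentralTriple (V cl) (V op))

/-- The complexes underlying the deformation of a triple. -/
def deformV : Color → ChainComplex (ModuleCat.{w} k) ℤ
  | cl => polyComplex (V cl)
  | op => jetComplex (V op) (polyGer T.ger)

/-- The deformation of a triple. -/
def deformAlg : ScAlgebra (deformV T cl) (deformV T op) := deformation T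

/-- The projection from the deformation of a triple. -/
def deformProj : ∀ x n, (deformV T x).X n →ₗ[k] (V x).X n
  | cl, _ => evalOne
  | op, _ => jetBase

lemma deformProj_surjective : ∀ x n, Function.Surjective (deformProj T x n)
  | cl, _ => fun x => ⟨monomialOne x, evalOne_monomialOne x⟩
  | op, _ => fun a => ⟨jetSection a, jetBase_section a⟩

lemma deformV_d (x : Color) (i j : ℤ) : (deformV T x).d i j = 0 := by cases x <;> rfl

variable {l : List Color} {d : Color} {p q : ℤ}

lemma deformAlg_boundary (h : q + 1 = p) (f : (scDual k).obj l d p) :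
    (deformAlg T).ev ((scDual k).diff h f) = 0 := by
  rw [ScAlgebra.ev_diff]
  refine EndObj.ext' fun v r hv => ?_
  have := dSumL_eq_zero ((deformAlg T).ev f).2 r v
    (fun a _ => by simp only [HomEl.diff, deformV_d]; rfl) []
  simp only [List.nil_append] at this
  rw [endDiff_apply, deformV_d, this, smul_zero, sub_zero]
  rfl

/-- The operation `f` of the deformation induces `F` on the triple. -/
def Acts (f : (scDual k).obj l d p) (F : EndObj V l d p) : Prop :=
  Intertwines (deformProj T) ((deformAlg T).ev f) F

lemma acts_l2 : Acts T (scDualGens k).l2 (binOp fun h => T.ger.br (by omega)) := by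
  unfold Acts
  rw [ScAlgebra.ev_l2]
  exact Intertwines.bin (f' := fun h => (deformAlg T).ger.br (by omega))
    (f := fun h => T.ger.br (by omega)) (π := deformProj T) fun h a b => evalOne_br T.ger _ a b

lemma acts_c2 : Acts T (scDualGens k).c2 (binOp fun h => T.ger.mul (by omega)) := by
  unfold Acts
  rw [ScAlgebra.ev_c2]
  exact Intertwines.bin (f' := fun h => (deformAlg T).ger.mul (by omega))
    (f := fun h => T.ger.mul (by omega)) (π := deformProj T) fun h a b => evalOne_mul T.ger _ a b

lemma acts_n02 : Acts T (scDualGens k).n02 (binOp fun h => T.assoc.mul (by omega)) := by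
  unfold Acts
  rw [ScAlgebra.ev_n02]
  exact Intertwines.bin (f' := fun h => (deformAlg T).assoc.mul (by omega))
    (f := fun h => T.assoc.mul (by omega)) (π := deformProj T)
    fun h a b => jetBase_mul T.assoc _ a b

lemma acts_n10 [CharZero k] : Acts T (scDualGens k).n10 (unOp fun h => T.beta (by omega)) := by
  unfold Acts
  rw [ScAlgebra.ev_n10]
  exact Intertwines.un (f' := fun h => (deformAlg T).beta (by omega))
    (f := fun h => T.beta (by omega)) (π := deformProj T) fun h a => jetBase_beta T _ a

lemma Gen.exists_acts [CharZero k] {f : (scDual k).obj l d p} (hf : Gen f) :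
    ∃ F : EndObj V l d p, Acts T f F ∧ ∀ {q : ℤ} (hq : q + 1 = p), endDiff hq F = 0 := by
  induction hf with
  | l2 =>
    exact ⟨_, acts_l2 T, fun {q} hq => by
      obtain rfl : q = -1 := by omega
      exact T.ger.endDiff_br⟩
  | c2 =>
    exact ⟨_, acts_c2 T, fun {q} hq => by
      obtain rfl : q = -2 := by omega
      exact T.ger.endDiff_mul⟩
  | n02 =>
    exact ⟨_, acts_n02 T, fun {q} hq => by
      obtain rfl : q = -1 := by omega
      exact T.assoc.endDiff_mul⟩
  | n10 =>
    exact ⟨_, acts_n10 T, fun {q} hq => by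
      obtain rfl : q = -2 := by omega
      exact endDiff_unOp T.diff_beta⟩
  | zero =>
    exact ⟨0, fun v r hv => by rw [map_zero]; exact map_zero _, fun _ => map_zero _⟩
  | add _ _ ihf ihg =>
    obtain ⟨F, hF, hF'⟩ := ihf
    obtain ⟨G, hG, hG'⟩ := ihg
    refine ⟨F + G, ?_, fun hq => by rw [map_add, hF', hG', add_zero]⟩
    unfold Acts
    rw [map_add]
    exact hF.add hG
  | smul c _ ih =>
    obtain ⟨F, hF, hF'⟩ := ih
    refine ⟨c • F, ?_, fun hq => by rw [map_smul, hF', smul_zero]⟩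
    unfold Acts
    rw [map_smul]
    exact hF.smul c
  | one x =>
    exact ⟨endOne x, by unfold Acts; rw [ScAlgebra.ev_one]; exact .one x, fun hq => end_diff_one hq⟩
  | act e he _ ih =>
    obtain ⟨F, hF, hF'⟩ := ih
    refine ⟨endAct e he F, ?_, fun hq => by rw [end_diff_act, hF', map_zero]⟩
    unfold Acts
    rw [ScAlgebra.ev_act]
    exact hF.act e he
  | comp l₁ l₂ hl hl' hr _ _ ihf ihg =>
    obtain ⟨F, hF, hF'⟩ := ihf
    obtain ⟨G, hG, hG'⟩ := ihg
    refine ⟨endComp l₁ l₂ hl hl' hr F G, ?_, fun hq => ?_⟩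
    · unfold Acts
      rw [ScAlgebra.ev_comp]
      exact hF.comp l₁ l₂ hl hl' hr hG
    · rw [end_diff_comp _ _ _ _ hr (sub_add_cancel _ 1) (sub_add_cancel _ 1) hq (by omega)
        (by omega), hF', hG']
      simp

lemma exists_acts_class [CharZero k] (c : (scDualHomology k).obj l d p) :
    ∃ F : EndObj V l d p,
      (∀ f : (scDual k).cycles l d p, Submodule.Quotient.mk f = c → Acts T f.1 F) ∧
      ∀ {q : ℤ} (hq : q + 1 = p), endDiff hq F = 0 := by
  obtain ⟨f, rfl⟩ := Submodule.Quotient.mk_surjective _ c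
  obtain ⟨g, hg, b, hb⟩ := exists_gen_of_cycle _ f.1 ((DGOperad.mem_cycles (sub_add_cancel p 1)).1 f.2)
  obtain ⟨F, hF, hF'⟩ := hg.exists_acts T
  refine ⟨F, fun f' hf' => ?_, hF'⟩
  obtain ⟨b', hb'⟩ := (DGOperad.mem_boundaries rfl).1 ((Submodule.Quotient.eq _).1 hf')
  have h : (f' : (scDual k).obj l d p) = g + (scDual k).diff rfl b + (scDual k).diff rfl b' := by
    rw [hb', ← hb]; simp
  unfold Acts at hF ⊢
  rwa [h, map_add, map_add, deformAlg_boundary, deformAlg_boundary, add_zero, add_zero]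

variable [CharZero k]

/-- The operation of a homology class on a triple. -/
def classOp (c : (scDualHomology k).obj l d p) : EndObj V l d p :=
  Classical.choose (exists_acts_class T c)

lemma acts_classOp (f : (scDual k).cycles l d p) :
    Acts T f.1 (classOp T (Submodule.Quotient.mk f)) :=
  (Classical.choose_spec (exists_acts_class T _)).1 f rfl

lemma classOp_eq {f : (scDual k).cycles l d p} {F : EndObj V l d p} (h : Acts T f.1 F) :
    classOp T (Submodule.Quotient.mk f) = F :=
  (acts_classOp T f).unique (deformProj_surjective T) h

end TripleOps

section TripleAlgebra

open Color

variable {k : Type u} [Field k] {V W : Color → ChainComplex (ModuleCat.{w} k) ℤ}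

/-- The list of a tuple of inputs. -/
def Inputs.toList : {l : List Color} → Inputs V l → List (HomEl V)
  | _, nil => []
  | _, cons n a v => ⟨_, n, a⟩ :: v.toList

@[simp] lemma Inputs.cols_toList {l : List Color} (v : Inputs V l) : cols v.toList = l := by
  induction v with
  | nil => rfl
  | cons n a v ih => simp [toList, ih]

@[simp] lemma Inputs.degs_toList {l : List Color} (v : Inputs V l) : degs v.toList = v.deg := by
  induction v with
  | nil => rfl
  | cons n a v ih => simp [toList, ih, deg]

@[simp] lemma Inputs.toList_append {l m : List Color} (v : Inputs V l) (w : Inputs V m) :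
    (v.append w).toList = v.toList ++ w.toList := by
  induction v with
  | nil => rfl
  | cons n a v ih => simp [toList, append, ih]

lemma Inputs.dSum_toList {M : Type w} [AddCommGroup M] {l : List Color} (v : Inputs V l)
    (F : List (HomEl V) → M) : v.dSum (fun v' => F v'.toList) = dSumL v.toList F := by
  induction v generalizing F with
  | nil => rfl
  | cons n a v ih => exact congrArg₂ _ rfl (congrArg _ (ih fun v' => F (⟨_, n, a⟩ :: v')))

lemma permSign_swap {l l' : List Color} (e : Fin l'.length ≃ Fin l.length) (u w : List (HomEl V))
    (a b : HomEl V) (h : ∀ i, (e i : ℕ) = Equiv.swap u.length (u.length + 1) (i : ℕ))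
    (hl : l'.length = u.length + w.length + 2) :
    permSign e (u ++ b :: a :: w) = (a.deg * b.deg).negOnePow := by
  have h0 : u.length < l'.length := by omega
  have h1 : u.length + 1 < l'.length := by omega
  have hs : ∀ i j : Fin l'.length, (i : ℕ) < j → (e j : ℕ) < e i →
      i = ⟨u.length, h0⟩ ∧ j = ⟨u.length + 1, h1⟩ := by
    intro i j hij
    rw [h, h, Equiv.swap_apply_def, Equiv.swap_apply_def, Fin.ext_iff, Fin.ext_iff]
    dsimp only
    split_ifs <;> omega
  unfold permSign koszul
  rw [Finset.prod_eq_single ⟨u.length, h0⟩, Finset.prod_eq_single ⟨u.length + 1, h1⟩]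
  · rw [if_pos ⟨by simp, by simp [h]⟩]
    simp [degVec, mul_comm]
  · exact fun j _ hj => if_neg fun h' => hj (hs _ _ h'.1 h'.2).2
  · simp
  · exact fun i _ hi => Finset.prod_eq_one fun j _ => if_neg fun h' => hi (hs _ _ h'.1 h'.2).1
  · simp

lemma getElem?_swap {α : Type*} (u w : List α) (a b : α) (i : ℕ) :
    (u ++ b :: a :: w)[Equiv.swap u.length (u.length + 1) i]? = (u ++ a :: b :: w)[i]? := by
  rw [Equiv.swap_apply_def]
  split_ifs with h1 h2
  · simp [h1]
  · simp [h2]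
  · rcases lt_or_ge i u.length with h | h
    · rw [List.getElem?_append_left h, List.getElem?_append_left h]
    · obtain ⟨j, rfl⟩ : ∃ j, i = u.length + (j + 2) := ⟨i - u.length - 2, by omega⟩
      simp [List.getElem?_append_right]

lemma permL_swap {l l' : List Color} (e : Fin l'.length ≃ Fin l.length) (u w : List (HomEl V))
    (a b : HomEl V) (h : ∀ i, (e i : ℕ) = Equiv.swap u.length (u.length + 1) (i : ℕ))
    (hl : l.length = u.length + w.length + 2) :
    permL e (u ++ b :: a :: w) = u ++ a :: b :: w := by
  refine List.ext_getElem (by simp [hl]; omega) fun i h1 h2 => ?_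
  have hi : (e.symm ⟨i, by simpa using h1⟩ : ℕ) = Equiv.swap u.length (u.length + 1) i := by
    rw [← Equiv.swap_apply_self u.length (u.length + 1) (e.symm _ : ℕ), ← h]
    simp
  rw [permL_getElem, hi, List.getD_eq_getElem?_getD, getElem?_swap, List.getElem?_eq_getElem h2]
  rfl

variable [CharZero k] (T : CentralTriple (V cl) (V op))

/-- The algebra over the homology of `sc^!` given by a triple. -/
def CentralTriple.toAlgebra : OperadAlgebra (scDualHomology k) V where
  ev c v r := (classOp T c).1 v.toList r
  ev_deg c v r h := (classOp T c).2.degs_ne _ _ (by simpa using h)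
  ev_add := by
    rintro l d p ⟨f⟩ ⟨g⟩ v r
    exact congrFun (congrFun (congrArg Subtype.val (classOp_eq T (f := f + g) (by
      have := (acts_classOp T f).add (acts_classOp T g)
      rwa [← map_add] at this))) _) _
  ev_smul := by
    rintro l d p c ⟨f⟩ v r
    exact congrFun (congrFun (congrArg Subtype.val (classOp_eq T (f := c • f) (by
      have := (acts_classOp T f).smul c
      rwa [← map_smul] at this))) _) _
  ev_add_arg f u a b v r := by
    simp only [Inputs.toList_append, Inputs.toList]
    exact (classOp T f).2.map_add ..
  ev_smul_arg f u c a v r := by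
    simp only [Inputs.toList_append, Inputs.toList]
    exact (classOp T f).2.map_smul ..
  ev_one {x n} a := by
    have h : classOp T ((scDualHomology k).one x) = endOne x := classOp_eq T (by
      unfold Acts
      rw [ScAlgebra.ev_one]
      exact .one x)
    rw [h]
    exact endOne_apply a
  ev_comp := by
    rintro l₁ l₂ b x d p q s hs ⟨f⟩ ⟨g⟩ u v w r
    have h : classOp T ((scDualHomology k).comp l₁ l₂ rfl rfl hs (Submodule.Quotient.mk f)
        (Submodule.Quotient.mk g)) = endComp l₁ l₂ rfl rfl hs _ _ := classOp_eq T (by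
      have := (acts_classOp T f).comp l₁ l₂ rfl rfl hs (acts_classOp T g)
      rwa [← ScAlgebra.ev_comp] at this)
    refine (congrFun (congrFun (congrArg Subtype.val h) _) _).trans ?_
    simp only [Inputs.toList_append, Inputs.toList]
    rw [endComp_apply _ _ _ _ _ _ _ _ _ _ _ u.cols_toList v.cols_toList w.cols_toList,
      u.degs_toList, v.degs_toList]
    rfl
  ev_swap := by
    rintro l₁ l₂ x y d p m n ⟨f⟩ e he h u a b v r
    have h' : classOp T ((scDualHomology k).act e he (Submodule.Quotient.mk f)) =
        endAct e he _ := classOp_eq T (by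
      have := (acts_classOp T f).act e he
      rwa [← ScAlgebra.ev_act] at this)
    refine (congrFun (congrFun (congrArg Subtype.val h') _) _).trans ?_
    rw [endAct_apply _ _ _ _ _ (Inputs.cols_toList _)]
    have hu : l₁.length = u.toList.length := by rw [← length_cols, u.cols_toList]
    have hv : l₂.length = v.toList.length := by rw [← length_cols, v.cols_toList]
    rw [hu] at h
    simp only [Inputs.toList_append, Inputs.toList]
    rw [permSign_swap e u.toList v.toList _ _ h (by simp; omega),
      permL_swap e u.toList v.toList _ _ h (by simp; omega)]
    rfl
  ev_diff {l d p q} h c v r := by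
    have := (Classical.choose_spec (exists_acts_class T c)).2 h
    have := congrFun (congrFun (congrArg Subtype.val this) v.toList) (r - 1)
    rw [endDiff_apply, ← Inputs.dSum_toList, sub_add_cancel] at this
    have h0 : classOp T ((scDualHomology k).diff h c) = 0 := classOp_eq T (f := 0)
      fun v r hv => by rw [show (0 : (scDual k).cycles l d q).1 = 0 from rfl, map_zero]; exact map_zero _
    rw [h0]
    exact (sub_eq_zero.1 this).trans (zero_add _).symm

end TripleAlgebra

section AlgebraTriple

open Color Inputs

variable {k : Type u} [Field k] {V W : Color → ChainComplex (ModuleCat.{w} k) ℤ}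
variable {P : DGOperad k} (S : OperadAlgebra P V)
variable {x y z x' y' d : Color} {l : List Color} {m n t p q s r N : ℤ}

namespace Inputs

/-- One input. -/
abbrev one (a : (V x).X m) : Inputs V [x] := cons m a nil

/-- Two inputs. -/
abbrev two (a : (V x).X m) (b : (V y).X n) : Inputs V [x, y] := cons m a (one b)

/-- Three inputs. -/
abbrev three (a : (V x).X m) (b : (V y).X n) (c : (V z).X t) : Inputs V [x, y, z] :=
  cons m a (two b c)

end Inputs

namespace OperadAlgebra

lemma ev_zero (v : Inputs V l) (r : ℤ) : S.ev (0 : P.obj l d p) v r = 0 := by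
  rw [← zero_smul k (0 : P.obj l d p), S.ev_smul, zero_smul]

lemma ev_neg (f : P.obj l d p) (v : Inputs V l) (r : ℤ) : S.ev (-f) v r = -S.ev f v r := by
  rw [← neg_one_smul k, S.ev_smul, neg_one_smul]

/-- The linear map of a unary operation. -/
def lin (f : P.obj [x] d p) (m r : ℤ) : (V x).X m →ₗ[k] (V d).X r where
  toFun a := S.ev f (one a) r
  map_add' a b := S.ev_add_arg (l₁ := []) f nil a b nil r
  map_smul' c a := S.ev_smul_arg (l₁ := []) f nil c a nil r

/-- The bilinear map of a binary operation. -/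
def bilin (f : P.obj [x, y] d p) (m n r : ℤ) : (V x).X m →ₗ[k] (V y).X n →ₗ[k] (V d).X r :=
  LinearMap.mk₂ k (fun a b => S.ev f (two a b) r)
    (fun a b c => S.ev_add_arg (l₁ := []) f nil a b (one c) r)
    (fun c a b => S.ev_smul_arg (l₁ := []) f nil c a (one b) r)
    (fun a b c => S.ev_add_arg (l₁ := [x]) f (one a) b c nil r)
    (fun c a b => S.ev_smul_arg (l₁ := [x]) f (one a) c b nil r)

lemma ev_left (hs : p + q = s) (f : P.obj [x, y] d p) (g : P.obj [x', y'] x q) (a : (V x').X m)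
    (b : (V y').X n) (c : (V y).X t) (r : ℤ) (hN : q + (m + n) = N) :
    S.ev (P.comp (l := [x, y]) (l' := [x', y', y]) [] [y] rfl rfl hs f g) (three a b c) r =
      S.ev f (two (S.ev g (two a b) N) c) r := by
  obtain rfl : q + (two a b).deg = N := by simpa [deg] using hN
  refine (S.ev_comp (l₁ := []) (l₂ := [y]) hs f g nil (two a b) (one c) r).trans ?_
  rw [deg, mul_zero, Int.negOnePow_zero, one_smul]
  rfl

lemma ev_right (hs : p + q = s) (f : P.obj [x, y] d p) (g : P.obj [x', y'] y q) (a : (V x).X m)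
    (b : (V x').X n) (c : (V y').X t) (r : ℤ) (hN : q + (n + t) = N) :
    S.ev (P.comp (l := [x, y]) (l' := [x, x', y']) [x] [] rfl rfl hs f g) (three a b c) r =
      (q * m).negOnePow • S.ev f (two a (S.ev g (two b c) N)) r := by
  obtain rfl : q + (two b c).deg = N := by simpa [deg] using hN
  refine (S.ev_comp (l₁ := [x]) (l₂ := []) hs f g (one a) (two b c) nil r).trans ?_
  rw [deg, deg, add_zero]
  rfl

lemma ev_un_left (hs : p + q = s) (f : P.obj [x, y] d p) (g : P.obj [x'] x q) (a : (V x').X m)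
    (b : (V y).X n) (r : ℤ) (hN : q + m = N) :
    S.ev (P.comp (l := [x, y]) (l' := [x', y]) [] [y] rfl rfl hs f g) (two a b) r =
      S.ev f (two (S.ev g (one a) N) b) r := by
  obtain rfl : q + (one a).deg = N := by simpa [deg] using hN
  refine (S.ev_comp (l₁ := []) (l₂ := [y]) hs f g nil (one a) (one b) r).trans ?_
  rw [deg, mul_zero, Int.negOnePow_zero, one_smul]
  rfl

lemma ev_un_right (hs : p + q = s) (f : P.obj [x, y] d p) (g : P.obj [x'] y q) (a : (V x).X m)
    (b : (V x').X n) (r : ℤ) (hN : q + n = N) :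
    S.ev (P.comp (l := [x, y]) (l' := [x, x']) [x] [] rfl rfl hs f g) (two a b) r =
      (q * m).negOnePow • S.ev f (two a (S.ev g (one b) N)) r := by
  obtain rfl : q + (one b).deg = N := by simpa [deg] using hN
  refine (S.ev_comp (l₁ := [x]) (l₂ := []) hs f g (one a) (one b) nil r).trans ?_
  rw [deg, deg, add_zero]
  rfl

lemma ev_un_bin (hs : p + q = s) (f : P.obj [x] d p) (g : P.obj [x', y'] x q) (a : (V x').X m)
    (b : (V y').X n) (r : ℤ) (hN : q + (m + n) = N) :
    S.ev (P.comp (l := [x]) (l' := [x', y']) [] [] rfl rfl hs f g) (two a b) r =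
      S.ev f (one (S.ev g (two a b) N)) r := by
  obtain rfl : q + (two a b).deg = N := by simpa [deg] using hN
  refine (S.ev_comp (l₁ := []) (l₂ := []) hs f g nil (two a b) nil r).trans ?_
  rw [deg, mul_zero, Int.negOnePow_zero, one_smul]
  rfl

lemma ev_swap_two (f : P.obj [x, y] d p) (he) (a : (V x).X m) (b : (V y).X n) (r : ℤ) :
    S.ev (P.act (l := [x, y]) (l' := [y, x]) (Equiv.swap (0 : Fin 2) 1) he f) (two b a) r =
      (m * n).negOnePow • S.ev f (two a b) r :=
  S.ev_swap (l₁ := []) (l₂ := []) f _ he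
    (show ∀ i : Fin 2, (Equiv.swap (0 : Fin 2) 1 i : ℕ) = Equiv.swap 0 1 (i : ℕ) by decide) nil a b nil r

lemma ev_swap_left (f : P.obj [x, y, z] d p) (he) (a : (V x).X m) (b : (V y).X n)
    (c : (V z).X t) (r : ℤ) :
    S.ev (P.act (l := [x, y, z]) (l' := [y, x, z]) (Equiv.swap (0 : Fin 3) 1) he f)
      (three b a c) r = (m * n).negOnePow • S.ev f (three a b c) r :=
  S.ev_swap (l₁ := []) (l₂ := [z]) f _ he
    (show ∀ i : Fin 3, (Equiv.swap (0 : Fin 3) 1 i : ℕ) = Equiv.swap 0 1 (i : ℕ) by decide) nil a b (one c) r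

lemma ev_swap_right (f : P.obj [x, y, z] d p) (he) (a : (V x).X m) (b : (V y).X n)
    (c : (V z).X t) (r : ℤ) :
    S.ev (P.act (l := [x, y, z]) (l' := [x, z, y]) (Equiv.swap (1 : Fin 3) 2) he f)
      (three a c b) r = (n * t).negOnePow • S.ev f (three a b c) r :=
  S.ev_swap (l₁ := [x]) (l₂ := []) f _ he
    (show ∀ i : Fin 3, (Equiv.swap (1 : Fin 3) 2 i : ℕ) = Equiv.swap 1 2 (i : ℕ) by decide) (one a) b c nil r

lemma ev_rotate (f : P.obj [x, x, x] d p) {e : Fin 3 ≃ Fin 3}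
    (h : e = (Equiv.swap (1 : Fin 3) 2).trans (Equiv.swap 0 1)) (he) (a : (V x).X m)
    (b : (V x).X n) (c : (V x).X t) (r : ℤ) :
    S.ev (P.act (l := [x, x, x]) (l' := [x, x, x]) e he f) (three a b c) r =
      (t * (m + n)).negOnePow • S.ev f (three c a b) r := by
  subst h
  have h : ∀ i : Fin 3, [x, x, x].get i = x := by intro i; fin_cases i <;> rfl
  refine (congrArg (S.ev · _ _) (P.act_act (l := [x, x, x]) (l' := [x, x, x]) (Equiv.swap 0 1)
    (Equiv.swap 1 2) (fun i => (h _).trans (h _).symm)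
    (fun i => (h _).trans (h _).symm) f)).symm.trans ?_
  erw [S.ev_swap_right, S.ev_swap_left]
  rw [smul_smul, ← Int.negOnePow_add, mul_add, add_comm]

lemma ev_rotate_symm (f : P.obj [x, x, x] d p) {e : Fin 3 ≃ Fin 3}
    (h : e = (Equiv.swap (0 : Fin 3) 1).trans (Equiv.swap 1 2)) (he) (a : (V x).X m)
    (b : (V x).X n) (c : (V x).X t) (r : ℤ) :
    S.ev (P.act (l := [x, x, x]) (l' := [x, x, x]) e he f) (three a b c) r =
      (m * (n + t)).negOnePow • S.ev f (three b c a) r := by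
  subst h
  have h : ∀ i : Fin 3, [x, x, x].get i = x := by intro i; fin_cases i <;> rfl
  refine (congrArg (S.ev · _ _) (P.act_act (l := [x, x, x]) (l' := [x, x, x]) (Equiv.swap 1 2)
    (Equiv.swap 0 1) (fun i => (h _).trans (h _).symm)
    (fun i => (h _).trans (h _).symm) f)).symm.trans ?_
  erw [S.ev_swap_left, S.ev_swap_right]
  rw [smul_smul, ← Int.negOnePow_add, mul_add, mul_comm n, mul_comm t]

end OperadAlgebra

section Relations

variable (k)

lemma l2Class_symm : (scDualHomology k).act (l := [cl, cl]) (l' := [cl, cl])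
    (Equiv.swap (0 : Fin 2) 1) (by decide) (l2Class k) = -l2Class k :=
  congrArg Submodule.Quotient.mk (Subtype.ext (scDualGens k).l2_symm)

lemma c2Class_symm : (scDualHomology k).act (l := [cl, cl]) (l' := [cl, cl])
    (Equiv.swap (0 : Fin 2) 1) (by decide) (c2Class k) = -c2Class k :=
  congrArg Submodule.Quotient.mk (Subtype.ext (scDualGens k).c2_symm)

lemma c2Class_assoc : (scDualHomology k).comp (l' := [cl, cl, cl]) (r := -2) [cl] [] rfl rfl
      rfl (c2Class k) (c2Class k) =
    -(scDualHomology k).comp (l' := [cl, cl, cl]) (r := -2) [] [cl] rfl rfl rfl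
      (c2Class k) (c2Class k) :=
  congrArg Submodule.Quotient.mk (Subtype.ext (scDualGens k).c2_assoc)

lemma l2Class_jacobi :
    (scDualHomology k).comp (l' := [cl, cl, cl]) (r := 0) [] [cl] rfl rfl rfl
      (l2Class k) (l2Class k) +
    (scDualHomology k).act (l := [cl, cl, cl]) (l' := [cl, cl, cl]) (finRotate 3) (by decide)
      ((scDualHomology k).comp (l' := [cl, cl, cl]) (r := 0) [] [cl] rfl rfl rfl
        (l2Class k) (l2Class k)) +
    (scDualHomology k).act (l := [cl, cl, cl]) (l' := [cl, cl, cl]) (finRotate 3).symm (by decide)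
      ((scDualHomology k).comp (l' := [cl, cl, cl]) (r := 0) [] [cl] rfl rfl rfl
        (l2Class k) (l2Class k)) = 0 :=
  congrArg Submodule.Quotient.mk (Subtype.ext (scDualGens k).jacobi)

lemma l2Class_leibniz :
    (scDualHomology k).comp (l' := [cl, cl, cl]) (r := -1) [cl] [] rfl rfl rfl
      (l2Class k) (c2Class k) =
    (scDualHomology k).comp (l' := [cl, cl, cl]) (r := -1) [] [cl] rfl rfl rfl
      (c2Class k) (l2Class k) +
    (scDualHomology k).act (l := [cl, cl, cl]) (l' := [cl, cl, cl]) (Equiv.swap (0 : Fin 3) 1)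
      (by decide) ((scDualHomology k).comp (l' := [cl, cl, cl]) (r := -1) [cl] [] rfl rfl
        rfl (c2Class k) (l2Class k)) :=
  congrArg Submodule.Quotient.mk (Subtype.ext (scDualGens k).leibniz)

lemma n02Class_assoc : (scDualHomology k).comp (l' := [op, op, op]) (r := 0) [op] [] rfl rfl
      rfl (n02Class k) (n02Class k) =
    (scDualHomology k).comp (l' := [op, op, op]) (r := 0) [] [op] rfl rfl rfl
      (n02Class k) (n02Class k) :=
  congrArg Submodule.Quotient.mk (Subtype.ext (scDualGens k).n02_assoc)

lemma n10Class_c2Class : (scDualHomology k).comp (l' := [cl, cl]) (r := -2) [] [] rfl rfl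
    rfl (n10Class k) (c2Class k) = 0 :=
  congrArg Submodule.Quotient.mk (Subtype.ext (scDualGens k).n10_c2)

lemma n10Class_central :
    (scDualHomology k).comp (l' := [cl, op]) (r := -1) [] [op] rfl rfl rfl
      (n02Class k) (n10Class k) =
    (scDualHomology k).act (l := [op, cl]) (l' := [cl, op]) (Equiv.swap (0 : Fin 2) 1) (by decide)
      ((scDualHomology k).comp (l' := [op, cl]) (r := -1) [op] [] rfl rfl rfl
        (n02Class k) (n10Class k)) :=
  (Submodule.Quotient.eq _).2 ((DGOperad.mem_boundaries rfl).2
    ⟨(scDualGens k).n11, (scDualGens k).diff_n11⟩)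

end Relations

variable (S : OperadAlgebra (scDualHomology k) V)

lemma OperadAlgebra.diff_two (f : (scDualHomology k).obj [x, y] d p) (a : (V x).X m)
    (b : (V y).X n) (r : ℤ) : ((V d).d r (r - 1)).hom (S.ev f (two a b) r) =
      p.negOnePow • (S.ev f (two (((V x).d m (m - 1)).hom a) b) (r - 1) +
        m.negOnePow • S.ev f (two a (((V y).d n (n - 1)).hom b)) (r - 1)) := by
  rw [S.ev_diff (sub_add_cancel p 1)]
  refine (congrArg (· + _) (S.ev_zero _ _)).trans ((zero_add _).trans ?_)
  simp only [dSum, smul_zero, add_zero]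

lemma OperadAlgebra.diff_one (f : (scDualHomology k).obj [x] d p) (a : (V x).X m) (r : ℤ) :
    ((V d).d r (r - 1)).hom (S.ev f (one a) r) =
      p.negOnePow • S.ev f (one (((V x).d m (m - 1)).hom a)) (r - 1) := by
  rw [S.ev_diff (sub_add_cancel p 1)]
  refine (congrArg (· + _) (S.ev_zero _ _)).trans ((zero_add _).trans ?_)
  simp only [dSum, smul_zero, add_zero]

lemma OperadAlgebra.ev_antisymm {f : (scDualHomology k).obj [cl, cl] cl p}
    (hf : (scDualHomology k).act (l := [cl, cl]) (l' := [cl, cl]) (Equiv.swap (0 : Fin 2) 1)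
      (by decide) f = -f) (a : (V cl).X m) (b : (V cl).X n) (r : ℤ) :
    S.ev f (two a b) r = -((m * n).negOnePow • S.ev f (two b a) r) := by
  rw [mul_comm, ← S.ev_swap_two f (by decide), hf, S.ev_neg, neg_neg]

/-- The triple of an algebra over the homology of `sc^!`. -/
def OperadAlgebra.toTriple : CentralTriple (V cl) (V op) where
  ger :=
    { br := fun {m n r} _ => S.bilin (l2Class k) m n r
      mul := fun {m n r} _ => S.bilin (c2Class k) m n r
      br_symm := fun _ a b => S.ev_antisymm (l2Class_symm k) a b _
      mul_symm := fun _ a b => S.ev_antisymm (c2Class_symm k) a b _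
      mul_assoc := fun {m n p r} h a b c => by
        have := congrArg (S.ev · (three a b c) r) (c2Class_assoc k)
        simp only [S.ev_neg] at this
        rw [S.ev_right (hN := show _ = n + p - 1 by omega),
          S.ev_left (hN := show _ = m + n - 1 by omega), neg_one_mul, Int.negOnePow_neg] at this
        exact this
      jacobi := fun {m n p r} h a b c => by
        have := congrArg (S.ev · (three a b c) r) (l2Class_jacobi k)
        simp only [S.ev_add, S.ev_zero] at this
        rw [S.ev_rotate _ (by decide), S.ev_rotate_symm _ (by decide), S.ev_left (hN := show _ = m + n by omega),
          S.ev_left (hN := show _ = p + m by omega), S.ev_left (hN := show _ = n + p by omega),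
          add_right_comm] at this
        exact this
      leibniz := fun {m n p r} h a b c => by
        have := congrArg (S.ev · (three a b c) r) (l2Class_leibniz k)
        simp only [S.ev_add] at this
        rw [S.ev_swap_left, S.ev_right (hN := show _ = n + p - 1 by omega),
          S.ev_left (hN := show _ = m + n by omega), S.ev_right (hN := show _ = m + p by omega),
          neg_one_mul, Int.negOnePow_neg, zero_mul, Int.negOnePow_zero, one_smul,
          mul_comm n m] at this
        exact this
      diff_br := fun _ a b => (S.diff_two (l2Class k) a b _).trans (one_smul _ _)
      diff_mul := fun _ a b => (S.diff_two (c2Class k) a b _).trans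
        (by rw [show (-1 : ℤ).negOnePow = -1 by simp, Units.neg_smul, one_smul]; rfl) }
  assoc :=
    { mul := fun {m n r} _ => S.bilin (n02Class k) m n r
      mul_assoc := fun {m n p r} h a b c => by
        have := congrArg (S.ev · (three a b c) r) (n02Class_assoc k)
        rw [S.ev_right (hN := show _ = n + p by omega), S.ev_left (hN := show _ = m + n by omega),
          zero_mul, Int.negOnePow_zero, one_smul] at this
        exact this
      diff_mul := fun _ a b => (S.diff_two (n02Class k) a b _).trans (one_smul _ _) }
  beta := fun {m n} _ => S.lin (n10Class k) m n
  beta_central := fun {m n p r} h h' a b => by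
    have := congrArg (S.ev · (two a b) r) (n10Class_central k)
    rw [S.ev_swap_two, S.ev_un_left (hN := show _ = n by omega),
      S.ev_un_right (hN := show _ = n by omega), smul_smul, ← Int.negOnePow_add,
      show p * m + -1 * p = p * n by subst h; ring] at this
    exact this
  beta_mul := fun {m n r s} h h' a b => by
    have := congrArg (S.ev · (two a b) s) (n10Class_c2Class k)
    simp only [S.ev_zero] at this
    rw [S.ev_un_bin (hN := show _ = r by omega)] at this
    exact this
  diff_beta := fun _ a => (S.diff_one (n10Class k) a _).trans
    (by rw [show (-1 : ℤ).negOnePow = -1 by simp, Units.neg_smul, one_smul]; rfl)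

end AlgebraTriple

section Uniqueness

open Color Inputs

variable {k : Type u} [Field k] {V W : Color → ChainComplex (ModuleCat.{w} k) ℤ}

lemma Inputs.exists_append {l m : List Color} (v : Inputs V (l ++ m)) :
    ∃ (u : Inputs V l) (w : Inputs V m), v = u.append w := by
  induction l with
  | nil => exact ⟨nil, v, rfl⟩
  | cons x l ih =>
    cases v with
    | cons n a v =>
      obtain ⟨u, w, rfl⟩ := ih v
      exact ⟨cons n a u, w, rfl⟩

lemma Inputs.map_append (φ : ∀ x, V x ⟶ W x) {l m : List Color} (u : Inputs V l)
    (w : Inputs V m) : (u.append w).map φ = (u.map φ).append (w.map φ) := by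
  induction u with
  | nil => rfl
  | cons n a u ih => exact congrArg _ ih

lemma Inputs.deg_map (φ : ∀ x, V x ⟶ W x) {l : List Color} (v : Inputs V l) :
    (v.map φ).deg = v.deg := by
  induction v with
  | nil => rfl
  | cons n a u ih => exact congrArg _ ih

/-- A property of operations which is stable under adjacent transpositions is stable under all
permutations. -/
lemma DGOperad.act_induction (P : DGOperad k) {d : Color} {p : ℤ}
    {R : ∀ {l : List Color}, P.obj l d p → Prop}
    (hR : ∀ {l₁ l₂ : List Color} {x y : Color} (f : P.obj (l₁ ++ x :: y :: l₂) d p)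
      (e : Fin (l₁ ++ y :: x :: l₂).length ≃ Fin (l₁ ++ x :: y :: l₂).length) (he),
      (∀ i, (e i : ℕ) = Equiv.swap l₁.length (l₁.length + 1) (i : ℕ)) → R f → R (P.act e he f))
    {l l' : List Color} (e : Fin l'.length ≃ Fin l.length) (he : ∀ i, l'.get i = l.get (e i))
    {f : P.obj l d p} (hf : R f) : R (P.act e he f) := by
  have id_case : ∀ {l l' : List Color} (e : Fin l'.length ≃ Fin l.length)
      (he : ∀ i, l'.get i = l.get (e i)) {f : P.obj l d p}, (∀ i, (e i : ℕ) = i) → R f →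
      R (P.act e he f) := by
    intro l l' e he f hi hf
    have hl : l'.length = l.length := by simpa using Fintype.card_congr e
    obtain rfl : l' = l := List.ext_get hl fun i h1 h2 => by
      rw [he]; congr 1; exact Fin.ext (hi _)
    obtain rfl : e = Equiv.refl _ := Equiv.ext fun i => Fin.ext (hi i)
    rwa [P.act_refl]
  obtain ⟨n, hn⟩ : ∃ n, l.length = n := ⟨_, rfl⟩
  have hl : l'.length = n := (by simpa using Fintype.card_congr e : l'.length = l.length).trans hn
  rcases n with _ | n
  · exact id_case e he (fun i => absurd i.2 (by omega)) hf
  let σ : Equiv.Perm (Fin (n + 1)) := (finCongr hl.symm).trans (e.trans (finCongr hn))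
  have hσ : ∀ i, (e i : ℕ) = σ (Fin.cast hl i) := fun i => by simp [σ]
  clear_value σ
  have hm : σ ∈ Submonoid.closure (Set.range fun i : Fin n => Equiv.swap i.castSucc i.succ) := by
    rw [Equiv.Perm.mclosure_swap_castSucc_succ]; trivial
  induction hm using Submonoid.closure_induction_right generalizing l' with
  | one => exact id_case e he (fun i => by simp [hσ]) hf
  | mul_right τ _ s hs ih =>
    obtain ⟨j, rfl⟩ := hs
    obtain ⟨l₁, y, x, l₂, rfl, hj⟩ : ∃ l₁ y x l₂, l' = l₁ ++ y :: x :: l₂ ∧ l₁.length = j.1 := by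
      refine ⟨l'.take j, l'[j.1]'(by omega), l'[j.1 + 1]'(by omega), l'.drop (j + 2), ?_,
        by simp; omega⟩
      rw [← List.drop_eq_getElem_cons, ← List.drop_eq_getElem_cons, List.take_append_drop]
    have hl'' : (l₁ ++ x :: y :: l₂).length = n + 1 := by simp at hl ⊢; omega
    let t : Fin (l₁ ++ y :: x :: l₂).length ≃ Fin (l₁ ++ x :: y :: l₂).length :=
      (finCongr hl).trans ((Equiv.swap j.castSucc j.succ).trans (finCongr hl''.symm))
    have ht : ∀ i, (t i : ℕ) = Equiv.swap l₁.length (l₁.length + 1) (i : ℕ) := by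
      intro i
      simp only [t, Equiv.trans_apply, finCongr_apply, Fin.val_cast, Equiv.swap_apply_def, hj,
        Fin.ext_iff, Fin.val_castSucc, Fin.val_succ]
      split_ifs <;> simp
    have ht' : ∀ i, (l₁ ++ y :: x :: l₂).get i = (l₁ ++ x :: y :: l₂).get (t i) := by
      intro i
      have := getElem?_swap l₁ l₂ y x i
      rw [← ht] at this
      rw [List.getElem?_eq_getElem (t i).2, List.getElem?_eq_getElem i.2] at this
      exact (Option.some.inj this).symm
    have h := P.act_act (t.symm.trans e) t (fun i => by
      rw [Equiv.trans_apply, ← he, ht', t.apply_symm_apply]) ht' f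
    have h' : t.trans (t.symm.trans e) = e := by ext; simp
    simp only [h'] at h
    rw [← h]
    refine hR _ t ht' ht (ih _ _ hl'' fun i => ?_)
    simp [hσ, t]

section Hom

variable (φ : ∀ x, V x ⟶ W x)

section

variable {P : DGOperad k} (S : OperadAlgebra P V) (T : OperadAlgebra P W) {d : Color} {p : ℤ}

/-- The maps `φ` are compatible with the operation `c`. -/
def HomAt {l : List Color} (c : P.obj l d p) : Prop :=
  ∀ v r, ((φ d).f r).hom (S.ev c v r) = T.ev c (v.map φ) r

lemma homAt_of_deg {l : List Color} {c : P.obj l d p}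
    (h : ∀ v r, p + v.deg = r → ((φ d).f r).hom (S.ev c v r) = T.ev c (v.map φ) r) :
    HomAt φ S T c := fun v r => by
  by_cases hr : p + v.deg = r
  · exact h v r hr
  · rw [S.ev_deg c v r hr, T.ev_deg c _ r (by rwa [deg_map]), map_zero]

variable {φ S T}

lemma HomAt.act {l l' : List Color} (e : Fin l'.length ≃ Fin l.length)
    (he : ∀ i, l'.get i = l.get (e i)) {c : P.obj l d p} (h : HomAt φ S T c) :
    HomAt φ S T (P.act e he c) := by
  refine P.act_induction (R := HomAt φ S T) (fun c e he h' hc v r => ?_) e he h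
  obtain ⟨u, w, rfl⟩ := v.exists_append
  rcases w with _ | ⟨n, b, _ | ⟨m, a, w⟩⟩
  rw [S.ev_swap c e he h', map_append, map_units]
  refine (congrArg _ (hc _ r)).trans ?_
  rw [map_append]
  exact (T.ev_swap c e he h' _ _ _ _ r).symm

lemma HomAt.comp {b l₁ l₂ : List Color} {x : Color} {q s : ℤ} (hs : p + q = s)
    {c : P.obj (l₁ ++ x :: l₂) d p} {c' : P.obj b x q} (h : HomAt φ S T c) (h' : HomAt φ S T c') :
    HomAt φ S T (P.comp l₁ l₂ rfl rfl hs c c') := by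
  intro v r
  obtain ⟨v, w, rfl⟩ := v.exists_append
  obtain ⟨u, v, rfl⟩ := v.exists_append
  rw [S.ev_comp, map_append, map_append, T.ev_comp, map_units, deg_map, deg_map, ← h' v, h _ r,
    map_append]
  rfl

end

variable (S : OperadAlgebra (scDualHomology k) V) (T : OperadAlgebra (scDualHomology k) W)
variable {l : List Color} {d : Color} {p : ℤ} {φ S T}

lemma Gen.homAt (h : S.toTriple.IsHom T.toTriple (φ cl) (φ op)) {f : (scDual k).obj l d p}
    (hf : Gen f) : HomAt φ S T (DGOperad.homClass (sub_add_cancel p 1) f (hf.diff _)) := by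
  induction hf with
  | l2 =>
    refine homAt_of_deg φ S T fun v r hr => ?_
    rcases v with _ | ⟨m, a, _ | ⟨n, b, _ | _⟩⟩
    exact h.map_br (by simpa [deg] using hr) a b
  | c2 =>
    refine homAt_of_deg φ S T fun v r hr => ?_
    rcases v with _ | ⟨m, a, _ | ⟨n, b, _ | _⟩⟩
    exact h.map_ger_mul (by simp [deg] at hr; omega) a b
  | n02 =>
    refine homAt_of_deg φ S T fun v r hr => ?_
    rcases v with _ | ⟨m, a, _ | ⟨n, b, _ | _⟩⟩
    exact h.map_assoc_mul (by simpa [deg] using hr) a b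
  | n10 =>
    refine homAt_of_deg φ S T fun v r hr => ?_
    rcases v with _ | ⟨m, a, _ | _⟩
    exact h.map_beta (by simp [deg] at hr; omega) a
  | zero =>
    exact fun v r => (congrArg _ (S.ev_zero _ _)).trans ((map_zero _).trans (T.ev_zero _ _).symm)
  | add _ _ ih ih' =>
    exact fun v r => (congrArg _ (S.ev_add _ _ _ _)).trans ((map_add _ _ _).trans
      ((congrArg₂ _ (ih v r) (ih' v r)).trans (T.ev_add _ _ _ _).symm))
  | smul c _ ih =>
    exact fun v r => (congrArg _ (S.ev_smul _ _ _ _)).trans ((map_smul _ _ _).trans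
      ((congrArg _ (ih v r)).trans (T.ev_smul _ _ _ _).symm))
  | one x =>
    refine homAt_of_deg φ S T fun v r hr => ?_
    rcases v with _ | ⟨m, a, _ | _⟩
    obtain rfl : m = r := by simpa [deg] using hr
    exact (congrArg _ (S.ev_one a)).trans (T.ev_one _).symm
  | act e he _ ih => exact ih.act e he
  | comp l₁ l₂ hl hl' hr _ _ ih ih' =>
    subst hl hl'
    exact ih.comp hr ih'

variable [CharZero k]

lemma isHom_iff : S.IsHom T φ ↔ S.toTriple.IsHom T.toTriple (φ cl) (φ op) := by
  refine ⟨fun h => ⟨fun _ _ _ => h _ _ _, fun _ _ _ => h _ _ _, fun _ _ _ => h _ _ _,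
    fun _ _ => h _ _ _⟩, fun h l d p c => ?_⟩
  obtain ⟨f, rfl⟩ := Submodule.Quotient.mk_surjective _ c
  obtain ⟨g, hg, b, hb⟩ := exists_gen_of_cycle _ f.1
    ((DGOperad.mem_cycles (sub_add_cancel p 1)).1 f.2)
  rw [show Submodule.Quotient.mk f = DGOperad.homClass (sub_add_cancel p 1) g (hg.diff _) from
    (Submodule.Quotient.eq _).2 ((DGOperad.mem_boundaries rfl).2 ⟨b, by
      rw [Submodule.coe_sub, hb]; simp⟩)]
  exact hg.homAt h

end Hom

lemma Inputs.map_id {l : List Color} (v : Inputs V l) : v.map (fun x => 𝟙 (V x)) = v := by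
  induction v with
  | nil => rfl
  | cons n a v ih => exact congrArg _ ih

variable [CharZero k]

lemma OperadAlgebra.toTriple_injective :
    Function.Injective (OperadAlgebra.toTriple (k := k) (V := V)) := by
  intro S S' h
  have : S.IsHom S' fun x => 𝟙 (V x) := (isHom_iff (φ := fun x => 𝟙 (V x))).2 (by
    rw [h]
    exact ⟨fun _ _ _ => rfl, fun _ _ _ => rfl, fun _ _ _ => rfl, fun _ _ => rfl⟩)
  ext l d p c v r
  have := this c v r
  rwa [Inputs.map_id] at this

lemma CentralTriple.toTriple_toAlgebra (T : CentralTriple (V cl) (V op)) :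
    T.toAlgebra.toTriple = T := by
  have h1 : classOp T (l2Class k) = _ := classOp_eq T (acts_l2 T)
  have h2 : classOp T (c2Class k) = _ := classOp_eq T (acts_c2 T)
  have h3 : classOp T (n02Class k) = _ := classOp_eq T (acts_n02 T)
  have h4 : classOp T (n10Class k) = _ := classOp_eq T (acts_n10 T)
  refine CentralTriple.ext (LambdaGerAlgebra.ext ?_ ?_) (DGAssocAlgebra.ext ?_) ?_
  · funext m n r h
    refine LinearMap.ext₂ fun a b => (congrFun (congrFun (congrArg Subtype.val h1) _) _).trans ?_
    exact binOp_apply (V := V) (p := 0) (fun h => T.ger.br (by omega)) a b (by omega)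
  · funext m n r h
    refine LinearMap.ext₂ fun a b => (congrFun (congrFun (congrArg Subtype.val h2) _) _).trans ?_
    exact binOp_apply (V := V) (p := -1) (fun h => T.ger.mul (by omega)) a b (by omega)
  · funext m n r h
    refine LinearMap.ext₂ fun a b => (congrFun (congrFun (congrArg Subtype.val h3) _) _).trans ?_
    exact binOp_apply (V := V) (p := 0) (fun h => T.assoc.mul (by omega)) a b (by omega)
  · funext m n h
    refine LinearMap.ext fun a => (congrFun (congrFun (congrArg Subtype.val h4) _) _).trans ?_
    exact unOp_apply (V := V) (p := -1) (fun h => T.beta (by omega)) a (by omega)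

end Uniqueness

theorem mainTheorem5 (k : Type u) [Field k] [CharZero k] :
    ∃ Φ : ∀ V : Color → ChainComplex (ModuleCat.{w} k) ℤ,
        OperadAlgebra (scDualHomology k) V ≃ CentralTriple (V Color.cl) (V Color.op),
      (∀ (V : Color → ChainComplex (ModuleCat.{w} k) ℤ) (S : OperadAlgebra (scDualHomology k) V),
        (∀ {m n r : ℤ} (h : m + n = r) (x : (V Color.cl).X m) (y : (V Color.cl).X n),
          (Φ V S).ger.br h x y = S.ev (l2Class k) (.cons m x (.cons n y .nil)) r) ∧
        (∀ {m n r : ℤ} (h : m + n - 1 = r) (x : (V Color.cl).X m) (y : (V Color.cl).X n),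
          (Φ V S).ger.mul h x y = S.ev (c2Class k) (.cons m x (.cons n y .nil)) r) ∧
        (∀ {m n r : ℤ} (h : m + n = r) (a : (V Color.op).X m) (b : (V Color.op).X n),
          (Φ V S).assoc.mul h a b = S.ev (n02Class k) (.cons m a (.cons n b .nil)) r) ∧
        (∀ {m n : ℤ} (h : n + 1 = m) (x : (V Color.cl).X m),
          (Φ V S).beta h x = S.ev (n10Class k) (.cons m x .nil) n)) ∧
      (∀ (V W : Color → ChainComplex (ModuleCat.{w} k) ℤ)
        (S : OperadAlgebra (scDualHomology k) V) (T : OperadAlgebra (scDualHomology k) W)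
        (φ : ∀ x, V x ⟶ W x),
        S.IsHom T φ ↔ (Φ V S).IsHom (Φ W T) (φ Color.cl) (φ Color.op)) :=
  ⟨fun _ => ⟨OperadAlgebra.toTriple, CentralTriple.toAlgebra,
      fun _ => OperadAlgebra.toTriple_injective (CentralTriple.toTriple_toAlgebra _),
      CentralTriple.toTriple_toAlgebra⟩,
    fun _ _ => ⟨fun _ _ _ => rfl, fun _ _ _ => rfl, fun _ _ _ => rfl, fun _ _ => rfl⟩,
    fun _ _ _ _ _ => isHom_iff⟩
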